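/- Let $n\in\{1,2,3\}$, $T>0$, let $\Omega\subset\mathbb R^n$ be open, connected and bounded with smooth boundary, and put $\mathcal M=(0,T)\times\Omega$, $\Sigma=(0,T)\times\partial\Omega$, $\mathcal O=(0,T)\times\omega$ with $\omega\subset\overline\Omega$ relatively open. Let $A=\mathrm{diag}(-1,1,\dots,1)$, $\Box=\partial_t^2-\Delta$, $\nabla_{t,x}=(\partial_t,\nabla)$, let $n_{\partial\mathcal M}$, $n_{\partial\Omega}$ be the outward unit normals, and write $(\cdot,\cdot)_S$, $\|\cdot\|_S$ for the $L^2$ inner product and norm on a set $S$ (with surface measure on hypersurfaces). Let $(\mathcal T_h)_h$ be a family of finite triangulations of $\mathcal M$: the elements are the sets $K=\widehat K\cap\overline{\mathcal M}$ with $\widehat K\subset\mathbb R^{1+n}$ a nondegenerate closed simplex (so elements adjacent to $\partial\mathcal M$ may have curved faces fitting $\mathcal M$), they cover $\overline{\mathcal M}$, and two distinct elements $K=\widehat K\cap\overline{\mathcal M}$, $K'=\widehat K'\cap\overline{\mathcal M}$ meet in a common face, $K\cap K'=F\cap\overline{\mathcal M}=F'\cap\overline{\mathcal M}$ with $F$,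 $F'$ proper (possibly empty) faces of $\widehat K$, $\widehat K'$. Let $h=\max_{K}\operatorname{diam}K$. The family is assumed quasi-uniform: there is $r>0$ such that every element $K$ of every $\mathcal T_h$ contains a ball of radius $rh$ with respect to all of whose points $K$ is star-shaped. Let $V_h^k$ be the space of continuous functions on $\overline{\mathcal M}$ that are polynomials of degree at most $k$ on each $K\in\mathcal T_h$. For elementwise $H^2$ functions define $$a_h(u,z)=(A\nabla_{t,x}u,\nabla_{t,x}z)_{\mathcal M}-(A\nabla_{t,x}u\cdot n_{\partial\mathcal M},z)_{\partial\mathcal M}-(\nabla z\cdot n_{\partial\Omega},u)_\Sigma ,$$ $$s(u,v)=\sum_{K\in\mathcal T_h}\Big(h^2(\Box u,\Box v)_K+h^{-1}(u,v)_{\partial K\cap\Sigma}+\sum_{F\subset\partial K}h\,([\![n\cdot A\nabla_{t,x}u]\!],[\![n\cdot A\nabla_{t,x}v]\!])_F\Big),$$ $$s^*(z,w)=\sum_{K\in\mathcal T_h}\Big((\nabla_{t,x}z,\nabla_{t,x}w)_K+h^{-1}(z,w)_{\partial K\cap\partial\mathcal M}\Big),$$ where derivatives are taken elementwise, $F$ runs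 over the interior faces of the mesh contained in $\partial K$, and $[\![n\cdot g]\!]=n_1\cdot g|_{K_1}+n_2\cdot g|_{K_2}$ on $F=K_1\cap K_2$ with $n_j$ the outward unit normal of $K_j$. Set $$\|(u,z)\|_S^2=\|u\|_{\mathcal O}^2+s(u,u)+s^*(z,z).$$ Fix integers $p\ge q\ge1$ and constants $\gamma,\gamma^*>0$. Assume that the spaces $V_h^p$ admit interpolants: there is a constant $C_I$ such that for every $\mathcal T_h$ in the family and every $v\in H^{p+1}(\mathcal M)$ there is $\Pi_hv\in V_h^p$ with $$\Big(\sum_{K\in\mathcal T_h}\|v-\Pi_hv\|_{H^m(K)}^2\Big)^{1/2}\le C_I\,h^{p+1-m}\|v\|_{H^{p+1}(\mathcal M)},\qquad m=0,1,2 .$$ Then there is a constant $C>0$, independent of the mesh (in particular of $h$) and of $u$, such that the following holds for every $\mathcal T_h$ in the family. Let $u\in H^{p+1}(\mathcal M)$ satisfy $\Box u=0$ in $\mathcal M$, $u=0$ on $\Sigma$ and $u|_{\mathcal O}=u_{\mathcal O}$, and let $(u_h,z_h)\in V_h^p\times V_h^q$ satisfy $$(u_h,v_h)_{\mathcal O}+\gamma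 s(u_h,v_h)+a_h(v_h,z_h)+a_h(u_h,w_h)-\gamma^*s^*(z_h,w_h)=(u_{\mathcal O},v_h)_{\mathcal O}\qquad\forall (v_h,w_h)\in V_h^p\times V_h^q .$$ Then $$\|(u-u_h,z_h)\|_S\le C\,h^p\,\|u\|_{H^{p+1}(\mathcal M)} .$$ -/

import Mathlib

open MeasureTheory Filter Topology

noncomputable section

namespace WaveDA

open scoped ContDiff

/-- Spacetime `ℝ^{1+n}` with its Euclidean structure; coordinate `0` is time, the coordinates
`1, …, n` are space. -/
abbrev SpaceTime (n : ℕ) : Type := EuclideanSpace ℝ (Fin (n + 1))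

/-- The spatial part `x` of a spacetime point `(t, x)`. -/
def spatial {n : ℕ} (y : SpaceTime n) : EuclideanSpace ℝ (Fin n) :=
  WithLp.toLp 2 (fun i => y i.succ)

/-- The open cylinder `(0, T) × S`. -/
def cylinder {n : ℕ} (T : ℝ) (S : Set (EuclideanSpace ℝ (Fin n))) : Set (SpaceTime n) :=
  {y | 0 < y 0 ∧ y 0 < T ∧ spatial y ∈ S}

/-- `Ω` has smooth boundary: near each of its boundary points it is the sublevel set of a smooth
function with nonvanishing differential. -/
def HasSmoothBoundary {n : ℕ} (Ω : Set (EuclideanSpace ℝ (Fin n))) : Prop :=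
  ∀ x ∈ frontier Ω, ∃ (U : Set (EuclideanSpace ℝ (Fin n)))
    (ρ : EuclideanSpace ℝ (Fin n) → ℝ), IsOpen U ∧ x ∈ U ∧ ContDiffOn ℝ ∞ ρ U ∧
      (∀ y ∈ U, fderiv ℝ ρ y ≠ 0) ∧ Ω ∩ U = {y ∈ U | ρ y < 0}

/-! ### Sobolev spaces on open subsets of spacetime -/

/-- `g ∈ L²(U)` is the weak derivative `∂_{w 0} ⋯ ∂_{w (m-1)} v` of `v` on the open set `U`. -/
def IsWeakDeriv {n : ℕ} (U : Set (SpaceTime n)) {m : ℕ} (w : Fin m → Fin (n + 1))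
    (v g : SpaceTime n → ℝ) : Prop :=
  MemLp g 2 (volume.restrict U) ∧
    ∀ φ : SpaceTime n → ℝ, ContDiff ℝ ∞ φ → HasCompactSupport φ → tsupport φ ⊆ U →
      ∫ x in U, v x * iteratedFDeriv ℝ m φ x (fun j => EuclideanSpace.single (w j) (1 : ℝ)) =
        (-1) ^ m * ∫ x in U, g x * φ x

/-- `v ∈ H^k(U)`. -/
def MemSobolev {n : ℕ} (U : Set (SpaceTime n)) (k : ℕ) (v : SpaceTime n → ℝ) : Prop :=
  MemLp v 2 (volume.restrict U) ∧
    ∀ m ≤ k, ∀ w : Fin m → Fin (n + 1), ∃ g, IsWeakDeriv U w v g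

open Classical in
/-- The weak derivative of `v` on `U` (unique almost everywhere on `U`; the value is only used
for functions that have one). -/
def weakDeriv {n : ℕ} (U : Set (SpaceTime n)) {m : ℕ} (w : Fin m → Fin (n + 1))
    (v : SpaceTime n → ℝ) : SpaceTime n → ℝ :=
  if h : ∃ g, IsWeakDeriv U w v g then h.choose else 0

/-- `‖v‖²_{H^k(U)} = ∑_{m ≤ k} ‖D^m v‖²_{L²(U)}`. -/
def sobolevNormSq {n : ℕ} (U : Set (SpaceTime n)) (k : ℕ) (v : SpaceTime n → ℝ) : ℝ :=
  ∑ m ∈ Finset.range (k + 1), ∑ w : Fin m → Fin (n + 1), ∫ x in U, (weakDeriv U w v x) ^ 2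

/-- `‖v‖_{H^k(U)}`. -/
def sobolevNorm {n : ℕ} (U : Set (SpaceTime n)) (k : ℕ) (v : SpaceTime n → ℝ) : ℝ :=
  Real.sqrt (sobolevNormSq U k v)

/-- The weak spacetime gradient `∇_{t,x} v` on `U`. -/
def grad {n : ℕ} (U : Set (SpaceTime n)) (v : SpaceTime n → ℝ) (x : SpaceTime n) :
    Fin (n + 1) → ℝ :=
  fun i => weakDeriv U ![i] v x

/-- The wave operator `□ v = ∂_t² v - Δ v` on `U`, in the sense of weak derivatives. -/
def box {n : ℕ} (U : Set (SpaceTime n)) (v : SpaceTime n → ℝ) (x : SpaceTime n) : ℝ :=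
  weakDeriv U ![0, 0] v x - ∑ i : Fin n, weakDeriv U ![i.succ, i.succ] v x

/-! ### Boundary values and normals -/

/-- The natural `n`-dimensional surface measure on hypersurfaces of `ℝ^{1+n}`: the Hausdorff
measure normalized so that it is Lebesgue measure on hyperplanes. -/
abbrev surface (n : ℕ) : Measure (SpaceTime n) := Measure.euclideanHausdorffMeasure n

/-- `g ∈ L²(∂U)` is the trace of `v ∈ H¹(U)`: there are smooth functions that converge to `v` in
`H¹(U)` and whose restrictions to `∂U` converge to `g` in `L²(∂U)`. -/
def IsTrace {n : ℕ} (U : Set (SpaceTime n)) (v g : SpaceTime n → ℝ) : Prop :=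
  MemSobolev U 1 v ∧ MemLp g 2 ((surface n).restrict (frontier U)) ∧
    ∃ φ : ℕ → SpaceTime n → ℝ, (∀ j, ContDiff ℝ ∞ (φ j)) ∧
      Tendsto (fun j => eLpNorm (φ j - v) 2 (volume.restrict U)) atTop (𝓝 0) ∧
      (∀ i : Fin (n + 1),
        Tendsto (fun j => eLpNorm
          (fun x => fderiv ℝ (φ j) x (EuclideanSpace.single i (1 : ℝ)) - grad U v x i) 2
          (volume.restrict U)) atTop (𝓝 0)) ∧
      Tendsto (fun j => eLpNorm (φ j - g) 2 ((surface n).restrict (frontier U))) atTop (𝓝 0)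

open Classical in
/-- The trace on `∂U` of `v ∈ H¹(U)`. -/
def trace {n : ℕ} (U : Set (SpaceTime n)) (v : SpaceTime n → ℝ) : SpaceTime n → ℝ :=
  if h : ∃ g, IsTrace U v g then h.choose else 0

/-- The trace on `∂U` of the gradient of `v ∈ H²(U)`. -/
def traceGrad {n : ℕ} (U : Set (SpaceTime n)) (v : SpaceTime n → ℝ) (x : SpaceTime n) :
    Fin (n + 1) → ℝ :=
  fun i => trace U (fun y => grad U v y i) x

/-- `ν` is the outward unit normal vector of `S` at its boundary point `x`: the directions with
`w · ν < 0` enter the interior of `S`, those with `w · ν > 0` leave the closure of `S`. -/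
def IsOuterNormal {n : ℕ} (S : Set (SpaceTime n)) (x ν : SpaceTime n) : Prop :=
  ‖ν‖ = 1 ∧ ∀ w : SpaceTime n,
    (inner ℝ w ν < 0 → ∀ᶠ t : ℝ in 𝓝[>] 0, x + t • w ∈ interior S) ∧
    (0 < inner ℝ w ν → ∀ᶠ t : ℝ in 𝓝[>] 0, x + t • w ∉ closure S)

open Classical in
/-- The outward unit normal vector of `S` at `x` (it is unique when it exists; boundary points
without a normal, such as corners, form a null set for the surface measure in all uses below). -/
def outerNormal {n : ℕ} (S : Set (SpaceTime n)) (x : SpaceTime n) : Fin (n + 1) → ℝ :=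
  if h : ∃ ν, IsOuterNormal S x ν then fun i => h.choose i else 0

/-- The matrix `A = diag(-1, 1, …, 1)` of the Minkowski metric. -/
def minkowski (n : ℕ) : Matrix (Fin (n + 1)) (Fin (n + 1)) ℝ :=
  Matrix.diagonal (Fin.cons (-1) (fun _ : Fin n => (1 : ℝ)))

/-! ### Triangulations -/

/-- A triangulation of the spacetime domain `M`. The elements are simplices, trimmed along the
boundary of `M`: an element that does not meet the boundary is a straight simplex, an element
adjacent to the boundary may have curved faces that fit `M`. The intersection of two distinct
elements is a common face, of any dimension less than that of `M` (possibly empty). -/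
structure Triangulation {n : ℕ} (M : Set (SpaceTime n)) where
  /-- the number of elements -/
  card : ℕ
  /-- the straight simplices whose parts in the closure of `M` are the elements -/
  simplex : Fin card → Affine.Simplex ℝ (SpaceTime n) (n + 1)
  covers : closure M ⊆ ⋃ i, convexHull ℝ (Set.range (simplex i).points)
  conforming : ∀ i j, i ≠ j → ∃ s t : Set (Fin (n + 2)), s ≠ Set.univ ∧ t ≠ Set.univ ∧
    (convexHull ℝ (Set.range (simplex i).points) ∩ closure M) ∩
        (convexHull ℝ (Set.range (simplex j).points) ∩ closure M) =
      convexHull ℝ ((simplex i).points '' s) ∩ closure M ∧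
    (convexHull ℝ (Set.range (simplex i).points) ∩ closure M) ∩
        (convexHull ℝ (Set.range (simplex j).points) ∩ closure M) =
      convexHull ℝ ((simplex j).points '' t) ∩ closure M

namespace Triangulation

variable {n : ℕ} {M : Set (SpaceTime n)}

/-- The (closed) element `K`. -/
def elem (𝒯 : Triangulation M) (i : Fin 𝒯.card) : Set (SpaceTime n) :=
  convexHull ℝ (Set.range (𝒯.simplex i).points) ∩ closure M

/-- The interior of the element `K`. -/
def int (𝒯 : Triangulation M) (i : Fin 𝒯.card) : Set (SpaceTime n) := interior (𝒯.elem i)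

/-- The mesh parameter `h = max_K diam K`. -/
def meshSize (𝒯 : Triangulation M) : ℝ := ⨆ i, Metric.diam (𝒯.elem i)

/-- The space `V_h^k` of continuous functions that are polynomials of degree at most `k` on each
element (the values of the functions outside the closure of `M` are immaterial). -/
def femSpace (𝒯 : Triangulation M) (k : ℕ) : Set (SpaceTime n → ℝ) :=
  {v | ContinuousOn v (closure M) ∧ ∀ i, ∃ P : MvPolynomial (Fin (n + 1)) ℝ,
    P.totalDegree ≤ k ∧ ∀ x ∈ 𝒯.elem i, v x = MvPolynomial.eval (fun j => x j) P}

/-- `∂K ∩ ∂M` for the element `K`; these sets cover `∂M` and overlap in null sets. -/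
def bdry (𝒯 : Triangulation M) (i : Fin 𝒯.card) : Set (SpaceTime n) := 𝒯.elem i ∩ frontier M

/-- `K_i ∩ K_j` inside `M`: the interior face between the two elements if they share one, and
otherwise a null set for the surface measure. -/
def face (𝒯 : Triangulation M) (i j : Fin 𝒯.card) : Set (SpaceTime n) :=
  𝒯.elem i ∩ 𝒯.elem j ∩ M

/-- The jump `[[n · A ∇_{t,x} v]] = n_i · (A ∇_{t,x} v)|_{K_i} + n_j · (A ∇_{t,x} v)|_{K_j}`
across the face between `K_i` and `K_j`. -/
def jump (𝒯 : Triangulation M) (i j : Fin 𝒯.card) (v : SpaceTime n → ℝ) (x : SpaceTime n) : ℝ :=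
  outerNormal (𝒯.elem i) x ⬝ᵥ (minkowski n).mulVec (traceGrad (𝒯.int i) v x) +
    outerNormal (𝒯.elem j) x ⬝ᵥ (minkowski n).mulVec (traceGrad (𝒯.int j) v x)

/-- `a(u, z) = (A ∇_{t,x} u, ∇_{t,x} z)_M`, computed element by element. -/
def aForm (𝒯 : Triangulation M) (u z : SpaceTime n → ℝ) : ℝ :=
  ∑ i, ∫ x in 𝒯.int i, (minkowski n).mulVec (grad (𝒯.int i) u x) ⬝ᵥ grad (𝒯.int i) z x

/-- `a_h(u, z) = a(u, z) - (A ∇_{t,x} u · n_{∂M}, z)_{∂M} - (∇ z · n_{∂Ω}, u)_Σ`. On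
`Σ = (0, T) × ∂Ω` one has `n_{∂M} = (0, n_{∂Ω})`, so that the components `1, …, n` of `n_{∂M}`
are those of `n_{∂Ω}`. -/
def ahForm (𝒯 : Triangulation M) (Sig : Set (SpaceTime n)) (u z : SpaceTime n → ℝ) : ℝ :=
  𝒯.aForm u z -
    (∑ i, ∫ x in 𝒯.bdry i,
      ((minkowski n).mulVec (traceGrad (𝒯.int i) u x) ⬝ᵥ outerNormal M x) *
        trace (𝒯.int i) z x ∂(surface n)) -
    ∑ i, ∫ x in 𝒯.elem i ∩ Sig,
      (∑ k : Fin n, traceGrad (𝒯.int i) z x k.succ * outerNormal M x k.succ) *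
        trace (𝒯.int i) u x ∂(surface n)

/-- The primal stabilizer `s = ∑_K s_K`, where `s_K(u, v)` is
`(h □u, h □v)_K + (h^{-1/2} u, h^{-1/2} v)_{∂K ∩ Σ}
  + ∑_{F ⊆ ∂K interior} (h^{1/2} [[A ∇u]], h^{1/2} [[A ∇v]])_F`. -/
def sForm (𝒯 : Triangulation M) (Sig : Set (SpaceTime n)) (u v : SpaceTime n → ℝ) : ℝ :=
  ∑ i, (𝒯.meshSize ^ 2 * (∫ x in 𝒯.int i, box (𝒯.int i) u x * box (𝒯.int i) v x) +
    𝒯.meshSize⁻¹ *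
      (∫ x in 𝒯.elem i ∩ Sig, trace (𝒯.int i) u x * trace (𝒯.int i) v x ∂(surface n)) +
    ∑ j ∈ Finset.univ.erase i,
      𝒯.meshSize * ∫ x in 𝒯.face i j, 𝒯.jump i j u x * 𝒯.jump i j v x ∂(surface n))

/-- The dual stabilizer `s^* = ∑_K s^*_K`, where `s^*_K(z, w)` is
`(∇_{t,x} z, ∇_{t,x} w)_K + (h^{-1/2} z, h^{-1/2} w)_{∂K ∩ ∂M}`. -/
def sStarForm (𝒯 : Triangulation M) (z w : SpaceTime n → ℝ) : ℝ :=
  ∑ i, ((∫ x in 𝒯.int i, grad (𝒯.int i) z x ⬝ᵥ grad (𝒯.int i) w x) +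
    𝒯.meshSize⁻¹ *
      ∫ x in 𝒯.bdry i, trace (𝒯.int i) z x * trace (𝒯.int i) w x ∂(surface n))

/-- The bilinear form `𝒜_h[(u, z), (v, w)]` of the discrete Euler–Lagrange equations. -/
def bilin (𝒯 : Triangulation M) (Sig Obs : Set (SpaceTime n)) (γ γs : ℝ)
    (u z v w : SpaceTime n → ℝ) : ℝ :=
  (∫ x in Obs, u x * v x) + γ * 𝒯.sForm Sig u v + 𝒯.ahForm Sig v z + 𝒯.ahForm Sig u w -
    γs * 𝒯.sStarForm z w

/-- `(uh, zh) ∈ V_h^p × V_h^q` solves the discrete Euler–Lagrange equations with data `uObs`. -/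
def IsDiscreteSolution (𝒯 : Triangulation M) (Sig Obs : Set (SpaceTime n)) (γ γs : ℝ) (p q : ℕ)
    (uObs uh zh : SpaceTime n → ℝ) : Prop :=
  uh ∈ 𝒯.femSpace p ∧ zh ∈ 𝒯.femSpace q ∧
    ∀ v ∈ 𝒯.femSpace p, ∀ w ∈ 𝒯.femSpace q,
      𝒯.bilin Sig Obs γ γs uh zh v w = ∫ x in Obs, uObs x * v x

/-- The residual norm `‖(u, z)‖_S = (‖u‖²_𝒪 + |u|²_s + |z|²_{s^*})^{1/2}`. -/
def residualNorm (𝒯 : Triangulation M) (Sig Obs : Set (SpaceTime n))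
    (u z : SpaceTime n → ℝ) : ℝ :=
  Real.sqrt ((∫ x in Obs, u x ^ 2) + 𝒯.sForm Sig u u + 𝒯.sStarForm z z)

end Triangulation

/-- The family is quasi-uniform: for some `r > 0`, each element of each triangulation of the
family is star-shaped with respect to all points of a ball of radius `r h` that it contains. -/
def QuasiUniform {n : ℕ} {M : Set (SpaceTime n)} {ι : Type*} (𝒯 : ι → Triangulation M) : Prop :=
  ∃ r : ℝ, 0 < r ∧ ∀ a, ∀ i : Fin (𝒯 a).card, ∃ c : SpaceTime n,
    Metric.ball c (r * (𝒯 a).meshSize) ⊆ (𝒯 a).elem i ∧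
      ∀ y ∈ Metric.ball c (r * (𝒯 a).meshSize), StarConvex ℝ y ((𝒯 a).elem i)

/-- The assumption on the interpolants in `V_h^k`: each `v ∈ H^{k+1}(M)` has an interpolant
`πv ∈ V_h^k` with `‖v - πv‖_{H^m} ≤ C h^{k+1-m} ‖v‖_{H^{k+1}(M)}` for `m = 0, 1, 2`, where the
norm on the left is the elementwise one (a function in `V_h^k` is in general not in `H²(M)`). -/
def HasInterpolants {n : ℕ} {M : Set (SpaceTime n)} {ι : Type*} (𝒯 : ι → Triangulation M)
    (k : ℕ) : Prop :=
  ∃ C : ℝ, ∀ a, ∀ v : SpaceTime n → ℝ, MemSobolev M (k + 1) v →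
    ∃ w ∈ (𝒯 a).femSpace k, ∀ m ≤ 2,
      Real.sqrt (∑ i, sobolevNormSq ((𝒯 a).int i) m (v - w)) ≤
        C * (𝒯 a).meshSize ^ (k + 1 - m) * sobolevNorm M (k + 1) v

/-- `u ∈ H²(M)` solves the wave equation `□ u = 0` in `M = (0, T) × Ω` with `u = 0` on
`Σ = (0, T) × ∂Ω` (the Cauchy data of `u` at `t = 0` are unknown, hence unconstrained). -/
def IsWaveSolution {n : ℕ} (T : ℝ) (Ω : Set (EuclideanSpace ℝ (Fin n)))
    (u : SpaceTime n → ℝ) : Prop :=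
  MemSobolev (cylinder T Ω) 2 u ∧
    (∀ᵐ x ∂(volume.restrict (cylinder T Ω)), box (cylinder T Ω) u x = 0) ∧
    ∃ g, IsTrace (cylinder T Ω) u g ∧
      ∀ᵐ x ∂((surface n).restrict (cylinder T (frontier Ω))), g x = 0

end WaveDA

end

/-! The residual norm is exactly the quantity that the stabilised scheme controls, so no
observability or stability of the continuous problem is needed: consistency, positivity and
approximation suffice. Let η = u - πu be the interpolation error and ξ = u_h - πu the discrete
error. The exact solution is invisible to both forms: s(u, ·) = 0, because □u = 0, u = 0 on Σ and
the gradient of an H² function does not jump, and a_h(u, w) = 0 for every finite element function w,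
by elementwise integration by parts. The discrete equations then give the energy identity
(`error_identity`) ‖ξ‖²_𝒪 + γ s(ξ, ξ) + γ* s*(z_h, z_h) = (η, ξ)_𝒪 + γ s(η, ξ) - a_h(η, z_h).
Young's inequality absorbs ξ and z_h into the left side, and what remains is bounded by the sum over
the elements of h⁻²‖η‖² + ‖∇η‖² + h²‖∇²η‖², which is of order h^(2p) by the interpolation bounds. In
a_h(η, z_h) the pairing of A∇η · n with z_h on ∂M needs the trace inequality for ∇η, and the pairing
of ∇z_h · n with η on Σ needs the inverse inequality for polynomials (`abs_ahForm_le`). The triangle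
inequality for u - u_h = η - ξ finishes the proof (`residual_le`).

The bulk of the work is the calculus on the elements, whose only known geometry is that they have
diameter at most h and are star-shaped with respect to a ball of radius r h. The frontier of such a
body is locally a Lipschitz graph, which yields a trace inequality whose constant depends on n and r
alone (`exists_trace_const`). Shrinking towards the centre and mollifying shows that smooth
functions are dense in H¹ (`IsStarBody.exists_h1Tendsto`), so traces exist, are unique and obey the
inequality.

Integration by parts is obtained without an area formula. On one element the integral of a partial
derivative is bounded by the L² norm on the frontier, so Riesz' theorem provides some flux density
(`IsStarBody.exists_flux`). Summed over the elements, these densities cancel inside M, and on ∂M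
they are identified with the outward normal by comparing fluxes near boundary points with a C¹
defining function (`RegularAt.exists_flux_near`, `Triangulation.IsMesh.exists_flux`). The
exceptional sets (lower-dimensional faces, the edges of the cylinder, transversal crossings of ∂M
with facet hyperplanes) are locally contained in the zero set of two functions with independent
differentials and hence null (`surface_eq_zero_of_pair`). -/

open MeasureTheory Filter Topology

noncomputable section

namespace WaveDA

open scoped ContDiff ENNReal NNReal

/-! ### Projections along a line and the surface measure -/

section Projection

variable {n : ℕ}

/-- The hyperplane orthogonal to `d`. -/
abbrev hyper (d : SpaceTime n) : Submodule ℝ (SpaceTime n) := (ℝ ∙ d)ᗮ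

/-- The orthogonal projection along `d`. -/
abbrev projAlong (d : SpaceTime n) : SpaceTime n →L[ℝ] hyper d :=
  (hyper d).orthogonalProjectionOnto

lemma finrank_hyper {d : SpaceTime n} (hd : ‖d‖ = 1) : Module.finrank ℝ (hyper d) = n := by
  have h0 : d ≠ 0 := by rintro rfl; simp at hd
  have : Fact (Module.finrank ℝ (SpaceTime n) = n + 1) := ⟨by simp⟩
  exact Submodule.finrank_orthogonal_span_singleton h0

lemma hausdorff_hyper {d : SpaceTime n} (hd : ‖d‖ = 1) :
    (Measure.euclideanHausdorffMeasure n : Measure (hyper d)) = volume := by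
  have := InnerProductSpace.euclideanHausdorffMeasure_eq_volume (V := hyper d)
  rwa [finrank_hyper hd] at this

/-- This makes Fubini's theorem available along the lines parallel to `d`, with the hyperplane
orthogonal to `d` as the space of lines. -/
lemma measurePreserving_line {d : SpaceTime n} (hd : ‖d‖ = 1) :
    MeasurePreserving (fun q : ℝ × hyper d => q.1 • d + (q.2 : SpaceTime n))
      (volume.prod volume) volume := by
  have h1 := ((ℝ ∙ d).measurePreserving_measurableEquivProd (0 : SpaceTime n)).symm
  rw [InnerProductSpace.euclideanHausdorffMeasure_eq_volume] at h1
  have h2 : MeasurePreserving (LinearIsometryEquiv.toSpanUnitSingleton d hd) volume volume :=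
    LinearIsometryEquiv.measurePreserving _
  have h3 := h1.comp (h2.prod (MeasurePreserving.id (volume : Measure (hyper d))))
  have he : (fun q : ℝ × hyper d => q.1 • d + (q.2 : SpaceTime n)) =
      ((ℝ ∙ d).measurableEquivProd (0 : SpaceTime n)).symm ∘
        Prod.map (LinearIsometryEquiv.toSpanUnitSingleton d hd) id := by
    funext q
    simp
  rw [he]
  exact h3

lemma projAlong_line {d : SpaceTime n} (s : ℝ) (z : hyper d) :
    projAlong d (s • d + z) = z := by
  have : projAlong d d = 0 := by
    rw [Submodule.orthogonalProjectionOnto_eq_zero_iff, Submodule.orthogonal_orthogonal]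
    exact Submodule.mem_span_singleton_self d
  simp [map_add, this]

lemma eq_line {d : SpaceTime n} (hd : ‖d‖ = 1) (y : SpaceTime n) :
    inner ℝ d y • d + (projAlong d y : SpaceTime n) = y := by
  have h := (ℝ ∙ d).starProjection_add_starProjection_orthogonal y
  rw [Submodule.starProjection_unit_singleton ℝ hd] at h
  exact h

lemma projAlong_eq_sub {d : SpaceTime n} (hd : ‖d‖ = 1) (y : SpaceTime n) :
    (projAlong d y : SpaceTime n) = y - inner ℝ d y • d := by
  rw [eq_sub_iff_add_eq, add_comm, eq_line hd]

lemma norm_sq_line {d : SpaceTime n} (hd : ‖d‖ = 1) (y : SpaceTime n) :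
    ‖y‖ ^ 2 = inner ℝ d y ^ 2 + ‖projAlong d y‖ ^ 2 := by
  have h : inner ℝ (inner ℝ d y • d) (projAlong d y : SpaceTime n) = 0 := by
    rw [inner_smul_left, Submodule.mem_orthogonal_singleton_iff_inner_right.1 (projAlong d y).2,
      mul_zero]
  have := norm_add_sq_eq_norm_sq_add_norm_sq_of_inner_eq_zero _ _ h
  rw [eq_line hd, norm_smul, hd, mul_one, Real.norm_eq_abs] at this
  rw [sq, this, abs_mul_abs_self]; simp [sq]

lemma lintegral_line {d : SpaceTime n} (hd : ‖d‖ = 1) {G : SpaceTime n → ℝ≥0∞}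
    (hG : Measurable G) :
    ∫⁻ y, G y = ∫⁻ z : hyper d, ∫⁻ s : ℝ, G (s • d + z) := by
  have hm := measurePreserving_line hd
  rw [← hm.lintegral_comp hG]
  exact lintegral_prod_symm' _ (hG.comp hm.measurable)

lemma integral_line {d : SpaceTime n} (hd : ‖d‖ = 1) {G : SpaceTime n → ℝ}
    (hG : Integrable G) :
    ∫ y, G y = ∫ z : hyper d, ∫ s : ℝ, G (s • d + z) := by
  have hm := measurePreserving_line hd
  have h1 : Integrable (fun q : ℝ × hyper d => G (q.1 • d + (q.2 : SpaceTime n)))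
      (volume.prod volume) := hm.integrable_comp_of_integrable hG
  rw [← integral_prod_symm _ h1, ← hm.map_eq, integral_map hm.measurable.aemeasurable
    (by rw [hm.map_eq]; exact hG.aestronglyMeasurable)]

lemma surface_image_le {X Y : Type*} [MetricSpace X] [MeasurableSpace X] [BorelSpace X]
    [MetricSpace Y] [MeasurableSpace Y] [BorelSpace Y] {f : X → Y} {K : ℝ≥0} {s : Set X}
    (hf : LipschitzOnWith K f s) (m : ℕ) :
    Measure.euclideanHausdorffMeasure m (f '' s) ≤
      (K : ℝ≥0∞) ^ m * Measure.euclideanHausdorffMeasure m s := by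
  have := hf.hausdorffMeasure_image_le (Nat.cast_nonneg m : (0 : ℝ) ≤ m)
  rw [ENNReal.rpow_natCast] at this
  simp only [Measure.euclideanHausdorffMeasure_def, Measure.smul_apply, ENNReal.smul_def,
    smul_eq_mul]
  calc _ ≤ _ * ((K : ℝ≥0∞) ^ m * Measure.hausdorffMeasure (m : ℝ) s) := by gcongr
    _ = _ := by ring

/-- The hypothesis makes `f` injective on `s` with an `L`-Lipschitz inverse, and the bound for
Lipschitz images is applied to that inverse. -/
lemma surface_le_of_antilipschitz {X Y : Type*} [MetricSpace X] [MeasurableSpace X]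
    [BorelSpace X] [MetricSpace Y] [MeasurableSpace Y] [BorelSpace Y] {f : X → Y} {s : Set X}
    {L : ℝ≥0} (hf : ∀ x ∈ s, ∀ y ∈ s, dist x y ≤ L * dist (f x) (f y)) (m : ℕ) :
    Measure.euclideanHausdorffMeasure m s ≤
      (L : ℝ≥0∞) ^ m * Measure.euclideanHausdorffMeasure m (f '' s) := by
  rcases s.eq_empty_or_nonempty with rfl | ⟨x₀, hx₀⟩
  · simp
  have : Nonempty X := ⟨x₀⟩
  have hinj : Set.InjOn f s := by
    intro x hx y hy hxy
    have := hf x hx y hy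
    rw [hxy, dist_self, mul_zero] at this
    exact dist_le_zero.1 this
  have hleft := hinj.leftInvOn_invFunOn
  have himg : Function.invFunOn f s '' (f '' s) = s := hleft.image_image
  have hl : LipschitzOnWith L (Function.invFunOn f s) (f '' s) := by
    apply LipschitzOnWith.of_dist_le_mul
    rintro _ ⟨x, hx, rfl⟩ _ ⟨y, hy, rfl⟩
    rw [hleft hx, hleft hy]
    exact hf x hx y hy
  have := surface_image_le hl m
  rwa [himg] at this

/-- Together with `le_map_projAlong` this stands in for the area formula: the projection is
1-Lipschitz, and on `S` it has an `L`-Lipschitz inverse. Only inequalities between surface integrals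
and integrals over the hyperplane are needed. -/
lemma map_projAlong_le {d : SpaceTime n} (hd : ‖d‖ = 1) {S : Set (SpaceTime n)} {L : ℝ≥0}
    (hS : ∀ y ∈ S, ∀ z ∈ S, dist y z ≤ L * dist (projAlong d y) (projAlong d z)) :
    ((surface n).restrict S).map (projAlong d) ≤ ((L : ℝ≥0∞) ^ n) • volume := by
  refine Measure.le_iff.2 fun B hB => ?_
  have hmeas : Measurable (projAlong d) := (projAlong d).continuous.measurable
  rw [Measure.map_apply hmeas hB, Measure.restrict_apply (hmeas hB), Measure.smul_apply,
    smul_eq_mul, ← hausdorff_hyper hd]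
  refine (surface_le_of_antilipschitz (f := projAlong d) (L := L)
    (fun x hx y hy => hS x hx.2 y hy.2) n).trans ?_
  gcongr
  rintro _ ⟨y, hy, rfl⟩
  exact hy.1

lemma le_map_projAlong {d : SpaceTime n} (hd : ‖d‖ = 1) (S : Set (SpaceTime n)) :
    volume.restrict (projAlong d '' S) ≤ ((surface n).restrict S).map (projAlong d) := by
  refine Measure.le_iff.2 fun B hB => ?_
  have hmeas : Measurable (projAlong d) := (projAlong d).continuous.measurable
  rw [Measure.map_apply hmeas hB, Measure.restrict_apply (hmeas hB), Measure.restrict_apply hB,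
    ← hausdorff_hyper hd]
  have hl : LipschitzOnWith 1 (projAlong d) (projAlong d ⁻¹' B ∩ S) :=
    ((Submodule.lipschitzWith_orthogonalProjectionOnto (hyper d))).lipschitzOnWith
  refine le_trans (measure_mono ?_) ((surface_image_le hl n).trans (by simp))
  rintro _ ⟨hz, y, hy, rfl⟩
  exact ⟨y, ⟨hz, hy⟩, rfl⟩

/-- The inner integral depends only on the line through `y`, hence only on the projection of `y`.
The pushforward bound turns the outer integral into a Fubini integral over all lines. -/
lemma lintegral_lines_le {d : SpaceTime n} (hd : ‖d‖ = 1) {S : Set (SpaceTime n)} {L : ℝ≥0}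
    (hS : ∀ y ∈ S, ∀ z ∈ S, dist y z ≤ L * dist (projAlong d y) (projAlong d z))
    {G : SpaceTime n → ℝ≥0∞} (hG : Measurable G) :
    ∫⁻ y in S, (∫⁻ s : ℝ, G (y + s • d)) ∂(surface n) ≤ (L : ℝ≥0∞) ^ n * ∫⁻ y, G y := by
  have hshift : ∀ y : SpaceTime n,
      ∫⁻ s : ℝ, G (y + s • d) = ∫⁻ s : ℝ, G (s • d + (projAlong d y : SpaceTime n)) := by
    intro y
    rw [← lintegral_add_left_eq_self (μ := volume)
      (fun s : ℝ => G (s • d + (projAlong d y : SpaceTime n))) (inner ℝ d y)]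
    congr 1 with s
    rw [projAlong_eq_sub hd]
    congr 1
    module
  have hm : Measurable fun z : hyper d => ∫⁻ s : ℝ, G (s • d + (z : SpaceTime n)) := by
    apply Measurable.lintegral_prod_right
    exact hG.comp (measurePreserving_line hd).measurable |>.comp measurable_swap
  calc ∫⁻ y in S, (∫⁻ s : ℝ, G (y + s • d)) ∂(surface n)
      = ∫⁻ z, (∫⁻ s : ℝ, G (s • d + (z : SpaceTime n)))
          ∂((surface n).restrict S).map (projAlong d) := by
        rw [lintegral_map hm (projAlong d).continuous.measurable]
        exact lintegral_congr fun y => hshift y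
    _ ≤ ∫⁻ z : hyper d, (∫⁻ s : ℝ, G (s • d + (z : SpaceTime n))) ∂(((L : ℝ≥0∞) ^ n) • volume) :=
        lintegral_mono' (map_projAlong_le hd hS) le_rfl
    _ = _ := by rw [lintegral_smul_measure, lintegral_line hd hG, smul_eq_mul]

end Projection

/-! ### Hypersurfaces transversal to a direction -/

section Transversal

variable {n : ℕ}

/-- Inside `B`, the set `U` lies behind its frontier in the direction `d`. -/
def Transversal (U B : Set (SpaceTime n)) (d : SpaceTime n) : Prop :=
  ∀ y ∈ frontier U ∩ B, ∀ s : ℝ, 0 < s →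
    (y - s • d ∈ B → y - s • d ∈ interior U) ∧ (y + s • d ∈ B → y + s • d ∉ closure U)

/-- The integral of `∂_d φ` over the part in `U` of the line through `z` in direction `d`. -/
def sliceIntegral (U : Set (SpaceTime n)) (d : SpaceTime n) (φ : SpaceTime n → ℝ)
    (z : hyper d) : ℝ :=
  ∫ s : ℝ, U.indicator (fun y => fderiv ℝ φ y d) (s • d + (z : SpaceTime n))

lemma hasDerivAt_slice {φ : SpaceTime n → ℝ} (hφ : ContDiff ℝ 1 φ) (d z : SpaceTime n) (s : ℝ) :
    HasDerivAt (fun s : ℝ => φ (s • d + z)) (fderiv ℝ φ (s • d + z) d) s := by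
  have h1 : HasDerivAt (fun s : ℝ => s • d + z) d s := by
    simpa using ((hasDerivAt_id s).smul_const d).add_const z
  exact ((hφ.differentiable one_ne_zero).differentiableAt.hasFDerivAt).comp_hasDerivAt s h1

lemma contDiff_slice {φ : SpaceTime n → ℝ} (hφ : ContDiff ℝ 1 φ) (d z : SpaceTime n) :
    ContDiff ℝ 1 (fun s : ℝ => φ (s • d + z)) := by
  fun_prop

lemma hasCompactSupport_slice {φ : SpaceTime n → ℝ} (hc : HasCompactSupport φ)
    {d : SpaceTime n} (hd : ‖d‖ = 1) (z : SpaceTime n) :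
    HasCompactSupport (fun s : ℝ => φ (s • d + z)) := by
  refine hc.comp_isClosedEmbedding (g := fun s : ℝ => s • d + z) ?_
  have hd0 : d ≠ 0 := by rintro rfl; simp at hd
  exact (Homeomorph.addRight z).isClosedEmbedding.comp (isClosedEmbedding_smul_left hd0)

lemma fderiv_eq_zero_of_notMem {φ : SpaceTime n → ℝ} {B : Set (SpaceTime n)}
    (hB : tsupport φ ⊆ B) {y : SpaceTime n} (hy : y ∉ B) : fderiv ℝ φ y = 0 := by
  have : y ∉ tsupport (fderiv ℝ φ) := fun h => hy (hB (tsupport_fderiv_subset ℝ h))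
  exact image_eq_zero_of_notMem_tsupport this

/-- As far as the support of `φ` can see, the line lies in `U` before `y` and outside `U` after `y`.
The slice integral is then that of a derivative over a half-line, and the fundamental theorem leaves
the value at its end. -/
lemma sliceIntegral_of_mem {U : Set (SpaceTime n)} {B : Set (SpaceTime n)} {d : SpaceTime n}
    (hd : ‖d‖ = 1) (hT : Transversal U B d) {φ : SpaceTime n → ℝ} (hφ : ContDiff ℝ 1 φ)
    (hc : HasCompactSupport φ) (hB : tsupport φ ⊆ B) {y : SpaceTime n}
    (hy : y ∈ frontier U ∩ B) : sliceIntegral U d φ (projAlong d y) = φ y := by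
  set z : SpaceTime n := (projAlong d y : SpaceTime n) with hz
  set s₀ : ℝ := inner ℝ d y with hs₀
  have hyz : s₀ • d + z = y := eq_line hd y
  have hpt : ∀ s : ℝ, s • d + z = y - (s₀ - s) • d := fun s => by rw [← hyz]; module
  have hderiv : deriv (fun s : ℝ => φ (s • d + z)) = fun s => fderiv ℝ φ (s • d + z) d :=
    funext fun s => (hasDerivAt_slice hφ d z s).deriv
  have hae : (fun s : ℝ => U.indicator (fun y => fderiv ℝ φ y d) (s • d + z)) =ᵐ[volume]
      (Set.Iic s₀).indicator (deriv fun s : ℝ => φ (s • d + z)) := by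
    have hne : ∀ᵐ s : ℝ ∂volume, s ≠ s₀ := Measure.ae_ne volume s₀
    filter_upwards [hne] with s hs
    rw [hderiv]
    by_cases hsB : s • d + z ∈ B
    · rcases lt_or_gt_of_ne hs with h | h
      · have hin : s • d + z ∈ U := by
          have := (hT y hy (s₀ - s) (by linarith)).1
          rw [← hpt] at this
          exact interior_subset (this hsB)
        rw [Set.indicator_of_mem hin, Set.indicator_of_mem (Set.mem_Iic.2 h.le)]
      · have hout : s • d + z ∉ U := by
          have := (hT y hy (s - s₀) (by linarith)).2
          have he : y + (s - s₀) • d = s • d + z := by rw [← hyz]; module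
          rw [he] at this
          exact fun hh => this hsB (subset_closure hh)
        rw [Set.indicator_of_notMem hout,
          Set.indicator_of_notMem (by simp only [Set.mem_Iic, not_le]; exact h)]
    · have h0 := fderiv_eq_zero_of_notMem hB hsB
      simp [Set.indicator_apply, h0]
  rw [sliceIntegral, ← hz, integral_congr_ae hae, integral_indicator measurableSet_Iic,
    HasCompactSupport.integral_Iic_deriv_eq (contDiff_slice hφ d z)
      (hasCompactSupport_slice hc hd z) s₀, hyz]

/-- The part of the line in the convex set `B` is connected and misses the frontier, so it lies
entirely in `U` or entirely outside. In the first case a compactly supported derivative is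
integrated over the whole line, in the second the integrand is zero. -/
lemma sliceIntegral_of_notMem {U : Set (SpaceTime n)} {B : Set (SpaceTime n)} {d : SpaceTime n}
    (hd : ‖d‖ = 1) (hBc : Convex ℝ B) {φ : SpaceTime n → ℝ} (hφ : ContDiff ℝ 1 φ)
    (hc : HasCompactSupport φ) (hB : tsupport φ ⊆ B) {z : hyper d}
    (hz : z ∉ projAlong d '' (frontier U ∩ B)) : sliceIntegral U d φ z = 0 := by
  set J : Set (SpaceTime n) := B ∩ Set.range (fun s : ℝ => s • d + (z : SpaceTime n)) with hJ
  have hJp : IsPreconnected J := by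
    refine (hBc.inter ?_).isPreconnected
    rw [← Set.image_univ]
    have : Convex ℝ ((AffineMap.lineMap (z : SpaceTime n) (d + z) : ℝ →ᵃ[ℝ] SpaceTime n) ''
      Set.univ) := convex_univ.affine_image _
    convert this using 1
    refine Set.image_congr' fun s => ?_
    simp [AffineMap.lineMap_apply]
  have hno : ¬ (J ∩ frontier U).Nonempty := by
    rintro ⟨y, ⟨hyB, s, rfl⟩, hyU⟩
    exact hz ⟨_, ⟨hyU, hyB⟩, projAlong_line s z⟩
  have hderiv : deriv (fun s : ℝ => φ (s • d + (z : SpaceTime n))) =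
      fun s => fderiv ℝ φ (s • d + z) d :=
    funext fun s => (hasDerivAt_slice hφ d z s).deriv
  by_cases h1 : (J ∩ U).Nonempty
  · have h2 : J ⊆ U := by
      by_contra hcon
      obtain ⟨y, hyJ, hyU⟩ := Set.not_subset.1 hcon
      have h3 := hJp (interior U) (closure U)ᶜ isOpen_interior isClosed_closure.isOpen_compl
        (fun x hx => by
          by_contra hcon
          simp only [Set.mem_union, Set.mem_compl_iff, not_or, not_not] at hcon
          exact hno ⟨x, hx, hcon.2, hcon.1⟩)
      obtain ⟨x, hxJ, hxU⟩ := h1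
      have hxi : x ∈ interior U := by
        by_contra hcon
        exact hno ⟨x, hxJ, subset_closure hxU, hcon⟩
      have hyi : y ∈ (closure U)ᶜ := fun hcon =>
        hno ⟨y, hyJ, hcon, fun h => hyU (interior_subset h)⟩
      obtain ⟨w, -, hw1, hw2⟩ := h3 ⟨x, hxJ, hxi⟩ ⟨y, hyJ, hyi⟩
      exact hw2 (subset_closure (interior_subset hw1))
    have : (fun s : ℝ => U.indicator (fun y => fderiv ℝ φ y d) (s • d + (z : SpaceTime n))) =
        deriv fun s : ℝ => φ (s • d + (z : SpaceTime n)) := by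
      rw [hderiv]
      funext s
      by_cases hsB : s • d + (z : SpaceTime n) ∈ B
      · rw [Set.indicator_of_mem (h2 ⟨hsB, s, rfl⟩)]
      · have h0 := fderiv_eq_zero_of_notMem hB hsB
        simp [h0]
    rw [sliceIntegral, this]
    have hint : Integrable (deriv fun s : ℝ => φ (s • d + (z : SpaceTime n))) :=
      ((contDiff_slice hφ d z).continuous_deriv le_rfl).integrable_of_hasCompactSupport
        (hasCompactSupport_slice hc hd z).deriv
    have hint' : Integrable (fun s : ℝ => φ (s • d + (z : SpaceTime n))) :=
      (contDiff_slice hφ d z).continuous.integrable_of_hasCompactSupport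
        (hasCompactSupport_slice hc hd z)
    exact integral_eq_zero_of_hasDerivAt_of_integrable
      (fun s => ((contDiff_slice hφ d z).differentiable one_ne_zero s).hasDerivAt) hint hint'
  · have : (fun s : ℝ => U.indicator (fun y => fderiv ℝ φ y d) (s • d + (z : SpaceTime n))) =
        fun _ => 0 := by
      funext s
      by_cases hsB : s • d + (z : SpaceTime n) ∈ B
      · rw [Set.indicator_of_notMem fun hU => h1 ⟨_, ⟨hsB, s, rfl⟩, hU⟩]
      · have h0 := fderiv_eq_zero_of_notMem hB hsB
        simp [h0]
    rw [sliceIntegral, this, integral_zero]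

lemma integrable_fderiv_apply {φ : SpaceTime n → ℝ} (hφ : ContDiff ℝ 1 φ)
    (hc : HasCompactSupport φ) (d : SpaceTime n) : Integrable (fun y => fderiv ℝ φ y d) :=
  ((hφ.continuous_fderiv one_ne_zero).clm_apply continuous_const).integrable_of_hasCompactSupport
    (hc.fderiv_apply ℝ d)

lemma integral_eq_sliceIntegral {U : Set (SpaceTime n)} (hU : MeasurableSet U) {d : SpaceTime n}
    (hd : ‖d‖ = 1) {φ : SpaceTime n → ℝ} (hφ : ContDiff ℝ 1 φ) (hc : HasCompactSupport φ) :
    ∫ y in U, fderiv ℝ φ y d = ∫ z, sliceIntegral U d φ z := by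
  rw [← integral_indicator hU, integral_line hd
    ((integrable_fderiv_apply hφ hc d).indicator hU)]
  rfl

lemma measurable_sliceIntegral {U : Set (SpaceTime n)} (hU : MeasurableSet U) {d : SpaceTime n}
    (hd : ‖d‖ = 1) {φ : SpaceTime n → ℝ} (hφ : ContDiff ℝ 1 φ) :
    Measurable (sliceIntegral U d φ) := by
  have hm : Measurable (U.indicator (fun y => fderiv ℝ φ y d)) :=
    (((hφ.continuous_fderiv one_ne_zero).clm_apply continuous_const).measurable).indicator hU
  have h2 : Measurable (fun q : hyper d × ℝ =>
      U.indicator (fun y => fderiv ℝ φ y d) (q.2 • d + (q.1 : SpaceTime n))) :=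
    (hm.comp (measurePreserving_line hd).measurable).comp measurable_swap
  exact (h2.stronglyMeasurable.integral_prod_right).measurable

/-- The flux of `φ d` through a transversal hypersurface is bounded by the surface integral. -/
lemma enorm_integral_fderiv_le {U : Set (SpaceTime n)} (hU : MeasurableSet U)
    {B : Set (SpaceTime n)} (hBc : Convex ℝ B) (hBm : MeasurableSet B) {d : SpaceTime n}
    (hd : ‖d‖ = 1) (hT : Transversal U B d) {φ : SpaceTime n → ℝ} (hφ : ContDiff ℝ 1 φ)
    (hc : HasCompactSupport φ) (hB : tsupport φ ⊆ B) :
    ‖∫ y in U, fderiv ℝ φ y d‖ₑ ≤ ∫⁻ y in frontier U ∩ B, ‖φ y‖ₑ ∂(surface n) := by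
  set S := frontier U ∩ B
  have hmeas := measurable_sliceIntegral hU hd hφ
  have hSm : MeasurableSet S := isClosed_frontier.measurableSet.inter hBm
  rw [integral_eq_sliceIntegral hU hd hφ hc]
  calc ‖∫ z, sliceIntegral U d φ z‖ₑ ≤ ∫⁻ z, ‖sliceIntegral U d φ z‖ₑ :=
        enorm_integral_le_lintegral_enorm _
    -- The projection of `S` may fail to be measurable. The domain is therefore first cut down to
    -- the measurable set where the slice integral does not vanish, and only then enlarged to the
    -- projection.
    _ = ∫⁻ z in {z | ‖sliceIntegral U d φ z‖ₑ ≠ 0}, ‖sliceIntegral U d φ z‖ₑ := by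
        have hN : MeasurableSet {z | ‖sliceIntegral U d φ z‖ₑ ≠ 0} :=
          hmeas.enorm (measurableSet_singleton 0).compl
        rw [← lintegral_indicator hN]
        congr 1 with z
        by_cases hz : ‖sliceIntegral U d φ z‖ₑ = 0
        · rw [Set.indicator_of_notMem (by simpa using hz), hz]
        · rw [Set.indicator_of_mem (by simpa using hz)]
    _ ≤ ∫⁻ z in projAlong d '' S, ‖sliceIntegral U d φ z‖ₑ := by
        refine lintegral_mono_set fun z hz => ?_
        by_contra hcon
        exact hz (by simp [sliceIntegral_of_notMem hd hBc hφ hc hB hcon])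
    _ ≤ ∫⁻ z, ‖sliceIntegral U d φ z‖ₑ ∂((surface n).restrict S).map (projAlong d) :=
        lintegral_mono' (le_map_projAlong hd S) le_rfl
    _ = ∫⁻ y in S, ‖sliceIntegral U d φ (projAlong d y)‖ₑ ∂(surface n) :=
        lintegral_map hmeas.enorm (projAlong d).continuous.measurable
    _ = ∫⁻ y in S, ‖φ y‖ₑ ∂(surface n) :=
        setLIntegral_congr_fun hSm fun y hy => by
          rw [sliceIntegral_of_mem hd hT hφ hc hB hy]

/-- The surface integral over a transversal hypersurface that is close to its projection along `d`
is bounded by the flux of `φ d`. -/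
lemma lintegral_le_integral_fderiv {U : Set (SpaceTime n)} (hU : MeasurableSet U)
    {B : Set (SpaceTime n)} (hBc : Convex ℝ B) (hBm : MeasurableSet B) {d : SpaceTime n}
    (hd : ‖d‖ = 1) (hT : Transversal U B d) {φ : SpaceTime n → ℝ} (hφ : ContDiff ℝ 1 φ)
    (hc : HasCompactSupport φ) (hB : tsupport φ ⊆ B) (hpos : ∀ y, 0 ≤ φ y) {L : ℝ≥0}
    (hL : ∀ y ∈ frontier U ∩ B, ∀ z ∈ frontier U ∩ B,
      dist y z ≤ L * dist (projAlong d y) (projAlong d z)) :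
    ∫⁻ y in frontier U ∩ B, ENNReal.ofReal (φ y) ∂(surface n) ≤
      (L : ℝ≥0∞) ^ n * ENNReal.ofReal (∫ y in U, fderiv ℝ φ y d) := by
  set S := frontier U ∩ B
  have hmeas := measurable_sliceIntegral hU hd hφ
  have hSm : MeasurableSet S := isClosed_frontier.measurableSet.inter hBm
  have hnonneg : ∀ z, 0 ≤ sliceIntegral U d φ z := by
    intro z
    by_cases hz : z ∈ projAlong d '' S
    · obtain ⟨y, hy, rfl⟩ := hz
      rw [sliceIntegral_of_mem hd hT hφ hc hB hy]; exact hpos y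
    · rw [sliceIntegral_of_notMem hd hBc hφ hc hB hz]
  have hint : Integrable (sliceIntegral U d φ) := by
    have h1 : Integrable (fun q : ℝ × hyper d =>
        U.indicator (fun y => fderiv ℝ φ y d) (q.1 • d + (q.2 : SpaceTime n)))
        (volume.prod volume) :=
      (measurePreserving_line hd).integrable_comp_of_integrable
        ((integrable_fderiv_apply hφ hc d).indicator hU)
    exact h1.integral_prod_right
  calc ∫⁻ y in S, ENNReal.ofReal (φ y) ∂(surface n)
      = ∫⁻ y in S, ENNReal.ofReal (sliceIntegral U d φ (projAlong d y)) ∂(surface n) :=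
        setLIntegral_congr_fun hSm fun y hy => by
          rw [sliceIntegral_of_mem hd hT hφ hc hB hy]
    _ = ∫⁻ z, ENNReal.ofReal (sliceIntegral U d φ z)
          ∂((surface n).restrict S).map (projAlong d) :=
        (lintegral_map hmeas.ennreal_ofReal (projAlong d).continuous.measurable).symm
    _ ≤ ∫⁻ z : hyper d, ENNReal.ofReal (sliceIntegral U d φ z) ∂(((L : ℝ≥0∞) ^ n) • volume) :=
        lintegral_mono' (map_projAlong_le hd hL) le_rfl
    _ = _ := by
        rw [lintegral_smul_measure, smul_eq_mul, integral_eq_sliceIntegral hU hd hφ hc,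
          ofReal_integral_eq_lintegral_ofReal hint (ae_of_all _ hnonneg)]

/-- A trace inequality for a hypersurface `S` and a layer of width `δ` behind it. -/
lemma lintegral_surface_le_layer {d : SpaceTime n} (hd : ‖d‖ = 1) {S : Set (SpaceTime n)}
    (hSm : MeasurableSet S) {L : ℝ≥0}
    (hS : ∀ y ∈ S, ∀ z ∈ S, dist y z ≤ L * dist (projAlong d y) (projAlong d z))
    {K : Set (SpaceTime n)} (hK : MeasurableSet K) {δ : ℝ} (hδ : 0 < δ)
    (hSK : ∀ y ∈ S, ∀ s ∈ Set.Ioo 0 δ, y - s • d ∈ K)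
    {ψ : SpaceTime n → ℝ} (hψ : ContDiff ℝ 1 ψ) (hpos : ∀ y, 0 ≤ ψ y) :
    ENNReal.ofReal δ * ∫⁻ y in S, ENNReal.ofReal (ψ y) ∂(surface n) ≤
      (L : ℝ≥0∞) ^ n * (∫⁻ y in K, ENNReal.ofReal (ψ y + δ * ‖fderiv ℝ ψ y‖)) := by
  set g : SpaceTime n → ℝ := fun y => ψ y + δ * ‖fderiv ℝ ψ y‖ with hg
  have hgc : Continuous g :=
    hψ.continuous.add (continuous_const.mul (hψ.continuous_fderiv one_ne_zero).norm)
  set G : SpaceTime n → ℝ≥0∞ := K.indicator fun y => ENNReal.ofReal (g y) with hG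
  have hGm : Measurable G := (hgc.measurable.ennreal_ofReal).indicator hK
  -- Bound `ψ y` by its value at a point behind `y` plus the integral of the gradient along the way,
  -- and integrate this over the layer of width `δ`.
  have key : ∀ y ∈ S, ENNReal.ofReal δ * ENNReal.ofReal (ψ y) ≤ ∫⁻ s : ℝ, G (y + s • d) := by
    intro y hy
    have hline : ∀ s : ℝ, HasDerivAt (fun s : ℝ => ψ (s • d + y)) (fderiv ℝ ψ (s • d + y) d) s :=
      fun s => hasDerivAt_slice hψ d y s
    have hcont : Continuous fun s : ℝ => ‖fderiv ℝ ψ (s • d + y)‖ :=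
      ((hψ.continuous_fderiv one_ne_zero).comp (by fun_prop)).norm
    have hcont' : Continuous fun s : ℝ => fderiv ℝ ψ (s • d + y) d :=
      ((hψ.continuous_fderiv one_ne_zero).comp (by fun_prop)).clm_apply continuous_const
    set I := ∫ t in (-δ)..0, ‖fderiv ℝ ψ (t • d + y)‖ with hI
    have hpt : ∀ s ∈ Set.Icc (-δ) 0, ψ y ≤ ψ (s • d + y) + I := by
      intro s hs
      have h1 : ∫ t in s..0, fderiv ℝ ψ (t • d + y) d = ψ ((0 : ℝ) • d + y) - ψ (s • d + y) :=
        intervalIntegral.integral_eq_sub_of_hasDerivAt (fun t _ => hline t)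
          (hcont'.intervalIntegrable _ _)
      have h2 : ∫ t in s..0, fderiv ℝ ψ (t • d + y) d ≤ ∫ t in s..0, ‖fderiv ℝ ψ (t • d + y)‖ := by
        refine intervalIntegral.integral_mono_on hs.2 (hcont'.intervalIntegrable _ _)
          (hcont.intervalIntegrable _ _) fun t _ => ?_
        refine (le_abs_self _).trans ?_
        have := (fderiv ℝ ψ (t • d + y)).le_opNorm d
        rwa [hd, mul_one] at this
      have h3 : ∫ t in s..0, ‖fderiv ℝ ψ (t • d + y)‖ ≤ I := by
        refine intervalIntegral.integral_mono_interval hs.1 hs.2 le_rfl ?_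
          (hcont.intervalIntegrable _ _)
        exact ae_of_all _ fun t => norm_nonneg _
      rw [zero_smul, zero_add] at h1
      linarith
    have hψc : Continuous fun s : ℝ => ψ (s • d + y) := (contDiff_slice hψ d y).continuous
    have h4 : δ * ψ y ≤ ∫ s in (-δ)..0, g (s • d + y) := by
      have : ∫ _s in (-δ)..0, ψ y ≤ ∫ s in (-δ)..0, (ψ (s • d + y) + I) :=
        intervalIntegral.integral_mono_on (by linarith) (by simp)
          ((hψc.add continuous_const).intervalIntegrable _ _) hpt
      rw [intervalIntegral.integral_const, intervalIntegral.integral_add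
        (hψc.intervalIntegrable _ _) (by simp), intervalIntegral.integral_const] at this
      simp only [hg]
      rw [intervalIntegral.integral_add (hψc.intervalIntegrable _ _)
        ((hcont.intervalIntegrable _ _).const_mul δ),
        intervalIntegral.integral_const_mul]
      simpa using this
    rw [← ENNReal.ofReal_mul hδ.le]
    calc ENNReal.ofReal (δ * ψ y) ≤ ENNReal.ofReal (∫ s in (-δ)..0, g (s • d + y)) :=
          ENNReal.ofReal_le_ofReal h4
      _ = ∫⁻ s in Set.Ioc (-δ) 0, ENNReal.ofReal (g (s • d + y)) := by
          rw [intervalIntegral.integral_of_le (by linarith)]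
          refine ofReal_integral_eq_lintegral_ofReal ?_ (ae_of_all _ fun s => ?_)
          · exact ((hgc.comp (by fun_prop : Continuous fun s : ℝ => s • d + y)).intervalIntegrable
              (-δ) 0).1
          · have := hpos (s • d + y)
            simp only [hg, Pi.zero_apply]
            positivity
      -- The endpoints are dropped because the layer condition covers the open interval only.
      _ = ∫⁻ s in Set.Ioo (-δ) 0, G (y + s • d) := by
          rw [← Measure.restrict_congr_set Ioo_ae_eq_Ioc]
          refine setLIntegral_congr_fun measurableSet_Ioo fun s hs => ?_
          have : y + s • d ∈ K := by
            have := hSK y hy (-s) ⟨by linarith [hs.2], by linarith [hs.1]⟩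
            simpa [sub_neg_eq_add] using this
          simp only [hG]
          rw [Set.indicator_of_mem this, add_comm]
      _ ≤ ∫⁻ s : ℝ, G (y + s • d) := setLIntegral_le_lintegral _ _
  calc ENNReal.ofReal δ * ∫⁻ y in S, ENNReal.ofReal (ψ y) ∂(surface n)
      = ∫⁻ y in S, ENNReal.ofReal δ * ENNReal.ofReal (ψ y) ∂(surface n) :=
        (lintegral_const_mul _ hψ.continuous.measurable.ennreal_ofReal).symm
    _ ≤ ∫⁻ y in S, (∫⁻ s : ℝ, G (y + s • d)) ∂(surface n) := setLIntegral_mono' hSm key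
    _ ≤ (L : ℝ≥0∞) ^ n * ∫⁻ y, G y := lintegral_lines_le hd hS hGm
    _ = _ := by rw [hG, lintegral_indicator hK]

end Transversal

/-! ### Bodies that are star-shaped with respect to a ball -/

section StarBody

variable {n : ℕ}

/-- `K` is closed, of diameter at most `h`, and star-shaped with respect to all points of the ball
of radius `κ` around `c`, which it contains. -/
structure IsStarBody (K : Set (SpaceTime n)) (c : SpaceTime n) (κ h : ℝ) : Prop where
  closed : IsClosed K
  pos : 0 < κ
  ball_subset : Metric.ball c κ ⊆ K
  star : ∀ y ∈ Metric.ball c κ, StarConvex ℝ y K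
  dist_le : ∀ x ∈ K, ∀ y ∈ K, dist x y ≤ h

namespace IsStarBody

variable {K : Set (SpaceTime n)} {c : SpaceTime n} {κ h : ℝ}

lemma center_mem (hK : IsStarBody K c κ h) : c ∈ K :=
  hK.ball_subset (Metric.mem_ball_self hK.pos)

lemma isBounded (hK : IsStarBody K c κ h) : Bornology.IsBounded K :=
  Metric.isBounded_iff.2 ⟨h, fun x hx y hy => hK.dist_le x hx y hy⟩

lemma isCompact (hK : IsStarBody K c κ h) : IsCompact K :=
  Metric.isCompact_of_isClosed_isBounded hK.closed hK.isBounded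

/-- The homothety `z ↦ (1 - t) x + t z` maps the ball onto an open set, and star-shapedness with
respect to every point of the ball keeps this set inside `K`. -/
lemma combo_mem_interior (hK : IsStarBody K c κ h) {x y : SpaceTime n} (hx : x ∈ K)
    (hy : y ∈ Metric.ball c κ) {t : ℝ} (ht : 0 < t) (ht1 : t ≤ 1) :
    (1 - t) • x + t • y ∈ interior K := by
  have hopen : IsOpen ((fun z : SpaceTime n => (1 - t) • x + t • z) '' Metric.ball c κ) := by
    have : (fun z : SpaceTime n => (1 - t) • x + t • z) =
        (Homeomorph.addLeft ((1 - t) • x)) ∘ (Homeomorph.smulOfNeZero t ht.ne') := by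
      ext z; simp
    rw [this]
    exact ((Homeomorph.addLeft _).isOpenMap.comp (Homeomorph.smulOfNeZero t ht.ne').isOpenMap) _
      Metric.isOpen_ball
  refine interior_maximal ?_ hopen ⟨y, hy, rfl⟩
  rintro _ ⟨z, hz, rfl⟩
  have := hK.star z hz hx ht.le (by linarith : 0 ≤ 1 - t) (by ring)
  simpa [add_comm] using this

lemma closure_interior (hK : IsStarBody K c κ h) : closure (interior K) = K := by
  refine Set.Subset.antisymm (hK.closed.closure_subset_iff.2 interior_subset) fun x hx => ?_
  have hlim : Tendsto (fun t : ℝ => (1 - t) • x + t • c) (𝓝[>] 0) (𝓝 x) := by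
    have : Continuous fun t : ℝ => (1 - t) • x + t • c := by fun_prop
    have h0 := this.tendsto 0
    simp only [sub_zero, one_smul, zero_smul, add_zero] at h0
    exact h0.mono_left nhdsWithin_le_nhds
  refine mem_closure_of_tendsto hlim ?_
  filter_upwards [Ioc_mem_nhdsGT (zero_lt_one' ℝ)] with t ht
  exact hK.combo_mem_interior hx (Metric.mem_ball_self hK.pos) ht.1 ht.2

lemma frontier_interior (hK : IsStarBody K c κ h) : frontier (interior K) = frontier K := by
  rw [frontier, frontier, hK.closure_interior, interior_interior, hK.closed.closure_eq]

lemma frontier_subset (hK : IsStarBody K c κ h) : frontier K ⊆ K := hK.closed.frontier_subset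

lemma isCompact_frontier (hK : IsStarBody K c κ h) : IsCompact (frontier K) :=
  hK.isCompact.of_isClosed_subset isClosed_frontier hK.frontier_subset

lemma le_dist_center (hK : IsStarBody K c κ h) {x : SpaceTime n} (hx : x ∈ frontier K) :
    κ ≤ dist x c := by
  by_contra hcon
  exact hx.2 (interior_maximal hK.ball_subset Metric.isOpen_ball (not_le.1 hcon))

/-- Stepping from `y` against `x - c'` is moving towards `c' + (y - x)`, which lies in the ball when
`y` is close to `x`. Thus one direction serves all points near `x`. -/
lemma sub_mem_interior (hK : IsStarBody K c κ h) {x y c' : SpaceTime n} {κ' : ℝ} (hy : y ∈ K)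
    (hyx : dist y x < κ') (hc' : Metric.ball c' κ' ⊆ Metric.ball c κ) {t : ℝ} (ht : 0 < t)
    (ht1 : t ≤ 1) : y - t • (x - c') ∈ interior K := by
  have : y - t • (x - c') = (1 - t) • y + t • (c' + (y - x)) := by module
  rw [this]
  refine hK.combo_mem_interior hy (hc' ?_) ht ht1
  rwa [Metric.mem_ball, dist_eq_norm, add_sub_cancel_left, ← dist_eq_norm]

lemma ball_half_subset {c c' : SpaceTime n} {κ : ℝ} (hc' : dist c' c ≤ κ / 4) :
    Metric.ball c' (κ / 2) ⊆ Metric.ball c κ := by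
  intro y hy
  rw [Metric.mem_ball] at hy ⊢
  have h0 := dist_nonneg (x := y) (y := c')
  have := dist_triangle y c' c
  linarith

/-- The centre may be displaced by `κ / 4`, because several transversal directions at the same
boundary point are needed to reach every coordinate direction. That forward steps leave `K` follows
from the backward statement: going back from a forward point in `K` would put `y` in the interior.
-/
lemma transversal (hK : IsStarBody K c κ h) {x : SpaceTime n} (hx : x ∈ frontier K)
    {c' : SpaceTime n} (hc' : dist c' c ≤ κ / 4) :
    Transversal (interior K) (Metric.ball x (κ / 4)) ((‖x - c'‖⁻¹ : ℝ) • (x - c')) := by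
  have hκ := hK.pos
  have hlow : 3 * κ / 4 ≤ ‖x - c'‖ := by
    have h1 := hK.le_dist_center hx
    have h2 := dist_triangle x c' c
    rw [← dist_eq_norm]
    linarith
  have hv0 : 0 < ‖x - c'‖ := by linarith
  have hback : ∀ y ∈ K, y ∈ Metric.ball x (κ / 4) → ∀ s : ℝ, 0 < s →
      y - s • ((‖x - c'‖⁻¹ : ℝ) • (x - c')) ∈ Metric.ball x (κ / 4) →
      y - s • ((‖x - c'‖⁻¹ : ℝ) • (x - c')) ∈ interior K := by
    intro y hyK hyB s hs hsB
    have hs' : s < κ / 2 := by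
      have h1 : dist y (y - s • ((‖x - c'‖⁻¹ : ℝ) • (x - c'))) = s := by
        rw [dist_eq_norm, sub_sub_cancel, norm_smul, norm_smul, norm_inv, norm_norm,
          inv_mul_cancel₀ hv0.ne', mul_one, Real.norm_of_nonneg hs.le]
      have h2 := dist_triangle_right y (y - s • ((‖x - c'‖⁻¹ : ℝ) • (x - c'))) x
      rw [Metric.mem_ball] at hyB hsB
      linarith
    rw [smul_smul]
    refine hK.sub_mem_interior hyK (κ' := κ / 2) ?_ (ball_half_subset hc') (by positivity) ?_
    · rw [Metric.mem_ball] at hyB; linarith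
    · rw [← div_eq_mul_inv, div_le_one hv0]; linarith
  rintro y ⟨hy, hyB⟩ s hs
  rw [hK.frontier_interior] at hy
  rw [interior_interior, hK.closure_interior]
  refine ⟨hback y (hK.frontier_subset hy) hyB s hs, fun hB hmem => hy.2 ?_⟩
  have := hback _ hmem hB s hs (by simpa using hyB)
  simpa using this

lemma enorm_integral_fderiv_sub_le (hK : IsStarBody K c κ h) {x : SpaceTime n}
    (hx : x ∈ frontier K) {c' : SpaceTime n} (hc' : dist c' c ≤ κ / 4) {φ : SpaceTime n → ℝ}
    (hφ : ContDiff ℝ 1 φ) (hB : tsupport φ ⊆ Metric.ball x (κ / 4)) :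
    ‖∫ y in interior K, fderiv ℝ φ y (x - c')‖ₑ ≤
      ‖x - c'‖ₑ * ∫⁻ y in frontier K, ‖φ y‖ₑ ∂(surface n) := by
  have hκ := hK.pos
  have hv0 : 0 < ‖x - c'‖ := by
    have h1 := hK.le_dist_center hx
    have h2 := dist_triangle x c' c
    rw [← dist_eq_norm]
    linarith
  set d : SpaceTime n := (‖x - c'‖⁻¹ : ℝ) • (x - c') with hd
  have hd1 : ‖d‖ = 1 := by
    rw [hd, norm_smul, norm_inv, norm_norm, inv_mul_cancel₀ hv0.ne']
  have hxd : x - c' = ‖x - c'‖ • d := by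
    rw [hd, smul_smul, mul_inv_cancel₀ hv0.ne', one_smul]
  have hc : HasCompactSupport φ :=
    Metric.isCompact_of_isClosed_isBounded (isClosed_tsupport φ) (Metric.isBounded_ball.subset hB)
  have hmain := enorm_integral_fderiv_le isOpen_interior.measurableSet (convex_ball x (κ / 4))
    Metric.isOpen_ball.measurableSet hd1 (hK.transversal hx hc') hφ hc hB
  have heq : ∫ y in interior K, fderiv ℝ φ y (x - c') =
      ‖x - c'‖ * ∫ y in interior K, fderiv ℝ φ y d := by
    rw [← integral_const_mul]
    congr 1 with y
    conv_lhs => rw [hxd]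
    simp
  rw [heq, enorm_mul]
  gcongr
  · simp
  · rw [hK.frontier_interior] at hmain
    exact hmain.trans (lintegral_mono_set Set.inter_subset_left)

/-- A coordinate vector need not be transversal, but it is `4 / κ` times the difference of the
transversal vectors `x - c` and `x - c'`, where `c' = c + (κ / 4) e`. The lengths of these are at
most `h` and `h + κ / 4`, which explains the constant. -/
lemma enorm_integral_fderiv_single_le (hK : IsStarBody K c κ h) {x : SpaceTime n}
    (hx : x ∈ frontier K) {φ : SpaceTime n → ℝ} (hφ : ContDiff ℝ 1 φ)
    (hB : tsupport φ ⊆ Metric.ball x (κ / 4)) (j : Fin (n + 1)) :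
    ‖∫ y in interior K, fderiv ℝ φ y (EuclideanSpace.single j (1 : ℝ))‖ₑ ≤
      ENNReal.ofReal ((4 / κ) * (2 * h + κ)) *
        ∫⁻ y in frontier K, ‖φ y‖ₑ ∂(surface n) := by
  have hκ := hK.pos
  set e : SpaceTime n := EuclideanSpace.single j (1 : ℝ) with he
  have he1 : ‖e‖ = 1 := by simp [he]
  set c' : SpaceTime n := c + (κ / 4) • e with hc'
  have hdc : dist c' c ≤ κ / 4 := by
    rw [hc', dist_eq_norm, add_sub_cancel_left, norm_smul, he1, mul_one, Real.norm_of_nonneg]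
    linarith
  have hcomp : HasCompactSupport φ :=
    Metric.isCompact_of_isClosed_isBounded (isClosed_tsupport φ) (Metric.isBounded_ball.subset hB)
  have h1 := hK.enorm_integral_fderiv_sub_le hx (c' := c) (by simp; positivity) hφ hB
  have h2 := hK.enorm_integral_fderiv_sub_le hx hdc hφ hB
  have hb1 : ‖x - c‖ ≤ h := by
    rw [← dist_eq_norm]; exact hK.dist_le x (hK.frontier_subset hx) c hK.center_mem
  have hb2 : ‖x - c'‖ ≤ h + κ / 4 := by
    rw [← dist_eq_norm]
    have := dist_triangle_right x c' c
    rw [← dist_eq_norm] at hb1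
    linarith
  have heq : ∫ y in interior K, fderiv ℝ φ y e = (4 / κ) *
      ((∫ y in interior K, fderiv ℝ φ y (x - c)) - ∫ y in interior K, fderiv ℝ φ y (x - c')) := by
    rw [← integral_sub (integrable_fderiv_apply hφ hcomp _).integrableOn
      (integrable_fderiv_apply hφ hcomp _).integrableOn, ← integral_const_mul]
    congr 1 with y
    rw [← map_sub, hc']
    have : x - c - (x - (c + (κ / 4) • e)) = (κ / 4) • e := by module
    rw [this, map_smul, smul_eq_mul]
    field_simp
  rw [heq, enorm_mul, ENNReal.ofReal_mul (by positivity), mul_assoc]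
  have h4 : ‖(4 / κ : ℝ)‖ₑ = ENNReal.ofReal (4 / κ) := by
    rw [Real.enorm_eq_ofReal (by positivity)]
  rw [h4]
  gcongr
  calc _ ≤ _ := enorm_sub_le
    _ ≤ ENNReal.ofReal h * ∫⁻ y in frontier K, ‖φ y‖ₑ ∂(surface n) +
        ENNReal.ofReal (h + κ / 4) * ∫⁻ y in frontier K, ‖φ y‖ₑ ∂(surface n) := by
      gcongr
      · refine h1.trans ?_
        gcongr
        rw [← ofReal_norm]
        exact ENNReal.ofReal_le_ofReal hb1
      · refine h2.trans ?_
        gcongr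
        rw [← ofReal_norm]
        exact ENNReal.ofReal_le_ofReal hb2
    _ ≤ _ := by
      have hh : 0 ≤ h := le_trans (norm_nonneg _) hb1
      rw [← add_mul, ← ENNReal.ofReal_add hh (by positivity)]
      refine mul_le_mul_left (ENNReal.ofReal_le_ofReal ?_) _
      linarith

/-- The frontier of a body that is star-shaped with respect to a ball is locally a graph. -/
lemma dist_le_proj (hK : IsStarBody K c κ h) {x : SpaceTime n} (hx : x ∈ frontier K)
    {y z : SpaceTime n} (hy : y ∈ frontier K ∩ Metric.ball x (κ / 4))
    (hz : z ∈ frontier K ∩ Metric.ball x (κ / 4)) :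
    dist y z ≤ (1 + 2 * h / κ) *
      dist (projAlong ((‖x - c‖⁻¹ : ℝ) • (x - c)) y)
        (projAlong ((‖x - c‖⁻¹ : ℝ) • (x - c)) z) := by
  have hκ := hK.pos
  have hv : κ ≤ ‖x - c‖ := by rw [← dist_eq_norm]; exact hK.le_dist_center hx
  have hv0 : 0 < ‖x - c‖ := by linarith
  have hvh : ‖x - c‖ ≤ h := by
    rw [← dist_eq_norm]; exact hK.dist_le x (hK.frontier_subset hx) c hK.center_mem
  set d : SpaceTime n := (‖x - c‖⁻¹ : ℝ) • (x - c) with hd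
  have hd1 : ‖d‖ = 1 := by
    rw [hd, norm_smul, norm_inv, norm_norm, inv_mul_cancel₀ hv0.ne']
  have hxd : x - c = ‖x - c‖ • d := by
    rw [hd, smul_smul, mul_inv_cancel₀ hv0.ne', one_smul]
  have key : ∀ y z : SpaceTime n, y ∈ frontier K ∩ Metric.ball x (κ / 4) →
      z ∈ frontier K ∩ Metric.ball x (κ / 4) →
      inner ℝ d (y - z) ≤ (2 * h / κ) * ‖projAlong d (y - z)‖ := by
    intro y z hy hz
    -- Cone argument: if `y` rose too steeply above `z` in the direction `d`, then `z` would be a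
    -- convex combination of `y` and a point of the ball around `c`, hence an interior point of `K`.
    by_contra hcon
    rw [not_le] at hcon
    set a := inner ℝ d (y - z) with ha
    set p : SpaceTime n := (projAlong d (y - z) : SpaceTime n) with hp
    have hpn : ‖projAlong d (y - z)‖ = ‖p‖ := rfl
    rw [hpn] at hcon
    have hh : 0 ≤ h := hv0.le.trans hvh
    have ha0 : 0 < a := lt_of_le_of_lt (by positivity) hcon
    have hsum : a • d + p = y - z := eq_line hd1 (y - z)
    have hyz : ‖y - z‖ < κ / 2 := by
      have := dist_triangle_right y z x
      rw [← dist_eq_norm]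
      have h1 := hy.2; have h2 := hz.2
      rw [Metric.mem_ball] at h1 h2
      linarith
    have hay : a ≤ ‖y - z‖ := by
      have := real_inner_le_norm d (y - z)
      rwa [hd1, one_mul] at this
    set t := a / ‖x - c‖ with ht
    have ht0 : 0 < t := by positivity
    have ht1 : t ≤ 1 := by rw [ht, div_le_one hv0]; linarith
    have hz' : z = (1 - t) • y + t • (c + (y - x) - t⁻¹ • p) := by
      have e1 : (1 - t) • y + t • (c + (y - x) - t⁻¹ • p) = y - t • (x - c) - (t * t⁻¹) • p := by
        module
      rw [e1, mul_inv_cancel₀ ht0.ne', one_smul, hxd, smul_smul, ht, div_mul_cancel₀ _ hv0.ne',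
        sub_sub, hsum]
      abel
    have hmem : c + (y - x) - t⁻¹ • p ∈ Metric.ball c κ := by
      rw [Metric.mem_ball, dist_eq_norm]
      have e1 : c + (y - x) - t⁻¹ • p - c = (y - x) - t⁻¹ • p := by abel
      rw [e1]
      have h1 := hy.2
      rw [Metric.mem_ball, dist_eq_norm] at h1
      have h2 : ‖t⁻¹ • p‖ ≤ κ / 2 := by
        rw [norm_smul, norm_inv, Real.norm_of_nonneg ht0.le, inv_mul_le_iff₀ ht0, ht]
        have h3 : h * ‖p‖ * 2 < a * κ := by
          have : 2 * h / κ * ‖p‖ = (h * ‖p‖ * 2) / κ := by ring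
          rw [this, div_lt_iff₀ hκ] at hcon
          exact hcon
        have h4 : ‖x - c‖ * ‖p‖ ≤ h * ‖p‖ := by gcongr
        rw [div_mul_eq_mul_div, le_div_iff₀ hv0]
        nlinarith
      calc _ ≤ _ := norm_sub_le _ _
        _ < κ := by linarith
    have := hK.combo_mem_interior (hK.frontier_subset hy.1) hmem ht0 ht1
    rw [← hz'] at this
    exact hz.1.2 this
  have h1 := key y z hy hz
  have h2 := key z y hz hy
  have h3 : inner ℝ d (z - y) = - inner ℝ d (y - z) := by rw [← inner_neg_right, neg_sub]
  have h4 : ‖projAlong d (z - y)‖ = ‖projAlong d (y - z)‖ := by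
    rw [← norm_neg, ← map_neg, neg_sub]
  rw [h3, h4] at h2
  rw [dist_eq_norm, dist_eq_norm, ← map_sub]
  have h5 : ‖y - z‖ ≤ |inner ℝ d (y - z)| + ‖projAlong d (y - z)‖ := by
    conv_lhs => rw [← eq_line hd1 (y - z)]
    refine (norm_add_le _ _).trans ?_
    rw [norm_smul, hd1, mul_one, Real.norm_eq_abs]
    rfl
  have h6 : |inner ℝ d (y - z)| ≤ 2 * h / κ * ‖projAlong d (y - z)‖ :=
    abs_le.2 ⟨by linarith, h1⟩
  linarith

/-- The local trace inequality. -/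
lemma lintegral_frontier_ball_le (hK : IsStarBody K c κ h) {x : SpaceTime n}
    (hx : x ∈ frontier K) {ψ : SpaceTime n → ℝ} (hψ : ContDiff ℝ 1 ψ) (hpos : ∀ y, 0 ≤ ψ y) :
    ENNReal.ofReal (κ / 2) *
        ∫⁻ y in frontier K ∩ Metric.ball x (κ / 4), ENNReal.ofReal (ψ y) ∂(surface n) ≤
      ENNReal.ofReal (1 + 2 * h / κ) ^ n *
        (∫⁻ y in interior K, ENNReal.ofReal (ψ y + κ / 2 * ‖fderiv ℝ ψ y‖)) := by
  have hκ := hK.pos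
  have hv : κ ≤ ‖x - c‖ := by rw [← dist_eq_norm]; exact hK.le_dist_center hx
  have hv0 : 0 < ‖x - c‖ := by linarith
  have hvh : ‖x - c‖ ≤ h := by
    rw [← dist_eq_norm]; exact hK.dist_le x (hK.frontier_subset hx) c hK.center_mem
  have hd1 : ‖(‖x - c‖⁻¹ : ℝ) • (x - c)‖ = 1 := by
    rw [norm_smul, norm_inv, norm_norm, inv_mul_cancel₀ hv0.ne']
  set d : SpaceTime n := (‖x - c‖⁻¹ : ℝ) • (x - c) with hd
  set S := frontier K ∩ Metric.ball x (κ / 4)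
  have hSm : MeasurableSet S :=
    isClosed_frontier.measurableSet.inter Metric.isOpen_ball.measurableSet
  have hh : 0 ≤ h := (norm_nonneg _).trans hvh
  exact lintegral_surface_le_layer hd1 hSm (L := (1 + 2 * h / κ).toNNReal)
    (fun y hy z hz => by
      rw [Real.coe_toNNReal _ (by positivity)]
      exact hK.dist_le_proj hx hy hz)
    isOpen_interior.measurableSet (δ := κ / 2) (by positivity)
    (fun y hy s hs => by
      rw [hd, smul_smul]
      refine hK.sub_mem_interior (hK.frontier_subset hy.1) (κ' := κ) ?_ le_rfl
        (mul_pos hs.1 (inv_pos.2 hv0)) ?_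
      · have := hy.2; rw [Metric.mem_ball] at this; linarith
      · rw [← div_eq_mul_inv, div_le_one hv0]; linarith [hs.2]) hψ hpos

lemma _root_.WaveDA.lintegral_biUnion_finset_le {α ι : Type*} [MeasurableSpace α] (μ : Measure α)
    (F : Finset ι) (s : ι → Set α) (f : α → ℝ≥0∞) :
    ∫⁻ y in ⋃ t ∈ F, s t, f y ∂μ ≤ ∑ t ∈ F, ∫⁻ y in s t, f y ∂μ := by
  classical
  induction F using Finset.induction_on with
  | empty => simp
  | insert a F ha ih =>
    rw [Finset.set_biUnion_insert, Finset.sum_insert ha]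
    exact (lintegral_union_le f _ _).trans (add_le_add le_rfl ih)

/-- The trace inequality for bodies that are star-shaped with respect to a ball of comparable
size, with a constant that depends only on the ratio of the sizes. -/
theorem exists_trace_const (n : ℕ) {r : ℝ} (hr : 0 < r) :
    ∃ C : ℝ, 0 < C ∧ ∀ (K : Set (SpaceTime n)) (c : SpaceTime n) (h : ℝ),
      IsStarBody K c (r * h) h → ∀ ψ : SpaceTime n → ℝ, ContDiff ℝ 1 ψ → (∀ y, 0 ≤ ψ y) →
        ∫⁻ y in frontier K, ENNReal.ofReal (ψ y) ∂(surface n) ≤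
          ENNReal.ofReal C *
            ∫⁻ y in interior K, ENNReal.ofReal (h⁻¹ * ψ y + ‖fderiv ℝ ψ y‖) := by
  -- One finite cover of the unit ball, scaled by `h` and moved to `c`, covers every body of size
  -- `h`. The number of pieces depends only on `n` and `r`, which makes the constant uniform.
  obtain ⟨F, hF⟩ := (isCompact_closedBall (0 : SpaceTime n) 1).elim_nhds_subcover
    (fun x => Metric.ball x (r / 8)) (fun x _ => Metric.ball_mem_nhds x (by positivity))
  set C : ℝ := (F.card + 1) * ((1 + 2 / r) ^ n * (1 + 2 / r)) with hC
  refine ⟨C, by positivity, fun K c h hK ψ hψ hpos => ?_⟩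
  have hh : 0 < h := by
    have := hK.pos
    exact (mul_pos_iff_of_pos_left hr).1 this
  set R := ∫⁻ y in interior K, ENNReal.ofReal (h⁻¹ * ψ y + ‖fderiv ℝ ψ y‖) with hR
  have hlocal : ∀ t : SpaceTime n,
      ∫⁻ y in frontier K ∩ Metric.ball (c + h • t) (r * h / 8), ENNReal.ofReal (ψ y) ∂(surface n) ≤
        ENNReal.ofReal ((1 + 2 / r) ^ n * (1 + 2 / r)) * R := by
    intro t
    rcases (frontier K ∩ Metric.ball (c + h • t) (r * h / 8)).eq_empty_or_nonempty with he | ⟨x, hx⟩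
    · simp [he]
    have h1 := hK.lintegral_frontier_ball_le hx.1 hψ hpos
    -- A ball of radius `r h / 8` around an arbitrary centre is contained in one of radius `r h / 4`
    -- around a frontier point, as the local inequality requires.
    have hsub : frontier K ∩ Metric.ball (c + h • t) (r * h / 8) ⊆
        frontier K ∩ Metric.ball x (r * h / 4) := by
      rintro y ⟨hy1, hy2⟩
      refine ⟨hy1, ?_⟩
      have hx2 := hx.2
      rw [Metric.mem_ball] at hy2 hx2 ⊢
      have := dist_triangle_right y x (c + h • t)
      linarith
    refine (lintegral_mono_set hsub).trans ?_
    have e1 : 1 + 2 * h / (r * h) = 1 + 2 / r := by field_simp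
    rw [e1] at h1
    have h2 : ∫⁻ y in interior K, ENNReal.ofReal (ψ y + r * h / 2 * ‖fderiv ℝ ψ y‖) ≤
        ENNReal.ofReal (r * h / 2) * (ENNReal.ofReal (1 + 2 / r) * R) := by
      rw [hR, ← lintegral_const_mul' _ _ ENNReal.ofReal_ne_top,
        ← lintegral_const_mul' _ _ ENNReal.ofReal_ne_top]
      refine lintegral_mono fun y => ?_
      rw [← ENNReal.ofReal_mul (by positivity), ← ENNReal.ofReal_mul (by positivity)]
      refine ENNReal.ofReal_le_ofReal ?_
      have h3 := hpos y
      have h4 := norm_nonneg (fderiv ℝ ψ y)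
      have h5 : r * h / 2 * ((1 + 2 / r) * (h⁻¹ * ψ y + ‖fderiv ℝ ψ y‖)) =
          (r / 2) * ψ y + ψ y + r * h / 2 * ‖fderiv ℝ ψ y‖ + h * ‖fderiv ℝ ψ y‖ := by
        field_simp
        ring
      rw [h5]
      have h6 : 0 ≤ r / 2 * ψ y := by positivity
      have h7 : 0 ≤ h * ‖fderiv ℝ ψ y‖ := by positivity
      linarith
    have h0 : ENNReal.ofReal (r * h / 2) ≠ 0 := by
      rw [Ne, ENNReal.ofReal_eq_zero, not_le]; positivity
    rw [← ENNReal.mul_le_mul_iff_right h0 ENNReal.ofReal_ne_top]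
    refine h1.trans ((mul_le_mul_right h2 _).trans (le_of_eq ?_))
    rw [ENNReal.ofReal_mul (by positivity), ENNReal.ofReal_pow (by positivity)]
    ring
  have hcover : frontier K ⊆ ⋃ t ∈ F, frontier K ∩ Metric.ball (c + h • t) (r * h / 8) := by
    intro y hy
    have hmem : h⁻¹ • (y - c) ∈ Metric.closedBall (0 : SpaceTime n) 1 := by
      rw [mem_closedBall_zero_iff, norm_smul, norm_inv, Real.norm_of_nonneg hh.le,
        inv_mul_le_iff₀ hh, mul_one, ← dist_eq_norm]
      exact hK.dist_le y (hK.frontier_subset hy) c hK.center_mem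
    obtain ⟨t, htF, ht⟩ := Set.mem_iUnion₂.1 (hF.2 hmem)
    refine Set.mem_iUnion₂.2 ⟨t, htF, hy, ?_⟩
    rw [Metric.mem_ball, dist_eq_norm] at ht ⊢
    have : y - (c + h • t) = h • (h⁻¹ • (y - c) - t) := by
      rw [smul_sub, smul_smul, mul_inv_cancel₀ hh.ne', one_smul]; abel
    rw [this, norm_smul, Real.norm_of_nonneg hh.le]
    calc h * ‖h⁻¹ • (y - c) - t‖ < h * (r / 8) := by gcongr
      _ = r * h / 8 := by ring
  calc ∫⁻ y in frontier K, ENNReal.ofReal (ψ y) ∂(surface n)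
      ≤ ∫⁻ y in ⋃ t ∈ F, frontier K ∩ Metric.ball (c + h • t) (r * h / 8),
          ENNReal.ofReal (ψ y) ∂(surface n) := lintegral_mono_set hcover
    _ ≤ ∑ t ∈ F, ∫⁻ y in frontier K ∩ Metric.ball (c + h • t) (r * h / 8),
          ENNReal.ofReal (ψ y) ∂(surface n) := lintegral_biUnion_finset_le _ _ _ _
    _ ≤ ∑ _t ∈ F, ENNReal.ofReal ((1 + 2 / r) ^ n * (1 + 2 / r)) * R :=
        Finset.sum_le_sum fun t _ => hlocal t
    _ ≤ ENNReal.ofReal C * R := by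
        rw [Finset.sum_const, nsmul_eq_mul, ← mul_assoc]
        refine mul_le_mul' ?_ le_rfl
        rw [hC, ENNReal.ofReal_mul (p := (F.card + 1 : ℝ)) (by positivity)]
        refine mul_le_mul' ?_ le_rfl
        rw [ENNReal.ofReal_add (by positivity) (by norm_num), ENNReal.ofReal_natCast]
        exact le_self_add

/-- The case `ψ = 1` of the trace inequality. It yields finite perimeter and, later, the correct
power of `h` in the inverse inequality. -/
lemma surface_frontier_le_of_trace {C : ℝ} {K : Set (SpaceTime n)} {h : ℝ}
    (hC : ∀ ψ : SpaceTime n → ℝ, ContDiff ℝ 1 ψ → (∀ y, 0 ≤ ψ y) →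
        ∫⁻ y in frontier K, ENNReal.ofReal (ψ y) ∂(surface n) ≤
          ENNReal.ofReal C *
            ∫⁻ y in interior K, ENNReal.ofReal (h⁻¹ * ψ y + ‖fderiv ℝ ψ y‖)) :
    surface n (frontier K) ≤ ENNReal.ofReal C * (ENNReal.ofReal h⁻¹ * volume (interior K)) := by
  have := hC (fun _ => 1) contDiff_const (fun _ => zero_le_one)
  simpa using this

lemma size_pos (hK : IsStarBody K c κ h) : 0 < h := by
  have hκ := hK.pos
  have h1 : dist (c + (κ / 2) • EuclideanSpace.single (0 : Fin (n + 1)) (1 : ℝ)) c = κ / 2 := by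
    rw [dist_eq_norm, add_sub_cancel_left, norm_smul, Real.norm_of_nonneg (by positivity)]
    simp
  have := hK.dist_le _ (hK.ball_subset (Metric.mem_ball.2 (by rw [h1]; linarith))) c
    hK.center_mem
  rw [h1] at this
  linarith

lemma surface_frontier_lt_top (hK : IsStarBody K c κ h) : surface n (frontier K) < ⊤ := by
  have hκ := hK.pos
  have hh := hK.size_pos
  obtain ⟨C, -, hC⟩ := exists_trace_const n (r := κ / h) (by positivity)
  have hK' : IsStarBody K c (κ / h * h) h := by rwa [div_mul_cancel₀ _ hh.ne']
  refine (surface_frontier_le_of_trace (hC K c h hK')).trans_lt ?_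
  refine ENNReal.mul_lt_top ENNReal.ofReal_lt_top (ENNReal.mul_lt_top ENNReal.ofReal_lt_top ?_)
  exact (measure_mono interior_subset).trans_lt hK.isCompact.measure_lt_top

end IsStarBody

end StarBody

/-! ### The boundary flux of a star-shaped body -/

section Flux

variable {n : ℕ}

/-- The functional factors through the range of `T` and is bounded there. Hahn–Banach extends it to
`H` and Riesz' theorem represents the extension. -/
lemma exists_inner_representative {V H : Type*} [AddCommGroup V] [Module ℝ V]
    [NormedAddCommGroup H] [InnerProductSpace ℝ H] [CompleteSpace H] (T : V →ₗ[ℝ] H)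
    (ℓ : V →ₗ[ℝ] ℝ) (C : ℝ) (hC : ∀ v, |ℓ v| ≤ C * ‖T v‖) :
    ∃ b : H, ∀ v, ℓ v = inner ℝ b (T v) := by
  have hker : LinearMap.ker T ≤ LinearMap.ker ℓ := by
    intro v hv
    have := hC v
    rw [LinearMap.mem_ker.1 hv, norm_zero, mul_zero] at this
    exact abs_eq_zero.1 (le_antisymm this (abs_nonneg _))
  let ℓ' : LinearMap.range T →ₗ[ℝ] ℝ :=
    ((LinearMap.ker T).liftQ ℓ hker).comp T.quotKerEquivRange.symm.toLinearMap
  have hℓ' : ∀ v, ℓ' ⟨T v, v, rfl⟩ = ℓ v := by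
    intro v
    have : T.quotKerEquivRange.symm ⟨T v, v, rfl⟩ = (LinearMap.ker T).mkQ v := by
      rw [LinearEquiv.symm_apply_eq]
      rfl
    simp [ℓ', this]
  have hb : ∀ y : LinearMap.range T, ‖ℓ' y‖ ≤ C * ‖y‖ := by
    rintro ⟨_, v, rfl⟩
    rw [hℓ']
    exact hC v
  obtain ⟨g, hg, -⟩ := exists_extension_norm_eq (𝕜 := ℝ) (LinearMap.range T)
    (ℓ'.mkContinuous C hb)
  refine ⟨(InnerProductSpace.toDual ℝ H).symm g, fun v => ?_⟩
  rw [InnerProductSpace.toDual_symm_apply, hg ⟨T v, v, rfl⟩]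
  exact (hℓ' v).symm

/-- This is the flux bound with `U` the whole space, whose frontier is empty. -/
lemma integral_fderiv_eq_zero_of_compactSupport {φ : SpaceTime n → ℝ} (hφ : ContDiff ℝ 1 φ)
    (hc : HasCompactSupport φ) (j : Fin (n + 1)) :
    ∫ y, fderiv ℝ φ y (EuclideanSpace.single j (1 : ℝ)) = 0 := by
  have h := enorm_integral_fderiv_le (U := Set.univ) MeasurableSet.univ
    (B := Set.univ) convex_univ MeasurableSet.univ
    (d := EuclideanSpace.single j (1 : ℝ)) (by simp)
    (fun y hy => by simp at hy) hφ hc (Set.subset_univ _)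
  simpa using h

-- A partition of unity, subordinate to the interior and to finitely many balls at the frontier,
-- localises `φ`. The interior piece has no flux. Since the weights add up to one on `K`, the local
-- constant is also the global one.
open Manifold in
lemma IsStarBody.exists_enorm_integral_fderiv_le {K : Set (SpaceTime n)} {c : SpaceTime n}
    {κ h : ℝ} (hK : IsStarBody K c κ h) (j : Fin (n + 1)) :
    ∃ C : ℝ, 0 ≤ C ∧ ∀ φ : SpaceTime n → ℝ, ContDiff ℝ ∞ φ →
      ‖∫ y in interior K, fderiv ℝ φ y (EuclideanSpace.single j (1 : ℝ))‖ₑ ≤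
        ENNReal.ofReal C * ∫⁻ y in frontier K, ‖φ y‖ₑ ∂(surface n) := by
  have hκ := hK.pos
  have hh := hK.size_pos
  obtain ⟨F, hFK, hF⟩ := hK.isCompact_frontier.elim_nhds_subcover
    (fun x => Metric.ball x (κ / 4)) (fun x _ => Metric.ball_mem_nhds x (by positivity))
  let U : Option F → Set (SpaceTime n) := fun i => i.elim (interior K)
    (fun x => Metric.ball (x : SpaceTime n) (κ / 4))
  have hUo : ∀ i, IsOpen (U i) := by
    rintro (_ | x)
    · exact isOpen_interior
    · exact Metric.isOpen_ball
  have hUK : K ⊆ ⋃ i, U i := by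
    intro y hy
    by_cases hyi : y ∈ interior K
    · exact Set.mem_iUnion.2 ⟨none, hyi⟩
    · obtain ⟨x, hx, hxy⟩ := Set.mem_iUnion₂.1 (hF ⟨subset_closure hy, hyi⟩)
      exact Set.mem_iUnion.2 ⟨some ⟨x, hx⟩, hxy⟩
  obtain ⟨f, hf⟩ := SmoothPartitionOfUnity.exists_isSubordinate 𝓘(ℝ, SpaceTime n) hK.closed U hUo hUK
  refine ⟨(4 / κ) * (2 * h + κ), by positivity, fun φ hφ => ?_⟩
  have hfd : ∀ i, ContDiff ℝ ∞ (f i : SpaceTime n → ℝ) := fun i => (f i).contMDiff.contDiff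
  set g : Option F → SpaceTime n → ℝ := fun i y => f i y * φ y with hg
  have hgd : ∀ i, ContDiff ℝ ∞ (g i) := fun i => (hfd i).mul hφ
  have hgd1 : ∀ i, ContDiff ℝ 1 (g i) := fun i => (hgd i).of_le (by norm_cast)
  have hgs : ∀ i, tsupport (g i) ⊆ U i := fun i =>
    (closure_mono (Function.support_mul_subset_left _ _)).trans (hf i)
  have hUb : ∀ i, Bornology.IsBounded (U i) := by
    rintro (_ | x)
    · exact hK.isBounded.subset interior_subset
    · exact Metric.isBounded_ball
  have hgc : ∀ i, HasCompactSupport (g i) := fun i =>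
    Metric.isCompact_of_isClosed_isBounded (isClosed_tsupport _) ((hUb i).subset (hgs i))
  have hsum : ∀ y ∈ K, ∑ i, g i y = φ y := by
    intro y hy
    have := f.sum_eq_one hy
    rw [finsum_eq_sum_of_fintype] at this
    simp only [hg]
    rw [← Finset.sum_mul, this, one_mul]
  set e : SpaceTime n := EuclideanSpace.single j (1 : ℝ) with he
  have hfder : ∀ y ∈ interior K, fderiv ℝ φ y e = ∑ i, fderiv ℝ (g i) y e := by
    intro y hy
    have h1 : φ =ᶠ[𝓝 y] fun y => ∑ i, g i y := by
      filter_upwards [isOpen_interior.mem_nhds hy] with z hz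
      exact (hsum z (interior_subset hz)).symm
    rw [h1.fderiv_eq, fderiv_fun_sum fun i _ =>
      ((hgd1 i).differentiable one_ne_zero).differentiableAt]
    simp
  have hint : ∫ y in interior K, fderiv ℝ φ y e = ∑ i, ∫ y in interior K, fderiv ℝ (g i) y e := by
    rw [setIntegral_congr_fun isOpen_interior.measurableSet hfder, integral_finsetSum]
    exact fun i _ => (integrable_fderiv_apply (hgd1 i) (hgc i) e).integrableOn
  have hone : ∀ i, ‖∫ y in interior K, fderiv ℝ (g i) y e‖ₑ ≤
      ENNReal.ofReal ((4 / κ) * (2 * h + κ)) * ∫⁻ y in frontier K, ‖g i y‖ₑ ∂(surface n) := by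
    rintro (_ | x)
    · have : ∫ y in interior K, fderiv ℝ (g none) y e = ∫ y, fderiv ℝ (g none) y e := by
        refine setIntegral_eq_integral_of_forall_compl_eq_zero fun y hy => ?_
        rw [fderiv_eq_zero_of_notMem (hgs none) hy]
        simp
      rw [this, integral_fderiv_eq_zero_of_compactSupport (hgd1 none) (hgc none)]
      simp
    · exact hK.enorm_integral_fderiv_single_le (hFK x x.2) (hgd1 _) (hgs (some x)) j
  rw [hint]
  calc ‖∑ i, ∫ y in interior K, fderiv ℝ (g i) y e‖ₑ
      ≤ ∑ i, ‖∫ y in interior K, fderiv ℝ (g i) y e‖ₑ := enorm_sum_le _ _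
    _ ≤ ∑ i, ENNReal.ofReal ((4 / κ) * (2 * h + κ)) *
          ∫⁻ y in frontier K, ‖g i y‖ₑ ∂(surface n) := Finset.sum_le_sum fun i _ => hone i
    _ = ENNReal.ofReal ((4 / κ) * (2 * h + κ)) *
          ∫⁻ y in frontier K, ∑ i, ‖g i y‖ₑ ∂(surface n) := by
        rw [← Finset.mul_sum, lintegral_finsetSum]
        exact fun i _ => (hgd i).continuous.measurable.enorm
    _ = _ := by
        congr 1
        refine setLIntegral_congr_fun isClosed_frontier.measurableSet fun y hy => ?_
        have hyK := hK.frontier_subset hy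
        have hs := f.sum_eq_one hyK
        rw [finsum_eq_sum_of_fintype] at hs
        simp only [hg, enorm_mul]
        rw [← Finset.sum_mul]
        have : ∑ i, ‖f i y‖ₑ = 1 := by
          simp_rw [Real.enorm_eq_ofReal (f.nonneg _ y)]
          rw [← ENNReal.ofReal_sum_of_nonneg fun i _ => f.nonneg i y, hs, ENNReal.ofReal_one]
        rw [this, one_mul]

lemma memLp_of_continuous_of_isCompact {X : Type*} [TopologicalSpace X] [T2Space X]
    [MeasurableSpace X] [OpensMeasurableSpace X] {μ : Measure X} {S : Set X} (hS : IsCompact S)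
    (hμ : μ S < ⊤) {φ : X → ℝ} (hφ : Continuous φ) (p : ℝ≥0∞) : MemLp φ p (μ.restrict S) := by
  have : IsFiniteMeasure (μ.restrict S) := ⟨by rwa [Measure.restrict_apply_univ]⟩
  obtain ⟨C, hC⟩ := hS.exists_bound_of_continuousOn hφ.continuousOn
  refine MemLp.of_bound hφ.measurable.aestronglyMeasurable C ?_
  filter_upwards [ae_restrict_mem hS.isClosed.measurableSet] with x hx using hC x hx

lemma IsStarBody.memLp_frontier {K : Set (SpaceTime n)} {c : SpaceTime n}
    {κ h : ℝ} (hK : IsStarBody K c κ h) {φ : SpaceTime n → ℝ} (hφ : Continuous φ) :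
    MemLp φ 2 ((surface n).restrict (frontier K)) :=
  memLp_of_continuous_of_isCompact hK.isCompact_frontier hK.surface_frontier_lt_top hφ 2

/-- The Gauss–Green formula for a star-shaped body, with an unidentified normal. -/
theorem IsStarBody.exists_flux {K : Set (SpaceTime n)} {c : SpaceTime n}
    {κ h : ℝ} (hK : IsStarBody K c κ h) (j : Fin (n + 1)) :
    ∃ b : SpaceTime n → ℝ, MemLp b 2 ((surface n).restrict (frontier K)) ∧
      ∀ φ : SpaceTime n → ℝ, ContDiff ℝ ∞ φ →
        ∫ y in interior K, fderiv ℝ φ y (EuclideanSpace.single j (1 : ℝ)) =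
          ∫ y in frontier K, b y * φ y ∂(surface n) := by
  obtain ⟨C, hC0, hC⟩ := hK.exists_enorm_integral_fderiv_le j
  set e : SpaceTime n := EuclideanSpace.single j (1 : ℝ) with he
  set μ := (surface n).restrict (frontier K) with hμ
  have hfin : IsFiniteMeasure μ :=
    ⟨by rw [hμ, Measure.restrict_apply_univ]; exact hK.surface_frontier_lt_top⟩
  let V : Submodule ℝ (SpaceTime n → ℝ) :=
    { carrier := {φ | ContDiff ℝ ∞ φ}
      add_mem' := fun {a b} (ha : ContDiff ℝ ∞ a) (hb : ContDiff ℝ ∞ b) => ha.add hb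
      zero_mem' := (contDiff_const : ContDiff ℝ ∞ fun _ : SpaceTime n => (0 : ℝ))
      smul_mem' := fun c a (ha : ContDiff ℝ ∞ a) => ha.const_smul c }
  have hsm : ∀ φ : V, ContDiff ℝ ∞ (φ : SpaceTime n → ℝ) := fun φ => φ.2
  have hmem : ∀ φ : V, MemLp (φ : SpaceTime n → ℝ) 2 μ := fun φ =>
    hK.memLp_frontier (hsm φ).continuous
  let T : V →ₗ[ℝ] Lp ℝ 2 μ :=
    { toFun := fun φ => (hmem φ).toLp
      map_add' := fun φ ψ => MemLp.toLp_add (hmem φ) (hmem ψ)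
      map_smul' := fun a φ => MemLp.toLp_const_smul a (hmem φ) }
  have hderint : ∀ φ : V, IntegrableOn (fun y => fderiv ℝ (φ : SpaceTime n → ℝ) y e)
      (interior K) := fun φ =>
    ((((hsm φ).continuous_fderiv (by simp)).clm_apply
      continuous_const).continuousOn.integrableOn_compact hK.isCompact).mono_set interior_subset
  have hdiff : ∀ φ : V, Differentiable ℝ (φ : SpaceTime n → ℝ) := fun φ =>
    (hsm φ).differentiable (by simp)
  let ℓ : V →ₗ[ℝ] ℝ :=
    { toFun := fun φ => ∫ y in interior K, fderiv ℝ (φ : SpaceTime n → ℝ) y e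
      map_add' := fun φ ψ => by
        rw [← integral_add (hderint φ) (hderint ψ)]
        congr 1 with y
        rw [Submodule.coe_add, fderiv_add (hdiff φ y) (hdiff ψ y)]
        simp
      map_smul' := fun a φ => by
        rw [RingHom.id_apply, smul_eq_mul, ← integral_const_mul]
        congr 1 with y
        rw [Submodule.coe_smul, fderiv_const_smul (hdiff φ y)]
        simp }
  -- The flux is controlled by an `L¹` norm on the frontier, hence by the `L²` norm, because the
  -- frontier has finite measure; this is the form that Riesz' theorem needs.
  have hbound : ∀ φ, |ℓ φ| ≤ (C * (μ Set.univ ^ (1 / 2 : ℝ)).toReal) * ‖T φ‖ := by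
    intro φ
    have h1 := hC φ (hsm φ)
    have h2 := eLpNorm_le_eLpNorm_mul_rpow_measure_univ (μ := μ) (p := 1) (q := 2)
      (by norm_num) (hmem φ).aestronglyMeasurable
    rw [eLpNorm_one_eq_lintegral_enorm] at h2
    have e1 : (1 / (1 : ℝ≥0∞).toReal - 1 / (2 : ℝ≥0∞).toReal) = (1 / 2 : ℝ) := by norm_num
    rw [e1] at h2
    have h3 : ‖ℓ φ‖ₑ ≤ ENNReal.ofReal C *
        (eLpNorm (φ : SpaceTime n → ℝ) 2 μ * μ Set.univ ^ (1 / 2 : ℝ)) :=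
      h1.trans (mul_le_mul' le_rfl h2)
    have hfin2 : μ Set.univ ^ (1 / 2 : ℝ) ≠ ⊤ :=
      ENNReal.rpow_ne_top_of_nonneg (by norm_num) (measure_ne_top _ _)
    have hne : ENNReal.ofReal C *
        (eLpNorm (φ : SpaceTime n → ℝ) 2 μ * μ Set.univ ^ (1 / 2 : ℝ)) ≠ ⊤ :=
      ENNReal.mul_ne_top ENNReal.ofReal_ne_top (ENNReal.mul_ne_top (hmem φ).eLpNorm_ne_top hfin2)
    have h4 := ENNReal.toReal_mono hne h3
    rw [toReal_enorm, Real.norm_eq_abs, ENNReal.toReal_mul, ENNReal.toReal_mul,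
      ENNReal.toReal_ofReal hC0] at h4
    have h5 : ‖T φ‖ = (eLpNorm (φ : SpaceTime n → ℝ) 2 μ).toReal := Lp.norm_toLp _ (hmem φ)
    rw [h5]
    linarith
  obtain ⟨b, hb⟩ := exists_inner_representative T ℓ _ hbound
  refine ⟨b, Lp.memLp b, fun φ hφ => ?_⟩
  have h1 := hb ⟨φ, hφ⟩
  rw [L2.inner_def] at h1
  refine h1.trans (integral_congr_ae ?_)
  filter_upwards [(hmem ⟨φ, hφ⟩).coeFn_toLp] with y hy
  simp only [T, LinearMap.coe_mk, AddHom.coe_mk]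
  rw [hy]
  simp [mul_comm]

end Flux

/-! ### Weak derivatives -/

section WeakDeriv

variable {n : ℕ} {U : Set (SpaceTime n)}

/-- The `j`-th unit vector of spacetime. -/
abbrev unitVec (j : Fin (n + 1)) : SpaceTime n := EuclideanSpace.single j (1 : ℝ)

lemma continuous_iteratedFDeriv_apply {m : ℕ} {φ : SpaceTime n → ℝ} (hφ : ContDiff ℝ ∞ φ)
    (v : Fin m → SpaceTime n) : Continuous fun x => iteratedFDeriv ℝ m φ x v :=
  (ContinuousMultilinearMap.apply ℝ (fun _ : Fin m => SpaceTime n) ℝ v).continuous.comp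
    (hφ.continuous_iteratedFDeriv (by exact_mod_cast le_top))

lemma hasCompactSupport_iteratedFDeriv_apply {m : ℕ} {φ : SpaceTime n → ℝ}
    (hc : HasCompactSupport φ) (v : Fin m → SpaceTime n) :
    HasCompactSupport fun x => iteratedFDeriv ℝ m φ x v :=
  (hc.iteratedFDeriv (𝕜 := ℝ) m).comp_left
    (g := fun A : ContinuousMultilinearMap ℝ (fun _ : Fin m => SpaceTime n) ℝ => A v) (by simp)

lemma integrable_mul_of_memLp_two {v φ : SpaceTime n → ℝ} (hv : MemLp v 2 (volume.restrict U))
    (hφ : Continuous φ) (hc : HasCompactSupport φ) :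
    Integrable (fun x => v x * φ x) (volume.restrict U) :=
  MemLp.integrable_mul hv
    ((hφ.memLp_of_hasCompactSupport hc : MemLp φ 2 volume).restrict U)

/-- The difference integrates to zero against every test function. Consequently the choice made in
`weakDeriv` is harmless up to null sets. -/
lemma IsWeakDeriv.ae_eq (hU : IsOpen U) {m : ℕ} {w : Fin m → Fin (n + 1)}
    {v v' g g' : SpaceTime n → ℝ} (hg : IsWeakDeriv U w v g) (hg' : IsWeakDeriv U w v' g')
    (hvv : v =ᵐ[volume.restrict U] v') : g =ᵐ[volume.restrict U] g' := by
  have hloc : LocallyIntegrableOn (g - g') U := by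
    have h1 : MemLp (g - g') 2 (volume.restrict U) := hg.1.sub hg'.1
    intro x hx
    refine ⟨U ∩ Metric.closedBall x 1, ?_, ?_⟩
    · exact inter_mem self_mem_nhdsWithin
        (mem_nhdsWithin_of_mem_nhds (Metric.closedBall_mem_nhds x one_pos))
    · have h2 : MemLp (g - g') 2 (volume.restrict (U ∩ Metric.closedBall x 1)) :=
        h1.mono_measure (Measure.restrict_mono Set.inter_subset_left le_rfl)
      have : IsFiniteMeasure (volume.restrict (U ∩ Metric.closedBall x 1)) :=
        ⟨by
          rw [Measure.restrict_apply_univ]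
          exact (measure_mono Set.inter_subset_right).trans_lt
            (isCompact_closedBall x 1).measure_lt_top⟩
      exact h2.integrable (by norm_num)
  have h := hU.ae_eq_zero_of_integral_contDiff_smul_eq_zero hloc (μ := volume) ?_
  · rw [Filter.EventuallyEq, ae_restrict_iff' hU.measurableSet]
    filter_upwards [h] with x hx hxU
    exact sub_eq_zero.1 (hx hxU)
  · intro φ hφ hc hs
    have e1 : ∫ x, φ x • (g - g') x = ∫ x in U, φ x • (g - g') x := by
      refine (setIntegral_eq_integral_of_forall_compl_eq_zero fun x hx => ?_).symm
      rw [image_eq_zero_of_notMem_tsupport fun h => hx (hs h), zero_smul]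
    have e2 : ∫ x in U, φ x • (g - g') x = (∫ x in U, g x * φ x) - ∫ x in U, g' x * φ x := by
      rw [← integral_sub (integrable_mul_of_memLp_two hg.1 hφ.continuous hc)
        (integrable_mul_of_memLp_two hg'.1 hφ.continuous hc)]
      congr 1 with x
      simp only [Pi.sub_apply, smul_eq_mul]; ring
    have h1 := hg.2 φ hφ hc hs
    have h2 := hg'.2 φ hφ hc hs
    have h3 : ∫ x in U, v x * iteratedFDeriv ℝ m φ x (fun j => unitVec (w j)) =
        ∫ x in U, v' x * iteratedFDeriv ℝ m φ x (fun j => unitVec (w j)) := by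
      refine integral_congr_ae ?_
      filter_upwards [hvv] with x hx
      rw [hx]
    rw [h1, h2] at h3
    have h4 : ∫ x in U, g x * φ x = ∫ x in U, g' x * φ x :=
      mul_left_cancel₀ (pow_ne_zero m (by norm_num)) h3
    rw [e1, e2, h4, sub_self]

lemma IsWeakDeriv.congr {m : ℕ} {w : Fin m → Fin (n + 1)}
    {v v' g : SpaceTime n → ℝ} (hg : IsWeakDeriv U w v g)
    (hvv : v =ᵐ[volume.restrict U] v') : IsWeakDeriv U w v' g := by
  refine ⟨hg.1, fun φ hφ hc hs => ?_⟩
  rw [← hg.2 φ hφ hc hs]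
  refine integral_congr_ae ?_
  filter_upwards [hvv] with x hx
  rw [hx]

lemma IsWeakDeriv.sub {m : ℕ} {w : Fin m → Fin (n + 1)}
    {v v' g g' : SpaceTime n → ℝ} (hv : MemLp v 2 (volume.restrict U))
    (hv' : MemLp v' 2 (volume.restrict U)) (hg : IsWeakDeriv U w v g)
    (hg' : IsWeakDeriv U w v' g') : IsWeakDeriv U w (v - v') (g - g') := by
  refine ⟨hg.1.sub hg'.1, fun φ hφ hc hs => ?_⟩
  have hD := continuous_iteratedFDeriv_apply (m := m) hφ (fun j => unitVec (w j))
  have hDc := hasCompactSupport_iteratedFDeriv_apply (m := m) hc (fun j => unitVec (w j))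
  simp only [Pi.sub_apply, sub_mul]
  rw [integral_sub (integrable_mul_of_memLp_two hv hD hDc) (integrable_mul_of_memLp_two hv' hD hDc),
    integral_sub (integrable_mul_of_memLp_two hg.1 hφ.continuous hc)
      (integrable_mul_of_memLp_two hg'.1 hφ.continuous hc),
    mul_sub, ← hg.2 φ hφ hc hs, ← hg'.2 φ hφ hc hs]

lemma iteratedFDeriv_eq_zero_of_notMem {m : ℕ} {φ : SpaceTime n → ℝ} {x : SpaceTime n}
    (hx : x ∉ tsupport φ) : iteratedFDeriv ℝ m φ x = 0 :=
  image_eq_zero_of_notMem_tsupport fun h => hx (tsupport_iteratedFDeriv_subset m h)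

lemma IsWeakDeriv.mono {m : ℕ} {w : Fin m → Fin (n + 1)} {U' : Set (SpaceTime n)}
    (hsub : U' ⊆ U)
    {v g : SpaceTime n → ℝ} (hg : IsWeakDeriv U w v g) : IsWeakDeriv U' w v g := by
  refine ⟨hg.1.mono_measure (Measure.restrict_mono hsub le_rfl), fun φ hφ hc hs => ?_⟩
  have h := hg.2 φ hφ hc (hs.trans hsub)
  have e1 : ∀ F : SpaceTime n → ℝ, (∀ x, x ∉ U' → F x = 0) →
      ∫ x in U, F x = ∫ x in U', F x := by
    intro F hF
    rw [setIntegral_eq_integral_of_forall_compl_eq_zero fun x hx => hF x fun h => hx (hsub h),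
      setIntegral_eq_integral_of_forall_compl_eq_zero fun x hx => hF x hx]
  rw [e1, e1] at h
  · exact h
  · intro x hx
    rw [image_eq_zero_of_notMem_tsupport fun h => hx (hs h), mul_zero]
  · intro x hx
    rw [iteratedFDeriv_eq_zero_of_notMem fun h => hx (hs h)]
    simp

lemma iteratedFDeriv_one_unitVec (φ : SpaceTime n → ℝ) (x : SpaceTime n)
    (w : Fin 1 → Fin (n + 1)) :
    iteratedFDeriv ℝ 1 φ x (fun j => unitVec (w j)) = fderiv ℝ φ x (unitVec (w 0)) := by
  rw [iteratedFDeriv_one_apply]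

lemma contDiff_fderiv_apply {φ : SpaceTime n → ℝ} (hφ : ContDiff ℝ ∞ φ) (v : SpaceTime n) :
    ContDiff ℝ ∞ fun x => fderiv ℝ φ x v :=
  (hφ.fderiv_right (m := ∞) (by norm_cast)).clm_apply contDiff_const

lemma iteratedFDeriv_succ_unitVec {φ : SpaceTime n → ℝ} (hφ : ContDiff ℝ ∞ φ) (x : SpaceTime n)
    {m : ℕ} (v : Fin (m + 1) → SpaceTime n) :
    iteratedFDeriv ℝ (m + 1) φ x v =
      fderiv ℝ (fun y => iteratedFDeriv ℝ m φ y (Fin.tail v)) x (v 0) := by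
  rw [iteratedFDeriv_succ_apply_left]
  have hd : DifferentiableAt ℝ (iteratedFDeriv ℝ m φ) x :=
    (hφ.differentiable_iteratedFDeriv (by exact_mod_cast ENat.natCast_lt_top m)) x
  have h2 : HasFDerivAt (fun y => iteratedFDeriv ℝ m φ y (Fin.tail v))
      ((ContinuousMultilinearMap.apply ℝ (fun _ : Fin m => SpaceTime n) ℝ (Fin.tail v)).comp
        (fderiv ℝ (iteratedFDeriv ℝ m φ) x)) x :=
    (ContinuousMultilinearMap.apply ℝ (fun _ : Fin m => SpaceTime n) ℝ
      (Fin.tail v)).hasFDerivAt.comp x hd.hasFDerivAt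
  rw [h2.fderiv]
  rfl

lemma integral_mul_fderiv_of_smooth {f φ : SpaceTime n → ℝ} (hf : ContDiff ℝ 1 f)
    (hφ : ContDiff ℝ 1 φ) (hc : HasCompactSupport φ) (v : SpaceTime n) :
    ∫ x, f x * fderiv ℝ φ x v = - ∫ x, fderiv ℝ f x v * φ x := by
  have hf' : Continuous fun x => fderiv ℝ f x v :=
    (hf.continuous_fderiv one_ne_zero).clm_apply continuous_const
  have hφ' : Continuous fun x => fderiv ℝ φ x v :=
    (hφ.continuous_fderiv one_ne_zero).clm_apply continuous_const
  refine integral_mul_fderiv_eq_neg_fderiv_mul_of_integrable ?_ ?_ ?_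
    (fun x _ => (hf.differentiable one_ne_zero) x) (fun x _ => (hφ.differentiable one_ne_zero) x)
  · exact (hf'.mul hφ.continuous).integrable_of_hasCompactSupport hc.mul_left
  · exact (hf.continuous.mul hφ').integrable_of_hasCompactSupport (hc.fderiv_apply ℝ v).mul_left
  · exact (hf.continuous.mul hφ.continuous).integrable_of_hasCompactSupport hc.mul_left

lemma memLp_two_of_continuous (hUb : Bornology.IsBounded U) {f : SpaceTime n → ℝ}
    (hf : Continuous f) : MemLp f 2 (volume.restrict U) :=
  (memLp_of_continuous_of_isCompact hUb.isCompact_closure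
    hUb.isCompact_closure.measure_lt_top hf 2).mono_measure
      (Measure.restrict_mono subset_closure le_rfl)

lemma isWeakDeriv_of_integral {m : ℕ} {w : Fin m → Fin (n + 1)} {v g : SpaceTime n → ℝ}
    (hg : MemLp g 2 (volume.restrict U))
    (h : ∀ φ : SpaceTime n → ℝ, ContDiff ℝ ∞ φ → HasCompactSupport φ →
      ∫ x, v x * iteratedFDeriv ℝ m φ x (fun j => unitVec (w j)) =
        (-1) ^ m * ∫ x, g x * φ x) : IsWeakDeriv U w v g := by
  refine ⟨hg, fun φ hφ hc hs => ?_⟩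
  rw [setIntegral_eq_integral_of_forall_compl_eq_zero,
    setIntegral_eq_integral_of_forall_compl_eq_zero]
  · exact h φ hφ hc
  · intro x hx
    rw [image_eq_zero_of_notMem_tsupport fun h => hx (hs h), mul_zero]
  · intro x hx
    rw [iteratedFDeriv_eq_zero_of_notMem fun h => hx (hs h)]
    simp

lemma exists_isWeakDeriv_of_smooth (hUb : Bornology.IsBounded U) {f : SpaceTime n → ℝ}
    (hf : ContDiff ℝ ∞ f) {m : ℕ} (w : Fin m → Fin (n + 1)) : ∃ g, IsWeakDeriv U w f g := by
  -- The induction runs over the whole space, where integration by parts against compactly supported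
  -- functions has no boundary terms. The set `U` enters only through the square integrability of
  -- the result.
  suffices H : ∃ g : SpaceTime n → ℝ, ContDiff ℝ ∞ g ∧ ∀ φ : SpaceTime n → ℝ, ContDiff ℝ ∞ φ →
      HasCompactSupport φ → ∫ x, f x * iteratedFDeriv ℝ m φ x (fun j => unitVec (w j)) =
        (-1) ^ m * ∫ x, g x * φ x by
    obtain ⟨g, hg, h⟩ := H
    exact ⟨g, isWeakDeriv_of_integral (memLp_two_of_continuous hUb hg.continuous) h⟩
  induction m generalizing f with
  | zero =>
    refine ⟨f, hf, fun φ _ _ => ?_⟩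
    simp
  | succ m ih =>
    obtain ⟨g, hg, h⟩ := ih (contDiff_fderiv_apply hf (unitVec (w 0))) (Fin.tail w)
    refine ⟨g, hg, fun φ hφ hc => ?_⟩
    simp_rw [iteratedFDeriv_succ_unitVec hφ]
    have hψ : ContDiff ℝ 1 fun y =>
        iteratedFDeriv ℝ m φ y (Fin.tail fun j => unitVec (w j)) :=
      (ContinuousMultilinearMap.apply ℝ (fun _ : Fin m => SpaceTime n) ℝ _).contDiff.comp
        (hφ.iteratedFDeriv_right (m := 1) (by exact_mod_cast le_top))
    rw [integral_mul_fderiv_of_smooth (hf.of_le (by norm_cast)) hψ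
      (hasCompactSupport_iteratedFDeriv_apply hc _), pow_succ, mul_assoc, neg_one_mul, mul_neg,
      ← h φ hφ hc]
    rfl

lemma isWeakDeriv_fderiv (hUb : Bornology.IsBounded U) {f : SpaceTime n → ℝ}
    (hf : ContDiff ℝ ∞ f) (i : Fin (n + 1)) :
    IsWeakDeriv U ![i] f fun x => fderiv ℝ f x (unitVec i) := by
  refine isWeakDeriv_of_integral
    (memLp_two_of_continuous hUb (contDiff_fderiv_apply hf _).continuous) fun φ hφ hc => ?_
  simp_rw [iteratedFDeriv_one_unitVec]
  rw [pow_one, neg_one_mul]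
  exact integral_mul_fderiv_of_smooth (hf.of_le (by norm_cast)) (hφ.of_le (by norm_cast)) hc _

lemma isWeakDeriv_zero {w : Fin 0 → Fin (n + 1)} {v : SpaceTime n → ℝ}
    (hv : MemLp v 2 (volume.restrict U)) : IsWeakDeriv U w v v :=
  ⟨hv, fun φ _ _ _ => by simp⟩

lemma isWeakDeriv_weakDeriv {m : ℕ} {w : Fin m → Fin (n + 1)} {v : SpaceTime n → ℝ}
    (h : ∃ g, IsWeakDeriv U w v g) : IsWeakDeriv U w v (weakDeriv U w v) := by
  rw [weakDeriv, dif_pos h]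
  exact h.choose_spec

lemma weakDeriv_ae_eq (hU : IsOpen U) {m : ℕ} {w : Fin m → Fin (n + 1)}
    {v v' g : SpaceTime n → ℝ} (hg : IsWeakDeriv U w v g)
    (hvv : v' =ᵐ[volume.restrict U] v) : weakDeriv U w v' =ᵐ[volume.restrict U] g :=
  (isWeakDeriv_weakDeriv ⟨g, hg.congr hvv.symm⟩).ae_eq hU hg hvv

/-- Test the equation for `∂_i v` with `∂_j φ`. This is how the components of the gradient of an
`H²` function are seen to belong to `H¹`, with the expected derivatives. -/
lemma IsWeakDeriv.succ {v g g' : SpaceTime n → ℝ} {i j : Fin (n + 1)}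
    (hg : IsWeakDeriv U ![i] v g) (hg' : IsWeakDeriv U ![i, j] v g') :
    IsWeakDeriv U ![j] g g' := by
  refine ⟨hg'.1, fun φ hφ hc hs => ?_⟩
  simp_rw [iteratedFDeriv_one_unitVec]
  have h1 := hg.2 (fun x => fderiv ℝ φ x (unitVec j)) (contDiff_fderiv_apply hφ _)
    (hc.fderiv_apply ℝ _) ((tsupport_fderiv_apply_subset ℝ _).trans hs)
  have h2 := hg'.2 φ hφ hc hs
  simp_rw [iteratedFDeriv_one_unitVec] at h1
  have h3 : ∀ x, iteratedFDeriv ℝ 2 φ x (fun k => unitVec (![i, j] k)) =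
      fderiv ℝ (fun y => fderiv ℝ φ y (unitVec j)) x (unitVec i) := by
    intro x
    rw [iteratedFDeriv_succ_unitVec hφ]
    simp_rw [iteratedFDeriv_one_apply]
    rfl
  simp_rw [h3] at h2
  have h4 := h1.symm.trans h2
  simp only [Matrix.cons_val_fin_one, pow_one, neg_one_mul] at h4 ⊢
  linarith

namespace MemSobolev

variable {k : ℕ} {v v' : SpaceTime n → ℝ}

lemma isWeakDeriv (h : MemSobolev U k v) {m : ℕ} (hm : m ≤ k) (w : Fin m → Fin (n + 1)) :
    IsWeakDeriv U w v (weakDeriv U w v) := isWeakDeriv_weakDeriv (h.2 m hm w)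

lemma memLp_weakDeriv (h : MemSobolev U k v) {m : ℕ} (hm : m ≤ k) (w : Fin m → Fin (n + 1)) :
    MemLp (weakDeriv U w v) 2 (volume.restrict U) := (h.isWeakDeriv hm w).1

lemma congr (h : MemSobolev U k v) (hvv : v =ᵐ[volume.restrict U] v') : MemSobolev U k v' :=
  ⟨(memLp_congr_ae hvv).1 h.1, fun m hm w => (h.2 m hm w).imp fun _ hg => hg.congr hvv⟩

lemma sub (h : MemSobolev U k v) (h' : MemSobolev U k v') : MemSobolev U k (v - v') :=
  ⟨h.1.sub h'.1, fun _ hm w => ⟨_, (h.isWeakDeriv hm w).sub h.1 h'.1 (h'.isWeakDeriv hm w)⟩⟩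

lemma of_le (h : MemSobolev U k v) {l : ℕ} (hl : l ≤ k) : MemSobolev U l v :=
  ⟨h.1, fun m hm w => h.2 m (hm.trans hl) w⟩

lemma mono (h : MemSobolev U k v) {U' : Set (SpaceTime n)}
    (hsub : U' ⊆ U) : MemSobolev U' k v :=
  ⟨h.1.mono_measure (Measure.restrict_mono hsub le_rfl), fun _ hm w =>
    (h.2 _ hm w).imp fun _ hg => hg.mono hsub⟩

lemma weakDeriv_sub (hU : IsOpen U) (h : MemSobolev U k v) (h' : MemSobolev U k v') {m : ℕ}
    (hm : m ≤ k) (w : Fin m → Fin (n + 1)) :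
    weakDeriv U w (v - v') =ᵐ[volume.restrict U] weakDeriv U w v - weakDeriv U w v' :=
  weakDeriv_ae_eq hU ((h.isWeakDeriv hm w).sub h.1 h'.1 (h'.isWeakDeriv hm w)) .rfl

lemma weakDeriv_mono (h : MemSobolev U k v) {U' : Set (SpaceTime n)}
    (hU' : IsOpen U') (hsub : U' ⊆ U) {m : ℕ} (hm : m ≤ k) (w : Fin m → Fin (n + 1)) :
    weakDeriv U' w v =ᵐ[volume.restrict U'] weakDeriv U w v :=
  weakDeriv_ae_eq hU' ((h.isWeakDeriv hm w).mono hsub) .rfl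

lemma grad_grad (h : MemSobolev U 2 v) (i j : Fin (n + 1)) :
    IsWeakDeriv U ![j] (fun y => grad U v y i) (weakDeriv U ![i, j] v) :=
  IsWeakDeriv.succ (h.isWeakDeriv (by norm_num) ![i]) (h.isWeakDeriv le_rfl ![i, j])

lemma of_first (hv : MemLp v 2 (volume.restrict U))
    (h : ∀ i, ∃ g, IsWeakDeriv U ![i] v g) : MemSobolev U 1 v := by
  refine ⟨hv, fun m hm w => ?_⟩
  interval_cases m
  · exact ⟨v, isWeakDeriv_zero hv⟩
  · obtain ⟨g, hg⟩ := h (w 0)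
    refine ⟨g, ?_⟩
    convert hg using 1
    funext i
    rw [Subsingleton.elim i 0]
    rfl

lemma grad (h : MemSobolev U 2 v) (i : Fin (n + 1)) :
    MemSobolev U 1 (fun y => grad U v y i) :=
  of_first (h.memLp_weakDeriv (by norm_num) ![i]) fun j => ⟨_, h.grad_grad i j⟩

lemma of_smooth (hUb : Bornology.IsBounded U) {f : SpaceTime n → ℝ} (hf : ContDiff ℝ ∞ f)
    (k : ℕ) : MemSobolev U k f :=
  ⟨memLp_two_of_continuous hUb hf.continuous, fun _ _ w => exists_isWeakDeriv_of_smooth hUb hf w⟩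

end MemSobolev

lemma grad_smooth_ae (hU : IsOpen U) (hUb : Bornology.IsBounded U) {f v : SpaceTime n → ℝ}
    (hf : ContDiff ℝ ∞ f) (hv : v =ᵐ[volume.restrict U] f) (i : Fin (n + 1)) :
    (fun x => grad U v x i) =ᵐ[volume.restrict U] fun x => fderiv ℝ f x (unitVec i) :=
  weakDeriv_ae_eq hU (isWeakDeriv_fderiv hUb hf i) hv

end WeakDeriv

/-! ### Approximation by smooth functions on a star-shaped body -/

section Averages

variable {n : ℕ}

/-- The average of `f` near `a x + b` with weight `η`. -/
def affAvg (η : SpaceTime n → ℝ) (a : ℝ) (b : SpaceTime n) (f : SpaceTime n → ℝ)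
    (x : SpaceTime n) : ℝ := ∫ s, η s * f (a • x + b - s)

/-- A weight: a smooth probability density supported in the ball of radius `ρ`. -/
structure IsWeight (η : SpaceTime n → ℝ) (ρ : ℝ) : Prop where
  smooth : ContDiff ℝ ∞ η
  compact : HasCompactSupport η
  nonneg : ∀ s, 0 ≤ η s
  integral : ∫ s, η s = 1
  small : ∀ s ∈ tsupport η, ‖s‖ ≤ ρ

lemma exists_isWeight {ρ : ℝ} (hρ : 0 < ρ) : ∃ η : SpaceTime n → ℝ, IsWeight η ρ := by
  let β : ContDiffBump (0 : SpaceTime n) := ⟨ρ / 2, ρ, by positivity, by linarith⟩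
  refine ⟨β.normed volume, β.contDiff_normed, β.hasCompactSupport_normed, β.nonneg_normed,
    β.integral_normed, fun s hs => ?_⟩
  rw [β.tsupport_normed_eq] at hs
  simpa using hs

lemma sq_lintegral_le {α : Type*} [MeasurableSpace α] (μ : Measure α) [IsProbabilityMeasure μ]
    {F : α → ℝ≥0∞} (hF : Measurable F) : (∫⁻ x, F x ∂μ) ^ 2 ≤ ∫⁻ x, F x ^ 2 ∂μ := by
  have h := ENNReal.lintegral_mul_le_Lp_mul_Lq μ (Real.HolderConjugate.two_two) hF.aemeasurable
    (aemeasurable_const (b := (1 : ℝ≥0∞)))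
  simp only [Pi.mul_apply, mul_one, ENNReal.one_rpow, lintegral_const, measure_univ] at h
  calc (∫⁻ x, F x ∂μ) ^ 2 ≤ ((∫⁻ x, F x ^ (2 : ℝ) ∂μ) ^ (1 / 2 : ℝ)) ^ 2 := by gcongr
    _ = ∫⁻ x, F x ^ 2 ∂μ := by
        rw [← ENNReal.rpow_natCast, ← ENNReal.rpow_mul]
        norm_num

variable {η : SpaceTime n → ℝ} {ρ a : ℝ} {b : SpaceTime n} {f g : SpaceTime n → ℝ}

lemma IsWeight.integrable (hη : IsWeight η ρ) : Integrable η :=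
  hη.smooth.continuous.integrable_of_hasCompactSupport hη.compact

lemma locallyIntegrable_of_memLp_two (hf : MemLp f 2 volume) : LocallyIntegrable f :=
  hf.locallyIntegrable (by norm_num)

lemma IsWeight.integrable_mul (hη : IsWeight η ρ) (hf : LocallyIntegrable f) (y : SpaceTime n) :
    Integrable fun s => η s * f (y - s) := by
  have := (hη.compact.convolutionExists_left (ContinuousLinearMap.mul ℝ ℝ) hη.smooth.continuous
    hf) y
  simpa [ConvolutionExistsAt] using this

lemma measurable_affAvg (hη : IsWeight η ρ) (hf : Measurable f) : Measurable (affAvg η a b f) := by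
  have h : Measurable fun q : SpaceTime n × SpaceTime n => η q.2 * f (a • q.1 + b - q.2) :=
    (hη.smooth.continuous.measurable.comp measurable_snd).mul (hf.comp (by fun_prop))
  exact h.stronglyMeasurable.integral_prod_right.measurable

lemma lintegral_comp_affine {G : SpaceTime n → ℝ≥0∞} (hG : Measurable G) (ha : 0 < a)
    (b : SpaceTime n) :
    ∫⁻ x, G (a • x + b) = ENNReal.ofReal ((a ^ (n + 1))⁻¹) * ∫⁻ x, G x := by
  have h1 : ∫⁻ x : SpaceTime n, G (a • x + b) = ∫⁻ x, G (x + b) ∂(volume.map (a • ·)) := by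
    rw [lintegral_map (f := fun x => G (x + b)) (hG.comp (measurable_add_const b))
      (measurable_const_smul a)]
  rw [h1, Measure.map_addHaar_smul _ ha.ne', lintegral_smul_measure,
    lintegral_add_right_eq_self, smul_eq_mul]
  congr 2
  rw [abs_of_pos (by positivity)]
  simp

/-- Jensen's inequality for the probability density `η`, followed by Tonelli and the change of
variables `x ↦ a x + b`. -/
lemma lintegral_affAvg_sq_le (hη : IsWeight η ρ) (ha : 0 < a) (hf : Measurable f) :
    ∫⁻ x, ‖affAvg η a b f x‖ₑ ^ 2 ≤ ENNReal.ofReal ((a ^ (n + 1))⁻¹) * ∫⁻ x, ‖f x‖ₑ ^ 2 := by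
  set μ : Measure (SpaceTime n) := volume.withDensity fun s => ENNReal.ofReal (η s) with hμ
  have hηm : Measurable fun s => ENNReal.ofReal (η s) :=
    hη.smooth.continuous.measurable.ennreal_ofReal
  have hprob : IsProbabilityMeasure μ := by
    refine ⟨?_⟩
    rw [hμ, withDensity_apply _ MeasurableSet.univ, Measure.restrict_univ,
      ← ofReal_integral_eq_lintegral_ofReal hη.integrable (ae_of_all _ hη.nonneg), hη.integral,
      ENNReal.ofReal_one]
  have hpt : ∀ x, ‖affAvg η a b f x‖ₑ ^ 2 ≤ ∫⁻ s, ‖f (a • x + b - s)‖ₑ ^ 2 ∂μ := by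
    intro x
    have hfm : Measurable fun s => ‖f (a • x + b - s)‖ₑ := (hf.comp (by fun_prop)).enorm
    have h1 : ‖affAvg η a b f x‖ₑ ≤ ∫⁻ s, ‖f (a • x + b - s)‖ₑ ∂μ := by
      rw [hμ, lintegral_withDensity_eq_lintegral_mul _ hηm hfm]
      refine (enorm_integral_le_lintegral_enorm _).trans (le_of_eq ?_)
      congr 1 with s
      rw [enorm_mul, Real.enorm_eq_ofReal (hη.nonneg s)]
      rfl
    exact (pow_le_pow_left' h1 2).trans (sq_lintegral_le μ hfm)
  calc ∫⁻ x, ‖affAvg η a b f x‖ₑ ^ 2 ≤ ∫⁻ x, ∫⁻ s, ‖f (a • x + b - s)‖ₑ ^ 2 ∂μ :=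
        lintegral_mono hpt
    _ = ∫⁻ s, (∫⁻ x, ‖f (a • x + b - s)‖ₑ ^ 2) ∂μ := by
        refine lintegral_lintegral_swap (Measurable.aemeasurable ?_)
        exact ((hf.comp (by fun_prop : Measurable fun q : SpaceTime n × SpaceTime n =>
          a • q.1 + b - q.2)).enorm).pow_const 2
    _ = ∫⁻ _s, (ENNReal.ofReal ((a ^ (n + 1))⁻¹) * ∫⁻ x, ‖f x‖ₑ ^ 2) ∂μ := by
        congr 1 with s
        rw [← lintegral_comp_affine (hf.enorm.pow_const 2) ha (b - s)]
        simp_rw [add_sub_assoc]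
    _ = _ := by rw [lintegral_const, measure_univ, mul_one]

lemma eLpNorm_two_sq {α : Type*} [MeasurableSpace α] (μ : Measure α) (f : α → ℝ) :
    eLpNorm f 2 μ ^ 2 = ∫⁻ x, ‖f x‖ₑ ^ 2 ∂μ := by
  have h := eLpNorm_nnreal_pow_eq_lintegral (μ := μ) (f := f) (p := 2) (by norm_num)
  simp only [NNReal.coe_ofNat, ENNReal.coe_ofNat] at h
  rw [← ENNReal.rpow_natCast]
  simpa using h

/-- The constant is crude; what matters is that it is uniform in `a ≥ 1 / 2`, so that the averaging
operators are uniformly bounded. -/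
lemma eLpNorm_affAvg_le (hη : IsWeight η ρ) (ha : 1 / 2 ≤ a) (hf : Measurable f) :
    eLpNorm (affAvg η a b f) 2 volume ≤ 2 ^ (n + 1) * eLpNorm f 2 volume := by
  have h := lintegral_affAvg_sq_le (b := b) hη (by linarith : 0 < a) hf
  rw [← eLpNorm_two_sq, ← eLpNorm_two_sq] at h
  have h2 : ENNReal.ofReal ((a ^ (n + 1))⁻¹) ≤ (2 ^ (n + 1)) ^ 2 := by
    have : (a ^ (n + 1))⁻¹ ≤ (2 : ℝ) ^ (n + 1) := by
      rw [← inv_pow]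
      gcongr
      rw [inv_le_comm₀ (by linarith) (by norm_num)]
      linarith
    calc ENNReal.ofReal ((a ^ (n + 1))⁻¹) ≤ ENNReal.ofReal ((2 : ℝ) ^ (n + 1)) :=
          ENNReal.ofReal_le_ofReal this
      _ = 2 ^ (n + 1) := by
          rw [ENNReal.ofReal_pow (by norm_num)]; simp
      _ ≤ (2 ^ (n + 1)) ^ 2 := by
          refine le_self_pow₀ (one_le_pow₀ (by norm_num)) (by norm_num)
  have h3 : eLpNorm (affAvg η a b f) 2 volume ^ 2 ≤ (2 ^ (n + 1) * eLpNorm f 2 volume) ^ 2 := by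
    rw [mul_pow]
    exact h.trans (mul_le_mul' h2 le_rfl)
  exact (ENNReal.pow_le_pow_left_iff (by norm_num)).1 h3

lemma affAvg_sub (hη : IsWeight η ρ) (hf : LocallyIntegrable f) (hg : LocallyIntegrable g) :
    affAvg η a b (f - g) = affAvg η a b f - affAvg η a b g := by
  funext x
  simp only [affAvg, Pi.sub_apply, mul_sub]
  exact integral_sub (hη.integrable_mul hf _) (hη.integrable_mul hg _)

lemma norm_affAvg_sub_le (hη : IsWeight η ρ) (hf : Continuous f) {x : SpaceTime n} {δ : ℝ}
    (h : ∀ s, ‖s‖ ≤ ρ → ‖f (a • x + b - s) - f x‖ ≤ δ) : ‖affAvg η a b f x - f x‖ ≤ δ := by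
  have h1 : affAvg η a b f x - f x = ∫ s, η s * (f (a • x + b - s) - f x) := by
    simp only [mul_sub]
    rw [integral_sub (hη.integrable_mul hf.locallyIntegrable _) (hη.integrable.mul_const _),
      integral_mul_const, hη.integral, one_mul]
    rfl
  rw [h1]
  calc ‖∫ s, η s * (f (a • x + b - s) - f x)‖ ≤ ∫ s, η s * δ := by
        refine norm_integral_le_of_norm_le (hη.integrable.mul_const δ) (ae_of_all _ fun s => ?_)
        rw [norm_mul, Real.norm_of_nonneg (hη.nonneg s)]
        by_cases hs : s ∈ tsupport η
        · exact mul_le_mul_of_nonneg_left (h s (hη.small s hs)) (hη.nonneg s)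
        · simp [image_eq_zero_of_notMem_tsupport hs]
    _ = δ := by rw [integral_mul_const, hη.integral, one_mul]

/-- Uniformly bounded operators that converge on a dense class converge everywhere. The dense class
consists of the compactly supported continuous functions, for which uniform continuity handles the
displacement, at most `|a - 1| R + ‖b‖ + ρ`. -/
lemma tendsto_eLpNorm_affAvg_sub {η : ℕ → SpaceTime n → ℝ} {ρ a : ℕ → ℝ} {b : ℕ → SpaceTime n}
    (hη : ∀ k, IsWeight (η k) (ρ k)) (hρ : Tendsto ρ atTop (𝓝 0)) (ha : Tendsto a atTop (𝓝 1))
    (ha' : ∀ k, 1 / 2 ≤ a k) (hb : Tendsto b atTop (𝓝 0)) {U : Set (SpaceTime n)}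
    (hU : MeasurableSet U) (hUb : Bornology.IsBounded U) (hf : Measurable f)
    (hf2 : MemLp f 2 volume) :
    Tendsto (fun k => eLpNorm (affAvg (η k) (a k) (b k) f - f) 2 (volume.restrict U)) atTop
      (𝓝 0) := by
  rw [ENNReal.tendsto_nhds_zero]
  intro ε hε
  rcases eq_or_ne ε ⊤ with rfl | hεt
  · simp
  have h3 : ε / 3 ≠ 0 := ENNReal.div_ne_zero.2 ⟨hε.ne', by norm_num⟩
  -- Dividing by the operator bound `2 ^ (n + 1)` leaves at most `ε / 3` after averaging the
  -- remainder.
  have h23 : ε / 3 / 2 ^ (n + 1) ≠ 0 :=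
    ENNReal.div_ne_zero.2 ⟨h3, ENNReal.pow_ne_top (by norm_num)⟩
  obtain ⟨ψ, hψc, hψ, hψcont, hψ2⟩ :=
    hf2.exists_hasCompactSupport_eLpNorm_sub_le (by norm_num) h23
  have hVfin : volume U ≠ ⊤ := hUb.measure_lt_top.ne
  -- a uniform bound that makes the middle term small
  obtain ⟨δ, hδ0, hδ⟩ : ∃ δ : ℝ, 0 < δ ∧
      ENNReal.ofReal δ * (volume U) ^ (1 / 2 : ℝ) ≤ ε / 3 := by
    have hne : (volume U) ^ (1 / 2 : ℝ) ≠ ⊤ := ENNReal.rpow_ne_top_of_nonneg (by norm_num) hVfin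
    set q := ((volume U) ^ (1 / 2 : ℝ)).toReal with hq
    have hq0 : 0 ≤ q := ENNReal.toReal_nonneg
    have hε3 : 0 < (ε / 3).toReal :=
      ENNReal.toReal_pos h3 (ENNReal.div_ne_top hεt (by norm_num))
    refine ⟨(ε / 3).toReal / (q + 1), by positivity, ?_⟩
    rw [← ENNReal.ofReal_toReal hne, ← hq, ← ENNReal.ofReal_mul (by positivity),
      ENNReal.ofReal_le_iff_le_toReal (ENNReal.div_ne_top hεt (by norm_num))]
    rw [div_mul_eq_mul_div, div_le_iff₀ (by positivity)]
    nlinarith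
  have huc := hψc.uniformContinuous_of_continuous hψcont
  obtain ⟨τ, hτ0, hτ⟩ := Metric.uniformContinuous_iff.1 huc δ hδ0
  obtain ⟨R, hR0, hR⟩ := hUb.exists_pos_norm_le
  have hev : ∀ᶠ k in atTop, |a k - 1| * R + ‖b k‖ + ρ k < τ := by
    have : Tendsto (fun k => |a k - 1| * R + ‖b k‖ + ρ k) atTop (𝓝 (|1 - 1| * R + ‖(0 : SpaceTime n)‖ + 0)) :=
      (((ha.sub_const 1).abs.mul_const R).add hb.norm).add hρ
    simp only [sub_self, abs_zero, zero_mul, norm_zero, add_zero] at this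
    exact this.eventually_lt_const hτ0
  filter_upwards [hev] with k hk
  have hψm : Measurable ψ := hψcont.measurable
  have hfl := locallyIntegrable_of_memLp_two hf2
  have hψl := locallyIntegrable_of_memLp_two hψ2
  have hdec : affAvg (η k) (a k) (b k) f - f = affAvg (η k) (a k) (b k) (f - ψ) +
      ((affAvg (η k) (a k) (b k) ψ - ψ) - (f - ψ)) := by
    rw [affAvg_sub (hη k) hfl hψl]; abel
  have hm1 : AEStronglyMeasurable (affAvg (η k) (a k) (b k) (f - ψ)) (volume.restrict U) :=
    (measurable_affAvg (hη k) (hf.sub hψm)).aestronglyMeasurable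
  have hm2 : AEStronglyMeasurable (affAvg (η k) (a k) (b k) ψ - ψ) (volume.restrict U) :=
    ((measurable_affAvg (hη k) hψm).sub hψm).aestronglyMeasurable
  have hm3 : AEStronglyMeasurable (f - ψ) (volume.restrict U) :=
    (hf.sub hψm).aestronglyMeasurable
  have hA : eLpNorm (affAvg (η k) (a k) (b k) (f - ψ)) 2 (volume.restrict U) ≤ ε / 3 := by
    refine (eLpNorm_mono_measure _ Measure.restrict_le_self).trans
      ((eLpNorm_affAvg_le (hη k) (ha' k) (hf.sub hψm)).trans ?_)
    calc _ ≤ 2 ^ (n + 1) * (ε / 3 / 2 ^ (n + 1)) := by gcongr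
      _ ≤ ε / 3 := ENNReal.mul_div_le
  have hC : eLpNorm (f - ψ) 2 (volume.restrict U) ≤ ε / 3 := by
    refine (eLpNorm_mono_measure _ Measure.restrict_le_self).trans (hψ.trans ?_)
    exact ENNReal.div_le_of_le_mul (le_mul_of_one_le_right zero_le
      (one_le_pow₀ (by norm_num)))
  have hB : eLpNorm (affAvg (η k) (a k) (b k) ψ - ψ) 2 (volume.restrict U) ≤ ε / 3 := by
    have hbd : ∀ᵐ x ∂(volume.restrict U),
        ‖(affAvg (η k) (a k) (b k) ψ - ψ) x‖ ≤ δ := by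
      filter_upwards [ae_restrict_mem hU] with x hx
      refine norm_affAvg_sub_le (hη k) hψcont fun s hs => ?_
      rw [← dist_eq_norm]
      refine (hτ ?_).le
      rw [dist_eq_norm]
      have e1 : a k • x + b k - s - x = (a k - 1) • x + b k - s := by module
      rw [e1]
      calc ‖(a k - 1) • x + b k - s‖ ≤ ‖(a k - 1) • x‖ + ‖b k‖ + ‖s‖ :=
            (norm_sub_le _ _).trans (add_le_add (norm_add_le _ _) le_rfl)
        _ ≤ |a k - 1| * R + ‖b k‖ + ρ k := by
            rw [norm_smul, Real.norm_eq_abs]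
            gcongr
            exact hR x hx
        _ < τ := hk
    have := eLpNorm_le_of_ae_bound (p := 2) hbd
    rw [Measure.restrict_apply_univ, mul_comm] at this
    refine this.trans (le_trans (le_of_eq ?_) hδ)
    norm_num
  rw [hdec]
  refine (eLpNorm_add_le hm1 (hm2.sub hm3) (by norm_num)).trans ?_
  calc _ ≤ ε / 3 + (ε / 3 + ε / 3) := by
        gcongr
        exact (eLpNorm_sub_le hm2 hm3 (by norm_num)).trans (add_le_add hB hC)
    _ = ε := by rw [← add_assoc, ENNReal.add_thirds]

end Averages

/-! ### Limits of norms and of pairings in L². -/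

section L2Limits

lemma tendsto_eLpNorm_of_sub {α : Type*} [MeasurableSpace α] {μ : Measure α} {φ : ℕ → α → ℝ}
    {v : α → ℝ} (hφ : ∀ k, AEStronglyMeasurable (φ k) μ) (hv : MemLp v 2 μ)
    (h : Tendsto (fun k => eLpNorm (φ k - v) 2 μ) atTop (𝓝 0)) :
    Tendsto (fun k => eLpNorm (φ k) 2 μ) atTop (𝓝 (eLpNorm v 2 μ)) := by
  have hup : Tendsto (fun k => eLpNorm v 2 μ + eLpNorm (φ k - v) 2 μ) atTop
      (𝓝 (eLpNorm v 2 μ)) := by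
    simpa using tendsto_const_nhds.add h
  have hlow : Tendsto (fun k => eLpNorm v 2 μ - eLpNorm (φ k - v) 2 μ) atTop
      (𝓝 (eLpNorm v 2 μ)) := by
    simpa using ENNReal.Tendsto.sub tendsto_const_nhds h (Or.inl hv.eLpNorm_ne_top)
  refine tendsto_of_tendsto_of_tendsto_of_le_of_le hlow hup (fun k => ?_) fun k => ?_
  · rw [tsub_le_iff_right]
    have e : v = φ k - (φ k - v) := by abel
    conv_lhs => rw [e]
    exact eLpNorm_sub_le (hφ k) ((hφ k).sub hv.1) (by norm_num)
  · have e : φ k = v + (φ k - v) := by abel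
    conv_lhs => rw [e]
    exact eLpNorm_add_le hv.1 ((hφ k).sub hv.1) (by norm_num)

lemma enorm_integral_mul_le {α : Type*} [MeasurableSpace α] {μ : Measure α} {f g : α → ℝ}
    (hf : MemLp f 2 μ) (hg : MemLp g 2 μ) :
    ‖∫ x, f x * g x ∂μ‖ₑ ≤ eLpNorm f 2 μ * eLpNorm g 2 μ := by
  refine (enorm_integral_le_lintegral_enorm _).trans ?_
  have h := ENNReal.lintegral_mul_le_Lp_mul_Lq μ (Real.HolderConjugate.two_two)
    hf.1.enorm hg.1.enorm
  rw [eLpNorm_eq_lintegral_rpow_enorm_toReal (by norm_num) (by norm_num),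
    eLpNorm_eq_lintegral_rpow_enorm_toReal (by norm_num) (by norm_num)]
  simpa [enorm_mul] using h

lemma tendsto_integral_mul {α : Type*} [MeasurableSpace α] {μ : Measure α} {φ : ℕ → α → ℝ}
    {v q : α → ℝ} (hφ : ∀ k, MemLp (φ k) 2 μ) (hv : MemLp v 2 μ) (hq : MemLp q 2 μ)
    (h : Tendsto (fun k => eLpNorm (φ k - v) 2 μ) atTop (𝓝 0)) :
    Tendsto (fun k => ∫ x, φ k x * q x ∂μ) atTop (𝓝 (∫ x, v x * q x ∂μ)) := by
  rw [tendsto_iff_edist_tendsto_0]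
  have h2 : Tendsto (fun k => eLpNorm (φ k - v) 2 μ * eLpNorm q 2 μ) atTop (𝓝 0) := by
    simpa using ENNReal.Tendsto.mul_const h (Or.inr hq.eLpNorm_ne_top)
  refine tendsto_of_tendsto_of_tendsto_of_le_of_le tendsto_const_nhds h2 (fun _ => zero_le)
    fun k => ?_
  change edist (∫ x, φ k x * q x ∂μ) (∫ x, v x * q x ∂μ) ≤ eLpNorm (φ k - v) 2 μ * eLpNorm q 2 μ
  have i1 : Integrable (fun x => φ k x * q x) μ := (hφ k).integrable_mul hq
  have i2 : Integrable (fun x => v x * q x) μ := hv.integrable_mul hq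
  rw [edist_eq_enorm_sub, ← integral_sub i1 i2]
  refine le_trans (le_of_eq ?_) (enorm_integral_mul_le ((hφ k).sub hv) hq)
  congr 2 with x
  simp only [Pi.sub_apply]; ring

lemma eLpNorm_mul_le_of_bound {α : Type*} [MeasurableSpace α] {μ : Measure α} {χ f : α → ℝ}
    {C : ℝ} (hC : ∀ x, |χ x| ≤ C) :
    eLpNorm (fun x => χ x * f x) 2 μ ≤ ENNReal.ofReal C * eLpNorm f 2 μ := by
  refine eLpNorm_le_mul_eLpNorm_of_ae_le_mul (ae_of_all _ fun x => ?_) 2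
  rw [norm_mul, Real.norm_eq_abs]
  exact mul_le_mul_of_nonneg_right (hC x) (norm_nonneg _)

end L2Limits

/-! ### Traces on star-shaped bodies -/

section Trace

variable {n : ℕ}

/-- The `j`-th partial derivative. -/
abbrev pd (φ : SpaceTime n → ℝ) (j : Fin (n + 1)) : SpaceTime n → ℝ :=
  fun x => fderiv ℝ φ x (unitVec j)

/-- `φ k → v` in `L²(U)` with gradients converging to `G`. -/
def H1Tendsto (U : Set (SpaceTime n)) (φ : ℕ → SpaceTime n → ℝ) (v : SpaceTime n → ℝ)
    (G : Fin (n + 1) → SpaceTime n → ℝ) : Prop :=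
  Tendsto (fun k => eLpNorm (φ k - v) 2 (volume.restrict U)) atTop (𝓝 0) ∧
    ∀ i, Tendsto (fun k => eLpNorm (pd (φ k) i - G i) 2 (volume.restrict U)) atTop (𝓝 0)

lemma isTrace_iff {U : Set (SpaceTime n)} {v g : SpaceTime n → ℝ} :
    IsTrace U v g ↔ MemSobolev U 1 v ∧ MemLp g 2 ((surface n).restrict (frontier U)) ∧
      ∃ φ : ℕ → SpaceTime n → ℝ, (∀ j, ContDiff ℝ ∞ (φ j)) ∧
        H1Tendsto U φ v (fun i x => grad U v x i) ∧
        Tendsto (fun j => eLpNorm (φ j - g) 2 ((surface n).restrict (frontier U))) atTop (𝓝 0) := by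
  constructor
  · rintro ⟨h1, h2, φ, h3, h4, h5, h6⟩
    exact ⟨h1, h2, φ, h3, ⟨h4, h5⟩, h6⟩
  · rintro ⟨h1, h2, φ, h3, ⟨h4, h5⟩, h6⟩
    exact ⟨h1, h2, φ, h3, h4, h5, h6⟩

lemma contDiff_pd {φ : SpaceTime n → ℝ} (hφ : ContDiff ℝ ∞ φ) (j : Fin (n + 1)) :
    ContDiff ℝ ∞ (pd φ j) := contDiff_fderiv_apply hφ _

lemma pd_sub {φ ψ : SpaceTime n → ℝ} (hφ : ContDiff ℝ ∞ φ) (hψ : ContDiff ℝ ∞ ψ)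
    (j : Fin (n + 1)) : pd (φ - ψ) j = pd φ j - pd ψ j := by
  funext x
  simp only [pd, Pi.sub_apply]
  rw [fderiv_sub (hφ.differentiable (by simp) x) (hψ.differentiable (by simp) x)]
  rfl

lemma pd_mul {φ ψ : SpaceTime n → ℝ} (hφ : ContDiff ℝ ∞ φ) (hψ : ContDiff ℝ ∞ ψ)
    (j : Fin (n + 1)) (x : SpaceTime n) :
    pd (fun y => φ y * ψ y) j x = φ x * pd ψ j x + pd φ j x * ψ x := by
  simp only [pd]
  rw [fderiv_fun_mul (hφ.differentiable (by simp) x) (hψ.differentiable (by simp) x)]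
  simp only [add_apply, smul_apply, smul_eq_mul]
  ring

lemma H1Tendsto.congr {U : Set (SpaceTime n)} {φ : ℕ → SpaceTime n → ℝ} {v v' : SpaceTime n → ℝ}
    {G G' : Fin (n + 1) → SpaceTime n → ℝ} (h : H1Tendsto U φ v G)
    (hv : v =ᵐ[volume.restrict U] v') (hG : ∀ i, G i =ᵐ[volume.restrict U] G' i) :
    H1Tendsto U φ v' G' := by
  refine ⟨h.1.congr fun k => eLpNorm_congr_ae ?_, fun i => (h.2 i).congr fun k =>
    eLpNorm_congr_ae ?_⟩
  · exact EventuallyEq.rfl.sub hv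
  · exact EventuallyEq.rfl.sub (hG i)

lemma H1Tendsto.mono {U U' : Set (SpaceTime n)} {φ : ℕ → SpaceTime n → ℝ} {v : SpaceTime n → ℝ}
    {G : Fin (n + 1) → SpaceTime n → ℝ} (h : H1Tendsto U φ v G) (hs : U' ⊆ U) :
    H1Tendsto U' φ v G := by
  have hle : volume.restrict U' ≤ volume.restrict U := Measure.restrict_mono hs le_rfl
  exact ⟨tendsto_of_tendsto_of_tendsto_of_le_of_le tendsto_const_nhds h.1 (fun _ => zero_le)
    fun k => eLpNorm_mono_measure _ hle, fun i =>
    tendsto_of_tendsto_of_tendsto_of_le_of_le tendsto_const_nhds (h.2 i) (fun _ => zero_le)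
    fun k => eLpNorm_mono_measure _ hle⟩

lemma tendsto_eLpNorm_sub_sub {α : Type*} [MeasurableSpace α] {μ : Measure α}
    {φ ψ : ℕ → α → ℝ} {v w : α → ℝ} (hφ : ∀ k, AEStronglyMeasurable (φ k) μ)
    (hψ : ∀ k, AEStronglyMeasurable (ψ k) μ) (hv : AEStronglyMeasurable v μ)
    (hw : AEStronglyMeasurable w μ)
    (h : Tendsto (fun k => eLpNorm (φ k - v) 2 μ) atTop (𝓝 0))
    (h' : Tendsto (fun k => eLpNorm (ψ k - w) 2 μ) atTop (𝓝 0)) :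
    Tendsto (fun k => eLpNorm ((φ k - ψ k) - (v - w)) 2 μ) atTop (𝓝 0) := by
  have h2 : Tendsto (fun k => eLpNorm (φ k - v) 2 μ + eLpNorm (ψ k - w) 2 μ) atTop (𝓝 0) := by
    simpa using h.add h'
  refine tendsto_of_tendsto_of_tendsto_of_le_of_le tendsto_const_nhds h2 (fun _ => zero_le)
    fun k => ?_
  change eLpNorm ((φ k - ψ k) - (v - w)) 2 μ ≤ eLpNorm (φ k - v) 2 μ + eLpNorm (ψ k - w) 2 μ
  have e : (φ k - ψ k) - (v - w) = (φ k - v) - (ψ k - w) := by abel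
  rw [e]
  exact eLpNorm_sub_le ((hφ k).sub hv) ((hψ k).sub hw) (by norm_num)

lemma H1Tendsto.sub {U : Set (SpaceTime n)} {φ ψ : ℕ → SpaceTime n → ℝ} {v w : SpaceTime n → ℝ}
    {G H : Fin (n + 1) → SpaceTime n → ℝ} (hφ : ∀ k, ContDiff ℝ ∞ (φ k))
    (hψ : ∀ k, ContDiff ℝ ∞ (ψ k)) (hv : MemLp v 2 (volume.restrict U))
    (hw : MemLp w 2 (volume.restrict U)) (hG : ∀ i, MemLp (G i) 2 (volume.restrict U))
    (hH : ∀ i, MemLp (H i) 2 (volume.restrict U))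
    (h : H1Tendsto U φ v G) (h' : H1Tendsto U ψ w H) :
    H1Tendsto U (fun k => φ k - ψ k) (v - w) (fun i => G i - H i) := by
  refine ⟨tendsto_eLpNorm_sub_sub (fun k => (hφ k).continuous.aestronglyMeasurable)
    (fun k => (hψ k).continuous.aestronglyMeasurable) hv.1 hw.1 h.1 h'.1, fun i => ?_⟩
  simp_rw [pd_sub (hφ _) (hψ _)]
  exact tendsto_eLpNorm_sub_sub (fun k => (contDiff_pd (hφ k) i).continuous.aestronglyMeasurable)
    (fun k => (contDiff_pd (hψ k) i).continuous.aestronglyMeasurable) (hG i).1 (hH i).1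
    (h.2 i) (h'.2 i)

/-- The extension by zero matters: the averages integrate over the whole space and must not see
arbitrary values outside `U`. -/
lemma exists_measurable_rep {U : Set (SpaceTime n)} (hU : MeasurableSet U) {v : SpaceTime n → ℝ}
    (hv : MemLp v 2 (volume.restrict U)) : ∃ f : SpaceTime n → ℝ, Measurable f ∧
      MemLp f 2 volume ∧ v =ᵐ[volume.restrict U] f ∧ ∀ x, x ∉ U → f x = 0 := by
  refine ⟨U.indicator (hv.1.mk v), (hv.1.stronglyMeasurable_mk.measurable).indicator hU, ?_, ?_,
    fun x hx => Set.indicator_of_notMem hx _⟩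
  · rw [memLp_indicator_iff_restrict hU]
    exact (memLp_congr_ae hv.1.ae_eq_mk).1 hv
  · filter_upwards [hv.1.ae_eq_mk, ae_restrict_mem hU] with x hx hxU
    rw [Set.indicator_of_mem hxU, hx]

lemma affAvg_eq_convolution (η : SpaceTime n → ℝ) (a : ℝ) (b : SpaceTime n) (f : SpaceTime n → ℝ) :
    affAvg η a b f =
      fun x => (convolution η f (ContinuousLinearMap.mul ℝ ℝ) volume) (a • x + b) := by
  funext x
  simp [affAvg, convolution]

lemma contDiff_affAvg {η : SpaceTime n → ℝ} {ρ a : ℝ} {b : SpaceTime n} {f : SpaceTime n → ℝ}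
    (hη : IsWeight η ρ) (hf : LocallyIntegrable f) : ContDiff ℝ ∞ (affAvg η a b f) := by
  rw [affAvg_eq_convolution]
  exact (hη.compact.contDiff_convolution_left _ hη.smooth hf).comp (by fun_prop)

/-- Differentiation falls on the weight. Reflected about `a x + b`, the weight is a test function
supported in `U`, so the definition of the weak derivative moves the derivative over to `f`. The
factor `a` comes from the chain rule. -/
lemma pd_affAvg {U : Set (SpaceTime n)} {η : SpaceTime n → ℝ} {ρ a : ℝ}
    {b x : SpaceTime n} {f g : SpaceTime n → ℝ} {i : Fin (n + 1)} (hη : IsWeight η ρ)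
    (hf : LocallyIntegrable f) (hfU : ∀ x, x ∉ U → f x = 0) (hgU : ∀ x, x ∉ U → g x = 0)
    (hfg : IsWeakDeriv U ![i] f g) (hx : ∀ s, ‖s‖ ≤ ρ → a • x + b - s ∈ U) :
    pd (affAvg η a b f) i x = a * affAvg η a b g x := by
  set y := a • x + b with hy
  have hconv := hη.compact.hasFDerivAt_convolution_left (ContinuousLinearMap.mul ℝ ℝ)
    (hη.smooth.of_le (by norm_cast)) hf (μ := volume) y
  have haff : HasFDerivAt (fun x : SpaceTime n => a • x + b)
      (a • ContinuousLinearMap.id ℝ (SpaceTime n)) x :=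
    ((hasFDerivAt_id x).const_smul a).add_const b
  have h1 : pd (affAvg η a b f) i x = a * ∫ s, fderiv ℝ η s (unitVec i) * f (y - s) := by
    have h2 := (hconv.comp x haff).fderiv
    have h3 : affAvg η a b f =
        convolution η f (ContinuousLinearMap.mul ℝ ℝ) volume ∘ fun x => a • x + b :=
      affAvg_eq_convolution η a b f
    simp only [pd]
    rw [h3, h2]
    simp only [ContinuousLinearMap.comp_apply, smul_apply,
      ContinuousLinearMap.id_apply, map_smul, smul_eq_mul]
    congr 1
    have hex := (hη.compact.fderiv ℝ).convolutionExists_left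
      ((ContinuousLinearMap.mul ℝ ℝ).precompL (SpaceTime n))
      (hη.smooth.continuous_fderiv (by simp)) hf y
    rw [convolution_def, ContinuousLinearMap.integral_apply hex]
    rfl
  rw [h1]
  congr 1
  -- the test function `s ↦ η (y - s)`
  set φ : SpaceTime n → ℝ := fun s => η (y - s) with hφ
  have hφd : ContDiff ℝ ∞ φ := hη.smooth.comp (contDiff_const.sub contDiff_id)
  have hφts : tsupport φ ⊆ (fun s => y - s) ⁻¹' tsupport η := by
    refine closure_minimal (fun s hs => subset_tsupport η hs) ?_
    exact (isClosed_tsupport η).preimage (by fun_prop)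
  have hφc : HasCompactSupport φ := by
    refine hη.compact.comp_isClosedEmbedding (g := fun s => y - s) ?_
    exact (Homeomorph.subLeft y).isClosedEmbedding
  have hφU : tsupport φ ⊆ U := by
    intro s hs
    have := hx (y - s) (hη.small _ (hφts hs))
    simpa using this
  have hw := hfg.2 φ hφd hφc hφU
  simp_rw [iteratedFDeriv_one_unitVec] at hw
  have hder : ∀ s, fderiv ℝ φ s (unitVec i) = - fderiv ℝ η (y - s) (unitVec i) := by
    intro s
    have h3 : HasFDerivAt (fun s : SpaceTime n => y - s)
        (-ContinuousLinearMap.id ℝ (SpaceTime n)) s := by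
      simpa using (hasFDerivAt_id s).const_sub y
    have h4 : HasFDerivAt φ _ s :=
      ((hη.smooth.differentiable (by simp)) (y - s)).hasFDerivAt.comp s h3
    rw [h4.fderiv]
    simp
  have e1 : ∫ s, fderiv ℝ η s (unitVec i) * f (y - s) =
      ∫ s, fderiv ℝ η (y - s) (unitVec i) * f s := by
    rw [← integral_sub_left_eq_self (fun s => fderiv ℝ η (y - s) (unitVec i) * f s) volume y]
    simp
  have e2 : affAvg η a b g x = ∫ s, η (y - s) * g s := by
    rw [← integral_sub_left_eq_self (fun s => η (y - s) * g s) volume y]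
    simp [affAvg, hy]
  rw [e1, e2]
  rw [setIntegral_eq_integral_of_forall_compl_eq_zero (fun s hs => by rw [hfU s hs, zero_mul]),
    setIntegral_eq_integral_of_forall_compl_eq_zero (fun s hs => by rw [hgU s hs, zero_mul])] at hw
  simp only [Matrix.cons_val_fin_one, hder, mul_neg, integral_neg, pow_one, neg_mul, one_mul,
    neg_inj] at hw
  simp_rw [mul_comm _ (f _), hw, hφ, mul_comm (g _)]

/-- Smooth functions are dense in `H¹` of a star-shaped body. -/
theorem IsStarBody.exists_h1Tendsto {K : Set (SpaceTime n)} {c : SpaceTime n} {κ h : ℝ}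
    (hK : IsStarBody K c κ h) {v : SpaceTime n → ℝ} (hv : MemSobolev (interior K) 1 v) :
    ∃ φ : ℕ → SpaceTime n → ℝ, (∀ k, ContDiff ℝ ∞ (φ k)) ∧
      H1Tendsto (interior K) φ v (fun i x => grad (interior K) v x i) := by
  set U := interior K with hU
  have hUo : IsOpen U := isOpen_interior
  have hUm : MeasurableSet U := hUo.measurableSet
  have hUb : Bornology.IsBounded U := hK.isBounded.subset interior_subset
  have hκ := hK.pos
  obtain ⟨f, hfm, hf2, hvf, hf0⟩ := exists_measurable_rep hUm hv.1
  have hg := fun i : Fin (n + 1) => exists_measurable_rep hUm (hv.memLp_weakDeriv le_rfl ![i])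
  choose g hgm hg2 hvg hg0 using hg
  have hfg : ∀ i, IsWeakDeriv U ![i] f (g i) := by
    intro i
    have h1 := (hv.isWeakDeriv le_rfl ![i]).congr hvf
    refine ⟨(hg2 i).restrict U, fun φ hφ hc hs => ?_⟩
    rw [h1.2 φ hφ hc hs]
    congr 1
    refine integral_congr_ae ?_
    filter_upwards [hvg i] with x hx
    rw [hx]
  -- The shift by two keeps `t k ≤ 1 / 2`, so that the scaling factor `1 - t k` never drops below `1
  -- / 2`.
  set t : ℕ → ℝ := fun k => 1 / ((k : ℝ) + 2) with ht
  have ht0 : ∀ k, 0 < t k := fun k => by positivity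
  have ht1 : ∀ k, t k ≤ 1 / 2 := fun k => by
    simp only [ht]
    gcongr
    have : (0 : ℝ) ≤ k := by positivity
    linarith
  have htlim : Tendsto t atTop (𝓝 0) := by
    have := (tendsto_natCast_atTop_atTop (R := ℝ)).atTop_add (tendsto_const_nhds (x := (2 : ℝ)))
    have h2 := this.inv_tendsto_atTop
    refine h2.congr fun k => ?_
    simp [ht]
  have hη := fun k => exists_isWeight (n := n) (ρ := t k * κ / 2)
    (by have := ht0 k; positivity)
  choose η hη using hη
  -- Shrink towards the centre by the factor `1 - t k`, then average over radius `t k κ / 2`.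
  -- Star-shapedness leaves a ball of radius `t k κ` inside `K` around each shrunk point, so only
  -- values in the body are averaged.
  set φ : ℕ → SpaceTime n → ℝ := fun k => affAvg (η k) (1 - t k) (t k • c) f with hφ
  have hlimρ : Tendsto (fun k => t k * κ / 2) atTop (𝓝 0) := by
    simpa using (htlim.mul_const κ).div_const 2
  have hlima : Tendsto (fun k => 1 - t k) atTop (𝓝 1) := by
    simpa using htlim.const_sub 1
  have hlimb : Tendsto (fun k => t k • c) atTop (𝓝 0) := by
    simpa using htlim.smul_const c
  have ha' : ∀ k, 1 / 2 ≤ 1 - t k := fun k => by linarith [ht1 k]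
  have hconv : ∀ f : SpaceTime n → ℝ, Measurable f → MemLp f 2 volume →
      Tendsto (fun k => eLpNorm (affAvg (η k) (1 - t k) (t k • c) f - f) 2 (volume.restrict U))
        atTop (𝓝 0) := fun f hfm hf2 =>
    tendsto_eLpNorm_affAvg_sub hη hlimρ hlima ha' hlimb hUm hUb hfm hf2
  refine ⟨φ, fun k => contDiff_affAvg (hη k) (locallyIntegrable_of_memLp_two hf2), ?_⟩
  suffices H : H1Tendsto U φ f g from H.congr hvf.symm fun i => (hvg i).symm
  refine ⟨hconv f hfm hf2, fun i => ?_⟩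
  have hin : ∀ k, ∀ x ∈ U, ∀ s, ‖s‖ ≤ t k * κ / 2 → (1 - t k) • x + t k • c - s ∈ U := by
    intro k x hx s hs
    have e : (1 - t k) • x + t k • c - s = (1 - t k) • x + t k • (c - (t k)⁻¹ • s) := by
      rw [smul_sub, smul_smul, mul_inv_cancel₀ (ht0 k).ne', one_smul]; abel
    rw [e]
    refine hK.combo_mem_interior (interior_subset hx) ?_ (ht0 k) (by linarith [ht1 k])
    rw [Metric.mem_ball, dist_eq_norm, sub_sub_cancel_left, norm_neg, norm_smul, norm_inv,
      Real.norm_of_nonneg (ht0 k).le, inv_mul_lt_iff₀ (ht0 k)]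
    have := mul_pos (ht0 k) hκ
    linarith
  have hpd : ∀ k, pd (φ k) i =ᵐ[volume.restrict U]
      fun x => (1 - t k) * affAvg (η k) (1 - t k) (t k • c) (g i) x := by
    intro k
    filter_upwards [ae_restrict_mem hUm] with x hx
    exact pd_affAvg (hη k) (locallyIntegrable_of_memLp_two hf2) hf0 (hg0 i) (hfg i)
      (hin k x hx)
  -- The factor `1 - t k` from the chain rule leaves the additional term `-t k g`, which also tends
  -- to zero.
  have hbound : ∀ k, eLpNorm (pd (φ k) i - g i) 2 (volume.restrict U) ≤
      eLpNorm (affAvg (η k) (1 - t k) (t k • c) (g i) - g i) 2 (volume.restrict U) +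
        ENNReal.ofReal (t k) * eLpNorm (g i) 2 (volume.restrict U) := by
    intro k
    have e : (pd (φ k) i - g i) =ᵐ[volume.restrict U]
        (fun x => (1 - t k) * (affAvg (η k) (1 - t k) (t k • c) (g i) - g i) x) +
          fun x => (- t k) * g i x := by
      filter_upwards [hpd k] with x hx
      simp only [Pi.sub_apply, Pi.add_apply, hx]
      ring
    rw [eLpNorm_congr_ae e]
    have hm : Measurable (affAvg (η k) (1 - t k) (t k • c) (g i) - g i) :=
      (measurable_affAvg (hη k) (hgm i)).sub (hgm i)
    refine (eLpNorm_add_le (hm.const_mul _).aestronglyMeasurable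
      ((hgm i).const_mul _).aestronglyMeasurable (by norm_num)).trans ?_
    gcongr
    · refine (eLpNorm_mul_le_of_bound (χ := fun _ => 1 - t k) (C := 1) fun _ => ?_).trans ?_
      · rw [abs_of_nonneg (by linarith [ha' k])]; linarith [ht0 k]
      · simp
    · refine eLpNorm_mul_le_of_bound (χ := fun _ => - t k) (C := t k) fun _ => ?_
      rw [abs_neg, abs_of_pos (ht0 k)]
  refine tendsto_of_tendsto_of_tendsto_of_le_of_le tendsto_const_nhds ?_ (fun _ => zero_le) hbound
  have h1 := hconv (g i) (hgm i) (hg2 i)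
  have h2 : Tendsto (fun k => ENNReal.ofReal (t k) * eLpNorm (g i) 2 (volume.restrict U)) atTop
      (𝓝 0) := by
    have := ENNReal.Tendsto.mul_const (b := eLpNorm (g i) 2 (volume.restrict U))
      (ENNReal.tendsto_ofReal htlim) (Or.inr ((hg2 i).restrict U).eLpNorm_ne_top)
    simpa using this
  simpa using h1.add h2

end Trace

/-! ### Existence and uniqueness of traces, and the trace inequality. -/

section TraceExistence

variable {n : ℕ}

/-- `C` is a constant for the trace inequality on `K`, scaled with the size `h`. -/
def HasTraceConst (K : Set (SpaceTime n)) (h C : ℝ) : Prop :=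
  ∀ ψ : SpaceTime n → ℝ, ContDiff ℝ 1 ψ → (∀ y, 0 ≤ ψ y) →
    ∫⁻ y in frontier K, ENNReal.ofReal (ψ y) ∂(surface n) ≤
      ENNReal.ofReal C * ∫⁻ y in interior K, ENNReal.ofReal (h⁻¹ * ψ y + ‖fderiv ℝ ψ y‖)

lemma norm_fderiv_sq_le (φ : SpaceTime n → ℝ) (x : SpaceTime n) :
    ‖fderiv ℝ φ x‖ ^ 2 ≤ ∑ i, pd φ i x ^ 2 := by
  set A := fderiv ℝ φ x with hA
  set S := ∑ i, pd φ i x ^ 2 with hS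
  have hS0 : 0 ≤ S := Finset.sum_nonneg fun i _ => sq_nonneg _
  have hle : ‖A‖ ≤ Real.sqrt S := by
    refine A.opNorm_le_bound (Real.sqrt_nonneg _) fun v => ?_
    have hv : v = ∑ i, v i • unitVec i := by
      ext j
      simp [unitVec, Finset.sum_apply, Pi.single_apply]
    have hAv : A v = ∑ i, v i * pd φ i x := by
      conv_lhs => rw [hv]
      rw [map_sum]
      simp [pd, hA]
    rw [hAv, Real.norm_eq_abs]
    have hcs := Finset.sum_mul_sq_le_sq_mul_sq Finset.univ (fun i => v i) (fun i => pd φ i x)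
    have hn : ‖v‖ ^ 2 = ∑ i, v i ^ 2 := by
      rw [EuclideanSpace.norm_sq_eq]; simp
    rw [← hn, ← hS] at hcs
    rw [← abs_of_nonneg (mul_nonneg (Real.sqrt_nonneg S) (norm_nonneg v)), ← sq_le_sq, mul_pow,
      Real.sq_sqrt hS0]
    linarith
  calc ‖A‖ ^ 2 ≤ Real.sqrt S ^ 2 := by gcongr
    _ = S := Real.sq_sqrt hS0

lemma eLpNorm_two_sq_ofReal {α : Type*} [MeasurableSpace α] (μ : Measure α) (f : α → ℝ) :
    eLpNorm f 2 μ ^ 2 = ∫⁻ x, ENNReal.ofReal (f x ^ 2) ∂μ := by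
  rw [eLpNorm_two_sq]
  congr 1 with x
  rw [← ofReal_norm, ← ENNReal.ofReal_pow (norm_nonneg _), Real.norm_eq_abs, sq_abs]

/-- Take `ψ = φ²` and split `2 |φ| ‖∇φ‖ ≤ h⁻¹ φ² + h ‖∇φ‖²`. The outer factor 2 accounts for `h⁻¹
φ²` occurring twice. -/
lemma HasTraceConst.sq_le {K : Set (SpaceTime n)} {h C : ℝ} (hC : HasTraceConst K h C)
    (hh : 0 < h) {φ : SpaceTime n → ℝ} (hφ : ContDiff ℝ ∞ φ) :
    eLpNorm φ 2 ((surface n).restrict (frontier K)) ^ 2 ≤ ENNReal.ofReal C *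
      (2 * (ENNReal.ofReal h⁻¹ * eLpNorm φ 2 (volume.restrict (interior K)) ^ 2 +
        ENNReal.ofReal h * ∑ i, eLpNorm (pd φ i) 2 (volume.restrict (interior K)) ^ 2)) := by
  have hφ1 : ContDiff ℝ 1 φ := hφ.of_le (by norm_cast)
  have h1 := hC (fun y => φ y ^ 2) (hφ1.pow 2) (fun y => sq_nonneg _)
  rw [← eLpNorm_two_sq_ofReal] at h1
  refine h1.trans (mul_le_mul' le_rfl ?_)
  simp_rw [eLpNorm_two_sq_ofReal]
  have hm : ∀ i, Measurable fun x => ENNReal.ofReal (pd φ i x ^ 2) := fun i =>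
    ((contDiff_pd hφ i).continuous.pow 2).measurable.ennreal_ofReal
  have hm0 : Measurable fun x => ENNReal.ofReal (φ x ^ 2) :=
    (hφ.continuous.pow 2).measurable.ennreal_ofReal
  have hm2 : Measurable fun x => ENNReal.ofReal h⁻¹ * ENNReal.ofReal (φ x ^ 2) +
      ENNReal.ofReal h * ∑ i, ENNReal.ofReal (pd φ i x ^ 2) :=
    (hm0.const_mul _).add ((Finset.measurable_fun_sum _ fun i _ => hm i).const_mul _)
  rw [← lintegral_finsetSum _ fun i _ => hm i, ← lintegral_const_mul _ hm0,
    ← lintegral_const_mul _ (Finset.measurable_fun_sum _ fun i _ => hm i),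
    ← lintegral_add_left (hm0.const_mul _), ← lintegral_const_mul _ hm2]
  refine lintegral_mono fun x => ?_
  have hd : ‖fderiv ℝ (fun y => φ y ^ 2) x‖ ≤ h⁻¹ * φ x ^ 2 + h * ∑ i, pd φ i x ^ 2 := by
    have e : fderiv ℝ (fun y => φ y ^ 2) x = (2 * φ x) • fderiv ℝ φ x := by
      rw [fderiv_fun_pow 2 (hφ.differentiable (by simp) x)]
      simp
    rw [e, norm_smul, Real.norm_eq_abs, abs_mul, abs_two]
    have h2 := norm_fderiv_sq_le φ x
    have h3 : 2 * |φ x| * ‖fderiv ℝ φ x‖ ≤ h⁻¹ * φ x ^ 2 + h * ‖fderiv ℝ φ x‖ ^ 2 := by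
      have h4 := sq_nonneg (|φ x| - h * ‖fderiv ℝ φ x‖)
      have h5 : h⁻¹ * (|φ x| - h * ‖fderiv ℝ φ x‖) ^ 2 =
          h⁻¹ * φ x ^ 2 + h * ‖fderiv ℝ φ x‖ ^ 2 - 2 * |φ x| * ‖fderiv ℝ φ x‖ := by
        rw [← sq_abs (φ x)]
        field_simp
        ring
      have h6 : 0 ≤ h⁻¹ * (|φ x| - h * ‖fderiv ℝ φ x‖) ^ 2 := by positivity
      linarith
    have h7 : h * ‖fderiv ℝ φ x‖ ^ 2 ≤ h * ∑ i, pd φ i x ^ 2 := by gcongr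
    linarith
  have hS : 0 ≤ ∑ i, pd φ i x ^ 2 := Finset.sum_nonneg fun i _ => sq_nonneg _
  rw [← ENNReal.ofReal_sum_of_nonneg fun i _ => sq_nonneg _,
    ← ENNReal.ofReal_mul (by positivity), ← ENNReal.ofReal_mul (by positivity),
    ← ENNReal.ofReal_add (by positivity) (by positivity), two_mul,
    ← ENNReal.ofReal_add (by positivity) (by positivity)]
  refine ENNReal.ofReal_le_ofReal ?_
  have : 0 ≤ h * ∑ i, pd φ i x ^ 2 := by positivity
  linarith

namespace IsStarBody

variable {K : Set (SpaceTime n)} {c : SpaceTime n} {κ h : ℝ}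

lemma exists_hasTraceConst (hK : IsStarBody K c κ h) : ∃ C, HasTraceConst K h C := by
  have hκ := hK.pos
  have hh := hK.size_pos
  obtain ⟨C, -, hC⟩ := exists_trace_const n (r := κ / h) (by positivity)
  have hK' : IsStarBody K c (κ / h * h) h := by rwa [div_mul_cancel₀ _ hh.ne']
  exact ⟨C, hC K c h hK'⟩

lemma tendsto_frontier_zero (hK : IsStarBody K c κ h) {ι : Type*} {l : Filter ι}
    {φ : ι → SpaceTime n → ℝ} (hφ : ∀ k, ContDiff ℝ ∞ (φ k))
    (h0 : Tendsto (fun k => eLpNorm (φ k) 2 (volume.restrict (interior K))) l (𝓝 0))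
    (h1 : ∀ i, Tendsto (fun k => eLpNorm (pd (φ k) i) 2 (volume.restrict (interior K))) l (𝓝 0)) :
    Tendsto (fun k => eLpNorm (φ k) 2 ((surface n).restrict (frontier K))) l (𝓝 0) := by
  obtain ⟨C, hC⟩ := hK.exists_hasTraceConst
  have hsq : Tendsto (fun k => eLpNorm (φ k) 2 ((surface n).restrict (frontier K)) ^ 2) l
      (𝓝 0) := by
    refine tendsto_of_tendsto_of_tendsto_of_le_of_le tendsto_const_nhds ?_ (fun _ => zero_le)
      fun k => hC.sq_le hK.size_pos (hφ k)
    have e0 : Tendsto (fun k => eLpNorm (φ k) 2 (volume.restrict (interior K)) ^ 2) l (𝓝 0) := by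
      simpa [Function.comp_def] using (ENNReal.continuous_pow 2).tendsto 0 |>.comp h0
    have e1 : Tendsto (fun k => ∑ i, eLpNorm (pd (φ k) i) 2 (volume.restrict (interior K)) ^ 2) l
        (𝓝 0) := by
      have : ∀ i : Fin (n + 1), Tendsto (fun k =>
          eLpNorm (pd (φ k) i) 2 (volume.restrict (interior K)) ^ 2) l (𝓝 0) := fun i => by
        simpa [Function.comp_def] using (ENNReal.continuous_pow 2).tendsto 0 |>.comp (h1 i)
      simpa using tendsto_finsetSum Finset.univ fun i _ => this i
    have e2 := ENNReal.Tendsto.const_mul (a := ENNReal.ofReal h⁻¹) e0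
      (Or.inr ENNReal.ofReal_ne_top)
    have e3 := ENNReal.Tendsto.const_mul (a := ENNReal.ofReal h) e1
      (Or.inr ENNReal.ofReal_ne_top)
    have e4 := ENNReal.Tendsto.const_mul (a := ENNReal.ofReal C)
      (ENNReal.Tendsto.const_mul (a := 2) (e2.add e3) (Or.inr (by norm_num)))
      (Or.inr ENNReal.ofReal_ne_top)
    simpa using e4
  have := (ENNReal.continuous_rpow_const (y := (1 / 2 : ℝ))).tendsto 0 |>.comp hsq
  rw [ENNReal.zero_rpow_of_pos (by norm_num)] at this
  refine this.congr fun k => ?_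
  simp only [Function.comp_apply]
  rw [← ENNReal.rpow_natCast, ← ENNReal.rpow_mul]
  norm_num

/-- Sequences with the same limit in `H¹(K)` have the same limit in `L²(∂K)`. -/
lemma tendsto_frontier_sub (hK : IsStarBody K c κ h) {φ ψ : ℕ → SpaceTime n → ℝ}
    (hφ : ∀ k, ContDiff ℝ ∞ (φ k)) (hψ : ∀ k, ContDiff ℝ ∞ (ψ k)) {v : SpaceTime n → ℝ}
    {G : Fin (n + 1) → SpaceTime n → ℝ} (hv : MemLp v 2 (volume.restrict (interior K)))
    (hG : ∀ i, MemLp (G i) 2 (volume.restrict (interior K)))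
    (h1 : H1Tendsto (interior K) φ v G) (h2 : H1Tendsto (interior K) ψ v G) :
    Tendsto (fun k => eLpNorm (φ k - ψ k) 2 ((surface n).restrict (frontier K))) atTop (𝓝 0) := by
  have h3 := h1.sub hφ hψ hv hv hG hG h2
  refine hK.tendsto_frontier_zero (fun k => (hφ k).sub (hψ k)) ?_ fun i => ?_
  · simpa using h3.1
  · simpa using h3.2 i

/-- By the trace inequality, smooth functions that converge in `H¹` form a Cauchy sequence in `L²`
of the frontier. Its limit is the trace. -/
lemma exists_isTrace (hK : IsStarBody K c κ h) {v : SpaceTime n → ℝ}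
    (hv : MemSobolev (interior K) 1 v) : ∃ g, IsTrace (interior K) v g := by
  obtain ⟨φ, hφ, hlim⟩ := hK.exists_h1Tendsto hv
  set μ := (surface n).restrict (frontier K) with hμ
  have hmem : ∀ k, MemLp (φ k) 2 μ := fun k => hK.memLp_frontier (hφ k).continuous
  have htwo : ∀ {F : ℕ → SpaceTime n → ℝ} {w : SpaceTime n → ℝ},
      (∀ k, Continuous (F k)) → MemLp w 2 (volume.restrict (interior K)) →
      Tendsto (fun k => eLpNorm (F k - w) 2 (volume.restrict (interior K))) atTop (𝓝 0) →
      Tendsto (fun k : ℕ × ℕ => eLpNorm (F k.1 - F k.2) 2 (volume.restrict (interior K)))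
        atTop (𝓝 0) := by
    intro F w hF hw hlim
    have h1 : Tendsto (fun k : ℕ × ℕ => eLpNorm (F k.1 - w) 2 (volume.restrict (interior K)) +
        eLpNorm (F k.2 - w) 2 (volume.restrict (interior K))) atTop (𝓝 0) := by
      rw [← prod_atTop_atTop_eq]
      simpa using (hlim.comp tendsto_fst).add (hlim.comp tendsto_snd)
    refine tendsto_of_tendsto_of_tendsto_of_le_of_le tendsto_const_nhds h1 (fun _ => zero_le)
      fun k => ?_
    have e : F k.1 - F k.2 = (F k.1 - w) - (F k.2 - w) := by abel
    change eLpNorm (F k.1 - F k.2) 2 _ ≤ _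
    rw [e]
    exact eLpNorm_sub_le ((hF _).aestronglyMeasurable.sub hw.1)
      ((hF _).aestronglyMeasurable.sub hw.1) (by norm_num)
  have hcauchy : CauchySeq fun k => (hmem k).toLp := by
    rw [cauchySeq_iff_tendsto_dist_atTop_0]
    have h1 : Tendsto (fun k : ℕ × ℕ => eLpNorm (φ k.1 - φ k.2) 2 μ) atTop (𝓝 0) := by
      refine hK.tendsto_frontier_zero (fun k => (hφ k.1).sub (hφ k.2)) ?_ fun i => ?_
      · exact htwo (fun k => (hφ k).continuous) hv.1 hlim.1
      · simp_rw [pd_sub (hφ _) (hφ _)]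
        exact htwo (F := fun k => pd (φ k) i) (fun k => (contDiff_pd (hφ k) i).continuous)
          (hv.memLp_weakDeriv le_rfl ![i]) (hlim.2 i)
    have h2 := (ENNReal.tendsto_toReal ENNReal.zero_ne_top).comp h1
    refine h2.congr fun k => ?_
    rw [Function.comp_apply, ← Lp.edist_toLp_toLp _ _ (hmem k.1) (hmem k.2), ← dist_edist]
  obtain ⟨G, hG⟩ := cauchySeq_tendsto_of_complete hcauchy
  refine ⟨G, isTrace_iff.2 ⟨hv, ?_, φ, hφ, hlim, ?_⟩⟩
  · rw [hK.frontier_interior]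
    exact Lp.memLp G
  · rw [hK.frontier_interior]
    have := (Lp.tendsto_Lp_iff_tendsto_eLpNorm'' φ hmem G (Lp.memLp G)).1 (by simpa using hG)
    exact this

lemma isTrace_trace (hK : IsStarBody K c κ h) {v : SpaceTime n → ℝ}
    (hv : MemSobolev (interior K) 1 v) : IsTrace (interior K) v (trace (interior K) v) := by
  have hex := hK.exists_isTrace hv
  rw [trace, dif_pos hex]
  exact hex.choose_spec

/-- Any smooth sequence converging in `H¹(K)` converges to the trace in `L²(∂K)`. -/
lemma tendsto_trace (hK : IsStarBody K c κ h) {v g : SpaceTime n → ℝ}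
    (hg : IsTrace (interior K) v g) {φ : ℕ → SpaceTime n → ℝ} (hφ : ∀ k, ContDiff ℝ ∞ (φ k))
    (hlim : H1Tendsto (interior K) φ v (fun i x => grad (interior K) v x i)) :
    Tendsto (fun k => eLpNorm (φ k - g) 2 ((surface n).restrict (frontier K))) atTop (𝓝 0) := by
  obtain ⟨hv, hg2, ψ, hψ, hlim', hψg⟩ := isTrace_iff.1 hg
  rw [hK.frontier_interior] at hg2 hψg
  have h1 := hK.tendsto_frontier_sub hφ hψ hv.1 (fun i => hv.memLp_weakDeriv le_rfl ![i]) hlim hlim'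
  have h2 : Tendsto (fun k => eLpNorm (φ k - ψ k) 2 ((surface n).restrict (frontier K)) +
      eLpNorm (ψ k - g) 2 ((surface n).restrict (frontier K))) atTop (𝓝 0) := by
    simpa using h1.add hψg
  refine tendsto_of_tendsto_of_tendsto_of_le_of_le tendsto_const_nhds h2 (fun _ => zero_le)
    fun k => ?_
  have e : φ k - g = (φ k - ψ k) + (ψ k - g) := by abel
  change eLpNorm (φ k - g) 2 _ ≤ _
  rw [e]
  exact eLpNorm_add_le (((hφ k).continuous.sub (hψ k).continuous).aestronglyMeasurable)
    ((hψ k).continuous.aestronglyMeasurable.sub hg2.1) (by norm_num)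

lemma _root_.WaveDA.ae_eq_of_tendsto_eLpNorm {α : Type*} [MeasurableSpace α] {μ : Measure α}
    {φ : ℕ → α → ℝ} {g g' : α → ℝ} (hφ : ∀ k, AEStronglyMeasurable (φ k) μ)
    (hg : AEStronglyMeasurable g μ) (hg' : AEStronglyMeasurable g' μ)
    (h : Tendsto (fun k => eLpNorm (φ k - g) 2 μ) atTop (𝓝 0))
    (h' : Tendsto (fun k => eLpNorm (φ k - g') 2 μ) atTop (𝓝 0)) : g =ᵐ[μ] g' := by
  have h2 : Tendsto (fun k => eLpNorm (φ k - g') 2 μ + eLpNorm (φ k - g) 2 μ) atTop (𝓝 0) := by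
    simpa using h'.add h
  have h3 : eLpNorm (g - g') 2 μ = 0 := by
    refine le_antisymm (ge_of_tendsto' h2 fun k => ?_) zero_le
    have e : g - g' = (φ k - g') - (φ k - g) := by abel
    rw [e]
    exact eLpNorm_sub_le ((hφ k).sub hg') ((hφ k).sub hg) (by norm_num)
  have h4 := (eLpNorm_eq_zero_iff (hg.sub hg') (by norm_num)).1 h3
  filter_upwards [h4] with x hx
  exact sub_eq_zero.1 hx

lemma _root_.WaveDA.IsTrace.congr {U : Set (SpaceTime n)} (hU : IsOpen U)
    {v v' g : SpaceTime n → ℝ} (hg : IsTrace U v g) (hvv : v =ᵐ[volume.restrict U] v') :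
    IsTrace U v' g := by
  obtain ⟨hv, hg2, ψ, hψ, hlim', hψg⟩ := isTrace_iff.1 hg
  refine isTrace_iff.2 ⟨hv.congr hvv, hg2, ψ, hψ, hlim'.congr hvv fun i => ?_, hψg⟩
  exact (weakDeriv_ae_eq hU (hv.isWeakDeriv le_rfl ![i]) hvv.symm).symm

/-- Every approximating sequence of `v'` also approximates `v`, and the limit on the frontier does
not depend on the sequence. Hence the choice made in `trace` matters only on null sets. -/
lemma isTrace_unique (hK : IsStarBody K c κ h) {v v' g g' : SpaceTime n → ℝ}
    (hg : IsTrace (interior K) v g) (hg' : IsTrace (interior K) v' g')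
    (hvv : v =ᵐ[volume.restrict (interior K)] v') :
    g =ᵐ[(surface n).restrict (frontier K)] g' := by
  have hg'' := hg.congr isOpen_interior hvv
  obtain ⟨hv, hg2, ψ, hψ, hlim', hψg⟩ := isTrace_iff.1 hg'
  have h1 := hK.tendsto_trace hg'' hψ hlim'
  have hg3 := hg.2.1
  rw [hK.frontier_interior] at hg2 hψg hg3
  exact ae_eq_of_tendsto_eLpNorm (fun k => (hψ k).continuous.aestronglyMeasurable) hg3.1 hg2.1
    h1 hψg

lemma trace_ae_eq (hK : IsStarBody K c κ h) {v v' g : SpaceTime n → ℝ}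
    (hg : IsTrace (interior K) v g) (hvv : v' =ᵐ[volume.restrict (interior K)] v) :
    trace (interior K) v' =ᵐ[(surface n).restrict (frontier K)] g :=
  hK.isTrace_unique (hK.isTrace_trace (hg.1.congr hvv.symm)) hg hvv

lemma memLp_trace (hK : IsStarBody K c κ h) {v : SpaceTime n → ℝ}
    (hv : MemSobolev (interior K) 1 v) :
    MemLp (trace (interior K) v) 2 ((surface n).restrict (frontier K)) := by
  have := (hK.isTrace_trace hv).2.1
  rwa [hK.frontier_interior] at this

lemma _root_.WaveDA.IsTrace.sub {U : Set (SpaceTime n)} (hU : IsOpen U)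
    {v v' g g' : SpaceTime n → ℝ} (hg : IsTrace U v g) (hg' : IsTrace U v' g') :
    IsTrace U (v - v') (g - g') := by
  obtain ⟨hv, hg2, φ, hφ, hlim, hφg⟩ := isTrace_iff.1 hg
  obtain ⟨hv', hg2', ψ, hψ, hlim', hψg⟩ := isTrace_iff.1 hg'
  refine isTrace_iff.2 ⟨hv.sub hv', hg2.sub hg2', fun k => φ k - ψ k,
    fun k => (hφ k).sub (hψ k), ?_, ?_⟩
  · refine (hlim.sub hφ hψ hv.1 hv'.1 (fun i => hv.memLp_weakDeriv le_rfl ![i])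
      (fun i => hv'.memLp_weakDeriv le_rfl ![i]) hlim').congr .rfl fun i => ?_
    exact (hv.weakDeriv_sub hU hv' le_rfl ![i]).symm
  · exact tendsto_eLpNorm_sub_sub (fun k => (hφ k).continuous.aestronglyMeasurable)
      (fun k => (hψ k).continuous.aestronglyMeasurable) hg2.1 hg2'.1 hφg hψg

lemma trace_sub (hK : IsStarBody K c κ h) {v v' : SpaceTime n → ℝ}
    (hv : MemSobolev (interior K) 1 v) (hv' : MemSobolev (interior K) 1 v') :
    trace (interior K) (v - v') =ᵐ[(surface n).restrict (frontier K)]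
      trace (interior K) v - trace (interior K) v' :=
  hK.trace_ae_eq ((hK.isTrace_trace hv).sub isOpen_interior (hK.isTrace_trace hv')) .rfl

lemma isTrace_smooth (hK : IsStarBody K c κ h) {f : SpaceTime n → ℝ} (hf : ContDiff ℝ ∞ f) :
    IsTrace (interior K) f f := by
  have hUb : Bornology.IsBounded (interior K) := hK.isBounded.subset interior_subset
  refine isTrace_iff.2 ⟨MemSobolev.of_smooth hUb hf 1, ?_, fun _ => f, fun _ => hf, ⟨?_, fun i => ?_⟩,
    ?_⟩
  · rw [hK.frontier_interior]
    exact hK.memLp_frontier hf.continuous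
  · simp
  · have h0 : eLpNorm (pd f i - fun x => grad (interior K) f x i) 2
        (volume.restrict (interior K)) = 0 := by
      have h1 := grad_smooth_ae isOpen_interior hUb hf .rfl i
      have h2 : (pd f i - fun x => grad (interior K) f x i) =ᵐ[volume.restrict (interior K)] 0 := by
        filter_upwards [h1] with x hx
        simp only [Pi.sub_apply, pd, Pi.zero_apply]
        rw [hx, sub_self]
      rw [eLpNorm_congr_ae h2, eLpNorm_zero]
    simp_rw [h0]
    exact tendsto_const_nhds
  · simp

lemma trace_smooth (hK : IsStarBody K c κ h) {f v : SpaceTime n → ℝ} (hf : ContDiff ℝ ∞ f)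
    (hv : v =ᵐ[volume.restrict (interior K)] f) :
    trace (interior K) v =ᵐ[(surface n).restrict (frontier K)] f :=
  hK.trace_ae_eq (hK.isTrace_smooth hf) hv

/-- The trace inequality. -/
lemma trace_sq_le (hK : IsStarBody K c κ h) {C : ℝ} (hC : HasTraceConst K h C)
    {v : SpaceTime n → ℝ} (hv : MemSobolev (interior K) 1 v) :
    eLpNorm (trace (interior K) v) 2 ((surface n).restrict (frontier K)) ^ 2 ≤ ENNReal.ofReal C *
      (2 * (ENNReal.ofReal h⁻¹ * eLpNorm v 2 (volume.restrict (interior K)) ^ 2 +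
        ENNReal.ofReal h * ∑ i, eLpNorm (fun x => grad (interior K) v x i) 2
          (volume.restrict (interior K)) ^ 2)) := by
  obtain ⟨-, hg2, φ, hφ, hlim, hφg⟩ := isTrace_iff.1 (hK.isTrace_trace hv)
  rw [hK.frontier_interior] at hg2 hφg
  have t0 := tendsto_eLpNorm_of_sub (fun k => (hφ k).continuous.aestronglyMeasurable) hg2 hφg
  have t1 := tendsto_eLpNorm_of_sub (fun k => (hφ k).continuous.aestronglyMeasurable) hv.1 hlim.1
  have t2 := fun i => tendsto_eLpNorm_of_sub
    (fun k => (contDiff_pd (hφ k) i).continuous.aestronglyMeasurable)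
    (hv.memLp_weakDeriv le_rfl ![i]) (hlim.2 i)
  have hsum : Tendsto (fun k => ∑ i, eLpNorm (pd (φ k) i) 2 (volume.restrict (interior K)) ^ 2)
      atTop (𝓝 (∑ i, eLpNorm (fun x => grad (interior K) v x i) 2
        (volume.restrict (interior K)) ^ 2)) :=
    tendsto_finsetSum Finset.univ fun i _ => (ENNReal.continuous_pow 2).tendsto _ |>.comp (t2 i)
  refine le_of_tendsto_of_tendsto' ((ENNReal.continuous_pow 2).tendsto _ |>.comp t0) ?_
    fun k => hC.sq_le hK.size_pos (hφ k)
  refine ENNReal.Tendsto.const_mul (ENNReal.Tendsto.const_mul ?_ (Or.inr (by norm_num)))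
    (Or.inr ENNReal.ofReal_ne_top)
  exact (ENNReal.Tendsto.const_mul ((ENNReal.continuous_pow 2).tendsto _ |>.comp t1)
    (Or.inr ENNReal.ofReal_ne_top)).add (ENNReal.Tendsto.const_mul hsum
      (Or.inr ENNReal.ofReal_ne_top))

end IsStarBody

end TraceExistence

/-! ### Null sets of codimension two. -/

section CodimensionTwo

variable {n : ℕ}

/-- If `F y = F z`, strict differentiability makes `A (y - z)` small relative to `y - z`, while `A`
is bounded below on the orthogonal complement of its kernel. So `y - z` is mostly a kernel vector.
The tolerance `1 / (2 κ)` keeps the complementary part below half of `‖y - z‖`, whence the constant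
2. -/
lemma exists_dist_le_proj_ker {A : SpaceTime n →L[ℝ] ℝ × ℝ} {F : SpaceTime n → ℝ × ℝ}
    {x : SpaceTime n} (hF : HasStrictFDerivAt F A x) :
    ∃ U ∈ 𝓝 x, ∀ y ∈ U, ∀ z ∈ U, F y = F z →
      dist y z ≤ (2 : ℝ≥0) * dist (A.ker.orthogonalProjectionOnto y)
        (A.ker.orthogonalProjectionOnto z) := by
  set P := A.ker
  have hker : LinearMap.ker ((A : SpaceTime n →ₗ[ℝ] ℝ × ℝ).comp Pᗮ.subtype) = ⊥ := by
    rw [LinearMap.ker_eq_bot']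
    intro q hq
    have h1 : (q : SpaceTime n) ∈ P := hq
    have h2 := (Submodule.isOrtho_orthogonal_right P).disjoint.le_bot ⟨h1, q.2⟩
    exact Subtype.ext ((Submodule.mem_bot ℝ).1 h2)
  obtain ⟨κ, hκ, hanti⟩ := LinearMap.exists_antilipschitzWith _ hker
  have hκ' : (0 : ℝ) < κ := hκ
  have hdef := hF.isLittleO.def (c := 1 / (2 * κ)) (by positivity)
  rw [nhds_prod_eq] at hdef
  obtain ⟨U, hU, hUU⟩ := mem_prod_same_iff.1 hdef
  refine ⟨U, hU, fun y hy z hz hyz => ?_⟩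
  have h1 : ‖F y - F z - A (y - z)‖ ≤ 1 / (2 * κ) * ‖y - z‖ := hUU (Set.mk_mem_prod hy hz)
  simp only [hyz, sub_self, zero_sub, norm_neg] at h1
  set v := y - z with hv
  have hq : v - P.orthogonalProjectionOnto v ∈ Pᗮ := by
    simp
  have h2 := hanti.le_mul_norm_sub (⟨_, hq⟩ : Pᗮ) 0
  have hAP : A (P.orthogonalProjectionOnto v : SpaceTime n) = 0 :=
    (P.orthogonalProjectionOnto v).2
  simp only [sub_zero, map_zero, LinearMap.comp_apply, Submodule.subtype_apply,
    ContinuousLinearMap.coe_coe, map_sub, hAP, Submodule.coe_norm,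
    add_zero, norm_neg] at h2
  have h3 : ‖v‖ ≤ ‖P.orthogonalProjectionOnto v‖ + κ * ‖A v‖ := by
    have e : v = (P.orthogonalProjectionOnto v : SpaceTime n) +
      (v - P.orthogonalProjectionOnto v) := by abel
    calc ‖v‖ = ‖(P.orthogonalProjectionOnto v : SpaceTime n) +
          (v - P.orthogonalProjectionOnto v)‖ := by rw [← e]
      _ ≤ _ := norm_add_le _ _
      _ ≤ _ := add_le_add le_rfl h2
  have h4 : κ * ‖A v‖ ≤ 1 / 2 * ‖v‖ := by
    calc κ * ‖A v‖ ≤ κ * (1 / (2 * κ) * ‖v‖) := by gcongr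
      _ = 1 / 2 * ‖v‖ := by field_simp
  rw [dist_eq_norm, dist_eq_norm, ← map_sub]
  change ‖v‖ ≤ 2 * ‖P.orthogonalProjectionOnto v‖
  linarith

/-- A set which is locally contained in the common zero set of two functions with independent
differentials is a null set for the surface measure. -/
lemma surface_eq_zero_of_pair {E : Set (SpaceTime n)}
    (h : ∀ x ∈ E, ∃ (f g : SpaceTime n → ℝ) (f' g' : SpaceTime n →L[ℝ] ℝ),
      HasStrictFDerivAt f f' x ∧ HasStrictFDerivAt g g' x ∧ (∃ v, f' v = 0 ∧ g' v ≠ 0) ∧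
      (∃ v, g' v = 0 ∧ f' v ≠ 0) ∧ ∀ᶠ y in 𝓝[E] x, f y = 0 ∧ g y = 0) : surface n E = 0 := by
  refine measure_null_of_locally_null _ fun x hx => ?_
  obtain ⟨f, g, f', g', hf, hg, ⟨v, hv, hv'⟩, ⟨w, hw, hw'⟩, hE⟩ := h x hx
  set A := f'.prod g' with hA
  obtain ⟨U, hU, hUd⟩ := exists_dist_le_proj_ker (hf.prodMk hg)
  refine ⟨{y | f y = 0 ∧ g y = 0} ∩ (U ∩ E), inter_mem hE (inter_mem (mem_nhdsWithin_of_mem_nhds hU)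
    self_mem_nhdsWithin), ?_⟩
  have hsurj : Function.Surjective A := by
    rintro ⟨a, b⟩
    refine ⟨(a / f' w) • w + (b / g' v) • v, ?_⟩
    simp [hA, hv, hw, hv', hw']
  -- Two independent differentials leave a kernel of dimension `n - 1`, on which the `n`-dimensional
  -- measure is zero.
  have hrank : Module.finrank ℝ A.ker < n := by
    have h1 := LinearMap.finrank_range_add_finrank_ker (A : SpaceTime n →ₗ[ℝ] ℝ × ℝ)
    rw [LinearMap.range_eq_top.2 hsurj, finrank_top, Module.finrank_prod, Module.finrank_self,
      finrank_euclideanSpace, Fintype.card_fin] at h1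
    change 1 + 1 + Module.finrank ℝ A.ker = n + 1 at h1
    omega
  refine le_antisymm ((surface_le_of_antilipschitz (L := 2) (fun y hy z hz =>
    hUd y hy.2.1 z hz.2.1 ?_) n).trans ?_) zero_le
  · simp [hy.1.1, hy.1.2, hz.1.1, hz.1.2]
  · have h0 : (Measure.hausdorffMeasure (n : ℝ) : Measure A.ker) = 0 :=
      Real.hausdorffMeasure_of_finrank_lt (by exact_mod_cast hrank)
    have : (Measure.euclideanHausdorffMeasure n : Measure A.ker) = 0 := by
      rw [Measure.euclideanHausdorffMeasure_def, h0, smul_zero]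
    change _ * (Measure.euclideanHausdorffMeasure n : Measure A.ker) _ ≤ _
    rw [this, Measure.coe_zero, Pi.zero_apply, mul_zero]

end CodimensionTwo

/-! ### Outward normals: uniqueness and opposite sides. -/

section OuterNormal

variable {n : ℕ} {S S' : Set (SpaceTime n)} {x ν ν' : SpaceTime n}

lemma inner_lt_one_of_ne (hν : ‖ν‖ = 1) (hν' : ‖ν'‖ = 1) (h : ν ≠ ν') : inner ℝ ν ν' < 1 := by
  have h1 := norm_sub_sq_real ν ν'
  have h2 : 0 < ‖ν - ν'‖ := norm_pos_iff.2 (sub_ne_zero.2 h)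
  rw [hν, hν'] at h1
  nlinarith

/-- Otherwise the direction `ν' - ν` would enter the set according to `ν` and leave its closure
according to `ν'`. -/
lemma IsOuterNormal.unique (h : IsOuterNormal S x ν) (h' : IsOuterNormal S x ν') : ν = ν' := by
  by_contra hne
  have h1 := inner_lt_one_of_ne h.1 h'.1 hne
  have e1 : inner ℝ (ν' - ν) ν = inner ℝ ν ν' - 1 := by
    rw [inner_sub_left, real_inner_self_eq_norm_sq, h.1, real_inner_comm]; norm_num
  have e2 : inner ℝ (ν' - ν) ν' = 1 - inner ℝ ν ν' := by
    rw [inner_sub_left, real_inner_self_eq_norm_sq, h'.1]; norm_num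
  obtain ⟨t, ht, ht'⟩ := (((h.2 (ν' - ν)).1 (by linarith)).and
    ((h'.2 (ν' - ν)).2 (by linarith))).exists
  exact ht' (subset_closure (interior_subset ht))

lemma IsOuterNormal.outerNormal_eq (h : IsOuterNormal S x ν) : outerNormal S x = fun i => ν i := by
  have hex : ∃ ν, IsOuterNormal S x ν := ⟨ν, h⟩
  rw [outerNormal, dif_pos hex, hex.choose_spec.unique h]

lemma outerNormal_sq_le (S : Set (SpaceTime n)) (x : SpaceTime n) :
    ∑ i, outerNormal S x i ^ 2 ≤ 1 := by
  by_cases hex : ∃ ν, IsOuterNormal S x ν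
  · obtain ⟨ν, hν⟩ := hex
    rw [hν.outerNormal_eq]
    have := EuclideanSpace.norm_sq_eq ν
    simp only [hν.1, Real.norm_eq_abs, sq_abs] at this
    rw [← this]; norm_num
  -- Where no normal exists, `outerNormal` is zero and the bound is trivial.
  · rw [outerNormal, dif_neg hex]
    simp

/-- Two sets with disjoint interiors have opposite normals. -/
lemma IsOuterNormal.eq_neg_of_disjoint (h : IsOuterNormal S x ν) (h' : IsOuterNormal S' x ν')
    (hd : Disjoint (interior S) (interior S')) : ν' = -ν := by
  by_contra hne
  have h1 := inner_lt_one_of_ne h'.1 (by rw [norm_neg, h.1] : ‖-ν‖ = 1) hne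
  rw [inner_neg_right] at h1
  -- If the normals are not opposite, `-(ν + ν')` points into both sets.
  have e1 : inner ℝ (-(ν + ν')) ν = -1 - inner ℝ ν' ν := by
    rw [inner_neg_left, inner_add_left, real_inner_self_eq_norm_sq, h.1]; ring
  have e2 : inner ℝ (-(ν + ν')) ν' = -1 - inner ℝ ν' ν := by
    rw [inner_neg_left, inner_add_left, real_inner_self_eq_norm_sq, h'.1, real_inner_comm]; ring
  obtain ⟨t, ht, ht'⟩ := (((h.2 (-(ν + ν'))).1 (by linarith)).and
    ((h'.2 (-(ν + ν'))).1 (by linarith))).exists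
  exact Set.disjoint_left.1 hd ht ht'

end OuterNormal

/-! ### Simplices: barycentric coordinates, skeleton and facet normals. -/

section SimplexCoordinates

variable {n : ℕ}

/-- The vertices of a nondegenerate simplex of full dimension, as an affine basis. -/
def simplexBasis (s : Affine.Simplex ℝ (SpaceTime n) (n + 1)) :
    AffineBasis (Fin (n + 2)) ℝ (SpaceTime n) where
  toFun := s.points
  ind' := s.independent
  tot' := by
    rw [s.independent.affineSpan_eq_top_iff_card_eq_finrank_add_one]
    simp

/-- The barycentric coordinate of a point with respect to a simplex. -/
def bary (s : Affine.Simplex ℝ (SpaceTime n) (n + 1)) (k : Fin (n + 2)) (x : SpaceTime n) : ℝ :=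
  (simplexBasis s).coord k x

/-- The differential of a barycentric coordinate. -/
def baryDiff (s : Affine.Simplex ℝ (SpaceTime n) (n + 1)) (k : Fin (n + 2)) :
    SpaceTime n →L[ℝ] ℝ :=
  LinearMap.toContinuousLinearMap ((simplexBasis s).coord k).linear

variable (s : Affine.Simplex ℝ (SpaceTime n) (n + 1))

lemma bary_add (k : Fin (n + 2)) (x w : SpaceTime n) :
    bary s k (x + w) = bary s k x + baryDiff s k w := by
  have := ((simplexBasis s).coord k).map_vadd x w
  simpa [bary, baryDiff, add_comm] using this

lemma continuous_bary (k : Fin (n + 2)) : Continuous (bary s k) :=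
  continuous_barycentric_coord (simplexBasis s) k

lemma hasStrictFDerivAt_bary (k : Fin (n + 2)) (x : SpaceTime n) :
    HasStrictFDerivAt (bary s k) (baryDiff s k) x := by
  have e : bary s k = fun y => bary s k 0 + baryDiff s k y := by
    ext y
    rw [← bary_add, zero_add]
  rw [e]
  exact (baryDiff s k).hasStrictFDerivAt.const_add _

lemma convexHull_simplex :
    convexHull ℝ (Set.range s.points) = {x | ∀ k, 0 ≤ bary s k x} :=
  (simplexBasis s).convexHull_eq_nonneg_coord

lemma interior_convexHull_simplex :
    interior (convexHull ℝ (Set.range s.points)) = {x | ∀ k, 0 < bary s k x} :=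
  (simplexBasis s).interior_convexHull

lemma isClosed_convexHull_simplex : IsClosed (convexHull ℝ (Set.range s.points)) := by
  rw [convexHull_simplex, Set.ofPred_forall]
  exact isClosed_iInter fun k => isClosed_le continuous_const (continuous_bary s k)

lemma bary_vertex (k l : Fin (n + 2)) : bary s k (s.points l) = if k = l then 1 else 0 :=
  (simplexBasis s).coord_apply k l

lemma baryDiff_vertex_sub (k l m : Fin (n + 2)) :
    baryDiff s k (s.points l - s.points m) = (if k = l then 1 else 0) - if k = m then 1 else 0 := by
  have := bary_add s k (s.points m) (s.points l - s.points m)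
  rw [add_sub_cancel, bary_vertex, bary_vertex] at this
  linarith

lemma bary_eq_zero_of_mem_face {t : Set (Fin (n + 2))} {k : Fin (n + 2)} (hk : k ∉ t)
    {x : SpaceTime n} (hx : x ∈ convexHull ℝ (s.points '' t)) : bary s k x = 0 := by
  have hconv : Convex ℝ {y | bary s k y = 0} :=
    (convex_singleton (0 : ℝ)).affine_preimage ((simplexBasis s).coord k)
  refine convexHull_min ?_ hconv hx
  rintro _ ⟨l, hl, rfl⟩
  change bary s k _ = 0
  rw [bary_vertex, if_neg]
  rintro rfl
  exact hk hl

/-- The points where at least two barycentric coordinates vanish. -/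
def skeleton : Set (SpaceTime n) := {x | ∃ k l, k ≠ l ∧ bary s k x = 0 ∧ bary s l x = 0}

/-- Two distinct barycentric coordinates have independent differentials, as the edges from a third
vertex `m` show. Such a vertex exists because there are `n + 2 ≥ 3` of them. -/
lemma surface_skeleton (hn : 1 ≤ n) : surface n (skeleton s) = 0 := by
  have h : skeleton s = ⋃ k, ⋃ l, {x | k ≠ l ∧ bary s k x = 0 ∧ bary s l x = 0} := by
    ext x; simp [skeleton]
  rw [h]
  refine measure_iUnion_null fun k => measure_iUnion_null fun l => ?_
  refine surface_eq_zero_of_pair fun x hx => ?_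
  obtain ⟨m, hm⟩ : ∃ m, m ∉ ({k, l} : Finset (Fin (n + 2))) := by
    by_contra! hcon
    have h1 : (Finset.univ : Finset (Fin (n + 2))) ⊆ {k, l} := fun m _ => hcon m
    have h2 := (Finset.card_le_card h1).trans Finset.card_le_two
    simp at h2
    omega
  simp only [Finset.mem_insert, Finset.mem_singleton, not_or] at hm
  refine ⟨bary s k, bary s l, baryDiff s k, baryDiff s l, hasStrictFDerivAt_bary s k x,
    hasStrictFDerivAt_bary s l x, ⟨s.points l - s.points m, ?_⟩, ⟨s.points k - s.points m, ?_⟩, ?_⟩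
  · simp [baryDiff_vertex_sub, hx.1, Ne.symm hm.1, Ne.symm hm.2]
  · simp [baryDiff_vertex_sub, Ne.symm hx.1, Ne.symm hm.1, Ne.symm hm.2]
  · filter_upwards [self_mem_nhdsWithin] with y hy using hy.2

/-- The outward unit normal of the facet opposite to a vertex. -/
def facetNormal (k : Fin (n + 2)) : SpaceTime n :=
  -(‖(InnerProductSpace.toDual ℝ (SpaceTime n)).symm (baryDiff s k)‖⁻¹ •
    (InnerProductSpace.toDual ℝ (SpaceTime n)).symm (baryDiff s k))

lemma baryDiff_ne_zero (k : Fin (n + 2)) : baryDiff s k ≠ 0 := by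
  obtain ⟨m, hm⟩ := exists_ne k
  intro h
  have := baryDiff_vertex_sub s k k m
  simp [h, hm.symm] at this

lemma norm_dual_pos (k : Fin (n + 2)) :
    0 < ‖(InnerProductSpace.toDual ℝ (SpaceTime n)).symm (baryDiff s k)‖ := by
  rw [norm_pos_iff]
  simpa using baryDiff_ne_zero s k

lemma norm_facetNormal (k : Fin (n + 2)) : ‖facetNormal s k‖ = 1 := by
  rw [facetNormal, norm_neg, norm_smul, norm_inv, norm_norm, inv_mul_cancel₀ (norm_dual_pos s k).ne']

lemma inner_facetNormal (k : Fin (n + 2)) (w : SpaceTime n) :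
    inner ℝ w (facetNormal s k) =
      -(‖(InnerProductSpace.toDual ℝ (SpaceTime n)).symm (baryDiff s k)‖⁻¹ * baryDiff s k w) := by
  rw [facetNormal, inner_neg_right, real_inner_comm, real_inner_smul_left,
    InnerProductSpace.toDual_symm_apply]

lemma eventually_bary_pos {k : Fin (n + 2)} {x : SpaceTime n} (hx : 0 < bary s k x) :
    ∀ᶠ y in 𝓝 x, 0 < bary s k y :=
  (continuous_bary s k).continuousAt.eventually (lt_mem_nhds hx)

lemma tendsto_add_smul (x w : SpaceTime n) : Tendsto (fun t : ℝ => x + t • w) (𝓝[>] 0) (𝓝 x) := by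
  have h : Tendsto (fun t : ℝ => x + t • w) (𝓝 0) (𝓝 (x + (0 : ℝ) • w)) :=
    Continuous.tendsto (by fun_prop) 0
  simpa using h.mono_left nhdsWithin_le_nhds

/-- The normal of a simplex at a point in the relative interior of a facet. -/
lemma isOuterNormal_simplex {k : Fin (n + 2)} {x : SpaceTime n} (hk : bary s k x = 0)
    (hpos : ∀ l, l ≠ k → 0 < bary s l x) :
    IsOuterNormal (convexHull ℝ (Set.range s.points)) x (facetNormal s k) := by
  have hpn := inv_pos.2 (norm_dual_pos s k)
  refine ⟨norm_facetNormal s k, fun w => ⟨fun hw => ?_, fun hw => ?_⟩⟩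
  · rw [inner_facetNormal] at hw
    have hd : 0 < baryDiff s k w := by
      by_contra! hcon
      have := mul_nonpos_of_nonneg_of_nonpos hpn.le hcon
      linarith
    rw [interior_convexHull_simplex]
    have h1 : ∀ᶠ t : ℝ in 𝓝[>] 0, ∀ l, l ≠ k → 0 < bary s l (x + t • w) :=
      eventually_all.2 fun l => by
        by_cases hl : l = k
        · simp [hl]
        · filter_upwards [(tendsto_add_smul x w).eventually (eventually_bary_pos s (hpos l hl))]
            with t ht _ using ht
    filter_upwards [h1, self_mem_nhdsWithin] with t ht (ht0 : 0 < t) l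
    by_cases hl : l = k
    · rw [hl, bary_add, hk, map_smul, zero_add]
      exact mul_pos ht0 hd
    · exact ht l hl
  · rw [inner_facetNormal] at hw
    have hd : baryDiff s k w < 0 := by
      by_contra! hcon
      have := mul_nonneg hpn.le hcon
      linarith
    rw [(isClosed_convexHull_simplex s).closure_eq]
    filter_upwards [self_mem_nhdsWithin] with t (ht0 : 0 < t) hmem
    rw [convexHull_simplex] at hmem
    have := hmem k
    rw [bary_add, hk, map_smul, zero_add, smul_eq_mul] at this
    have := mul_neg_of_pos_of_neg ht0 hd
    linarith

end SimplexCoordinates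

/-! ### Boundary points with a C¹ defining function. -/

section RegularBoundary

variable {n : ℕ}

/-- `x` is a boundary point of `M` near which `M` is the sublevel set of the continuously
differentiable function `ρ`. -/
structure RegularAt (M : Set (SpaceTime n)) (x : SpaceTime n) (ρ : SpaceTime n → ℝ) : Prop where
  contDiff : ContDiffAt ℝ 1 ρ x
  ne_zero : fderiv ℝ ρ x ≠ 0
  zero : ρ x = 0
  mem_iff : ∀ᶠ y in 𝓝 x, (y ∈ M ↔ ρ y < 0)

/-- The normalized gradient. -/
def unitNormal (ρ : SpaceTime n → ℝ) (x : SpaceTime n) : SpaceTime n :=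
  ‖(InnerProductSpace.toDual ℝ (SpaceTime n)).symm (fderiv ℝ ρ x)‖⁻¹ •
    (InnerProductSpace.toDual ℝ (SpaceTime n)).symm (fderiv ℝ ρ x)

lemma inner_unitNormal (ρ : SpaceTime n → ℝ) (x w : SpaceTime n) :
    inner ℝ w (unitNormal ρ x) = ‖fderiv ℝ ρ x‖⁻¹ * fderiv ℝ ρ x w := by
  rw [unitNormal, real_inner_comm, real_inner_smul_left, InnerProductSpace.toDual_symm_apply,
    LinearIsometryEquiv.norm_map]

namespace RegularAt

variable {M : Set (SpaceTime n)} {x : SpaceTime n} {ρ : SpaceTime n → ℝ}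

lemma norm_pos (h : RegularAt M x ρ) : 0 < ‖fderiv ℝ ρ x‖ := norm_pos_iff.2 h.ne_zero

lemma norm_unitNormal (h : RegularAt M x ρ) : ‖unitNormal ρ x‖ = 1 := by
  rw [unitNormal, norm_smul, norm_inv, norm_norm, LinearIsometryEquiv.norm_map,
    inv_mul_cancel₀ h.norm_pos.ne']

/-- The defining function describes `M` and not its closure, but positivity of `ρ` persists nearby
and so keeps `M` at a distance. -/
lemma eventually_notMem_closure (h : RegularAt M x ρ) :
    ∀ᶠ y in 𝓝 x, 0 < ρ y → y ∉ closure M := by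
  filter_upwards [h.mem_iff.eventually_nhds, h.contDiff.eventually (by simp)] with y hy hc hpos hcl
  rw [mem_closure_iff_frequently] at hcl
  refine hcl ?_
  filter_upwards [hy, hc.continuousAt.eventually (lt_mem_nhds hpos)] with z hz hz' hzM
  exact absurd (hz.1 hzM) hz'.not_gt

/-- One `ρ` serves all frontier points near `x`. This makes the normal vary continuously along the
frontier and allows null set arguments to be local. -/
lemma eventually_frontier (h : RegularAt M x ρ) (hM : IsOpen M) :
    ∀ᶠ y in 𝓝 x, y ∈ frontier M → RegularAt M y ρ := by
  have hne : ∀ᶠ y in 𝓝 x, fderiv ℝ ρ y ≠ 0 :=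
    (h.contDiff.fderiv_right (m := 0) (by simp)).continuousAt.eventually_ne h.ne_zero
  filter_upwards [h.mem_iff.eventually_nhds, h.contDiff.eventually (by simp),
    h.eventually_notMem_closure, hne] with y hy hc hncl hne hyf
  refine ⟨hc, hne, ?_, hy⟩
  rw [hM.frontier_eq] at hyf
  have h1 := hy.self_of_nhds
  by_contra h0
  rcases lt_or_gt_of_ne h0 with h2 | h2
  · exact hyf.2 (h1.2 h2)
  · exact hncl h2 hyf.1

/-- The sign of `ρ` along the ray from `x` in direction `w` is eventually that of its derivative,
which is a positive multiple of the inner product of `w` with the normal. -/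
lemma isOuterNormal (h : RegularAt M x ρ) (hM : IsOpen M) :
    IsOuterNormal M x (unitNormal ρ x) := by
  have hpn := inv_pos.2 h.norm_pos
  refine ⟨h.norm_unitNormal, fun w => ?_⟩
  have hd : HasDerivAt (fun t : ℝ => ρ (x + t • w)) (fderiv ℝ ρ x w) 0 := by
    have h1 : HasFDerivAt ρ (fderiv ℝ ρ x) (x + (0 : ℝ) • w) := by
      rw [zero_smul, add_zero]
      exact (h.contDiff.differentiableAt (by simp)).hasFDerivAt
    have h2 : HasDerivAt (fun t : ℝ => x + t • w) w 0 := by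
      simpa using ((hasDerivAt_id (0 : ℝ)).smul_const w).const_add x
    exact h1.comp_hasDerivAt 0 h2
  have hslope := hd.tendsto_slope_zero_right
  simp only [zero_add, zero_smul, add_zero, h.zero, sub_zero, smul_eq_mul] at hslope
  have hev := tendsto_add_smul x w
  rw [inner_unitNormal, hM.interior_eq]
  constructor
  · intro hw
    have hw' : fderiv ℝ ρ x w < 0 := by
      by_contra! hcon
      have := mul_nonneg hpn.le hcon
      linarith
    filter_upwards [hslope.eventually (gt_mem_nhds hw'), hev.eventually h.mem_iff,
      self_mem_nhdsWithin] with t ht hiff (ht0 : 0 < t)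
    rw [hiff]
    by_contra! hcon
    have := mul_nonneg (inv_pos.2 ht0).le hcon
    linarith
  · intro hw
    have hw' : 0 < fderiv ℝ ρ x w := by
      by_contra! hcon
      have := mul_nonpos_of_nonneg_of_nonpos hpn.le hcon
      linarith
    filter_upwards [hslope.eventually (lt_mem_nhds hw'), hev.eventually h.eventually_notMem_closure,
      self_mem_nhdsWithin] with t ht hncl (ht0 : 0 < t)
    refine hncl ?_
    by_contra! hcon
    have := mul_nonpos_of_nonneg_of_nonpos (inv_pos.2 ht0).le hcon
    linarith

end RegularAt

end RegularBoundary

/-! ### Meshes: how the elements meet. -/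

namespace Triangulation

variable {n : ℕ} {M : Set (SpaceTime n)} {𝒯 : Triangulation M} {r : ℝ}

/-- The standing assumptions on a triangulation of a domain whose boundary is regular up to a
null set. -/
structure IsMesh (𝒯 : Triangulation M) (r : ℝ) : Prop where
  dim_pos : 1 ≤ n
  isOpen : IsOpen M
  interior_closure : interior (closure M) = M
  regular : ∀ᵐ x ∂(surface n).restrict (frontier M), ∃ ρ, RegularAt M x ρ
  star : ∀ i, ∃ c, IsStarBody (𝒯.elem i) c (r * 𝒯.meshSize) 𝒯.meshSize

lemma elem_subset (𝒯 : Triangulation M) (i : Fin 𝒯.card) : 𝒯.elem i ⊆ closure M :=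
  Set.inter_subset_right

lemma isClosed_elem (𝒯 : Triangulation M) (i : Fin 𝒯.card) : IsClosed (𝒯.elem i) :=
  (isClosed_convexHull_simplex _).inter isClosed_closure

lemma iUnion_elem (𝒯 : Triangulation M) : ⋃ i, 𝒯.elem i = closure M := by
  refine Set.Subset.antisymm (Set.iUnion_subset fun i => 𝒯.elem_subset i) fun x hx => ?_
  obtain ⟨i, hi⟩ := Set.mem_iUnion.1 (𝒯.covers hx)
  exact Set.mem_iUnion.2 ⟨i, hi, hx⟩

/-- A proper face omits some vertex, and the coordinate of that vertex vanishes on it. This is all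
that conformity contributes to the proof. -/
lemma exists_bary_eq_zero (𝒯 : Triangulation M) {i j : Fin 𝒯.card} (hij : i ≠ j) :
    ∃ k, ∀ x ∈ 𝒯.elem i, x ∈ 𝒯.elem j → bary (𝒯.simplex i) k x = 0 := by
  obtain ⟨s, t, hs, -, h, -⟩ := 𝒯.conforming i j hij
  obtain ⟨k, hk⟩ := (Set.ne_univ_iff_exists_notMem s).1 hs
  refine ⟨k, fun x hx hx' => bary_eq_zero_of_mem_face _ hk ?_⟩
  have : x ∈ 𝒯.elem i ∩ 𝒯.elem j := ⟨hx, hx'⟩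
  have h2 := h.subset this
  exact h2.1

/-- Common interior points would form an open set on which one barycentric coordinate vanishes, but
this coordinate changes at unit rate along an edge that ends at its vertex. -/
lemma disjoint_int (𝒯 : Triangulation M) {i j : Fin 𝒯.card} (hij : i ≠ j) :
    Disjoint (𝒯.int i) (𝒯.int j) := by
  obtain ⟨k, hk⟩ := 𝒯.exists_bary_eq_zero hij
  rw [Set.disjoint_left]
  intro x hx hx'
  obtain ⟨m, hm⟩ := exists_ne k
  set w := (𝒯.simplex i).points k - (𝒯.simplex i).points m
  have hev := tendsto_add_smul x w
  obtain ⟨t, ⟨ht1, ht2⟩, ht0⟩ := ((hev.eventually (isOpen_interior.mem_nhds hx)).and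
    (hev.eventually (isOpen_interior.mem_nhds hx')) |>.and self_mem_nhdsWithin).exists
  have h1 := hk _ (interior_subset ht1) (interior_subset ht2)
  rw [bary_add, hk _ (interior_subset hx) (interior_subset hx'), map_smul,
    baryDiff_vertex_sub] at h1
  simp only [if_true, if_neg hm.symm] at h1
  have : (0 : ℝ) < t := ht0
  simp at h1
  linarith

lemma measurableSet_bdry (𝒯 : Triangulation M) (i : Fin 𝒯.card) : MeasurableSet (𝒯.bdry i) :=
  ((𝒯.isClosed_elem i).inter isClosed_frontier).measurableSet

/-- A point of `K ∩ M` on which exactly one barycentric coordinate vanishes. -/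
lemma isOuterNormal_elem (hM : IsOpen M) {i : Fin 𝒯.card} {k : Fin (n + 2)} {x : SpaceTime n}
    (hx : x ∈ 𝒯.elem i) (hxM : x ∈ M) (hk : bary (𝒯.simplex i) k x = 0)
    (hs : x ∉ skeleton (𝒯.simplex i)) :
    IsOuterNormal (𝒯.elem i) x (facetNormal (𝒯.simplex i) k) := by
  have hnn : ∀ l, 0 ≤ bary (𝒯.simplex i) l x := by
    have := hx.1
    rw [convexHull_simplex] at this
    exact this
  have hpos : ∀ l, l ≠ k → 0 < bary (𝒯.simplex i) l x := fun l hl =>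
    lt_of_le_of_ne (hnn l) fun h0 => hs ⟨l, k, hl, h0.symm, hk⟩
  have hN := isOuterNormal_simplex _ hk hpos
  refine ⟨hN.1, fun w => ⟨fun hw => ?_, fun hw => ?_⟩⟩
  · filter_upwards [(hN.2 w).1 hw, (tendsto_add_smul x w).eventually (hM.mem_nhds hxM)]
      with t ht ht'
    rw [elem, interior_inter]
    exact ⟨ht, interior_mono subset_closure (by rwa [hM.interior_eq])⟩
  · filter_upwards [(hN.2 w).2 hw] with t ht ht'
    exact ht (closure_mono Set.inter_subset_left ht')

lemma surface_skeleton_restrict (hn : 1 ≤ n) (i : Fin 𝒯.card) (S : Set (SpaceTime n)) :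
    ∀ᵐ x ∂(surface n).restrict S, x ∉ skeleton (𝒯.simplex i) :=
  ae_restrict_of_ae (measure_eq_zero_iff_ae_notMem.1 (surface_skeleton _ hn))

namespace IsMesh

lemma meshSize_pos (h : 𝒯.IsMesh r) (i : Fin 𝒯.card) : 0 < 𝒯.meshSize := by
  obtain ⟨c, hc⟩ := h.star i
  exact hc.size_pos

lemma closure_int (h : 𝒯.IsMesh r) (i : Fin 𝒯.card) : closure (𝒯.int i) = 𝒯.elem i := by
  obtain ⟨c, hc⟩ := h.star i
  exact hc.closure_interior

lemma int_subset (h : 𝒯.IsMesh r) (i : Fin 𝒯.card) : 𝒯.int i ⊆ M := by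
  exact (interior_mono (𝒯.elem_subset i)).trans h.interior_closure.subset

lemma bdry_subset (h : 𝒯.IsMesh r) (i : Fin 𝒯.card) : 𝒯.bdry i ⊆ frontier (𝒯.elem i) := by
  rintro x ⟨hx, hxf⟩
  refine ⟨subset_closure hx, fun hxi => ?_⟩
  rw [h.isOpen.frontier_eq] at hxf
  exact hxf.2 (h.int_subset i hxi)

/-- The interior of the second element is dense in it, so a common point interior to the first would
make the two interiors meet. -/
lemma face_subset (h : 𝒯.IsMesh r) {i j : Fin 𝒯.card} (hij : i ≠ j) :
    𝒯.face i j ⊆ frontier (𝒯.elem i) := by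
  rintro x ⟨⟨hx, hxj⟩, -⟩
  refine ⟨subset_closure hx, fun hxi => ?_⟩
  rw [← h.closure_int j, mem_closure_iff] at hxj
  obtain ⟨y, hy, hy'⟩ := hxj _ isOpen_interior hxi
  exact Set.disjoint_left.1 (𝒯.disjoint_int hij) hy hy'

lemma measurableSet_face (h : 𝒯.IsMesh r) (i j : Fin 𝒯.card) : MeasurableSet (𝒯.face i j) :=
  ((𝒯.isClosed_elem i).inter (𝒯.isClosed_elem j)).measurableSet.inter h.isOpen.measurableSet

lemma face_comm (𝒯 : Triangulation M) (i j : Fin 𝒯.card) : 𝒯.face i j = 𝒯.face j i := by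
  rw [face, face, Set.inter_comm (𝒯.elem i)]

/-- At almost every point of a face the adjacent elements have a normal, which is that of a
facet. -/
lemma ae_face_isOuterNormal (h : 𝒯.IsMesh r) {i j : Fin 𝒯.card} (hij : i ≠ j) :
    ∀ᵐ x ∂(surface n).restrict (𝒯.face i j), ∃ k, (∀ l, bary (𝒯.simplex i) l x = 0 ↔ l = k) ∧
      IsOuterNormal (𝒯.elem i) x (facetNormal (𝒯.simplex i) k) := by
  obtain ⟨k, hk⟩ := 𝒯.exists_bary_eq_zero hij
  filter_upwards [ae_restrict_mem (h.measurableSet_face i j),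
    surface_skeleton_restrict h.dim_pos i _] with x hx hs
  have hkx := hk x hx.1.1 hx.1.2
  refine ⟨k, fun l => ⟨fun hl => ?_, fun hl => hl ▸ hkx⟩, isOuterNormal_elem h.isOpen hx.1.1 hx.2 hkx hs⟩
  by_contra hne
  exact hs ⟨l, k, hne, hl, hkx⟩

/-- The normal is defined by choice, so its measurability needs a formula: almost everywhere on a
face it is the constant normal of the one facet whose coordinate vanishes. -/
lemma aestronglyMeasurable_outerNormal (h : 𝒯.IsMesh r) {i j : Fin 𝒯.card} (hij : i ≠ j)
    (m : Fin (n + 1)) :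
    AEStronglyMeasurable (fun x => outerNormal (𝒯.elem i) x m)
      ((surface n).restrict (𝒯.face i j)) := by
  have hmeas : Measurable fun x => ∑ k, Set.indicator {y | bary (𝒯.simplex i) k y = 0}
      (fun _ => facetNormal (𝒯.simplex i) k m) x :=
    Finset.measurable_fun_sum _ fun k _ => measurable_const.indicator
      (measurableSet_eq_fun (continuous_bary _ k).measurable measurable_const)
  refine ⟨_, hmeas.stronglyMeasurable, ?_⟩
  filter_upwards [h.ae_face_isOuterNormal hij] with x hx
  obtain ⟨k, hk, hN⟩ := hx
  rw [hN.outerNormal_eq, Finset.sum_eq_single k]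
  · rw [Set.indicator_of_mem (show x ∈ {y | bary (𝒯.simplex i) k y = 0} from (hk k).2 rfl)]
  · intro l _ hl
    exact Set.indicator_of_notMem
      (show x ∉ {y | bary (𝒯.simplex i) l y = 0} from fun hl' => hl ((hk l).1 hl')) _
  · simp

lemma ae_outerNormal_neg (h : 𝒯.IsMesh r) {i j : Fin 𝒯.card} (hij : i ≠ j) :
    ∀ᵐ x ∂(surface n).restrict (𝒯.face i j),
      outerNormal (𝒯.elem j) x = -outerNormal (𝒯.elem i) x := by
  have h2 := h.ae_face_isOuterNormal hij.symm
  rw [face_comm] at h2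
  filter_upwards [h.ae_face_isOuterNormal hij, h2] with x hx hx'
  obtain ⟨k, -, hk⟩ := hx
  obtain ⟨l, -, hl⟩ := hx'
  have := hk.eq_neg_of_disjoint hl (𝒯.disjoint_int hij)
  rw [hk.outerNormal_eq, hl.outerNormal_eq, this]
  ext i
  simp

/-- Two faces of an element overlap in a null set. -/
lemma surface_face_inter (h : 𝒯.IsMesh r) {i j k : Fin 𝒯.card} (hij : i ≠ j) (hik : i ≠ k)
    (hjk : j ≠ k) : surface n (𝒯.face i j ∩ 𝒯.face i k) = 0 := by
  rw [measure_eq_zero_iff_ae_notMem]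
  have e := fun j => measurableSet_face h i j
  have h1 := (ae_restrict_iff' (e j)).1 (h.ae_face_isOuterNormal hij)
  have h2 := h.ae_face_isOuterNormal hij.symm
  rw [face_comm, ae_restrict_iff' (e j)] at h2
  have h3 := h.ae_face_isOuterNormal hik.symm
  rw [face_comm, ae_restrict_iff' (e k)] at h3
  filter_upwards [h1, h2, h3] with x h1 h2 h3 hx
  obtain ⟨m, -, hi⟩ := h1 hx.1
  obtain ⟨_, -, hj⟩ := h2 hx.1
  obtain ⟨_, -, hk⟩ := h3 hx.2
  -- At a point shared by three elements their normals would be pairwise opposite, which is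
  -- impossible for three unit vectors.
  have e1 := hi.eq_neg_of_disjoint hj (𝒯.disjoint_int hij)
  have e2 := hi.eq_neg_of_disjoint hk (𝒯.disjoint_int hik)
  have e3 := hj.eq_neg_of_disjoint hk (𝒯.disjoint_int hjk)
  rw [e1, neg_neg] at e3
  rw [e2] at e3
  have h4 := congrArg (fun ν => inner ℝ ν (facetNormal (𝒯.simplex i) m)) e3
  simp only [inner_neg_left, real_inner_self_eq_norm_sq, hi.1] at h4
  norm_num at h4

lemma _root_.WaveDA.volume_eq_zero_of_surface_lt_top {S : Set (SpaceTime n)}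
    (hS : surface n S < ⊤) : volume S = 0 := by
  have h1 : (Measure.euclideanHausdorffMeasure (n + 1) : Measure (SpaceTime n)) = volume :=
    EuclideanSpace.euclideanHausdorffMeasure_eq_volume (n + 1)
  rw [← h1]
  exact (Measure.euclideanHausdorffMeasure_zero_or_top (Nat.lt_succ_self n) S).resolve_right hS.ne

lemma volume_frontier_elem (h : 𝒯.IsMesh r) (i : Fin 𝒯.card) :
    volume (frontier (𝒯.elem i)) = 0 := by
  obtain ⟨c, hc⟩ := h.star i
  exact volume_eq_zero_of_surface_lt_top hc.surface_frontier_lt_top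

lemma volume_iUnion_frontier (h : 𝒯.IsMesh r) : volume (⋃ i, frontier (𝒯.elem i)) = 0 :=
  measure_iUnion_null fun i => h.volume_frontier_elem i

lemma closure_subset (𝒯 : Triangulation M) :
    closure M ⊆ (⋃ i, 𝒯.int i) ∪ ⋃ i, frontier (𝒯.elem i) := by
  rw [← 𝒯.iUnion_elem]
  refine Set.iUnion_subset fun i x hx => ?_
  by_cases hxi : x ∈ 𝒯.int i
  · exact Or.inl (Set.mem_iUnion.2 ⟨i, hxi⟩)
  · exact Or.inr (Set.mem_iUnion.2 ⟨i, subset_closure hx, hxi⟩)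

lemma frontier_eq_iUnion_bdry (𝒯 : Triangulation M) : frontier M = ⋃ i, 𝒯.bdry i := by
  rw [← Set.inter_eq_right.2 (frontier_subset_closure (s := M)), ← 𝒯.iUnion_elem,
    Set.iUnion_inter]
  rfl

lemma volume_frontier (h : 𝒯.IsMesh r) : volume (frontier M) = 0 := by
  rw [frontier_eq_iUnion_bdry 𝒯]
  exact measure_iUnion_null fun i => measure_mono_null (h.bdry_subset i) (h.volume_frontier_elem i)

/-- The open elements are disjoint and together miss only frontiers, which have finite surface
measure and hence no volume. -/
lemma restrict_volume (h : 𝒯.IsMesh r) :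
    volume.restrict M = ∑ i, volume.restrict (𝒯.int i) := by
  have h1 : M =ᵐ[volume] ⋃ i, 𝒯.int i := by
    refine ae_eq_set.2 ⟨measure_mono_null ?_ h.volume_iUnion_frontier, ?_⟩
    · rintro x ⟨hx, hx'⟩
      exact (closure_subset 𝒯 (subset_closure hx)).resolve_left hx'
    · rw [Set.sdiff_eq_empty.2 (Set.iUnion_subset fun i => h.int_subset i), measure_empty]
  rw [Measure.restrict_congr_set h1, Measure.restrict_iUnion (fun i j hij => 𝒯.disjoint_int hij)
    (fun i => isOpen_interior.measurableSet), Measure.sum_fintype]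

end IsMesh

end Triangulation

/-! ### Crossings of the boundary with the hyperplanes of facets. -/

section Transversality

variable {n : ℕ}

/-- Where the boundary crosses the hyperplane at an angle, the two defining functions have
independent differentials, so the crossing has codimension two. Hence almost every regular boundary
point on the hyperplane is a point of tangency. -/
lemma surface_transversal {M : Set (SpaceTime n)} (hM : IsOpen M)
    (s : Affine.Simplex ℝ (SpaceTime n) (n + 1)) (k : Fin (n + 2)) :
    surface n {x | x ∈ frontier M ∧ bary s k x = 0 ∧ ∃ ρ, RegularAt M x ρ ∧
      unitNormal ρ x ≠ facetNormal s k ∧ unitNormal ρ x ≠ -facetNormal s k} = 0 := by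
  refine surface_eq_zero_of_pair fun x ⟨hxf, hx0, ρ, hρ, hne, hne'⟩ => ?_
  set ν := unitNormal ρ x with hν
  set e := facetNormal s k with he
  have hν1 : ‖ν‖ = 1 := hρ.norm_unitNormal
  have he1 : ‖e‖ = 1 := norm_facetNormal s k
  have h1 : inner ℝ ν e < 1 := inner_lt_one_of_ne hν1 he1 hne
  have h2 : -1 < inner ℝ ν e := by
    have := inner_lt_one_of_ne hν1 (by rwa [norm_neg]) hne'
    rw [inner_neg_right] at this
    linarith
  have h3 : 0 < 1 - inner ℝ ν e ^ 2 := by nlinarith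
  have hf : ∀ w, fderiv ℝ ρ x w = ‖fderiv ℝ ρ x‖ * inner ℝ w ν := fun w => by
    rw [hν, inner_unitNormal, mul_inv_cancel_left₀ hρ.norm_pos.ne']
  have hg : ∀ w, baryDiff s k w =
      -(‖(InnerProductSpace.toDual ℝ (SpaceTime n)).symm (baryDiff s k)‖ * inner ℝ w e) :=
    fun w => by
      rw [he, inner_facetNormal, mul_neg, neg_neg, mul_inv_cancel_left₀ (norm_dual_pos s k).ne']
  -- The two witness vectors are each normal minus its component along the other.
  refine ⟨ρ, bary s k, fderiv ℝ ρ x, baryDiff s k, hρ.contDiff.hasStrictFDerivAt (by simp),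
    hasStrictFDerivAt_bary s k x, ⟨e - inner ℝ ν e • ν, ?_, ?_⟩, ⟨ν - inner ℝ ν e • e, ?_, ?_⟩, ?_⟩
  · rw [hf, inner_sub_left, real_inner_smul_left, real_inner_self_eq_norm_sq, hν1,
      real_inner_comm]
    ring
  · rw [hg, inner_sub_left, real_inner_smul_left, real_inner_self_eq_norm_sq, he1]
    have := mul_pos (norm_dual_pos s k) h3
    intro h0
    nlinarith
  · rw [hg, inner_sub_left, real_inner_smul_left, real_inner_self_eq_norm_sq, he1]
    ring
  · rw [hf, inner_sub_left, real_inner_smul_left, real_inner_self_eq_norm_sq, hν1,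
      real_inner_comm e ν]
    have := mul_pos hρ.norm_pos h3
    intro h0
    rw [real_inner_comm] at h0
    nlinarith
  · filter_upwards [self_mem_nhdsWithin, mem_nhdsWithin_of_mem_nhds (hρ.eventually_frontier hM)]
      with y hy hy'
    exact ⟨(hy' hy.1).zero, hy.2.1⟩

end Transversality

/-! ### Boundary parts of distinct elements overlap in null sets. -/

namespace Triangulation.IsMesh

variable {n : ℕ} {M : Set (SpaceTime n)} {𝒯 : Triangulation M} {r : ℝ}

lemma isOuterNormal_simplex_of_mem {i : Fin 𝒯.card} {k : Fin (n + 2)} {x : SpaceTime n}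
    (hx : x ∈ 𝒯.elem i) (hk : bary (𝒯.simplex i) k x = 0)
    (hs : x ∉ skeleton (𝒯.simplex i)) :
    IsOuterNormal (convexHull ℝ (Set.range (𝒯.simplex i).points)) x
      (facetNormal (𝒯.simplex i) k) := by
  have hnn : ∀ l, 0 ≤ bary (𝒯.simplex i) l x := by
    have := hx.1
    rw [convexHull_simplex] at this
    exact this
  exact isOuterNormal_simplex _ hk fun l hl =>
    lt_of_le_of_ne (hnn l) fun h0 => hs ⟨l, k, hl, h0.symm, hk⟩

/-- An element cannot lie between two sets with opposite normals. -/
lemma normal_ne_neg (h : 𝒯.IsMesh r) {i : Fin 𝒯.card} {S : Set (SpaceTime n)} {x ν : SpaceTime n}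
    (hx : x ∈ 𝒯.elem i) (hν : IsOuterNormal M x ν) (hS : 𝒯.elem i ⊆ S)
    (hSν : IsOuterNormal S x (-ν)) : False := by
  obtain ⟨c, hc⟩ := h.star i
  have hκ := hc.pos
  -- Segments from `x` to the ball stay in the element, so they leave neither `M` nor `S`. With
  -- opposite normals this confines the whole ball to the hyperplane through `x` orthogonal to `ν`,
  -- which is absurd.
  have key : ∀ y ∈ Metric.ball c (r * 𝒯.meshSize), inner ℝ (y - x) ν = 0 := by
    intro y hy
    have hmem : ∀ᶠ t : ℝ in 𝓝[>] 0, x + t • (y - x) ∈ 𝒯.elem i := by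
      filter_upwards [Ioc_mem_nhdsGT (zero_lt_one' ℝ)] with t ht
      have := interior_subset (hc.combo_mem_interior hx hy ht.1 ht.2)
      convert this using 1
      module
    refine le_antisymm ?_ ?_
    · by_contra! hcon
      obtain ⟨t, ht, ht'⟩ := (hmem.and ((hν.2 (y - x)).2 hcon)).exists
      exact ht' (𝒯.elem_subset i ht)
    · by_contra! hcon
      obtain ⟨t, ht, ht'⟩ := (hmem.and ((hSν.2 (y - x)).2 (by rw [inner_neg_right]; linarith))).exists
      exact ht' (subset_closure (hS ht))
  have h1 := key c (Metric.mem_ball_self hκ)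
  have h2 := key (c + (r * 𝒯.meshSize / 2) • ν) (by
    rw [Metric.mem_ball, dist_eq_norm, add_sub_cancel_left, norm_smul, hν.1, mul_one,
      Real.norm_of_nonneg (by positivity)]
    linarith)
  rw [add_sub_right_comm, inner_add_left, h1, real_inner_smul_left, real_inner_self_eq_norm_sq,
    hν.1] at h2
  linarith

/-- The boundary parts of two elements overlap in a null set. -/
lemma surface_bdry_inter (h : 𝒯.IsMesh r) {i j : Fin 𝒯.card} (hij : i ≠ j) :
    surface n (𝒯.bdry i ∩ 𝒯.bdry j) = 0 := by
  obtain ⟨k, hk⟩ := 𝒯.exists_bary_eq_zero hij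
  obtain ⟨l, hl⟩ := 𝒯.exists_bary_eq_zero hij.symm
  have hreg := (ae_restrict_iff' isClosed_frontier.measurableSet).1 h.regular
  rw [measure_eq_zero_iff_ae_notMem]
  filter_upwards [hreg, measure_eq_zero_iff_ae_notMem.1 (surface_skeleton (𝒯.simplex i) h.dim_pos),
    measure_eq_zero_iff_ae_notMem.1 (surface_skeleton (𝒯.simplex j) h.dim_pos),
    measure_eq_zero_iff_ae_notMem.1 (surface_transversal h.isOpen (𝒯.simplex i) k),
    measure_eq_zero_iff_ae_notMem.1 (surface_transversal h.isOpen (𝒯.simplex j) l)]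
    with x hreg hsi hsj hti htj hx
  obtain ⟨⟨hxi, hxf⟩, ⟨hxj, -⟩⟩ := hx
  obtain ⟨ρ, hρ⟩ := hreg hxf
  have hN := hρ.isOuterNormal h.isOpen
  have hi := isOuterNormal_simplex_of_mem hxi (hk x hxi hxj) hsi
  have hj := isOuterNormal_simplex_of_mem hxj (hl x hxj hxi) hsj
  -- The point is one of tangency, and the wrong sign is excluded by `normal_ne_neg`. So both
  -- simplices share the normal of `M`.
  have ei : unitNormal ρ x = facetNormal (𝒯.simplex i) k := by
    by_contra hne
    refine hti ⟨hxf, hk x hxi hxj, ρ, hρ, hne, fun heq => ?_⟩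
    exact h.normal_ne_neg hxi hN Set.inter_subset_left (by rwa [heq, neg_neg])
  have ej : unitNormal ρ x = facetNormal (𝒯.simplex j) l := by
    by_contra hne
    refine htj ⟨hxf, hl x hxj hxi, ρ, hρ, hne, fun heq => ?_⟩
    exact h.normal_ne_neg hxj hN Set.inter_subset_left (by rwa [heq, neg_neg])
  rw [← ei] at hi
  rw [← ej] at hj
  -- A short step inwards then enters `M` and both simplices, hence the interiors of two distinct
  -- elements.
  have hw : inner ℝ (-unitNormal ρ x) (unitNormal ρ x) < 0 := by
    rw [inner_neg_left, real_inner_self_eq_norm_sq, hN.1]; norm_num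
  obtain ⟨t, ⟨h1, h2⟩, h3⟩ := (((hN.2 _).1 hw).and ((hi.2 _).1 hw) |>.and ((hj.2 _).1 hw)).exists
  have h1' := interior_mono (subset_closure (s := M)) h1
  have hmi : x + t • -unitNormal ρ x ∈ 𝒯.int i := by
    rw [int, elem, interior_inter]; exact ⟨h2, h1'⟩
  have hmj : x + t • -unitNormal ρ x ∈ 𝒯.int j := by
    rw [int, elem, interior_inter]; exact ⟨h3, h1'⟩
  exact Set.disjoint_left.1 (𝒯.disjoint_int hij) hmi hmj

end Triangulation.IsMesh

/-! ### Flat pieces of the boundary and vectors that are nearly normal. -/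

section NormalIdentification

variable {n : ℕ}

/-- A vector whose component is at most `H` in all directions near `ν` and almost `H` along `ν` is
close to `H ν`. Testing with `(4/5) ν + (3/5) u`, where `u` is the direction of the orthogonal part,
bounds that part by `H / 2`. So the direction of `G` itself is admissible, `‖G‖ ≤ H`, and expanding
the square gives `2 ε H²`. -/
lemma norm_sub_smul_sq_le {E : Type*} [NormedAddCommGroup E] [InnerProductSpace ℝ E] {G ν : E}
    {H ε : ℝ} (hν : ‖ν‖ = 1) (hH : 0 ≤ H) (hε : ε ≤ 1 / 8)
    (hG : ∀ d : E, ‖d‖ = 1 → 1 / 2 ≤ inner ℝ d ν → inner ℝ G d ≤ H)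
    (hGν : (1 - ε) * H ≤ inner ℝ G ν) : ‖G - H • ν‖ ^ 2 ≤ 2 * ε * H ^ 2 := by
  set a := inner ℝ G ν with ha
  set w := G - a • ν with hw
  have hνν : inner ℝ ν ν = 1 := by rw [real_inner_self_eq_norm_sq, hν]; norm_num
  have hwν : inner ℝ w ν = 0 := by
    rw [hw, inner_sub_left, real_inner_smul_left, hνν]; ring
  have hGw : inner ℝ G w = ‖w‖ ^ 2 := by
    have : G = w + a • ν := by rw [hw]; abel
    conv_lhs => rw [this]
    rw [inner_add_left, real_inner_smul_left, real_inner_comm w ν, hwν, real_inner_self_eq_norm_sq]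
    ring
  have hnG : ‖G‖ ^ 2 = a ^ 2 + ‖w‖ ^ 2 := by
    have : G = w + a • ν := by rw [hw]; abel
    rw [this, norm_add_sq_real, real_inner_smul_right, hwν, norm_smul, hν, mul_one,
      Real.norm_eq_abs, sq_abs]
    ring
  have ha0 : 7 / 8 * H ≤ a := by nlinarith
  have hwb : ‖w‖ ≤ 1 / 2 * H := by
    rcases eq_or_ne w 0 with h0 | h0
    · rw [h0, norm_zero]; positivity
    have hw0 : 0 < ‖w‖ := norm_pos_iff.2 h0
    set u := ‖w‖⁻¹ • w with hu
    have hu1 : ‖u‖ = 1 := by rw [hu, norm_smul, norm_inv, norm_norm, inv_mul_cancel₀ hw0.ne']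
    have huν : inner ℝ u ν = 0 := by rw [hu, real_inner_smul_left, hwν, mul_zero]
    have hd1 : ‖(4 / 5 : ℝ) • ν + (3 / 5 : ℝ) • u‖ = 1 := by
      have : ‖(4 / 5 : ℝ) • ν + (3 / 5 : ℝ) • u‖ ^ 2 = 1 := by
        rw [norm_add_sq_real, real_inner_smul_left, real_inner_smul_right, real_inner_comm, huν,
          norm_smul, norm_smul, hν, hu1]
        norm_num
      nlinarith [norm_nonneg ((4 / 5 : ℝ) • ν + (3 / 5 : ℝ) • u)]
    have h1 := hG _ hd1 (by
      rw [inner_add_left, real_inner_smul_left, real_inner_smul_left, huν, hνν]; norm_num)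
    have hGu : inner ℝ G u = ‖w‖ := by
      rw [hu, real_inner_smul_right, hGw, sq, inv_mul_cancel_left₀ hw0.ne']
    rw [inner_add_right, real_inner_smul_right, real_inner_smul_right, hGu] at h1
    linarith
  have hGH : ‖G‖ ≤ H := by
    rcases eq_or_ne G 0 with h0 | h0
    · rw [h0, norm_zero]; exact hH
    have hG0 : 0 < ‖G‖ := norm_pos_iff.2 h0
    have h1 := hG (‖G‖⁻¹ • G) (by rw [norm_smul, norm_inv, norm_norm, inv_mul_cancel₀ hG0.ne']) (by
      rw [real_inner_smul_left, ← ha, inv_mul_eq_div, le_div_iff₀ hG0]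
      have : ‖G‖ ≤ 2 * a := by
        have hw0 := norm_nonneg w
        refine abs_le_of_sq_le_sq' ?_ (by linarith) |>.2
        nlinarith
      linarith)
    rwa [real_inner_smul_right, real_inner_self_eq_norm_sq, sq, inv_mul_cancel_left₀ hG0.ne'] at h1
  rw [norm_sub_sq_real, real_inner_smul_right, ← ha, norm_smul, hν, mul_one, Real.norm_eq_abs,
    sq_abs]
  have : ‖G‖ ^ 2 ≤ H ^ 2 := by gcongr
  nlinarith

/-- Near a regular boundary point all directions close to the normal are transversal, and the
boundary is nearly flat. -/
lemma RegularAt.exists_ball {M : Set (SpaceTime n)} {x : SpaceTime n} {ρ : SpaceTime n → ℝ}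
    (h : RegularAt M x ρ) (hM : IsOpen M) {τ : ℝ} (hτ : 0 < τ) (hτ' : τ < 1 / 2) :
    ∃ δ, 0 < δ ∧ (∀ d, 1 / 2 ≤ inner ℝ d (unitNormal ρ x) → ‖d‖ = 1 →
        Transversal M (Metric.ball x δ) d) ∧
      ∀ y ∈ frontier M ∩ Metric.ball x δ, ∀ z ∈ frontier M ∩ Metric.ball x δ,
        dist y z ≤ (1 + τ) * dist (projAlong (unitNormal ρ x) y) (projAlong (unitNormal ρ x) z) := by
  set ν := unitNormal ρ x with hν
  have hν1 : ‖ν‖ = 1 := h.norm_unitNormal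
  set Λ := ‖fderiv ℝ ρ x‖ with hΛ
  have hΛ0 : 0 < Λ := h.norm_pos
  have hf : ∀ w, fderiv ℝ ρ x w = Λ * inner ℝ w ν := fun w => by
    rw [hν, inner_unitNormal, mul_inv_cancel_left₀ hΛ0.ne']
  -- With this tolerance the deviation of `ρ` from its linearisation corresponds to a slope of at
  -- most `τ`, less than the slope `1 / 2` of the admissible directions.
  have hs := (h.contDiff.hasStrictFDerivAt (by simp)).isLittleO.def (c := τ * Λ) (by positivity)
  rw [nhds_prod_eq] at hs
  obtain ⟨U, hU, hUU⟩ := mem_prod_same_iff.1 hs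
  obtain ⟨δ, hδ, hball⟩ := Metric.mem_nhds_iff.1 (inter_mem hU (inter_mem h.mem_iff
    (inter_mem h.eventually_notMem_closure (h.eventually_frontier hM))))
  have hstrict : ∀ y ∈ Metric.ball x δ, ∀ z ∈ Metric.ball x δ,
      |ρ y - ρ z - Λ * inner ℝ (y - z) ν| ≤ τ * Λ * ‖y - z‖ := by
    intro y hy z hz
    have h1 : ‖ρ y - ρ z - fderiv ℝ ρ x (y - z)‖ ≤ τ * Λ * ‖y - z‖ :=
      hUU (Set.mk_mem_prod (hball hy).1 (hball hz).1)
    rwa [hf, Real.norm_eq_abs] at h1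
  have hzero : ∀ y ∈ frontier M ∩ Metric.ball x δ, ρ y = 0 := fun y hy =>
    ((hball hy.2).2.2.2 hy.1).zero
  refine ⟨δ, hδ, fun d hd hd1 y hy s hs => ⟨fun hB => ?_, fun hB => ?_⟩, fun y hy z hz => ?_⟩
  · have hiff : y - s • d ∈ M ↔ ρ (y - s • d) < 0 := (hball hB).2.1
    rw [hM.interior_eq, hiff]
    have h1 := (abs_le.1 (hstrict _ hB y hy.2)).2
    have e : y - s • d - y = (-s) • d := by module
    rw [hzero y hy, e, real_inner_smul_left, norm_smul, hd1, norm_neg, Real.norm_of_nonneg hs.le] at h1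
    have h2 : Λ * s * τ < Λ * s * inner ℝ d ν := by
      apply mul_lt_mul_of_pos_left _ (by positivity); linarith
    linarith
  · refine (hball hB).2.2.1 ?_
    have h1 := (abs_le.1 (hstrict _ hB y hy.2)).1
    have e : y + s • d - y = s • d := by module
    rw [hzero y hy, e, real_inner_smul_left, norm_smul, hd1, Real.norm_of_nonneg hs.le] at h1
    have h2 : Λ * s * τ < Λ * s * inner ℝ d ν := by
      apply mul_lt_mul_of_pos_left _ (by positivity); linarith
    linarith
  · have h1 := hstrict y hy.2 z hz.2
    rw [hzero y hy, hzero z hz, sub_self, zero_sub, abs_neg, abs_mul, abs_of_pos hΛ0] at h1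
    have h2 : |inner ℝ (y - z) ν| ≤ τ * ‖y - z‖ := by
      rw [mul_comm τ, mul_assoc] at h1
      exact le_of_mul_le_mul_left h1 hΛ0
    have h3 := norm_sq_line hν1 (y - z)
    rw [dist_eq_norm, dist_eq_norm, ← map_sub]
    set N := ‖y - z‖
    have hN0 : 0 ≤ N := norm_nonneg _
    set q := ‖projAlong ν (y - z)‖ with hq
    have hq0 : 0 ≤ q := norm_nonneg _
    have h4 : inner ℝ ν (y - z) ^ 2 ≤ τ ^ 2 * N ^ 2 := by
      rw [real_inner_comm, ← sq_abs, ← mul_pow]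
      gcongr
    refine abs_le_of_sq_le_sq' ?_ (by positivity) |>.2
    have h5 : (1 - τ ^ 2) * N ^ 2 ≤ q ^ 2 := by linarith
    -- True for `τ < 1 / 2`; it converts the flatness bound `(1 - τ²) N² ≤ q²` into the Lipschitz
    -- constant `1 + τ`.
    have h6 : 1 ≤ (1 + τ) ^ 2 * (1 - τ ^ 2) := by
      have t2 : τ * τ ≤ 1 / 4 := by nlinarith
      have t3 : τ * τ * τ ≤ 1 / 4 * τ := mul_le_mul_of_nonneg_right t2 hτ.le
      have t4 : τ * τ * τ * τ ≤ 1 / 4 * τ * τ := mul_le_mul_of_nonneg_right t3 hτ.le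
      nlinarith
    calc N ^ 2 ≤ (1 + τ) ^ 2 * (1 - τ ^ 2) * N ^ 2 := by nlinarith [sq_nonneg N]
      _ = (1 + τ) ^ 2 * ((1 - τ ^ 2) * N ^ 2) := by ring
      _ ≤ (1 + τ) ^ 2 * q ^ 2 := by gcongr
      _ = ((1 + τ) * q) ^ 2 := by ring

end NormalIdentification

/-! ### Smooth test functions and the flux near a regular boundary point. -/

section SmoothTests

variable {n : ℕ}

open Manifold in
/-- The integral of `f` over a compact set is a limit of integrals against smooth functions. -/
lemma exists_smooth_tendsto_setIntegral {μ : Measure (SpaceTime n)} {f : SpaceTime n → ℝ}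
    (hf : Integrable f μ) {U s : Set (SpaceTime n)} (hU : IsOpen U) (hs : IsCompact s)
    (hsU : s ⊆ U) :
    ∃ g : ℕ → SpaceTime n → ℝ, (∀ k, ContDiff ℝ ∞ (g k)) ∧ (∀ k, HasCompactSupport (g k)) ∧
      (∀ k, tsupport (g k) ⊆ U) ∧ (∀ k x, 0 ≤ g k x) ∧
      Tendsto (fun k => ∫ x, f x * g k x ∂μ) atTop (𝓝 (∫ x in s, f x ∂μ)) := by
  obtain ⟨δ, hδ, hδU⟩ := hs.exists_cthickening_subset_open hU hsU
  obtain ⟨u, -, u_pos, u_lim⟩ : ∃ u : ℕ → ℝ, StrictAnti u ∧ (∀ k, u k ∈ Set.Ioo 0 δ) ∧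
    Tendsto u atTop (𝓝 0) := exists_seq_strictAnti_tendsto' hδ
  have hex : ∀ k, ∃ g : SpaceTime n → ℝ, Function.support g = Metric.thickening (u k) s ∧
      ContDiff ℝ ∞ g ∧ Set.range g ⊆ Set.Icc 0 1 ∧ ∀ x ∈ s, g x = 1 := by
    intro k
    rcases exists_contMDiff_support_eq_eq_one_iff 𝓘(ℝ, SpaceTime n) Metric.isOpen_thickening
      hs.isClosed (Metric.self_subset_thickening (u_pos k).1 s) with
      ⟨g, g_smooth, g_range, g_supp, hg⟩
    exact ⟨g, g_supp, g_smooth.contDiff, g_range, fun x hx => (hg x).1 hx⟩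
  choose g g_supp g_diff g_range hg using hex
  have hts : ∀ k, tsupport (g k) ⊆ Metric.cthickening δ s := fun k => by
    rw [tsupport, g_supp]
    exact (Metric.closure_thickening_subset_cthickening _ _).trans
      (Metric.cthickening_mono (u_pos k).2.le s)
  have hr : ∀ k x, g k x ∈ Set.Icc (0 : ℝ) 1 := fun k x => g_range k (Set.mem_range_self x)
  refine ⟨g, g_diff, fun k => ?_, fun k => (hts k).trans hδU, fun k x => (hr k x).1, ?_⟩
  · exact hs.cthickening.of_isClosed_subset (isClosed_tsupport _) (hts k)
  rw [← integral_indicator hs.measurableSet]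
  refine tendsto_integral_of_dominated_convergence (fun x => ‖f x‖)
    (fun k => hf.1.mul (g_diff k).continuous.aestronglyMeasurable) hf.norm
    (fun k => ae_of_all _ fun x => ?_) (ae_of_all _ fun x => ?_)
  · rw [norm_mul, Real.norm_of_nonneg (hr k x).1]
    exact mul_le_of_le_one_right (norm_nonneg _) (hr k x).2
  · by_cases hxs : x ∈ s
    · have : ∀ k, g k x = 1 := fun k => hg k x hxs
      simp [this, Set.indicator_of_mem hxs f]
    · rw [Set.indicator_of_notMem hxs f]
      apply tendsto_const_nhds.congr'
      obtain ⟨ε, εpos, hε⟩ : ∃ ε, 0 < ε ∧ x ∉ Metric.thickening ε s := by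
        rw [← hs.isClosed.closure_eq, Metric.closure_eq_iInter_thickening s] at hxs
        simpa using hxs
      filter_upwards [(tendsto_order.1 u_lim).2 _ εpos] with k hk
      have : g k x = 0 := by
        rw [← Function.notMem_support, g_supp]
        exact fun h => hε (Metric.thickening_mono hk.le s h)
      rw [this, mul_zero]

/-- If `f` were negative on a subset of `U` of positive measure, inner regularity would give a
compact such set, whose indicator is a limit of admissible test functions. -/
lemma ae_nonneg_of_integral_smooth {μ : Measure (SpaceTime n)} [IsFiniteMeasure μ]
    {f : SpaceTime n → ℝ} (hf : Integrable f μ) {U : Set (SpaceTime n)} (hU : IsOpen U)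
    (h : ∀ φ : SpaceTime n → ℝ, ContDiff ℝ ∞ φ → HasCompactSupport φ → tsupport φ ⊆ U →
      (∀ x, 0 ≤ φ x) → 0 ≤ ∫ x, f x * φ x ∂μ) : ∀ᵐ x ∂μ, x ∈ U → 0 ≤ f x := by
  obtain ⟨f', hf'm, hff'⟩ := hf.1
  have hK : ∀ s ⊆ U, IsCompact s → 0 ≤ ∫ x in s, f x ∂μ := by
    intro s hsU hs
    obtain ⟨g, h1, h2, h3, h4, hlim⟩ := exists_smooth_tendsto_setIntegral hf hU hs hsU
    exact ge_of_tendsto' hlim fun k => h _ (h1 k) (h2 k) (h3 k) (h4 k)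
  have hnull : μ ({x | f' x < 0} ∩ U) = 0 := by
    by_contra hne
    have hmeas : MeasurableSet ({x | f' x < 0} ∩ U) :=
      (hf'm.measurable measurableSet_Iio).inter hU.measurableSet
    obtain ⟨s, hsub, hs, hpos⟩ := hmeas.exists_lt_isCompact (pos_iff_ne_zero.2 hne)
    have h1 := hK s (fun x hx => (hsub hx).2) hs
    have h2 : ∫ x in s, f x ∂μ = ∫ x in s, f' x ∂μ :=
      integral_congr_ae (ae_restrict_of_ae hff')
    have h3 : 0 ≤ᵐ[μ.restrict s] fun x => -f' x := by
      filter_upwards [ae_restrict_mem hs.measurableSet] with x hx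
      have : f' x < 0 := (hsub hx).1
      simp only [Pi.zero_apply]; linarith
    have hint : Integrable (fun x => -f' x) (μ.restrict s) := ((hf.congr hff').restrict).neg
    have h4 : ∫ x in s, -f' x ∂μ = 0 := by
      refine le_antisymm ?_ (integral_nonneg_of_ae h3)
      rw [integral_neg]; linarith
    have h5 := (integral_eq_zero_iff_of_nonneg_ae h3 hint).1 h4
    have h6 : ∀ᵐ x ∂μ.restrict s, False := by
      filter_upwards [h5, ae_restrict_mem hs.measurableSet] with x hx hxs
      have h7 : f' x < 0 := (hsub hxs).1
      simp only [Pi.zero_apply] at hx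
      linarith
    rw [eventually_false_iff_eq_bot, ae_eq_bot, Measure.restrict_eq_zero] at h6
    exact hpos.ne' h6
  filter_upwards [hff', measure_eq_zero_iff_ae_notMem.1 hnull] with x hx hx' hxU
  rw [hx]
  by_contra! hcon
  exact hx' ⟨hcon, hxU⟩

/-- Near a regular boundary point the flux through the boundary is nearly that of the normal. -/
lemma RegularAt.exists_flux_near {M : Set (SpaceTime n)} {x : SpaceTime n} {ρ : SpaceTime n → ℝ}
    (h : RegularAt M x ρ) (hM : IsOpen M) (hfin : surface n (frontier M) < ⊤) {η : ℝ} (hη : 0 < η) :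
    ∃ δ, 0 < δ ∧ ∀ φ : SpaceTime n → ℝ, ContDiff ℝ ∞ φ → HasCompactSupport φ →
      tsupport φ ⊆ Metric.ball x δ → (∀ y, 0 ≤ φ y) → ∀ j,
      |(∫ y in M, fderiv ℝ φ y (unitVec j)) -
          unitNormal ρ x j * ∫ y in frontier M, φ y ∂(surface n)| ≤
        η * ∫ y in frontier M, φ y ∂(surface n) := by
  set ν := unitNormal ρ x with hν
  have hν1 : ‖ν‖ = 1 := h.norm_unitNormal
  -- The bound `2 ε H²` of `norm_sub_smul_sq_le` has to be at most `η² H²`.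
  obtain ⟨ε, hε0, hε, hε2⟩ : ∃ ε : ℝ, 0 < ε ∧ ε ≤ 1 / 8 ∧ 2 * ε ≤ η ^ 2 := by
    refine ⟨min (1 / 8) (η ^ 2 / 2), by positivity, min_le_left _ _, ?_⟩
    have := min_le_right (1 / 8 : ℝ) (η ^ 2 / 2)
    linarith
  -- The factor `(1 + τ) ^ n` bounds the loss of area when the nearly flat piece of boundary is
  -- projected along its normal; it must not exceed `1 / (1 - ε)`.
  obtain ⟨τ, hτ0, hτ, hτn⟩ : ∃ τ : ℝ, 0 < τ ∧ τ < 1 / 2 ∧ (1 - ε) * (1 + τ) ^ n ≤ 1 := by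
    have hlim : Tendsto (fun τ : ℝ => (1 - ε) * (1 + τ) ^ n) (𝓝[>] 0) (𝓝 (1 - ε)) := by
      have hc : Continuous fun τ : ℝ => (1 - ε) * (1 + τ) ^ n := by fun_prop
      have := hc.tendsto 0
      simp only [add_zero, one_pow, mul_one] at this
      exact this.mono_left nhdsWithin_le_nhds
    obtain ⟨τ, h1, h2⟩ := ((hlim.eventually (gt_mem_nhds (by linarith : 1 - ε < 1))).and
      (Ioo_mem_nhdsGT (by norm_num : (0 : ℝ) < 1 / 2))).exists
    exact ⟨τ, h2.1, h2.2, h1.le⟩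
  obtain ⟨δ, hδ, hT, hL⟩ := h.exists_ball hM hτ0 hτ
  refine ⟨δ, hδ, fun φ hφ hc hsupp hpos j => ?_⟩
  have hφ1 : ContDiff ℝ 1 φ := hφ.of_le (by norm_cast)
  set H := ∫ y in frontier M, φ y ∂(surface n) with hH
  have hH0 : 0 ≤ H := integral_nonneg hpos
  have hfm : IsFiniteMeasure ((surface n).restrict (frontier M)) :=
    ⟨by rw [Measure.restrict_apply_univ]; exact hfin⟩
  have hHl : ∫⁻ y in frontier M ∩ Metric.ball x δ, ENNReal.ofReal (φ y) ∂(surface n) =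
      ENNReal.ofReal H := by
    have hint : Integrable φ ((surface n).restrict (frontier M)) := by
      obtain ⟨C, hC⟩ := hc.exists_bound_of_continuous hφ.continuous
      exact Integrable.of_bound hφ.continuous.aestronglyMeasurable C (ae_of_all _ hC)
    rw [hH, ofReal_integral_eq_lintegral_ofReal hint (ae_of_all _ hpos), Set.inter_comm,
      ← Measure.restrict_restrict Metric.isOpen_ball.measurableSet]
    refine setLIntegral_eq_of_support_subset ?_
    intro y hy
    refine hsupp (subset_tsupport _ ?_)
    intro h0
    simp [h0] at hy
  have hGd : ∀ d : SpaceTime n, ‖d‖ = 1 → 1 / 2 ≤ inner ℝ d ν →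
      |∫ y in M, fderiv ℝ φ y d| ≤ H := by
    intro d hd hdν
    have h1 := enorm_integral_fderiv_le hM.measurableSet (convex_ball x δ)
      Metric.isOpen_ball.measurableSet hd (hT d hdν hd) hφ1 hc hsupp
    have e : ∀ y, ‖φ y‖ₑ = ENNReal.ofReal (φ y) := fun y => by
      rw [← ofReal_norm, Real.norm_of_nonneg (hpos y)]
    simp_rw [e] at h1
    rw [hHl, ← ofReal_norm, ENNReal.ofReal_le_ofReal_iff hH0] at h1
    exact h1
  -- The vector of the fluxes in all coordinate directions. Its component along a unit vector close
  -- to the normal is at most `H`, and along the normal it is at least `(1 - ε) H`.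
  set G : SpaceTime n := WithLp.toLp 2 fun j => ∫ y in M, fderiv ℝ φ y (unitVec j) with hG
  have hGin : ∀ d : SpaceTime n, inner ℝ G d = ∫ y in M, fderiv ℝ φ y d := by
    intro d
    have hv : d = ∑ i, d i • unitVec i := by
      ext j
      simp [unitVec, Finset.sum_apply, Pi.single_apply]
    have e : ∀ y, fderiv ℝ φ y d = ∑ i, d i * fderiv ℝ φ y (unitVec i) := fun y => by
      conv_lhs => rw [hv]
      rw [map_sum]
      simp
    simp_rw [e]
    rw [integral_finsetSum _ fun i _ =>
      ((integrable_fderiv_apply hφ1 hc (unitVec i)).restrict).const_mul _]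
    simp_rw [integral_const_mul]
    rw [PiLp.inner_apply]
    simp [hG]
  have hνν : inner ℝ ν ν = 1 := by rw [real_inner_self_eq_norm_sq, hν1]; norm_num
  have hlow : (1 - ε) * H ≤ inner ℝ G ν := by
    have hup := hGd ν hν1 (by rw [hνν]; norm_num)
    rw [hGin]
    have h1 := lintegral_le_integral_fderiv hM.measurableSet (convex_ball x δ)
      Metric.isOpen_ball.measurableSet hν1 (hT ν (by rw [hνν]; norm_num) hν1) hφ1 hc hsupp hpos
      (L := (1 + τ).toNNReal) (by rwa [Real.coe_toNNReal _ (by linarith)])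
    rw [hHl] at h1
    set a := ∫ y in M, fderiv ℝ φ y ν
    rcases le_or_gt 0 a with ha | ha
    · have h2 : H ≤ (1 + τ) ^ n * a := by
        change _ ≤ ENNReal.ofReal (1 + τ) ^ n * _ at h1
        rw [← ENNReal.ofReal_pow (by linarith), ← ENNReal.ofReal_mul (by positivity)] at h1
        exact (ENNReal.ofReal_le_ofReal_iff (by positivity)).1 h1
      calc (1 - ε) * H ≤ (1 - ε) * ((1 + τ) ^ n * a) := by
            apply mul_le_mul_of_nonneg_left h2; linarith
        _ = ((1 - ε) * (1 + τ) ^ n) * a := by ring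
        _ ≤ 1 * a := by gcongr
        _ = a := one_mul a
    · rw [ENNReal.ofReal_of_nonpos ha.le, mul_zero, nonpos_iff_eq_zero, ENNReal.ofReal_eq_zero] at h1
      have h3 := abs_pos.2 ha.ne
      linarith
  have hfinal := norm_sub_smul_sq_le hν1 hH0 hε
    (fun d hd hdν => by rw [hGin]; exact (le_abs_self _).trans (hGd d hd hdν)) hlow
  have hcomp : |G j - ν j * H| ≤ ‖G - H • ν‖ := by
    have := PiLp.norm_apply_le (p := 2) (G - H • ν) j
    simpa [mul_comm] using this
  refine hcomp.trans (abs_le_of_sq_le_sq' ?_ (by positivity)).2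
  calc ‖G - H • ν‖ ^ 2 ≤ 2 * ε * H ^ 2 := hfinal
    _ ≤ η ^ 2 * H ^ 2 := by gcongr
    _ = (η * H) ^ 2 := by ring

end SmoothTests

/-! ### The Gauss–Green formula on a mesh. -/

namespace Triangulation.IsMesh

variable {n : ℕ} {M : Set (SpaceTime n)} {𝒯 : Triangulation M} {r : ℝ}

lemma surface_frontier_elem_lt_top (h : 𝒯.IsMesh r) (i : Fin 𝒯.card) :
    surface n (frontier (𝒯.elem i)) < ⊤ := by
  obtain ⟨c, hc⟩ := h.star i
  exact hc.surface_frontier_lt_top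

lemma surface_frontier_lt_top (h : 𝒯.IsMesh r) : surface n (frontier M) < ⊤ := by
  rw [frontier_eq_iUnion_bdry 𝒯]
  refine (measure_iUnion_le _).trans_lt ?_
  rw [tsum_fintype]
  exact ENNReal.sum_lt_top.2 fun i _ =>
    (measure_mono (h.bdry_subset i)).trans_lt (h.surface_frontier_elem_lt_top i)

/-- The Gauss–Green formula on the elements of a mesh: the fluxes through the interior faces
cancel, and on the boundary they are given by the outward normal. -/
theorem exists_flux (h : 𝒯.IsMesh r) : ∃ b : Fin 𝒯.card → Fin (n + 1) → SpaceTime n → ℝ,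
    (∀ i j, MemLp (b i j) 2 ((surface n).restrict (frontier (𝒯.elem i)))) ∧
    (∀ i j (φ : SpaceTime n → ℝ), ContDiff ℝ ∞ φ →
      ∫ y in 𝒯.int i, fderiv ℝ φ y (unitVec j) =
        ∫ y in frontier (𝒯.elem i), b i j y * φ y ∂(surface n)) ∧
    (∀ j, ∀ᵐ x ∂(surface n).restrict M,
      ∑ i, (frontier (𝒯.elem i)).indicator (b i j) x = 0) ∧
    (∀ i j, ∀ᵐ x ∂(surface n).restrict (𝒯.bdry i), b i j x = outerNormal M x j) := by
  have hflux : ∀ i j, ∃ b : SpaceTime n → ℝ, MemLp b 2 ((surface n).restrict (frontier (𝒯.elem i))) ∧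
      ∀ φ : SpaceTime n → ℝ, ContDiff ℝ ∞ φ → ∫ y in 𝒯.int i, fderiv ℝ φ y (unitVec j) =
        ∫ y in frontier (𝒯.elem i), b y * φ y ∂(surface n) := fun i j => by
    obtain ⟨c, hc⟩ := h.star i
    exact hc.exists_flux j
  choose b hb hgauss using hflux
  have hfin : ∀ i, IsFiniteMeasure ((surface n).restrict (frontier (𝒯.elem i))) := fun i =>
    ⟨by rw [Measure.restrict_apply_univ]; exact h.surface_frontier_elem_lt_top i⟩
  have hfinM : IsFiniteMeasure ((surface n).restrict (frontier M)) :=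
    ⟨by rw [Measure.restrict_apply_univ]; exact h.surface_frontier_lt_top⟩
  have hmf : ∀ i, MeasurableSet (frontier (𝒯.elem i)) := fun i => isClosed_frontier.measurableSet
  -- The total flux density: the densities of the elements, extended by zero and added. It is the
  -- flux density of `M` itself.
  set B : Fin (n + 1) → SpaceTime n → ℝ := fun j x =>
    ∑ i, (frontier (𝒯.elem i)).indicator (b i j) x with hB
  have hbi : ∀ i j, Integrable ((frontier (𝒯.elem i)).indicator (b i j)) (surface n) := fun i j =>
    (integrable_indicator_iff (hmf i)).2 ((hb i j).integrable (by norm_num))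
  have hBi : ∀ j, Integrable (B j) (surface n) := fun j =>
    integrable_finsetSum _ fun i _ => hbi i j
  have hBgauss : ∀ j (φ : SpaceTime n → ℝ), ContDiff ℝ ∞ φ → HasCompactSupport φ →
      ∫ y in M, fderiv ℝ φ y (unitVec j) = ∫ y, B j y * φ y ∂(surface n) := by
    intro j φ hφ hc
    obtain ⟨C, hC⟩ := hc.exists_bound_of_continuous hφ.continuous
    have hd := integrable_fderiv_apply (hφ.of_le (by norm_cast)) hc (unitVec j)
    rw [h.restrict_volume, integral_finsetSum_measure fun i _ => hd.restrict]
    simp_rw [hgauss _ j φ hφ, hB, Finset.sum_mul]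
    rw [integral_finsetSum _ fun i _ => (hbi i j).mul_bdd (c := C)
      hφ.continuous.aestronglyMeasurable (ae_of_all _ hC)]
    refine Finset.sum_congr rfl fun i _ => ?_
    rw [← integral_indicator (hmf i)]
    congr 1 with x
    by_cases hx : x ∈ frontier (𝒯.elem i) <;> simp [hx]
  -- For a test function with compact support in `M` the total flux is the integral of a derivative
  -- over the whole space, which is zero.
  have hBM : ∀ j, ∀ᵐ x ∂(surface n), x ∈ M → B j x = 0 := by
    intro j
    refine h.isOpen.ae_eq_zero_of_integral_contDiff_smul_eq_zero
      ((hBi j).locallyIntegrable.locallyIntegrableOn _) fun φ hφ hc hsupp => ?_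
    have h1 := hBgauss j φ hφ hc
    have h2 : ∫ y in M, fderiv ℝ φ y (unitVec j) = ∫ y, fderiv ℝ φ y (unitVec j) := by
      refine setIntegral_eq_integral_of_forall_compl_eq_zero fun y hy => ?_
      rw [fderiv_eq_zero_of_notMem hsupp hy]
      rfl
    rw [h2, integral_fderiv_eq_zero_of_compactSupport (hφ.of_le (by norm_cast)) hc j] at h1
    simp_rw [smul_eq_mul, mul_comm (φ _)]
    exact h1.symm
  have hBout : ∀ j x, x ∉ closure M → B j x = 0 := fun j x hx =>
    Finset.sum_eq_zero fun i _ => Set.indicator_of_notMem (fun hx' => hx (𝒯.elem_subset i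
      ((𝒯.isClosed_elem i).frontier_subset hx'))) _
  have hBfr : ∀ j (φ : SpaceTime n → ℝ), ∫ y, B j y * φ y ∂(surface n) =
      ∫ y in frontier M, B j y * φ y ∂(surface n) := by
    intro j φ
    rw [← integral_indicator isClosed_frontier.measurableSet]
    refine integral_congr_ae ?_
    filter_upwards [hBM j] with x hx
    by_cases hxf : x ∈ frontier M
    · rw [Set.indicator_of_mem hxf]
    rw [Set.indicator_of_notMem hxf]
    by_cases hxM : x ∈ M
    · rw [hx hxM, zero_mul]
    · rw [hBout j x, zero_mul]
      intro hcl
      exact hxf (h.isOpen.frontier_eq ▸ ⟨hcl, hxM⟩)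
  have hmain : ∀ j, ∀ᵐ x ∂(surface n).restrict (frontier M), B j x = outerNormal M x j := by
    intro j
    -- One half of the tolerance is the error of the flux compared with the normal at a fixed point,
    -- the other half is the variation of the normal near that point.
    have key : ∀ k : ℕ, ∀ᵐ x ∂(surface n).restrict (frontier M),
        |B j x - outerNormal M x j| ≤ 2 * (1 / ((k : ℝ) + 1)) := by
      intro k
      set η : ℝ := 1 / ((k : ℝ) + 1)
      have hη : 0 < η := by positivity
      set R := {x | x ∈ frontier M ∧ ∃ ρ, RegularAt M x ρ}
      have hRnull : (surface n).restrict (frontier M)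
          {x | x ∈ R ∧ ¬|B j x - outerNormal M x j| ≤ 2 * η} = 0 := by
        refine measure_null_of_locally_null _ fun x hx => ?_
        obtain ⟨⟨hxf, ρ, hρ⟩, -⟩ := hx
        obtain ⟨δ, hδ, hnear⟩ := hρ.exists_flux_near h.isOpen h.surface_frontier_lt_top hη
        have hνc : ContinuousAt (fun y => unitNormal ρ y j) x := by
          have h1 : ContinuousAt (fderiv ℝ ρ) x :=
            (hρ.contDiff.fderiv_right (m := 0) (by simp)).continuousAt
          have h2 : ContinuousAt (fun y =>
              (InnerProductSpace.toDual ℝ (SpaceTime n)).symm (fderiv ℝ ρ y)) x :=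
            (InnerProductSpace.toDual ℝ (SpaceTime n)).symm.continuous.continuousAt.comp h1
          have h3 : ContinuousAt (unitNormal ρ) x :=
            (h2.norm.inv₀ (by simpa using hρ.ne_zero)).smul h2
          exact (EuclideanSpace.proj (𝕜 := ℝ) j).continuous.continuousAt.comp h3
        have hev := hνc.eventually (Metric.ball_mem_nhds _ hη)
        have hB1 : ∀ᵐ y ∂(surface n).restrict (frontier M), y ∈ Metric.ball x δ →
            |B j y - unitNormal ρ x j| ≤ η := by
          have hBr := (hBi j).restrict (s := frontier M)
          have hsgn : ∀ σ : ℝ, |σ| = 1 → ∀ᵐ y ∂(surface n).restrict (frontier M),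
              y ∈ Metric.ball x δ → 0 ≤ η - σ * (B j y - unitNormal ρ x j) := by
            intro σ hσ
            refine ae_nonneg_of_integral_smooth ((integrable_const η).sub
              ((hBr.sub (integrable_const _)).const_mul σ)) Metric.isOpen_ball
              fun φ hφ hc hsupp hpos => ?_
            obtain ⟨C, hC⟩ := hc.exists_bound_of_continuous hφ.continuous
            have hφi : Integrable φ ((surface n).restrict (frontier M)) :=
              Integrable.of_bound hφ.continuous.aestronglyMeasurable C (ae_of_all _ hC)
            have hBφ : Integrable (fun y => B j y * φ y) ((surface n).restrict (frontier M)) :=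
              hBr.mul_bdd (c := C) hφ.continuous.aestronglyMeasurable (ae_of_all _ hC)
            have h1 := hnear φ hφ hc hsupp hpos j
            rw [hBgauss j φ hφ hc, hBfr] at h1
            set H := ∫ y in frontier M, φ y ∂(surface n)
            have e : ∫ y in frontier M, (η - σ * (B j y - unitNormal ρ x j)) * φ y ∂(surface n) =
                η * H - σ * ((∫ y in frontier M, B j y * φ y ∂(surface n)) -
                  unitNormal ρ x j * H) := by
              have e1 : ∀ y, (η - σ * (B j y - unitNormal ρ x j)) * φ y =
                  η * φ y - σ * (B j y * φ y - unitNormal ρ x j * φ y) := fun y => by ring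
              simp_rw [e1]
              have hD : Integrable (fun y => B j y * φ y - unitNormal ρ x j * φ y)
                ((surface n).restrict (frontier M)) := hBφ.sub (hφi.const_mul _)
              rw [integral_sub (hφi.const_mul _) (hD.const_mul _),
                integral_const_mul, integral_const_mul, integral_sub hBφ (hφi.const_mul _),
                integral_const_mul]
            change 0 ≤ ∫ y in frontier M, (η - σ * (B j y - unitNormal ρ x j)) * φ y ∂(surface n)
            rw [e]
            have h2 := le_abs_self (σ * ((∫ y in frontier M, B j y * φ y ∂(surface n)) -
                  unitNormal ρ x j * H))
            rw [abs_mul, hσ, one_mul] at h2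
            linarith
          filter_upwards [hsgn 1 (by simp), hsgn (-1) (by simp)] with y h1 h2 hy
          rw [abs_le]
          constructor
          · linarith [h2 hy]
          · linarith [h1 hy]
        refine ⟨{y | y ∈ Metric.ball x δ ∧ y ∈ frontier M ∧
          RegularAt M y ρ ∧ unitNormal ρ y j ∈ Metric.ball (unitNormal ρ x j) η ∧
            ¬|B j y - outerNormal M y j| ≤ 2 * η}, ?_, ?_⟩
        · filter_upwards [self_mem_nhdsWithin, mem_nhdsWithin_of_mem_nhds hev,
            mem_nhdsWithin_of_mem_nhds (hρ.eventually_frontier h.isOpen),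
            mem_nhdsWithin_of_mem_nhds (Metric.ball_mem_nhds x hδ)] with y hy h1 h2 h3
          exact ⟨h3, hy.1.1, h2 hy.1.1, h1, hy.2⟩
        · rw [measure_eq_zero_iff_ae_notMem]
          filter_upwards [hB1] with y hy1 hy
          obtain ⟨h1, h2, h3, h4, h5⟩ := hy
          refine h5 ?_
          rw [(h3.isOuterNormal h.isOpen).outerNormal_eq]
          have h6 := hy1 h1
          have h7 : |unitNormal ρ y j - unitNormal ρ x j| < η := h4
          have e : B j y - unitNormal ρ y j = (B j y - unitNormal ρ x j) -
            (unitNormal ρ y j - unitNormal ρ x j) := by ring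
          change |B j y - unitNormal ρ y j| ≤ _
          rw [e]
          exact (abs_sub _ _).trans (by linarith)
      filter_upwards [h.regular, ae_restrict_mem isClosed_frontier.measurableSet,
        measure_eq_zero_iff_ae_notMem.1 hRnull] with x h1 h2 h3
      by_contra hcon
      exact h3 ⟨⟨h2, h1⟩, hcon⟩
    filter_upwards [ae_all_iff.2 key] with x hx
    have hlim : Tendsto (fun k : ℕ => 2 * (1 / ((k : ℝ) + 1))) atTop (𝓝 0) := by
      simpa using tendsto_one_div_add_atTop_nhds_zero_nat.const_mul (2 : ℝ)
    have := ge_of_tendsto' hlim hx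
    exact sub_eq_zero.1 (abs_nonpos_iff.1 this)
  refine ⟨b, hb, hgauss, fun j => ?_, fun i j => ?_⟩
  · rw [ae_restrict_iff' h.isOpen.measurableSet]
    exact hBM j
  -- Almost every boundary point belongs to a single element, so that the sum reduces there to one
  -- density.
  · have hov : ∀ᵐ x ∂(surface n), ∀ k, k ≠ i → x ∉ 𝒯.bdry k ∩ 𝒯.bdry i := by
      refine ae_all_iff.2 fun k => ?_
      by_cases hk : k = i
      · simp [hk]
      · filter_upwards [measure_eq_zero_iff_ae_notMem.1 (h.surface_bdry_inter hk)] with x hx _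
        exact hx
    have h1 := ae_restrict_of_ae_restrict_of_subset
      (show 𝒯.bdry i ⊆ frontier M from Set.inter_subset_right) (hmain j)
    filter_upwards [h1, ae_restrict_of_ae hov, ae_restrict_mem (𝒯.measurableSet_bdry i)]
      with x hx hx' hxi
    rw [← hx]
    simp only [hB]
    rw [Finset.sum_eq_single i]
    · rw [Set.indicator_of_mem (h.bdry_subset i hxi)]
    · intro k _ hk
      refine Set.indicator_of_notMem (fun hxk => hx' k hk ⟨⟨?_, hxi.2⟩, hxi⟩) _
      exact (𝒯.isClosed_elem k).frontier_subset hxk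
    · simp

end Triangulation.IsMesh

/-! ### Locality of traces and integration by parts. -/

section LocalTraces

variable {n : ℕ}

lemma tendsto_eLpNorm_cutoff_mul {U V : Set (SpaceTime n)} (hV : MeasurableSet V)
    {χ : SpaceTime n → ℝ} (hχ : Continuous χ) (hc : HasCompactSupport χ) (hsupp : tsupport χ ⊆ V)
    {f : ℕ → SpaceTime n → ℝ}
    (h : Tendsto (fun k => eLpNorm (f k) 2 (volume.restrict (U ∩ V))) atTop (𝓝 0)) :
    Tendsto (fun k => eLpNorm (fun x => χ x * f k x) 2 (volume.restrict U)) atTop (𝓝 0) := by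
  obtain ⟨C, hC⟩ := hc.exists_bound_of_continuous hχ
  have h2 := ENNReal.Tendsto.const_mul (a := ENNReal.ofReal C) h (Or.inr ENNReal.ofReal_ne_top)
  rw [mul_zero] at h2
  refine tendsto_of_tendsto_of_tendsto_of_le_of_le tendsto_const_nhds h2 (fun _ => zero_le)
    fun k => ?_
  have e : (fun x => χ x * f k x) = V.indicator fun x => χ x * f k x := by
    ext x
    by_cases hx : x ∈ V
    · rw [Set.indicator_of_mem hx]
    · rw [Set.indicator_of_notMem hx, image_eq_zero_of_notMem_tsupport fun h => hx (hsupp h),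
        zero_mul]
  change eLpNorm (fun x => χ x * f k x) 2 _ ≤ _
  rw [e, eLpNorm_indicator_eq_eLpNorm_restrict hV, Measure.restrict_restrict hV, Set.inter_comm]
  exact eLpNorm_mul_le_of_bound hC

/-- Smooth functions that converge in `H¹` near a part of the boundary converge to the trace on
that part. -/
lemma IsStarBody.tendsto_cutoff_trace {K V : Set (SpaceTime n)} {c : SpaceTime n} {κ h : ℝ}
    (hK : IsStarBody K c κ h) (hV : IsOpen V) {χ : SpaceTime n → ℝ} (hχ : ContDiff ℝ ∞ χ)
    (hc : HasCompactSupport χ) (hsupp : tsupport χ ⊆ V) {v : SpaceTime n → ℝ}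
    (hv : MemSobolev (interior K) 1 v) {φ : ℕ → SpaceTime n → ℝ} (hφ : ∀ k, ContDiff ℝ ∞ (φ k))
    (hlim : H1Tendsto (interior K ∩ V) φ v fun i x => grad (interior K) v x i) :
    Tendsto (fun k => eLpNorm ((fun x => χ x * φ k x) - fun x => χ x * trace (interior K) v x) 2
      ((surface n).restrict (frontier K))) atTop (𝓝 0) := by
  obtain ⟨ψ, hψ, hψlim⟩ := hK.exists_h1Tendsto hv
  have hVm := hV.measurableSet
  have hsub : volume.restrict (interior K ∩ V) ≤ volume.restrict (interior K) :=
    Measure.restrict_mono Set.inter_subset_left le_rfl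
  have hv1 := hv.1.mono_measure hsub
  have hG1 : ∀ i, MemLp (fun x => grad (interior K) v x i) 2 (volume.restrict (interior K ∩ V)) :=
    fun i => (hv.memLp_weakDeriv le_rfl ![i]).mono_measure hsub
  have hdiff := hlim.sub hφ hψ hv1 hv1 hG1 hG1 (hψlim.mono Set.inter_subset_left)
  have h0 : Tendsto (fun k => eLpNorm (φ k - ψ k) 2 (volume.restrict (interior K ∩ V))) atTop
      (𝓝 0) := by simpa using hdiff.1
  have h1 : ∀ i, Tendsto (fun k => eLpNorm (pd (φ k - ψ k) i) 2
      (volume.restrict (interior K ∩ V))) atTop (𝓝 0) := fun i => by simpa using hdiff.2 i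
  have hd := fun k => (hφ k).sub (hψ k)
  -- The two sequences have the same limit only on `V`. Multiplication by the cut-off makes their
  -- difference tend to zero on the whole body, where the trace inequality applies.
  have hfr : Tendsto (fun k => eLpNorm (fun x => χ x * (φ k - ψ k) x) 2
      ((surface n).restrict (frontier K))) atTop (𝓝 0) := by
    refine hK.tendsto_frontier_zero (fun k => hχ.mul (hd k)) ?_ fun i => ?_
    · exact tendsto_eLpNorm_cutoff_mul hVm hχ.continuous hc hsupp h0
    · have t1 := tendsto_eLpNorm_cutoff_mul hVm hχ.continuous hc hsupp (h1 i)
      have t2 := tendsto_eLpNorm_cutoff_mul (χ := pd χ i) hVm (contDiff_pd hχ i).continuous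
        (hc.fderiv_apply ℝ _) ((tsupport_fderiv_apply_subset ℝ _).trans hsupp) h0
      have t3 := t1.add t2
      rw [add_zero] at t3
      refine tendsto_of_tendsto_of_tendsto_of_le_of_le tendsto_const_nhds t3 (fun _ => zero_le)
        fun k => ?_
      have e : pd (fun x => χ x * (φ k - ψ k) x) i =
          (fun x => χ x * pd (φ k - ψ k) i x) + fun x => pd χ i x * (φ k - ψ k) x := by
        ext x
        exact pd_mul hχ (hd k) i x
      change eLpNorm (pd (fun x => χ x * (φ k - ψ k) x) i) 2 _ ≤ _
      rw [e]
      exact eLpNorm_add_le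
        (hχ.continuous.mul (contDiff_pd (hd k) i).continuous).aestronglyMeasurable
        ((contDiff_pd hχ i).continuous.mul (hd k).continuous).aestronglyMeasurable (by norm_num)
  have htr := hK.tendsto_trace (hK.isTrace_trace hv) hψ hψlim
  obtain ⟨C, hC⟩ := hc.exists_bound_of_continuous hχ.continuous
  have htr' : Tendsto (fun k => eLpNorm (fun x => χ x * (ψ k - trace (interior K) v) x) 2
      ((surface n).restrict (frontier K))) atTop (𝓝 0) := by
    have h2 := ENNReal.Tendsto.const_mul (a := ENNReal.ofReal C) htr
      (Or.inr ENNReal.ofReal_ne_top)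
    rw [mul_zero] at h2
    exact tendsto_of_tendsto_of_tendsto_of_le_of_le tendsto_const_nhds h2 (fun _ => zero_le)
      fun k => eLpNorm_mul_le_of_bound hC
  have hsum := hfr.add htr'
  rw [add_zero] at hsum
  refine tendsto_of_tendsto_of_tendsto_of_le_of_le tendsto_const_nhds hsum (fun _ => zero_le)
    fun k => ?_
  have e : ((fun x => χ x * φ k x) - fun x => χ x * trace (interior K) v x) =
      (fun x => χ x * (φ k - ψ k) x) + fun x => χ x * (ψ k - trace (interior K) v) x := by
    ext x
    simp only [Pi.sub_apply, Pi.add_apply]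
    ring
  change eLpNorm ((fun x => χ x * φ k x) - fun x => χ x * trace (interior K) v x) 2 _ ≤ _
  rw [e]
  refine eLpNorm_add_le (hχ.continuous.mul (hd k).continuous).aestronglyMeasurable ?_ (by norm_num)
  exact hχ.continuous.aestronglyMeasurable.mul
    ((hψ k).continuous.aestronglyMeasurable.sub (hK.memLp_trace hv).1)

lemma isStarBody_closedBall (x : SpaceTime n) {δ : ℝ} (hδ : 0 < δ) :
    IsStarBody (Metric.closedBall x δ) x δ (2 * δ) where
  closed := Metric.isClosed_closedBall
  pos := hδ
  ball_subset := Metric.ball_subset_closedBall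
  star := fun y hy => (convex_closedBall x δ).starConvex (Metric.ball_subset_closedBall hy)
  dist_le := fun y hy z hz => by
    have := dist_triangle_right y z x
    rw [Metric.mem_closedBall] at hy hz
    linarith

/-- The traces from two sides of a function in `H¹` coincide. -/
lemma IsStarBody.trace_ae_eq_trace {M : Set (SpaceTime n)} (hM : IsOpen M)
    {K K' : Set (SpaceTime n)} {c c' : SpaceTime n} {κ κ' h h' : ℝ} (hK : IsStarBody K c κ h)
    (hK' : IsStarBody K' c' κ' h') (hKM : interior K ⊆ M) (hKM' : interior K' ⊆ M)
    {v : SpaceTime n → ℝ} (hv : MemSobolev M 1 v) :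
    ∀ᵐ x ∂(surface n).restrict (frontier K ∩ frontier K' ∩ M),
      trace (interior K) v x = trace (interior K') v x := by
  have hm : MeasurableSet (frontier K ∩ frontier K' ∩ M) :=
    (isClosed_frontier.inter isClosed_frontier).measurableSet.inter hM.measurableSet
  rw [ae_restrict_iff' hm]
  refine measure_null_of_locally_null _ fun x hx => ?_
  simp only [Set.mem_compl_iff, Set.mem_ofPred_eq, Classical.not_imp] at hx
  obtain ⟨⟨-, hxM⟩, -⟩ := hx
  obtain ⟨δ, hδ, hball⟩ := Metric.nhds_basis_closedBall.mem_iff.1 (hM.mem_nhds hxM)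
  have hD := isStarBody_closedBall x hδ
  have hDM : interior (Metric.closedBall x δ) ⊆ M := interior_subset.trans hball
  -- Smooth functions that approximate `v` on a small ball around `x` do so on both sides at once.
  -- After multiplication by a cut-off, both traces are limits of the same sequence.
  obtain ⟨φ, hφ, hlim⟩ := hD.exists_h1Tendsto (hv.mono hDM)
  set V := interior (Metric.closedBall x δ) with hV
  have hlim' : H1Tendsto V φ v fun i x => grad M v x i :=
    hlim.congr .rfl fun i => hv.weakDeriv_mono isOpen_interior hDM le_rfl ![i]
  obtain ⟨χ, hχ1, hχc, hχ, -, hχx⟩ := exists_contDiff_tsupport_subset (n := ⊤) (isOpen_interior.mem_nhds (Metric.ball_subset_interior_closedBall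
      (Metric.mem_ball_self hδ)) : V ∈ 𝓝 x)
  have key : ∀ {L : Set (SpaceTime n)} {c : SpaceTime n} {κ h : ℝ}, IsStarBody L c κ h →
      interior L ⊆ M → ∀ S ⊆ frontier L,
      Tendsto (fun k => eLpNorm ((fun x => χ x * φ k x) - fun x => χ x * trace (interior L) v x) 2
      ((surface n).restrict S)) atTop (𝓝 0) := by
    intro L c κ h hL hLM S hS
    have h1 := hL.tendsto_cutoff_trace isOpen_interior hχ hχc hχ1 (hv.mono hLM) hφ
      ((hlim'.mono Set.inter_subset_right).congr .rfl fun i => ?_)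
    · exact tendsto_of_tendsto_of_tendsto_of_le_of_le tendsto_const_nhds h1 (fun _ => zero_le)
        fun k => eLpNorm_mono_measure _ (Measure.restrict_mono hS le_rfl)
    · exact ae_restrict_of_ae_restrict_of_subset Set.inter_subset_left
        (hv.weakDeriv_mono isOpen_interior hLM le_rfl ![i]).symm
  set S := frontier K ∩ frontier K' ∩ M with hS
  have hSK : S ⊆ frontier K := fun y hy => hy.1.1
  have hSK' : S ⊆ frontier K' := fun y hy => hy.1.2
  have hmeas : ∀ {L : Set (SpaceTime n)} {c : SpaceTime n} {κ h : ℝ}, IsStarBody L c κ h →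
      interior L ⊆ M → S ⊆ frontier L →
      AEStronglyMeasurable (fun x => χ x * trace (interior L) v x) ((surface n).restrict S) :=
    fun hL hLM hSL => hχ.continuous.aestronglyMeasurable.mul
      ((hL.memLp_trace (hv.mono hLM)).1.mono_measure (Measure.restrict_mono hSL le_rfl))
  have heq := ae_eq_of_tendsto_eLpNorm
    (fun k => (hχ.continuous.mul (hφ k).continuous).aestronglyMeasurable)
    (hmeas hK hKM hSK) (hmeas hK' hKM' hSK') (key hK hKM S hSK) (key hK' hKM' S hSK')
  rw [EventuallyEq, ae_restrict_iff' hm] at heq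
  refine ⟨{y | y ∈ S ∧ χ y ≠ 0 ∧ trace (interior K) v y ≠ trace (interior K') v y}, ?_, ?_⟩
  · filter_upwards [self_mem_nhdsWithin, mem_nhdsWithin_of_mem_nhds
      (hχ.continuous.continuousAt.eventually_ne (hχx ▸ one_ne_zero : χ x ≠ 0))] with y hy hy'
    simp only [Set.mem_compl_iff, Set.mem_ofPred_eq, Classical.not_imp] at hy
    exact ⟨hy.1, hy', hy.2⟩
  · rw [measure_eq_zero_iff_ae_notMem]
    filter_upwards [heq] with y hy hy'
    exact hy'.2.2 (mul_left_cancel₀ hy'.2.1 (hy hy'.1))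

/-- Integration by parts on a star-shaped body with flux `b`. -/
lemma IsStarBody.integral_grad_mul {K : Set (SpaceTime n)} {c : SpaceTime n} {κ h : ℝ}
    (hK : IsStarBody K c κ h) {b : SpaceTime n → ℝ} {j : Fin (n + 1)}
    (hb : MemLp b 2 ((surface n).restrict (frontier K)))
    (hgauss : ∀ φ : SpaceTime n → ℝ, ContDiff ℝ ∞ φ →
      ∫ y in interior K, fderiv ℝ φ y (unitVec j) = ∫ y in frontier K, b y * φ y ∂(surface n))
    {v f : SpaceTime n → ℝ} (hv : MemSobolev (interior K) 1 v) (hf : ContDiff ℝ ∞ f) :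
    (∫ y in interior K, grad (interior K) v y j * f y) + ∫ y in interior K, v y * pd f j y =
      ∫ y in frontier K, trace (interior K) v y * (b y * f y) ∂(surface n) := by
  have hUb : Bornology.IsBounded (interior K) := hK.isBounded.subset interior_subset
  obtain ⟨φ, hφ, hlim⟩ := hK.exists_h1Tendsto hv
  have htr := hK.tendsto_trace (hK.isTrace_trace hv) hφ hlim
  have hfL := memLp_two_of_continuous hUb hf.continuous
  have hpf := memLp_two_of_continuous hUb (contDiff_pd hf j).continuous
  have hbf : MemLp (fun y => b y * f y) 2 ((surface n).restrict (frontier K)) := by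
    obtain ⟨C, hC⟩ := hK.isCompact_frontier.exists_bound_of_continuousOn hf.continuous.continuousOn
    have : ∀ᵐ y ∂(surface n).restrict (frontier K), ‖b y * f y‖ ≤ C * ‖b y‖ := by
      filter_upwards [ae_restrict_mem isClosed_frontier.measurableSet] with y hy
      rw [norm_mul, mul_comm]
      exact mul_le_mul_of_nonneg_right (hC y hy) (norm_nonneg _)
    exact hb.of_le_mul (hb.1.mul hf.continuous.aestronglyMeasurable) this
  have hφL := fun k => memLp_two_of_continuous hUb (hφ k).continuous
  have hpφ := fun k => memLp_two_of_continuous hUb (contDiff_pd (hφ k) j).continuous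
  have t1 := tendsto_integral_mul hpφ (hv.memLp_weakDeriv le_rfl ![j]) hfL (hlim.2 j)
  have t2 := tendsto_integral_mul hφL hv.1 hpf hlim.1
  have t3 := tendsto_integral_mul (fun k => hK.memLp_frontier (hφ k).continuous)
    (hK.memLp_trace hv) hbf htr
  -- For smooth approximations this is the flux formula applied to a product; each of the three
  -- terms passes to the limit.
  refine tendsto_nhds_unique (t1.add t2) (t3.congr fun k => ?_)
  have h1 := hgauss (fun y => φ k y * f y) ((hφ k).mul hf)
  have e1 : ∀ y, fderiv ℝ (fun y => φ k y * f y) y (unitVec j) =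
      φ k y * pd f j y + pd (φ k) j y * f y := fun y => pd_mul (hφ k) hf j y
  simp_rw [e1] at h1
  have i1 : Integrable (fun y => φ k y * pd f j y) (volume.restrict (interior K)) :=
    (hφL k).integrable_mul hpf
  have i2 : Integrable (fun y => pd (φ k) j y * f y) (volume.restrict (interior K)) :=
    (hpφ k).integrable_mul hfL
  rw [integral_add i1 i2] at h1
  refine Eq.trans ?_ (h1.symm.trans (add_comm _ _))
  congr 1 with y
  ring

end LocalTraces

/-! ### The exact solution on the mesh: jumps, boundary values and wave operator. -/

namespace Triangulation.IsMesh

variable {n : ℕ} {M : Set (SpaceTime n)} {𝒯 : Triangulation M} {r : ℝ}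

lemma isBounded_int (h : 𝒯.IsMesh r) (i : Fin 𝒯.card) : Bornology.IsBounded (𝒯.int i) := by
  obtain ⟨c, hc⟩ := h.star i
  exact hc.isBounded.subset interior_subset

lemma isOpen_int (𝒯 : Triangulation M) (i : Fin 𝒯.card) : IsOpen (𝒯.int i) := isOpen_interior

/-- The traces of the gradient from the two sides of a face coincide. -/
lemma ae_traceGrad_eq (h : 𝒯.IsMesh r) {u : SpaceTime n → ℝ} (hu : MemSobolev M 2 u)
    (i j : Fin 𝒯.card) :
    ∀ᵐ x ∂(surface n).restrict (frontier (𝒯.elem i) ∩ frontier (𝒯.elem j) ∩ M),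
      traceGrad (𝒯.int i) u x = traceGrad (𝒯.int j) u x := by
  have key : ∀ i k, ∀ᵐ x ∂(surface n).restrict (frontier (𝒯.elem i)),
      traceGrad (𝒯.int i) u x k = trace (𝒯.int i) (fun y => grad M u y k) x := by
    intro i k
    obtain ⟨c, hc⟩ := h.star i
    exact hc.trace_ae_eq (hc.isTrace_trace ((hu.grad k).mono (h.int_subset i)))
      (hu.weakDeriv_mono isOpen_interior (h.int_subset i) (by norm_num) ![k])
  obtain ⟨c, hc⟩ := h.star i
  obtain ⟨c', hc'⟩ := h.star j
  have h1 := ae_all_iff.2 fun k => hc.trace_ae_eq_trace h.isOpen hc' (h.int_subset i)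
    (h.int_subset j) (hu.grad k)
  filter_upwards [h1, ae_all_iff.2 fun k => ae_restrict_of_ae_restrict_of_subset
    (show frontier (𝒯.elem i) ∩ frontier (𝒯.elem j) ∩ M ⊆ _ from fun y hy => hy.1.1) (key i k),
    ae_all_iff.2 fun k => ae_restrict_of_ae_restrict_of_subset
    (show frontier (𝒯.elem i) ∩ frontier (𝒯.elem j) ∩ M ⊆ _ from fun y hy => hy.1.2) (key j k)]
    with x h1 h2 h3
  ext k
  rw [h2 k, h3 k]
  exact h1 k

/-- The gradient has the same trace from both sides, and the normals are opposite. -/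
lemma ae_jump_eq_zero (h : 𝒯.IsMesh r) {u : SpaceTime n → ℝ} (hu : MemSobolev M 2 u)
    {i j : Fin 𝒯.card} (hij : i ≠ j) :
    ∀ᵐ x ∂(surface n).restrict (𝒯.face i j), 𝒯.jump i j u x = 0 := by
  have hsub : 𝒯.face i j ⊆ frontier (𝒯.elem i) ∩ frontier (𝒯.elem j) ∩ M := fun x hx =>
    ⟨⟨h.face_subset hij hx, h.face_subset hij.symm (face_comm 𝒯 i j ▸ hx)⟩, hx.2⟩
  filter_upwards [ae_restrict_of_ae_restrict_of_subset hsub (h.ae_traceGrad_eq hu i j),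
    h.ae_outerNormal_neg hij] with x h1 h2
  rw [jump, h1, h2, neg_dotProduct, add_neg_cancel]

/-- An approximating sequence for `M` restricts to the element, so that one sequence computes both
traces on the common part of the boundary. -/
lemma ae_trace_eq_of_isTrace (h : 𝒯.IsMesh r) {u g : SpaceTime n → ℝ} (hg : IsTrace M u g)
    (i : Fin 𝒯.card) :
    ∀ᵐ x ∂(surface n).restrict (𝒯.bdry i), trace (𝒯.int i) u x = g x := by
  obtain ⟨c, hc⟩ := h.star i
  obtain ⟨hu, hg2, φ, hφ, hlim, hφg⟩ := isTrace_iff.1 hg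
  have hui := hu.mono (h.int_subset i)
  have h1 := hc.tendsto_trace (hc.isTrace_trace hui) hφ ((hlim.mono (h.int_subset i)).congr .rfl
    fun k => (hu.weakDeriv_mono isOpen_interior (h.int_subset i) le_rfl ![k]).symm)
  have s1 : (surface n).restrict (𝒯.bdry i) ≤ (surface n).restrict (frontier (𝒯.elem i)) :=
    Measure.restrict_mono (h.bdry_subset i) le_rfl
  have s2 : (surface n).restrict (𝒯.bdry i) ≤ (surface n).restrict (frontier M) :=
    Measure.restrict_mono Set.inter_subset_right le_rfl
  refine ae_eq_of_tendsto_eLpNorm (fun k => (hφ k).continuous.aestronglyMeasurable)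
    ((hc.memLp_trace hui).1.mono_measure s1) (hg2.1.mono_measure s2) ?_ ?_
  · exact tendsto_of_tendsto_of_tendsto_of_le_of_le tendsto_const_nhds h1 (fun _ => zero_le)
      fun k => eLpNorm_mono_measure _ s1
  · exact tendsto_of_tendsto_of_tendsto_of_le_of_le tendsto_const_nhds hφg (fun _ => zero_le)
      fun k => eLpNorm_mono_measure _ s2

lemma ae_box_eq_zero (h : 𝒯.IsMesh r) {u : SpaceTime n → ℝ} (hu : MemSobolev M 2 u)
    (hbox : ∀ᵐ x ∂volume.restrict M, box M u x = 0) (i : Fin 𝒯.card) :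
    ∀ᵐ x ∂volume.restrict (𝒯.int i), box (𝒯.int i) u x = 0 := by
  have hw := fun w : Fin 2 → Fin (n + 1) =>
    hu.weakDeriv_mono (isOpen_int 𝒯 i) (h.int_subset i) le_rfl w
  filter_upwards [ae_restrict_of_ae_restrict_of_subset (h.int_subset i) hbox, hw ![0, 0],
    ae_all_iff.2 fun k : Fin n => hw ![k.succ, k.succ]] with x h1 h2 h3
  rw [← h1, box, box, h2]
  simp_rw [h3]

end Triangulation.IsMesh

/-! ### Polynomials as functions, and the signs of the Minkowski matrix. -/

section Polynomials

variable {n : ℕ}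

/-- The function defined by a polynomial. -/
def polyFun (P : MvPolynomial (Fin (n + 1)) ℝ) (x : SpaceTime n) : ℝ :=
  MvPolynomial.eval (fun j => x j) P

lemma contDiff_polyFun (P : MvPolynomial (Fin (n + 1)) ℝ) : ContDiff ℝ ∞ (polyFun P) := by
  induction P using MvPolynomial.induction_on with
  | C a =>
    have : polyFun (MvPolynomial.C a) = fun _ : SpaceTime n => a := by
      ext x; simp [polyFun]
    rw [this]
    exact contDiff_const
  | add p q hp hq =>
    have : polyFun (p + q) = fun x : SpaceTime n => polyFun p x + polyFun q x := by
      ext x; simp [polyFun]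
    rw [this]
    exact hp.add hq
  | mul_X p i hp =>
    have : polyFun (p * MvPolynomial.X i) = fun x : SpaceTime n => polyFun p x * x i := by
      ext x; simp [polyFun]
    rw [this]
    exact hp.mul (EuclideanSpace.proj (𝕜 := ℝ) i).contDiff

/-- The diagonal entries of the Minkowski matrix. -/
def minkSign (k : Fin (n + 1)) : ℝ := (Fin.cons (-1) (fun _ : Fin n => (1 : ℝ)) : Fin (n + 1) → ℝ) k

lemma minkowski_mulVec (v : Fin (n + 1) → ℝ) (k : Fin (n + 1)) :
    (minkowski n).mulVec v k = minkSign k * v k := by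
  rw [minkowski, Matrix.mulVec_diagonal]
  rfl

lemma abs_minkSign (k : Fin (n + 1)) : |minkSign k| = 1 := by
  refine Fin.cases ?_ (fun i => ?_) k <;> simp [minkSign]

lemma minkowski_dot (v w : Fin (n + 1) → ℝ) :
    (minkowski n).mulVec v ⬝ᵥ w = ∑ k, minkSign k * v k * w k := by
  simp [dotProduct, minkowski_mulVec]

/-- Applied to pure second derivatives, this says that the divergence of `A ∇v` is `-□v`. -/
lemma sum_minkSign (a : Fin (n + 1) → ℝ) :
    ∑ k, minkSign k * a k = -(a 0 - ∑ i : Fin n, a i.succ) := by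
  rw [Fin.sum_univ_succ]
  simp [minkSign]
  ring

end Polynomials

/-! ### Consistency of the bilinear form. -/

namespace Triangulation.IsMesh

variable {n : ℕ} {M : Set (SpaceTime n)} {𝒯 : Triangulation M} {r : ℝ}

section Elementwise

lemma exists_poly {q : ℕ} {w : SpaceTime n → ℝ} (hw : w ∈ 𝒯.femSpace q) (i : Fin 𝒯.card) :
    ∃ P : MvPolynomial (Fin (n + 1)) ℝ, P.totalDegree ≤ q ∧ ∀ x ∈ 𝒯.elem i, w x = polyFun P x :=
  hw.2 i

variable {w f : SpaceTime n → ℝ} {i : Fin 𝒯.card}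

lemma ae_int_of_eqOn (hwf : ∀ x ∈ 𝒯.elem i, w x = f x) :
    w =ᵐ[volume.restrict (𝒯.int i)] f := by
  filter_upwards [ae_restrict_mem (isOpen_int 𝒯 i).measurableSet] with x hx
  exact hwf x (interior_subset hx)

lemma grad_of_eqOn (h : 𝒯.IsMesh r) (hf : ContDiff ℝ ∞ f) (hwf : ∀ x ∈ 𝒯.elem i, w x = f x)
    (k : Fin (n + 1)) :
    (fun x => grad (𝒯.int i) w x k) =ᵐ[volume.restrict (𝒯.int i)] pd f k :=
  grad_smooth_ae (isOpen_int 𝒯 i) (h.isBounded_int i) hf (ae_int_of_eqOn hwf) k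

lemma trace_of_eqOn (h : 𝒯.IsMesh r) (hf : ContDiff ℝ ∞ f) (hwf : ∀ x ∈ 𝒯.elem i, w x = f x) :
    trace (𝒯.int i) w =ᵐ[(surface n).restrict (frontier (𝒯.elem i))] f := by
  obtain ⟨c, hc⟩ := h.star i
  exact hc.trace_smooth hf (ae_int_of_eqOn hwf)

lemma traceGrad_of_eqOn (h : 𝒯.IsMesh r) (hf : ContDiff ℝ ∞ f)
    (hwf : ∀ x ∈ 𝒯.elem i, w x = f x) (k : Fin (n + 1)) :
    (fun x => traceGrad (𝒯.int i) w x k) =ᵐ[(surface n).restrict (frontier (𝒯.elem i))]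
      pd f k := by
  obtain ⟨c, hc⟩ := h.star i
  exact hc.trace_smooth (contDiff_pd hf k) (h.grad_of_eqOn hf hwf k)

lemma memSobolev_of_eqOn (h : 𝒯.IsMesh r) (hf : ContDiff ℝ ∞ f)
    (hwf : ∀ x ∈ 𝒯.elem i, w x = f x) (k : ℕ) : MemSobolev (𝒯.int i) k w :=
  (MemSobolev.of_smooth (h.isBounded_int i) hf k).congr (ae_int_of_eqOn hwf).symm

end Elementwise

lemma memLp_trace (h : 𝒯.IsMesh r) {v : SpaceTime n → ℝ} {i : Fin 𝒯.card}
    (hv : MemSobolev (𝒯.int i) 1 v) :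
    MemLp (trace (𝒯.int i) v) 2 ((surface n).restrict (frontier (𝒯.elem i))) := by
  obtain ⟨c, hc⟩ := h.star i
  exact hc.memLp_trace hv

lemma memLp_traceGrad (h : 𝒯.IsMesh r) {v : SpaceTime n → ℝ} {i : Fin 𝒯.card}
    (hv : MemSobolev (𝒯.int i) 2 v) (k : Fin (n + 1)) :
    MemLp (fun x => traceGrad (𝒯.int i) v x k) 2 ((surface n).restrict (frontier (𝒯.elem i))) :=
  h.memLp_trace (hv.grad k)

lemma memLp_mul_continuous_frontier (h : 𝒯.IsMesh r) {b f : SpaceTime n → ℝ} {i : Fin 𝒯.card}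
    (hb : MemLp b 2 ((surface n).restrict (frontier (𝒯.elem i)))) (hf : Continuous f) :
    MemLp (fun x => b x * f x) 2 ((surface n).restrict (frontier (𝒯.elem i))) := by
  obtain ⟨c, hc⟩ := h.star i
  obtain ⟨C, hC⟩ := hc.isCompact_frontier.exists_bound_of_continuousOn hf.continuousOn
  have : ∀ᵐ y ∂(surface n).restrict (frontier (𝒯.elem i)), ‖b y * f y‖ ≤ C * ‖b y‖ := by
    filter_upwards [ae_restrict_mem isClosed_frontier.measurableSet] with y hy
    rw [norm_mul, mul_comm]
    exact mul_le_mul_of_nonneg_right (hC y hy) (norm_nonneg _)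
  exact hb.of_le_mul (hb.1.mul hf.aestronglyMeasurable) this

/-- The bilinear form is consistent: it vanishes at a solution of the wave equation. -/
theorem ahForm_eq_zero (h : 𝒯.IsMesh r) {Sig : Set (SpaceTime n)} {u : SpaceTime n → ℝ}
    (hu : MemSobolev M 2 u) (hbox : ∀ᵐ x ∂volume.restrict M, box M u x = 0)
    (hbd : ∀ i, ∀ᵐ x ∂(surface n).restrict (𝒯.elem i ∩ Sig), trace (𝒯.int i) u x = 0)
    {q : ℕ} {w : SpaceTime n → ℝ} (hw : w ∈ 𝒯.femSpace q) : 𝒯.ahForm Sig u w = 0 := by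
  choose P hPd hP using exists_poly hw
  obtain ⟨b, hb, hgauss, hint, hbdry⟩ := h.exists_flux
  set f : Fin 𝒯.card → SpaceTime n → ℝ := fun i => polyFun (P i) with hf
  have hfs : ∀ i, ContDiff ℝ ∞ (f i) := fun i => contDiff_polyFun (P i)
  have hui := fun i => hu.mono (h.int_subset i)
  set t : Fin 𝒯.card → Fin (n + 1) → SpaceTime n → ℝ := fun i k x => traceGrad (𝒯.int i) u x k
    with ht
  -- The boundary integrand left by integration by parts on an element: the conormal flux of `u`
  -- times the polynomial that represents `w`.
  set F : Fin 𝒯.card → SpaceTime n → ℝ := fun i x =>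
    ∑ k, minkSign k * (t i k x * (b i k x * f i x)) with hF
  have htb : ∀ i k, Integrable (fun x => t i k x * (b i k x * f i x))
      ((surface n).restrict (frontier (𝒯.elem i))) := fun i k =>
    (h.memLp_traceGrad (hui i) k).integrable_mul
      (h.memLp_mul_continuous_frontier (hb i k) (hfs i).continuous)
  have hFi : ∀ i, Integrable (F i) ((surface n).restrict (frontier (𝒯.elem i))) := fun i =>
    integrable_finsetSum _ fun k _ => (htb i k).const_mul _
  have hvol : ∀ i, ∫ x in 𝒯.int i, (minkowski n).mulVec (grad (𝒯.int i) u x) ⬝ᵥ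
      grad (𝒯.int i) w x = ∫ x in frontier (𝒯.elem i), F i x ∂(surface n) := by
    intro i
    obtain ⟨c, hc⟩ := h.star i
    have hfL := memLp_two_of_continuous (h.isBounded_int i) (hfs i).continuous
    have hpf := fun k => memLp_two_of_continuous (h.isBounded_int i)
      (contDiff_pd (hfs i) k).continuous
    have hg1 := fun k => (hui i).memLp_weakDeriv (by norm_num) ![k]
    have hg2 := fun k => (hui i).memLp_weakDeriv le_rfl ![k, k]
    have i1 : ∀ k, Integrable (fun x => grad (𝒯.int i) u x k * pd (f i) k x)
      (volume.restrict (𝒯.int i)) := fun k => (hg1 k).integrable_mul (hpf k)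
    have i2 : ∀ k, Integrable (fun x => weakDeriv (𝒯.int i) ![k, k] u x * f i x)
      (volume.restrict (𝒯.int i)) := fun k => (hg2 k).integrable_mul hfL
    have hgreen : ∀ k, ∫ x in 𝒯.int i, grad (𝒯.int i) u x k * pd (f i) k x =
        (∫ x in frontier (𝒯.elem i), t i k x * (b i k x * f i x) ∂(surface n)) -
          ∫ x in 𝒯.int i, weakDeriv (𝒯.int i) ![k, k] u x * f i x := by
      intro k
      have h1 := hc.integral_grad_mul (hb i k) (hgauss i k) ((hui i).grad k) (hfs i)
      have h2 : ∫ x in 𝒯.int i, grad (𝒯.int i) (fun y => grad (𝒯.int i) u y k) x k * f i x =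
          ∫ x in 𝒯.int i, weakDeriv (𝒯.int i) ![k, k] u x * f i x := by
        refine integral_congr_ae ?_
        filter_upwards [weakDeriv_ae_eq (isOpen_int 𝒯 i) ((hui i).grad_grad k k) .rfl] with x hx
        simp only [grad]
        rw [← hx]
        rfl
      change (∫ x in 𝒯.int i, grad (𝒯.int i) (fun y => grad (𝒯.int i) u y k) x k * f i x) +
        ∫ x in 𝒯.int i, grad (𝒯.int i) u x k * pd (f i) k x =
        ∫ x in frontier (𝒯.elem i), t i k x * (b i k x * f i x) ∂(surface n) at h1
      rw [h2] at h1
      linarith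
    have e1 : ∫ x in 𝒯.int i, (minkowski n).mulVec (grad (𝒯.int i) u x) ⬝ᵥ
        grad (𝒯.int i) w x =
        ∫ x in 𝒯.int i, ∑ k, minkSign k * (grad (𝒯.int i) u x k * pd (f i) k x) := by
      refine integral_congr_ae ?_
      filter_upwards [ae_all_iff.2 fun k => h.grad_of_eqOn (hfs i) (hP i) k] with x hx
      rw [minkowski_dot]
      refine Finset.sum_congr rfl fun k _ => ?_
      rw [← hx k, mul_assoc]
    -- The divergence of `A ∇u` is `-□u`, which vanishes.
    have e2 : ∫ x in 𝒯.int i, ∑ k, minkSign k * (weakDeriv (𝒯.int i) ![k, k] u x * f i x) = 0 := by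
      refine integral_eq_zero_of_ae ?_
      filter_upwards [h.ae_box_eq_zero hu hbox i] with x hx
      have := sum_minkSign fun k => weakDeriv (𝒯.int i) ![k, k] u x
      rw [box] at hx
      simp_rw [← mul_assoc]
      rw [← Finset.sum_mul, this, hx]
      simp
    rw [integral_finsetSum _ fun k _ => (i2 k).const_mul _] at e2
    rw [e1, integral_finsetSum _ fun k _ => (i1 k).const_mul _,
      integral_finsetSum _ fun k _ => (htb i k).const_mul _]
    simp_rw [integral_const_mul] at e2 ⊢
    simp_rw [hgreen, mul_sub]
    rw [Finset.sum_sub_distrib, e2, sub_zero]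
  have hsplit : ∀ i, ∫ x in frontier (𝒯.elem i), F i x ∂(surface n) =
      (∫ x in 𝒯.bdry i, F i x ∂(surface n)) +
        ∫ x in frontier (𝒯.elem i) ∩ M, F i x ∂(surface n) := by
    intro i
    have hset : frontier (𝒯.elem i) = 𝒯.bdry i ∪ (frontier (𝒯.elem i) ∩ M) := by
      ext x
      constructor
      · intro hx
        have hxe := (𝒯.isClosed_elem i).frontier_subset hx
        by_cases hxM : x ∈ M
        · exact Or.inr ⟨hx, hxM⟩
        · exact Or.inl ⟨hxe, h.isOpen.frontier_eq ▸ ⟨𝒯.elem_subset i hxe, hxM⟩⟩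
      · rintro (hx | hx)
        · exact h.bdry_subset i hx
        · exact hx.1
    have hdisj : Disjoint (𝒯.bdry i) (frontier (𝒯.elem i) ∩ M) := by
      rw [Set.disjoint_left]
      intro x hx hx'
      have := hx.2
      rw [h.isOpen.frontier_eq] at this
      exact this.2 hx'.2
    conv_lhs => rw [hset]
    exact setIntegral_union hdisj (isClosed_frontier.measurableSet.inter h.isOpen.measurableSet)
      ((hFi i).mono_measure (Measure.restrict_mono (h.bdry_subset i) le_rfl))
      ((hFi i).mono_measure (Measure.restrict_mono Set.inter_subset_left le_rfl))
  -- On the boundary of `M` the flux density is the outward normal, so this part cancels against the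
  -- second term of `ahForm`.
  have hbdterm : ∀ i, ∫ x in 𝒯.bdry i, ((minkowski n).mulVec (traceGrad (𝒯.int i) u x) ⬝ᵥ
      outerNormal M x) * trace (𝒯.int i) w x ∂(surface n) =
        ∫ x in 𝒯.bdry i, F i x ∂(surface n) := by
    intro i
    refine integral_congr_ae ?_
    filter_upwards [ae_all_iff.2 fun k => hbdry i k,
      ae_restrict_of_ae_restrict_of_subset (h.bdry_subset i) (h.trace_of_eqOn (hfs i) (hP i))]
      with x h1 h2
    rw [h2, minkowski_dot, hF, Finset.sum_mul]
    refine Finset.sum_congr rfl fun k _ => ?_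
    rw [h1 k, ht]
    ring
  -- Inside `M` the traces of `∇u` agree from all sides and `w` is single-valued. Both factor out of
  -- the sum over the elements, and the remaining total flux density is zero there.
  have hintterm : ∑ i, ∫ x in frontier (𝒯.elem i) ∩ M, F i x ∂(surface n) = 0 := by
    have hmm : ∀ i, MeasurableSet (frontier (𝒯.elem i)) := fun i =>
      isClosed_frontier.measurableSet
    have e : ∀ i, ∫ x in frontier (𝒯.elem i) ∩ M, F i x ∂(surface n) =
        ∫ x in M, (frontier (𝒯.elem i)).indicator (F i) x ∂(surface n) := fun i => by
      rw [integral_indicator (hmm i), Measure.restrict_restrict (hmm i)]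
    simp_rw [e]
    rw [← integral_finsetSum]
    · refine integral_eq_zero_of_ae ?_
      have hcons : ∀ᵐ x ∂(surface n).restrict M, ∀ i j, x ∈ frontier (𝒯.elem i) →
          x ∈ frontier (𝒯.elem j) → traceGrad (𝒯.int i) u x = traceGrad (𝒯.int j) u x := by
        refine ae_all_iff.2 fun i => ae_all_iff.2 fun j => ?_
        have h1 := h.ae_traceGrad_eq hu i j
        rw [← Measure.restrict_restrict ((hmm i).inter (hmm j)),
          ae_restrict_iff' ((hmm i).inter (hmm j))] at h1
        filter_upwards [h1] with x hx hi hj using hx ⟨hi, hj⟩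
      filter_upwards [hcons, ae_all_iff.2 hint] with x hx hx0
      rw [Pi.zero_apply]
      by_cases hex : ∃ i, x ∈ frontier (𝒯.elem i)
      · obtain ⟨i, hi⟩ := hex
        have hterm : ∀ j, (frontier (𝒯.elem j)).indicator (F j) x =
            ∑ k, minkSign k * (t i k x * w x) * (frontier (𝒯.elem j)).indicator (b j k) x := by
          intro j
          by_cases hj : x ∈ frontier (𝒯.elem j)
          · simp only [Set.indicator_of_mem hj, hF, ht]
            refine Finset.sum_congr rfl fun k _ => ?_
            rw [hx i j hi hj, hP j x ((𝒯.isClosed_elem j).frontier_subset hj)]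
            simp only [hf]
            ring
          · simp [Set.indicator_of_notMem hj]
        simp_rw [hterm]
        rw [Finset.sum_comm]
        simp_rw [← Finset.mul_sum, hx0, mul_zero]
        simp
      · push Not at hex
        exact Finset.sum_eq_zero fun i _ => Set.indicator_of_notMem (hex i) _
    · intro i _
      exact ((integrable_indicator_iff (hmm i)).2 (hFi i)).restrict
  -- The last term of the form pairs with the trace of `u` on `Sig`, which is zero.
  have hthird : ∀ i, ∫ x in 𝒯.elem i ∩ Sig,
      (∑ k : Fin n, traceGrad (𝒯.int i) w x k.succ * outerNormal M x k.succ) *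
        trace (𝒯.int i) u x ∂(surface n) = 0 := by
    intro i
    refine integral_eq_zero_of_ae ?_
    filter_upwards [hbd i] with x hx
    rw [hx, mul_zero]
    rfl
  rw [ahForm, aForm]
  simp_rw [hvol, hsplit, hbdterm, hthird]
  rw [Finset.sum_add_distrib, hintterm]
  simp

end Triangulation.IsMesh

/-! ### The inverse inequality for polynomials. -/

section InverseInequality

variable {n : ℕ}

lemma pd_polyFun (P : MvPolynomial (Fin (n + 1)) ℝ) (k : Fin (n + 1)) :
    pd (polyFun P) k = polyFun (MvPolynomial.pderiv k P) := by
  ext x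
  induction P using MvPolynomial.induction_on with
  | C a =>
    have : polyFun (MvPolynomial.C a) = fun _ : SpaceTime n => a := by
      ext x; simp [polyFun]
    rw [this]
    simp [pd, polyFun]
  | add p q hp hq =>
    have : polyFun (p + q) = fun x : SpaceTime n => polyFun p x + polyFun q x := by
      ext x; simp [polyFun]
    rw [this, pd, fderiv_fun_add ((contDiff_polyFun p).differentiable (by simp) x)
      ((contDiff_polyFun q).differentiable (by simp) x)]
    simp only [pd] at hp hq
    rw [add_apply, hp, hq]
    simp [polyFun]
  | mul_X p i hp =>
    have : polyFun (p * MvPolynomial.X i) = fun x : SpaceTime n => polyFun p x * x i := by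
      ext x; simp [polyFun]
    have hX : ContDiff ℝ ∞ fun y : SpaceTime n => y i :=
      (EuclideanSpace.proj (𝕜 := ℝ) i).contDiff
    rw [this, pd_mul (contDiff_polyFun p) hX, hp]
    have hx : pd (fun y : SpaceTime n => y i) k x = if i = k then 1 else 0 := by
      have : fderiv ℝ (fun y : SpaceTime n => y i) x = EuclideanSpace.proj (𝕜 := ℝ) i :=
        (EuclideanSpace.proj (𝕜 := ℝ) i).fderiv
      rw [pd, this]
      simp
    rw [hx]
    simp only [polyFun, MvPolynomial.pderiv_mul, MvPolynomial.pderiv_X, map_add, map_mul,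
      MvPolynomial.eval_X, Pi.single_apply]
    by_cases hik : i = k
    · simp [hik]; ring
    · simp [hik]

lemma totalDegree_pderiv_le (P : MvPolynomial (Fin (n + 1)) ℝ) (k : Fin (n + 1)) :
    (MvPolynomial.pderiv k P).totalDegree ≤ P.totalDegree := by
  conv_lhs => rw [P.as_sum, map_sum]
  refine MvPolynomial.totalDegree_finsetSum_le fun s hs => ?_
  rw [MvPolynomial.pderiv_monomial]
  refine (MvPolynomial.totalDegree_monomial_le _ _).trans
    (le_trans ?_ (MvPolynomial.le_totalDegree hs))
  rw [Finsupp.sum_fintype _ _ (fun _ => rfl), Finsupp.sum_fintype _ _ (fun _ => rfl)]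
  exact Finset.sum_le_sum fun j _ => Nat.sub_le _ _

/-- The polynomial `P (c + t X)`. -/
def affSubst (c : SpaceTime n) (t : ℝ) (P : MvPolynomial (Fin (n + 1)) ℝ) :
    MvPolynomial (Fin (n + 1)) ℝ :=
  MvPolynomial.bind₁ (fun j => MvPolynomial.C (c j) + MvPolynomial.C t * MvPolynomial.X j) P

lemma polyFun_affSubst (c : SpaceTime n) (t : ℝ) (P : MvPolynomial (Fin (n + 1)) ℝ)
    (y : SpaceTime n) : polyFun (affSubst c t P) y = polyFun P (c + t • y) := by
  simp only [polyFun, affSubst]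
  induction P using MvPolynomial.induction_on with
  | C a => simp
  | add p q hp hq => simp only [map_add, hp, hq]
  | mul_X p i hp => simp only [map_mul, hp, MvPolynomial.bind₁_X_right]; simp

lemma totalDegree_affSubst_le (c : SpaceTime n) (t : ℝ) (P : MvPolynomial (Fin (n + 1)) ℝ) :
    (affSubst c t P).totalDegree ≤ P.totalDegree := by
  rw [affSubst]
  conv_lhs => rw [P.as_sum, map_sum]
  refine MvPolynomial.totalDegree_finsetSum_le fun s hs => ?_
  rw [MvPolynomial.bind₁_monomial]
  refine (MvPolynomial.totalDegree_mul _ _).trans ?_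
  rw [MvPolynomial.totalDegree_C, zero_add]
  refine (MvPolynomial.totalDegree_finsetProd _ _).trans
    (le_trans ?_ (MvPolynomial.le_totalDegree hs))
  refine Finset.sum_le_sum fun j _ => ?_
  refine (MvPolynomial.totalDegree_pow _ _).trans ?_
  have h1 : (MvPolynomial.C (c j) + MvPolynomial.C t * MvPolynomial.X j :
      MvPolynomial (Fin (n + 1)) ℝ).totalDegree ≤ 1 := by
    refine (MvPolynomial.totalDegree_add _ _).trans (max_le (by simp) ?_)
    refine (MvPolynomial.totalDegree_mul _ _).trans ?_
    simp
  exact (Nat.mul_le_mul_left _ h1).trans (mul_one _).le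

/-- The ball contains a cube, and a polynomial that vanishes on a product of infinite sets is zero.
-/
lemma polyFun_eq_zero_of_ball {P : MvPolynomial (Fin (n + 1)) ℝ} {r : ℝ} (hr : 0 < r)
    (h : ∀ x ∈ Metric.ball (0 : SpaceTime n) r, polyFun P x = 0) : P = 0 := by
  obtain ⟨δ, hδ, hsub⟩ : ∃ δ : ℝ, 0 < δ ∧ ∀ x : Fin (n + 1) → ℝ, (∀ i, x i ∈ Set.Ioo (-δ) δ) →
      (WithLp.toLp 2 x : SpaceTime n) ∈ Metric.ball (0 : SpaceTime n) r := by
    have hc : Continuous fun x : Fin (n + 1) → ℝ => (WithLp.toLp 2 x : SpaceTime n) :=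
      PiLp.continuous_toLp 2 _
    have hmem : (fun x : Fin (n + 1) → ℝ => (WithLp.toLp 2 x : SpaceTime n)) ⁻¹'
        Metric.ball 0 r ∈ 𝓝 0 :=
      hc.continuousAt.preimage_mem_nhds (by simpa using Metric.ball_mem_nhds _ hr)
    obtain ⟨δ, hδ, hsub⟩ := Metric.mem_nhds_iff.1 hmem
    refine ⟨δ, hδ, fun x hx => hsub ?_⟩
    rw [Metric.mem_ball, dist_zero_right, pi_norm_lt_iff hδ]
    exact fun i => abs_lt.2 (hx i)
  refine MvPolynomial.funext_set (fun _ => Set.Ioo (-δ) δ)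
    (fun _ => Set.Ioo_infinite (by linarith)) fun x hx => ?_
  rw [map_zero]
  exact h _ (hsub x fun i => hx i (Set.mem_univ i))

lemma memLp_polyFun_ball (P : MvPolynomial (Fin (n + 1)) ℝ) (r : ℝ) :
    MemLp (polyFun P) 2 (volume.restrict (Metric.ball (0 : SpaceTime n) r)) :=
  memLp_two_of_continuous Metric.isBounded_ball (contDiff_polyFun P).continuous

/-- Polynomials as elements of `L²` of a ball. -/
def polyLp (n : ℕ) (r : ℝ) : MvPolynomial (Fin (n + 1)) ℝ →ₗ[ℝ]
    Lp ℝ 2 (volume.restrict (Metric.ball (0 : SpaceTime n) r)) where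
  toFun P := (memLp_polyFun_ball P r).toLp
  map_add' P Q := by
    rw [← MemLp.toLp_add]
    exact MemLp.toLp_congr _ _ (Eventually.of_forall fun x => by simp [polyFun])
  map_smul' a P := by
    rw [RingHom.id_apply, ← MemLp.toLp_const_smul]
    exact MemLp.toLp_congr _ _ (Eventually.of_forall fun x => by simp [polyFun])

/-- Polynomials as continuous functions on the closed unit ball. -/
def polyBall (n : ℕ) : MvPolynomial (Fin (n + 1)) ℝ →ₗ[ℝ]
    C(Metric.closedBall (0 : SpaceTime n) 1, ℝ) where
  toFun P := ⟨fun y => polyFun P y.1, (contDiff_polyFun P).continuous.comp continuous_subtype_val⟩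
  map_add' P Q := by ext y; simp [polyFun]
  map_smul' a P := by ext y; simp [polyFun]

lemma ker_polyLp {r : ℝ} (hr : 0 < r) : LinearMap.ker (polyLp n r) = ⊥ := by
  rw [LinearMap.ker_eq_bot']
  intro P hP
  have h0 : (memLp_polyFun_ball P r).toLp = 0 := hP
  have h0 : polyFun P =ᵐ[volume.restrict (Metric.ball (0 : SpaceTime n) r)] fun _ => 0 := by
    refine (memLp_polyFun_ball P r).coeFn_toLp.symm.trans ?_
    rw [h0]
    exact Lp.coeFn_zero _ _ _
  refine polyFun_eq_zero_of_ball hr fun x hx => ?_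
  exact Measure.eqOn_open_of_ae_eq h0 Metric.isOpen_ball
    (contDiff_polyFun _).continuous.continuousOn continuousOn_const hx

lemma norm_polyLp_sq (P : MvPolynomial (Fin (n + 1)) ℝ) (r : ℝ) :
    ‖polyLp n r P‖ ^ 2 = ∫ x in Metric.ball (0 : SpaceTime n) r, polyFun P x ^ 2 := by
  have hL := memLp_polyFun_ball P r
  change ‖hL.toLp‖ ^ 2 = _
  rw [Lp.norm_toLp, hL.eLpNorm_eq_integral_rpow_norm (by norm_num) (by norm_num),
    ENNReal.toReal_ofReal (by positivity), ← Real.rpow_natCast, ← Real.rpow_mul (by positivity)]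
  simp

/-- On a finite-dimensional space an injective linear map is bounded below and every linear map is
bounded above. -/
lemma exists_norm_le_of_injective {W E F : Type*} [AddCommGroup W] [Module ℝ W]
    [FiniteDimensional ℝ W] [NormedAddCommGroup E] [NormedSpace ℝ E] [NormedAddCommGroup F]
    [NormedSpace ℝ F] (f : W →ₗ[ℝ] E) (g : W →ₗ[ℝ] F) (hf : LinearMap.ker f = ⊥) :
    ∃ C : ℝ, 0 ≤ C ∧ ∀ w, ‖g w‖ ≤ C * ‖f w‖ := by
  let e := (Module.finBasis ℝ W).equivFun
  have hker : LinearMap.ker (f ∘ₗ e.symm.toLinearMap) = ⊥ := by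
    rw [LinearMap.ker_comp, hf]
    exact LinearEquiv.ker e.symm
  obtain ⟨κ, -, hκ⟩ := LinearMap.exists_antilipschitzWith _ hker
  let G := LinearMap.toContinuousLinearMap (g ∘ₗ e.symm.toLinearMap)
  refine ⟨‖G‖ * κ, by positivity, fun w => ?_⟩
  have h1 : G (e w) = g w := by simp [G]
  have h2 : ‖e w‖ ≤ κ * ‖f w‖ := by
    have := hκ.le_mul_dist (e w) 0
    rw [dist_zero_right, map_zero, dist_zero_right] at this
    simpa using this
  calc ‖g w‖ ≤ ‖G‖ * ‖e w‖ := h1 ▸ G.le_opNorm _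
    _ ≤ ‖G‖ * (κ * ‖f w‖) := by gcongr
    _ = _ := by ring

/-- The polynomials of degree at most `q` form a finite-dimensional space on which the `L²` norm of
the small ball is a norm. The two balls model the one that an element of unit size contains and the
one that contains it. -/
lemma exists_sup_le_integral_ball (n q : ℕ) {r : ℝ} (hr : 0 < r) :
    ∃ C : ℝ, 0 < C ∧ ∀ P : MvPolynomial (Fin (n + 1)) ℝ, P.totalDegree ≤ q →
      ∀ y ∈ Metric.closedBall (0 : SpaceTime n) 1,
        polyFun P y ^ 2 ≤ C * ∫ x in Metric.ball (0 : SpaceTime n) r, polyFun P x ^ 2 := by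
  have : CompactSpace (Metric.closedBall (0 : SpaceTime n) 1) :=
    isCompact_iff_compactSpace.1 (isCompact_closedBall _ _)
  let W := MvPolynomial.restrictTotalDegree (Fin (n + 1)) ℝ q
  obtain ⟨C, hC, H⟩ := exists_norm_le_of_injective ((polyLp n r) ∘ₗ W.subtype)
    ((polyBall n) ∘ₗ W.subtype) (by
      rw [LinearMap.ker_comp, ker_polyLp hr]
      exact W.ker_subtype)
  -- The summand 1 only makes the constant positive.
  refine ⟨C ^ 2 + 1, by positivity, fun P hP y hy => ?_⟩
  have h1 : ‖polyBall n P‖ ≤ C * ‖polyLp n r P‖ :=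
    H ⟨P, (MvPolynomial.mem_restrictTotalDegree _ _ _).2 hP⟩
  have h2 : |polyFun P y| ≤ ‖polyBall n P‖ :=
    ContinuousMap.norm_coe_le_norm (polyBall n P) ⟨y, hy⟩
  calc polyFun P y ^ 2 = |polyFun P y| ^ 2 := (sq_abs _).symm
    _ ≤ (C * ‖polyLp n r P‖) ^ 2 := by gcongr; exact h2.trans h1
    _ = C ^ 2 * ∫ x in Metric.ball (0 : SpaceTime n) r, polyFun P x ^ 2 := by
      rw [mul_pow, norm_polyLp_sq]
    _ ≤ _ := by
      have : 0 ≤ ∫ x in Metric.ball (0 : SpaceTime n) r, polyFun P x ^ 2 :=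
        integral_nonneg fun _ => sq_nonneg _
      nlinarith

lemma setIntegral_ball_scale {f : SpaceTime n → ℝ} (c : SpaceTime n) {h r : ℝ}
    (hh : 0 < h) : ∫ x in Metric.ball c (r * h), f x =
      h ^ (n + 1) * ∫ y in Metric.ball (0 : SpaceTime n) r, f (c + h • y) := by
  have hpre : ∀ y : SpaceTime n, (c + h • y ∈ Metric.ball c (r * h) ↔
      y ∈ Metric.ball (0 : SpaceTime n) r) := by
    intro y
    rw [mem_ball_iff_norm, mem_ball_zero_iff, add_sub_cancel_left, norm_smul,
      Real.norm_of_nonneg hh.le, mul_comm r h]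
    exact mul_lt_mul_iff_right₀ hh
  rw [← integral_indicator measurableSet_ball, ← integral_indicator measurableSet_ball]
  have h1 := Measure.integral_comp_smul (volume : Measure (SpaceTime n))
    (fun x => (Metric.ball c (r * h)).indicator f (c + x)) h
  rw [integral_add_left_eq_self] at h1
  have h2 : (fun y => (Metric.ball c (r * h)).indicator f (c + h • y)) =
      (Metric.ball (0 : SpaceTime n) r).indicator fun y => f (c + h • y) := by
    ext y
    by_cases hy : y ∈ Metric.ball (0 : SpaceTime n) r
    · rw [Set.indicator_of_mem hy, Set.indicator_of_mem ((hpre y).2 hy)]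
    · rw [Set.indicator_of_notMem hy, Set.indicator_of_notMem (fun h' => hy ((hpre y).1 h'))]
  rw [h2] at h1
  rw [h1, smul_eq_mul, abs_of_pos (by positivity)]
  simp only [finrank_euclideanSpace, Fintype.card_fin]
  rw [← mul_assoc, mul_inv_cancel₀ (by positivity), one_mul]

/-- The inverse trace inequality for polynomials. -/
theorem exists_inverse_const (n q : ℕ) {r : ℝ} (hr : 0 < r) :
    ∃ C : ℝ, 0 < C ∧ ∀ (K : Set (SpaceTime n)) (c : SpaceTime n) (h : ℝ),
      IsStarBody K c (r * h) h → ∀ P : MvPolynomial (Fin (n + 1)) ℝ, P.totalDegree ≤ q →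
        h * ∫ y in frontier K, polyFun P y ^ 2 ∂(surface n) ≤
          C * ∫ y in interior K, polyFun P y ^ 2 := by
  obtain ⟨C₁, hC₁, H₁⟩ := IsStarBody.exists_trace_const n hr
  obtain ⟨C₂, hC₂, H₂⟩ := exists_sup_le_integral_ball n q hr
  set V : ℝ := volume.real (Metric.closedBall (0 : SpaceTime n) 1) with hV
  have hV0 : 0 ≤ V := measureReal_nonneg
  refine ⟨C₁ * V * C₂ + 1, by positivity, fun K c h hK P hP => ?_⟩
  have hh : 0 < h := hK.size_pos
  have hcont := (contDiff_polyFun P).continuous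
  set I := ∫ y in interior K, polyFun P y ^ 2 with hI
  have hIint : IntegrableOn (fun y => polyFun P y ^ 2) K :=
    (hcont.pow 2).continuousOn.integrableOn_compact hK.isCompact
  have hball : ∫ x in Metric.ball c (r * h), polyFun P x ^ 2 ≤ I := by
    refine setIntegral_mono_set (hIint.mono_set interior_subset)
      (Eventually.of_forall fun _ => sq_nonneg _) ?_
    exact (interior_maximal hK.ball_subset Metric.isOpen_ball).eventuallyLE
  have hI0 : 0 ≤ I := integral_nonneg fun _ => sq_nonneg _
  -- Scaling to unit size bounds point values of the square by its integral divided by `h ^ (n +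
  -- 1)`.
  have hsup : ∀ x ∈ K, polyFun P x ^ 2 ≤ C₂ * ((h ^ (n + 1))⁻¹ * I) := by
    intro x hx
    have hy : h⁻¹ • (x - c) ∈ Metric.closedBall (0 : SpaceTime n) 1 := by
      rw [mem_closedBall_zero_iff, norm_smul, Real.norm_of_nonneg (by positivity), ← dist_eq_norm]
      calc h⁻¹ * dist x c ≤ h⁻¹ * h := by
            gcongr; exact hK.dist_le x hx c hK.center_mem
        _ = 1 := inv_mul_cancel₀ hh.ne'
    have := H₂ (affSubst c h P) ((totalDegree_affSubst_le c h P).trans hP) _ hy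
    simp only [polyFun_affSubst] at this
    rw [smul_smul, mul_inv_cancel₀ hh.ne', one_smul, add_sub_cancel] at this
    refine this.trans ?_
    rw [setIntegral_ball_scale c hh] at hball
    gcongr
    rw [inv_mul_eq_div, le_div_iff₀ (by positivity), mul_comm]
    exact hball
  have hvol : volume.real (interior K) ≤ h ^ (n + 1) * V := by
    have h1 : interior K ⊆ Metric.closedBall c h := fun x hx =>
      hK.dist_le x (interior_subset hx) c hK.center_mem
    have h2 := Measure.addHaar_real_closedBall' (volume : Measure (SpaceTime n)) c hh.le
    rw [finrank_euclideanSpace, Fintype.card_fin] at h2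
    rw [hV, ← h2]
    exact measureReal_mono h1 (isCompact_closedBall _ _).measure_lt_top.ne
  have hKv : volume (interior K) ≠ ⊤ :=
    ((measure_mono interior_subset).trans_lt hK.isCompact.measure_lt_top).ne
  have hsurf : (surface n).real (frontier K) ≤ C₁ * (h⁻¹ * volume.real (interior K)) := by
    have h1 := IsStarBody.surface_frontier_le_of_trace (H₁ K c h hK)
    have h2 := ENNReal.toReal_mono (ENNReal.mul_ne_top ENNReal.ofReal_ne_top
      (ENNReal.mul_ne_top ENNReal.ofReal_ne_top hKv)) h1
    rw [ENNReal.toReal_mul, ENNReal.toReal_mul, ENNReal.toReal_ofReal hC₁.le,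
      ENNReal.toReal_ofReal (by positivity)] at h2
    exact h2
  have hint : ∫ y in frontier K, polyFun P y ^ 2 ∂(surface n) ≤
      C₂ * ((h ^ (n + 1))⁻¹ * I) * (surface n).real (frontier K) := by
    refine (le_abs_self _).trans ?_
    rw [← Real.norm_eq_abs]
    refine norm_setIntegral_le_of_norm_le_const hK.surface_frontier_lt_top fun x hx => ?_
    rw [Real.norm_of_nonneg (sq_nonneg _)]
    exact hsup x (hK.frontier_subset hx)
  -- All powers of `h` cancel: the sup bound contributes exponent `-(n + 1)`, the perimeter bound
  -- `n`, and the weight in front 1.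
  calc h * ∫ y in frontier K, polyFun P y ^ 2 ∂(surface n)
      ≤ h * (C₂ * ((h ^ (n + 1))⁻¹ * I) * (C₁ * (h⁻¹ * (h ^ (n + 1) * V)))) := by
        gcongr
        exact hint.trans (by gcongr; exact hsurf.trans (by gcongr))
    _ = C₁ * V * C₂ * I := by field_simp
    _ ≤ _ := by nlinarith

end InverseInequality

/-! ### Young's inequality, and operators into L² that are linear up to null sets. -/

section Forms

/-- Young's inequality under the integral. The free parameter is used both to absorb terms and to
distribute powers of the mesh size. -/
lemma abs_integral_mul_le {α : Type*} [MeasurableSpace α] {μ : Measure α} {f g : α → ℝ}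
    (hf : MemLp f 2 μ) (hg : MemLp g 2 μ) {t : ℝ} (ht : 0 < t) :
    |∫ x, f x * g x ∂μ| ≤ t * (∫ x, f x ^ 2 ∂μ) + (4 * t)⁻¹ * ∫ x, g x ^ 2 ∂μ := by
  have h1 : Integrable (fun x => t * f x ^ 2) μ := hf.integrable_sq.const_mul t
  have h2 : Integrable (fun x => (4 * t)⁻¹ * g x ^ 2) μ := hg.integrable_sq.const_mul _
  rw [← integral_const_mul, ← integral_const_mul, ← integral_add h1 h2]
  refine abs_integral_le_integral_abs.trans (integral_mono_of_nonneg
    (Eventually.of_forall fun _ => abs_nonneg _) (h1.add h2) (Eventually.of_forall fun x => ?_))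
  have h3 : (4 * t)⁻¹ * g x ^ 2 = t * ((2 * t)⁻¹ * g x) ^ 2 := by field_simp; ring
  have h4 : f x * g x = 2 * t * (f x * ((2 * t)⁻¹ * g x)) := by field_simp
  beta_reduce
  rw [h3, h4, abs_le]
  constructor
  · nlinarith [mul_nonneg ht.le (sq_nonneg (f x + (2 * t)⁻¹ * g x))]
  · nlinarith [mul_nonneg ht.le (sq_nonneg (f x - (2 * t)⁻¹ * g x))]

lemma dot_sq_le {ι : Type*} (s : Finset ι) (a b : ι → ℝ) (ha : ∑ k ∈ s, a k ^ 2 ≤ 1) :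
    (∑ k ∈ s, a k * b k) ^ 2 ≤ ∑ k ∈ s, b k ^ 2 := by
  refine (Finset.sum_mul_sq_le_sq_mul_sq s a b).trans ?_
  exact mul_le_of_le_one_left (Finset.sum_nonneg fun _ _ => sq_nonneg _) ha

variable {n : ℕ} {M : Set (SpaceTime n)}

/-- The functions that belong to `H²` on each element. -/
def Triangulation.PiecewiseH2 (𝒯 : Triangulation M) (v : SpaceTime n → ℝ) : Prop :=
  ∀ i, MemSobolev (𝒯.int i) 2 v

/-- An operator from the elementwise `H²` functions to `L²(μ)` that is linear up to null sets. -/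
structure Triangulation.IsL2Op (𝒯 : Triangulation M) (μ : Measure (SpaceTime n))
    (F : (SpaceTime n → ℝ) → SpaceTime n → ℝ) : Prop where
  memLp : ∀ v, 𝒯.PiecewiseH2 v → MemLp (F v) 2 μ
  sub : ∀ u v, 𝒯.PiecewiseH2 u → 𝒯.PiecewiseH2 v → F (u - v) =ᵐ[μ] fun x => F u x - F v x

namespace Triangulation

variable {𝒯 : Triangulation M}

lemma PiecewiseH2.sub {u v : SpaceTime n → ℝ} (hu : 𝒯.PiecewiseH2 u) (hv : 𝒯.PiecewiseH2 v) :
    𝒯.PiecewiseH2 (u - v) := fun i => (hu i).sub (hv i)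

namespace IsL2Op

variable {μ : Measure (SpaceTime n)} {F G : (SpaceTime n → ℝ) → SpaceTime n → ℝ}
  {u v w : SpaceTime n → ℝ}

lemma mono (hF : 𝒯.IsL2Op μ F) {ν : Measure (SpaceTime n)} (h : ν ≤ μ) : 𝒯.IsL2Op ν F :=
  ⟨fun v hv => (hF.memLp v hv).mono_measure h, fun u v hu hv =>
    (hF.sub u v hu hv).filter_mono (ae_mono h)⟩

lemma add (hF : 𝒯.IsL2Op μ F) (hG : 𝒯.IsL2Op μ G) : 𝒯.IsL2Op μ fun v x => F v x + G v x :=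
  ⟨fun v hv => (hF.memLp v hv).add (hG.memLp v hv), fun u v hu hv => by
    filter_upwards [hF.sub u v hu hv, hG.sub u v hu hv] with x h1 h2
    rw [h1, h2]; ring⟩

lemma finset_sum {ι : Type*} (s : Finset ι) {F : ι → (SpaceTime n → ℝ) → SpaceTime n → ℝ}
    (hF : ∀ k ∈ s, 𝒯.IsL2Op μ (F k)) : 𝒯.IsL2Op μ fun v x => ∑ k ∈ s, F k v x :=
  ⟨fun v hv => memLp_finsetSum s fun k hk => (hF k hk).memLp v hv, fun u v hu hv => by
    have : ∀ᵐ x ∂μ, ∀ k ∈ s, F k (u - v) x = F k u x - F k v x :=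
      (ae_ball_iff s.countable_toSet).2 fun k hk => (hF k hk).sub u v hu hv
    filter_upwards [this] with x hx
    rw [← Finset.sum_sub_distrib]
    exact Finset.sum_congr rfl hx⟩

lemma bounded_mul (hF : 𝒯.IsL2Op μ F) {b : SpaceTime n → ℝ} (hb : AEStronglyMeasurable b μ)
    (hb1 : ∀ x, |b x| ≤ 1) : 𝒯.IsL2Op μ fun v x => b x * F v x :=
  ⟨fun v hv => (hF.memLp v hv).of_le (hb.mul (hF.memLp v hv).1) (Eventually.of_forall fun x => by
      rw [norm_mul]
      exact mul_le_of_le_one_left (norm_nonneg _) (hb1 x)), fun u v hu hv => by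
    filter_upwards [hF.sub u v hu hv] with x hx
    rw [hx, mul_sub]⟩

lemma integral_sub_left (hF : 𝒯.IsL2Op μ F) (hG : 𝒯.IsL2Op μ G) (hu : 𝒯.PiecewiseH2 u)
    (hv : 𝒯.PiecewiseH2 v) (hw : 𝒯.PiecewiseH2 w) :
    ∫ x, F (u - v) x * G w x ∂μ = (∫ x, F u x * G w x ∂μ) - ∫ x, F v x * G w x ∂μ := by
  have h1 : Integrable (fun x => F u x * G w x) μ := (hF.memLp u hu).integrable_mul (hG.memLp w hw)
  have h2 : Integrable (fun x => F v x * G w x) μ := (hF.memLp v hv).integrable_mul (hG.memLp w hw)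
  rw [← integral_sub h1 h2]
  refine integral_congr_ae ?_
  filter_upwards [hF.sub u v hu hv] with x hx
  rw [hx, sub_mul]

/-- Write `0` as `v - v`; any elementwise `H²` function `v` will do. -/
lemma ae_zero (hF : 𝒯.IsL2Op μ F) (hv : 𝒯.PiecewiseH2 v) : F 0 =ᵐ[μ] 0 := by
  have := hF.sub v v hv hv
  rw [sub_self] at this
  filter_upwards [this] with x hx
  simp [hx]

lemma integral_zero_right (hG : 𝒯.IsL2Op μ G) (hv : 𝒯.PiecewiseH2 v) (f : SpaceTime n → ℝ) :
    ∫ x, f x * G 0 x ∂μ = 0 := by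
  refine integral_eq_zero_of_ae ?_
  filter_upwards [hG.ae_zero hv] with x hx
  simp [hx]

end IsL2Op

end Triangulation

end Forms

/-! ### The operators from which the forms are built. -/

namespace Triangulation.IsMesh

variable {n : ℕ} {M : Set (SpaceTime n)} {𝒯 : Triangulation M} {r : ℝ}

lemma piecewiseH2_of_memSobolev (h : 𝒯.IsMesh r) {u : SpaceTime n → ℝ} (hu : MemSobolev M 2 u) :
    𝒯.PiecewiseH2 u := fun i => hu.mono (h.int_subset i)

lemma piecewiseH2_of_mem_femSpace (h : 𝒯.IsMesh r) {q : ℕ} {w : SpaceTime n → ℝ}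
    (hw : w ∈ 𝒯.femSpace q) : 𝒯.PiecewiseH2 w := fun i => by
  obtain ⟨P, -, hP⟩ := exists_poly hw i
  exact h.memSobolev_of_eqOn (contDiff_polyFun P) hP 2

section Operators

lemma isL2Op_weakDeriv {m : ℕ} (hm : m ≤ 2) (i : Fin 𝒯.card)
    (w : Fin m → Fin (n + 1)) :
    𝒯.IsL2Op (volume.restrict (𝒯.int i)) fun v => weakDeriv (𝒯.int i) w v :=
  ⟨fun _ hv => (hv i).memLp_weakDeriv hm w,
    fun _ _ hu hv => (hu i).weakDeriv_sub (isOpen_int 𝒯 i) (hv i) hm w⟩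

lemma isL2Op_grad (i : Fin 𝒯.card) (k : Fin (n + 1)) :
    𝒯.IsL2Op (volume.restrict (𝒯.int i)) fun v x => grad (𝒯.int i) v x k :=
  isL2Op_weakDeriv (by norm_num) i ![k]

lemma box_eq_sum (U : Set (SpaceTime n)) (v : SpaceTime n → ℝ) (x : SpaceTime n) :
    box U v x = ∑ k, -minkSign k * weakDeriv U ![k, k] v x := by
  simp [box, Fin.sum_univ_succ, minkSign, sub_eq_neg_add]

lemma abs_minkSign_le (k : Fin (n + 1)) : |(-minkSign k : ℝ)| ≤ 1 := by
  rw [abs_neg, abs_minkSign]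

lemma isL2Op_box (i : Fin 𝒯.card) :
    𝒯.IsL2Op (volume.restrict (𝒯.int i)) fun v => box (𝒯.int i) v := by
  have := Triangulation.IsL2Op.finset_sum (𝒯 := 𝒯) (μ := volume.restrict (𝒯.int i)) Finset.univ
    (F := fun k v x => -minkSign k * weakDeriv (𝒯.int i) ![k, k] v x) fun k _ =>
      (isL2Op_weakDeriv le_rfl i ![k, k]).bounded_mul aestronglyMeasurable_const
        fun _ => abs_minkSign_le k
  have e : (fun v => box (𝒯.int i) v) =
      fun v x => ∑ k, -minkSign k * weakDeriv (𝒯.int i) ![k, k] v x := by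
    ext v x
    exact box_eq_sum _ _ _
  rwa [e]

lemma isL2Op_trace (h : 𝒯.IsMesh r) (i : Fin 𝒯.card) :
    𝒯.IsL2Op ((surface n).restrict (frontier (𝒯.elem i))) fun v => trace (𝒯.int i) v :=
  ⟨fun _ hv => h.memLp_trace ((hv i).of_le one_le_two), fun _ _ hu hv => by
    obtain ⟨c, hc⟩ := h.star i
    exact hc.trace_sub ((hu i).of_le one_le_two) ((hv i).of_le one_le_two)⟩

lemma isL2Op_traceGrad (h : 𝒯.IsMesh r) (i : Fin 𝒯.card) (k : Fin (n + 1)) :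
    𝒯.IsL2Op ((surface n).restrict (frontier (𝒯.elem i)))
      fun v x => traceGrad (𝒯.int i) v x k :=
  ⟨fun _ hv => h.memLp_traceGrad (hv i) k, fun u v hu hv => by
    obtain ⟨c, hc⟩ := h.star i
    have h1 : (fun y => grad (𝒯.int i) (u - v) y k) =ᵐ[volume.restrict (𝒯.int i)]
        (fun y => grad (𝒯.int i) u y k) - fun y => grad (𝒯.int i) v y k :=
      (isL2Op_grad i k).sub u v hu hv
    exact hc.trace_ae_eq ((hc.isTrace_trace ((hu i).grad k)).sub isOpen_interior
      (hc.isTrace_trace ((hv i).grad k))) h1⟩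

lemma abs_outerNormal_le (S : Set (SpaceTime n)) (x : SpaceTime n) (k : Fin (n + 1)) :
    |outerNormal S x k| ≤ 1 := by
  rw [abs_le_one_iff_mul_self_le_one, ← sq]
  exact (Finset.single_le_sum (f := fun k => outerNormal S x k ^ 2)
    (fun _ _ => sq_nonneg _) (Finset.mem_univ k)).trans (outerNormal_sq_le S x)

lemma conormal_eq (S U : Set (SpaceTime n)) (v : SpaceTime n → ℝ) (x : SpaceTime n) :
    outerNormal S x ⬝ᵥ (minkowski n).mulVec (traceGrad U v x) =
      ∑ k, minkSign k * outerNormal S x k * traceGrad U v x k := by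
  rw [dotProduct_comm, minkowski_dot]
  exact Finset.sum_congr rfl fun k _ => by ring

lemma abs_minkSign_mul_outerNormal_le (S : Set (SpaceTime n)) (k : Fin (n + 1)) (x : SpaceTime n) :
    |minkSign k * outerNormal S x k| ≤ 1 := by
  rw [abs_mul, abs_minkSign, one_mul]
  exact abs_outerNormal_le S x k

lemma isL2Op_conormal_face (h : 𝒯.IsMesh r) {i j : Fin 𝒯.card} (hij : i ≠ j) :
    𝒯.IsL2Op ((surface n).restrict (𝒯.face i j)) fun v x =>
      outerNormal (𝒯.elem i) x ⬝ᵥ (minkowski n).mulVec (traceGrad (𝒯.int i) v x) := by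
  simp_rw [conormal_eq]
  exact .finset_sum Finset.univ (F := fun k v x => minkSign k * outerNormal (𝒯.elem i) x k *
    traceGrad (𝒯.int i) v x k) fun k _ => ((h.isL2Op_traceGrad i k).mono
      (Measure.restrict_mono (h.face_subset hij) le_rfl)).bounded_mul
        ((h.aestronglyMeasurable_outerNormal hij k).const_mul _)
        (abs_minkSign_mul_outerNormal_le _ k)

lemma isL2Op_jump (h : 𝒯.IsMesh r) {i j : Fin 𝒯.card} (hij : i ≠ j) :
    𝒯.IsL2Op ((surface n).restrict (𝒯.face i j)) fun v => 𝒯.jump i j v := by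
  have h2 := h.isL2Op_conormal_face hij.symm
  rw [face_comm] at h2
  exact (h.isL2Op_conormal_face hij).add h2

/-- The normal is defined by choice, but almost everywhere it equals the flux density, which is
measurable. -/
lemma aestronglyMeasurable_outerNormal_bdry (h : 𝒯.IsMesh r) (i : Fin 𝒯.card)
    (k : Fin (n + 1)) : AEStronglyMeasurable (fun x => outerNormal M x k)
      ((surface n).restrict (𝒯.bdry i)) := by
  obtain ⟨b, hb, -, -, hbdry⟩ := h.exists_flux
  exact ((hb i k).1.mono_measure (Measure.restrict_mono (h.bdry_subset i) le_rfl)).congr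
    (hbdry i k)

lemma isL2Op_conormal_bdry (h : 𝒯.IsMesh r) (i : Fin 𝒯.card) :
    𝒯.IsL2Op ((surface n).restrict (𝒯.bdry i)) fun v x =>
      (minkowski n).mulVec (traceGrad (𝒯.int i) v x) ⬝ᵥ outerNormal M x := by
  simp_rw [dotProduct_comm _ (outerNormal M _), conormal_eq]
  exact .finset_sum Finset.univ (F := fun k v x => minkSign k * outerNormal M x k *
    traceGrad (𝒯.int i) v x k) fun k _ => ((h.isL2Op_traceGrad i k).mono
      (Measure.restrict_mono (h.bdry_subset i) le_rfl)).bounded_mul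
        ((h.aestronglyMeasurable_outerNormal_bdry i k).const_mul _)
        (abs_minkSign_mul_outerNormal_le _ k)

lemma isL2Op_normal_bdry (h : 𝒯.IsMesh r) (i : Fin 𝒯.card) :
    𝒯.IsL2Op ((surface n).restrict (𝒯.bdry i)) fun v x =>
      ∑ k : Fin n, traceGrad (𝒯.int i) v x k.succ * outerNormal M x k.succ := by
  simp_rw [mul_comm _ (outerNormal M _ _)]
  exact .finset_sum Finset.univ (F := fun (k : Fin n) v x => outerNormal M x k.succ *
    traceGrad (𝒯.int i) v x k.succ) fun k _ => ((h.isL2Op_traceGrad i k.succ).mono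
      (Measure.restrict_mono (h.bdry_subset i) le_rfl)).bounded_mul
        (h.aestronglyMeasurable_outerNormal_bdry i k.succ)
        (fun x => abs_outerNormal_le _ x _)

lemma inter_subset_bdry {Sig : Set (SpaceTime n)} (hSig : Sig ⊆ frontier M) (i : Fin 𝒯.card) :
    𝒯.elem i ∩ Sig ⊆ 𝒯.bdry i := Set.inter_subset_inter_right _ hSig

lemma isL2Op_trace_inter (h : 𝒯.IsMesh r) {Sig : Set (SpaceTime n)} (hSig : Sig ⊆ frontier M)
    (i : Fin 𝒯.card) : 𝒯.IsL2Op ((surface n).restrict (𝒯.elem i ∩ Sig))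
      fun v => trace (𝒯.int i) v :=
  (h.isL2Op_trace i).mono (Measure.restrict_mono
    ((inter_subset_bdry hSig i).trans (h.bdry_subset i)) le_rfl)

end Operators

end Triangulation.IsMesh

/-! ### Linearity, boundedness and positivity of the forms. -/

namespace Triangulation.IsMesh

variable {n : ℕ} {M : Set (SpaceTime n)} {𝒯 : Triangulation M} {r : ℝ}
  {Sig Obs : Set (SpaceTime n)} {u v w z : SpaceTime n → ℝ}

section Bilinear

/-- The observation set may touch the frontier of `M`, but that is a null set for the volume, so
square integrability on the open elements suffices. -/
lemma isL2Op_id (h : 𝒯.IsMesh r) (hObs : Obs ⊆ closure M) :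
    𝒯.IsL2Op (volume.restrict Obs) fun v => v := by
  have hle : volume.restrict Obs ≤ ∑ i, volume.restrict (𝒯.int i) := by
    rw [← h.restrict_volume]
    have : M =ᵐ[volume] closure M := by
      refine subset_closure.eventuallyLE.antisymm ?_
      rw [ae_le_set, ← h.isOpen.frontier_eq]
      exact h.volume_frontier
    rw [Measure.restrict_congr_set this]
    exact Measure.restrict_mono hObs le_rfl
  refine ⟨fun v hv => MemLp.mono_measure hle ?_, fun u v _ _ => .rfl⟩
  have hm : AEStronglyMeasurable v (∑ i, volume.restrict (𝒯.int i)) := by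
    rw [← Measure.sum_fintype, aestronglyMeasurable_sum_measure_iff]
    exact fun i => (hv i).1.1
  rw [memLp_two_iff_integrable_sq hm, integrable_finsetSum_measure]
  exact fun i _ => (hv i).1.integrable_sq

lemma integral_sq_obs_le (h : 𝒯.IsMesh r) (hObs : Obs ⊆ closure M) (hv : 𝒯.PiecewiseH2 v) :
    ∫ x in Obs, v x ^ 2 ≤ ∑ i, ∫ x in 𝒯.int i, v x ^ 2 := by
  have hi : Integrable (fun x => v x ^ 2) (volume.restrict (closure M)) :=
    ((h.isL2Op_id subset_rfl).memLp v hv).integrable_sq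
  have : M =ᵐ[volume] closure M := by
    refine subset_closure.eventuallyLE.antisymm ?_
    rw [ae_le_set, ← h.isOpen.frontier_eq]
    exact h.volume_frontier
  calc ∫ x in Obs, v x ^ 2 ≤ ∫ x in closure M, v x ^ 2 :=
        setIntegral_mono_set hi (Eventually.of_forall fun _ => sq_nonneg _) hObs.eventuallyLE
    _ = ∑ i, ∫ x in 𝒯.int i, v x ^ 2 := by
      rw [← Measure.restrict_congr_set this, h.restrict_volume, integral_finsetSum_measure]
      exact fun i _ => (hv i).1.integrable_sq

lemma sForm_comm (𝒯 : Triangulation M) (Sig : Set (SpaceTime n)) (u v : SpaceTime n → ℝ) :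
    𝒯.sForm Sig u v = 𝒯.sForm Sig v u := by
  simp only [sForm, mul_comm (box _ u _), mul_comm (trace _ u _), mul_comm (jump _ _ _ u _)]

lemma sForm_sub_left (h : 𝒯.IsMesh r) (hSig : Sig ⊆ frontier M) (hu : 𝒯.PiecewiseH2 u)
    (hv : 𝒯.PiecewiseH2 v) (hw : 𝒯.PiecewiseH2 w) :
    𝒯.sForm Sig (u - v) w = 𝒯.sForm Sig u w - 𝒯.sForm Sig v w := by
  simp only [sForm]
  rw [← Finset.sum_sub_distrib]
  refine Finset.sum_congr rfl fun i _ => ?_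
  rw [(isL2Op_box i).integral_sub_left (isL2Op_box i) hu hv hw,
    (h.isL2Op_trace_inter hSig i).integral_sub_left (h.isL2Op_trace_inter hSig i) hu hv hw]
  have : ∑ j ∈ Finset.univ.erase i, 𝒯.meshSize *
      ∫ x in 𝒯.face i j, 𝒯.jump i j (u - v) x * 𝒯.jump i j w x ∂(surface n) =
      (∑ j ∈ Finset.univ.erase i, 𝒯.meshSize *
        ∫ x in 𝒯.face i j, 𝒯.jump i j u x * 𝒯.jump i j w x ∂(surface n)) -
      ∑ j ∈ Finset.univ.erase i, 𝒯.meshSize *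
        ∫ x in 𝒯.face i j, 𝒯.jump i j v x * 𝒯.jump i j w x ∂(surface n) := by
    rw [← Finset.sum_sub_distrib]
    refine Finset.sum_congr rfl fun j hj => ?_
    have hij := (Finset.ne_of_mem_erase hj).symm
    rw [(h.isL2Op_jump hij).integral_sub_left (h.isL2Op_jump hij) hu hv hw, mul_sub]
  rw [this]
  ring

lemma sForm_sub_right (h : 𝒯.IsMesh r) (hSig : Sig ⊆ frontier M) (hu : 𝒯.PiecewiseH2 u)
    (hv : 𝒯.PiecewiseH2 v) (hw : 𝒯.PiecewiseH2 w) :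
    𝒯.sForm Sig w (u - v) = 𝒯.sForm Sig w u - 𝒯.sForm Sig w v := by
  rw [sForm_comm, h.sForm_sub_left hSig hu hv hw, sForm_comm, sForm_comm _ _ v]

lemma abs_sForm_le (h : 𝒯.IsMesh r) (hSig : Sig ⊆ frontier M) (hu : 𝒯.PiecewiseH2 u)
    (hv : 𝒯.PiecewiseH2 v) {t : ℝ} (ht : 0 < t) :
    |𝒯.sForm Sig u v| ≤ t * 𝒯.sForm Sig u u + (4 * t)⁻¹ * 𝒯.sForm Sig v v := by
  rw [sForm, sForm, sForm, Finset.mul_sum, Finset.mul_sum, ← Finset.sum_add_distrib]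
  refine (Finset.abs_sum_le_sum_abs _ _).trans (Finset.sum_le_sum fun i _ => ?_)
  have hh := h.meshSize_pos i
  have h1 := abs_integral_mul_le ((isL2Op_box i).memLp u hu) ((isL2Op_box i).memLp v hv) ht
  have h2 := abs_integral_mul_le ((h.isL2Op_trace_inter hSig i).memLp u hu)
    ((h.isL2Op_trace_inter hSig i).memLp v hv) ht
  have h3 : |∑ j ∈ Finset.univ.erase i, 𝒯.meshSize *
      ∫ x in 𝒯.face i j, 𝒯.jump i j u x * 𝒯.jump i j v x ∂(surface n)| ≤
      t * (∑ j ∈ Finset.univ.erase i, 𝒯.meshSize *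
        ∫ x in 𝒯.face i j, 𝒯.jump i j u x * 𝒯.jump i j u x ∂(surface n)) +
      (4 * t)⁻¹ * ∑ j ∈ Finset.univ.erase i, 𝒯.meshSize *
        ∫ x in 𝒯.face i j, 𝒯.jump i j v x * 𝒯.jump i j v x ∂(surface n) := by
    simp only [Finset.mul_sum, ← Finset.sum_add_distrib]
    refine (Finset.abs_sum_le_sum_abs _ _).trans (Finset.sum_le_sum fun j hj => ?_)
    have hij := (Finset.ne_of_mem_erase hj).symm
    have h4 := abs_integral_mul_le ((h.isL2Op_jump hij).memLp u hu)
      ((h.isL2Op_jump hij).memLp v hv) ht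
    simp only [sq] at h4
    rw [abs_mul, abs_of_pos hh]
    nlinarith [mul_le_mul_of_nonneg_left h4 hh.le]
  simp only [sq (box _ _ _), sq (trace _ _ _)] at h1 h2
  refine (abs_add_le _ _).trans ?_
  refine (add_le_add_left (abs_add_le _ _) _).trans ?_
  rw [abs_mul, abs_mul, abs_of_pos (pow_pos hh 2), abs_of_pos (inv_pos.2 hh)]
  have h1' := mul_le_mul_of_nonneg_left h1 (pow_pos hh 2).le
  have h2' := mul_le_mul_of_nonneg_left h2 (inv_pos.2 hh).le
  linarith

lemma sForm_self_nonneg (h : 𝒯.IsMesh r) (v : SpaceTime n → ℝ) : 0 ≤ 𝒯.sForm Sig v v := by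
  refine Finset.sum_nonneg fun i _ => ?_
  have hh := h.meshSize_pos i
  have hn : ∀ (μ : Measure (SpaceTime n)) (f : SpaceTime n → ℝ), 0 ≤ ∫ x, f x * f x ∂μ :=
    fun μ f => integral_nonneg fun x => mul_self_nonneg _
  have h3 : 0 ≤ ∑ j ∈ Finset.univ.erase i,
      𝒯.meshSize * ∫ x in 𝒯.face i j, 𝒯.jump i j v x * 𝒯.jump i j v x ∂(surface n) :=
    Finset.sum_nonneg fun j _ => mul_nonneg hh.le (hn _ _)
  have h1 := mul_nonneg (pow_pos hh 2).le (hn (volume.restrict (𝒯.int i)) (box (𝒯.int i) v))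
  have h2 := mul_nonneg (inv_pos.2 hh).le
    (hn ((surface n).restrict (𝒯.elem i ∩ Sig)) (trace (𝒯.int i) v))
  linarith

/-- Expand, and bound the mixed term by Young's inequality with `t = 1 / 2`. -/
lemma sForm_sub_self_le (h : 𝒯.IsMesh r) (hSig : Sig ⊆ frontier M) (hu : 𝒯.PiecewiseH2 u)
    (hv : 𝒯.PiecewiseH2 v) :
    𝒯.sForm Sig (u - v) (u - v) ≤ 2 * 𝒯.sForm Sig u u + 2 * 𝒯.sForm Sig v v := by
  rw [h.sForm_sub_left hSig hu hv (hu.sub hv), h.sForm_sub_right hSig hu hv hu,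
    h.sForm_sub_right hSig hu hv hv, sForm_comm _ _ v u]
  have := (abs_le.1 (h.abs_sForm_le hSig hu hv (t := 1 / 2) (by norm_num))).1
  norm_num at this
  linarith

lemma aForm_eq (hu : 𝒯.PiecewiseH2 u) (hz : 𝒯.PiecewiseH2 z) : 𝒯.aForm u z =
    ∑ i, ∑ k, minkSign k * ∫ x in 𝒯.int i, grad (𝒯.int i) u x k * grad (𝒯.int i) z x k := by
  refine Finset.sum_congr rfl fun i _ => ?_
  simp_rw [minkowski_dot, mul_assoc]
  have hi : ∀ k, Integrable (fun x => minkSign k *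
      (grad (𝒯.int i) u x k * grad (𝒯.int i) z x k)) (volume.restrict (𝒯.int i)) := fun k =>
    (((isL2Op_grad i k).memLp u hu).integrable_mul ((isL2Op_grad i k).memLp z hz)).const_mul _
  rw [integral_finsetSum _ fun k _ => hi k]
  exact Finset.sum_congr rfl fun k _ => integral_const_mul _ _

lemma isL2Op_normal_inter (h : 𝒯.IsMesh r) (hSig : Sig ⊆ frontier M) (i : Fin 𝒯.card) :
    𝒯.IsL2Op ((surface n).restrict (𝒯.elem i ∩ Sig)) fun v x =>
      ∑ k : Fin n, traceGrad (𝒯.int i) v x k.succ * outerNormal M x k.succ :=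
  (h.isL2Op_normal_bdry i).mono (Measure.restrict_mono (inter_subset_bdry hSig i) le_rfl)

lemma isL2Op_trace_bdry (h : 𝒯.IsMesh r) (i : Fin 𝒯.card) :
    𝒯.IsL2Op ((surface n).restrict (𝒯.bdry i)) fun v => trace (𝒯.int i) v :=
  (h.isL2Op_trace i).mono (Measure.restrict_mono (h.bdry_subset i) le_rfl)

lemma ahForm_sub_left (h : 𝒯.IsMesh r) (hSig : Sig ⊆ frontier M) (hu : 𝒯.PiecewiseH2 u)
    (hv : 𝒯.PiecewiseH2 v) (hz : 𝒯.PiecewiseH2 z) :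
    𝒯.ahForm Sig (u - v) z = 𝒯.ahForm Sig u z - 𝒯.ahForm Sig v z := by
  simp only [ahForm]
  rw [aForm_eq (hu.sub hv) hz, aForm_eq hu hz, aForm_eq hv hz]
  have h1 : ∀ i k, ∫ x in 𝒯.int i, grad (𝒯.int i) (u - v) x k * grad (𝒯.int i) z x k =
      (∫ x in 𝒯.int i, grad (𝒯.int i) u x k * grad (𝒯.int i) z x k) -
        ∫ x in 𝒯.int i, grad (𝒯.int i) v x k * grad (𝒯.int i) z x k := fun i k =>
    (isL2Op_grad i k).integral_sub_left (isL2Op_grad i k) hu hv hz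
  have h2 := fun i => (h.isL2Op_conormal_bdry i).integral_sub_left (h.isL2Op_trace_bdry i) hu hv hz
  have h3 := fun i => (h.isL2Op_trace_inter hSig i).integral_sub_left
    (h.isL2Op_normal_inter hSig i) hu hv hz
  simp_rw [mul_comm (trace _ _ _)] at h3
  simp_rw [h1, h2, h3, mul_sub, Finset.sum_sub_distrib]
  ring

/-- Derivatives and traces of the zero function are still obtained by choice and vanish only almost
everywhere, so this is not a matter of unfolding. -/
lemma ahForm_zero_right (h : 𝒯.IsMesh r) (hSig : Sig ⊆ frontier M) (hu : 𝒯.PiecewiseH2 u) :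
    𝒯.ahForm Sig u 0 = 0 := by
  have h1 : 𝒯.aForm u 0 = 0 := by
    refine Finset.sum_eq_zero fun i _ => integral_eq_zero_of_ae ?_
    filter_upwards [ae_all_iff.2 fun k => (isL2Op_grad i k).ae_zero hu] with x hx
    rw [minkowski_dot]
    exact Finset.sum_eq_zero fun k _ => by rw [hx k]; simp
  have h3 := fun i => (h.isL2Op_normal_inter hSig i).integral_zero_right hu (trace (𝒯.int i) u)
  simp_rw [mul_comm (trace _ _ _)] at h3
  simp_rw [ahForm, h1, (h.isL2Op_trace_bdry _).integral_zero_right hu, h3]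
  simp

lemma sStarForm_zero_right (h : 𝒯.IsMesh r) (hz : 𝒯.PiecewiseH2 z) : 𝒯.sStarForm z 0 = 0 := by
  refine Finset.sum_eq_zero fun i _ => ?_
  have h1 : ∫ x in 𝒯.int i, grad (𝒯.int i) z x ⬝ᵥ grad (𝒯.int i) 0 x = 0 := by
    refine integral_eq_zero_of_ae ?_
    filter_upwards [ae_all_iff.2 fun k => (isL2Op_grad i k).ae_zero hz] with x hx
    exact Finset.sum_eq_zero fun k _ => by rw [hx k]; simp
  rw [h1, (h.isL2Op_trace_bdry i).integral_zero_right hz]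
  simp

lemma sStarForm_self (hz : 𝒯.PiecewiseH2 z) : 𝒯.sStarForm z z =
    ∑ i, ((∑ k, ∫ x in 𝒯.int i, grad (𝒯.int i) z x k ^ 2) +
      𝒯.meshSize⁻¹ * ∫ x in 𝒯.bdry i, trace (𝒯.int i) z x ^ 2 ∂(surface n)) := by
  refine Finset.sum_congr rfl fun i _ => ?_
  rw [← integral_finsetSum _ fun k _ => ((isL2Op_grad i k).memLp z hz).integrable_sq]
  simp only [dotProduct, sq]

end Bilinear

end Triangulation.IsMesh

/-! ### Bounds by the scaled norm. -/

section Estimates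

variable {n : ℕ} {M : Set (SpaceTime n)}

lemma eLpNorm_two_sq_eq_ofReal_integral {α : Type*} [MeasurableSpace α] {μ : Measure α}
    {f : α → ℝ} (hf : MemLp f 2 μ) :
    eLpNorm f 2 μ ^ 2 = ENNReal.ofReal (∫ x, f x ^ 2 ∂μ) := by
  rw [eLpNorm_two_sq_ofReal, ofReal_integral_eq_lintegral_ofReal hf.integrable_sq
    (Eventually.of_forall fun _ => sq_nonneg _)]

/-- The trace inequality, in terms of integrals. -/
lemma IsStarBody.integral_trace_sq_le {K : Set (SpaceTime n)} {c : SpaceTime n} {κ h C : ℝ}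
    (hK : IsStarBody K c κ h) (hC0 : 0 ≤ C) (hC : HasTraceConst K h C) {v : SpaceTime n → ℝ}
    (hv : MemSobolev (interior K) 1 v) :
    ∫ x in frontier K, trace (interior K) v x ^ 2 ∂(surface n) ≤
      2 * C * (h⁻¹ * (∫ x in interior K, v x ^ 2) +
        h * ∑ k, ∫ x in interior K, grad (interior K) v x k ^ 2) := by
  have hh := hK.size_pos
  have h1 := hK.trace_sq_le hC hv
  have hg : ∀ k, MemLp (fun x => grad (interior K) v x k) 2 (volume.restrict (interior K)) :=
    fun k => hv.memLp_weakDeriv le_rfl ![k]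
  have hn : ∀ k, 0 ≤ ∫ x in interior K, grad (interior K) v x k ^ 2 := fun k =>
    integral_nonneg fun _ => sq_nonneg _
  have hn0 : 0 ≤ ∫ x in interior K, v x ^ 2 := integral_nonneg fun _ => sq_nonneg _
  have hs := Finset.sum_nonneg fun k (_ : k ∈ Finset.univ) => hn k
  simp_rw [eLpNorm_two_sq_eq_ofReal_integral (hg _)] at h1
  rw [eLpNorm_two_sq_eq_ofReal_integral (hK.memLp_trace hv),
    eLpNorm_two_sq_eq_ofReal_integral hv.1, ← ENNReal.ofReal_sum_of_nonneg fun k _ => hn k,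
    ← ENNReal.ofReal_mul (inv_pos.2 hh).le, ← ENNReal.ofReal_mul hh.le,
    ← ENNReal.ofReal_add (by positivity) (by positivity),
    mul_left_comm, ← ENNReal.ofReal_mul hC0] at h1
  have h2 : ∀ a : ℝ, (2 : ℝ≥0∞) * ENNReal.ofReal a = ENNReal.ofReal (2 * a) := fun a => by
    rw [ENNReal.ofReal_mul zero_le_two, ENNReal.ofReal_ofNat]
  rw [h2, ENNReal.ofReal_le_ofReal_iff (by positivity)] at h1
  linarith

namespace Triangulation

/-- The scaled `H²` norm `h⁻² ‖v‖² + ‖∇v‖² + h² ‖∇²v‖²` on the element `K`. -/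
def scaledNormSq (𝒯 : Triangulation M) (i : Fin 𝒯.card) (v : SpaceTime n → ℝ) : ℝ :=
  (𝒯.meshSize ^ 2)⁻¹ * (∫ x in 𝒯.int i, v x ^ 2) +
    (∑ k, ∫ x in 𝒯.int i, grad (𝒯.int i) v x k ^ 2) +
      𝒯.meshSize ^ 2 * ∑ k, ∑ l, ∫ x in 𝒯.int i, weakDeriv (𝒯.int i) ![k, l] v x ^ 2

namespace IsMesh

variable {𝒯 : Triangulation M} {r : ℝ} {Sig : Set (SpaceTime n)} {v z : SpaceTime n → ℝ}

lemma integral_sq_nonneg {α : Type*} [MeasurableSpace α] (μ : Measure α) (f : α → ℝ) :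
    0 ≤ ∫ x, f x ^ 2 ∂μ := integral_nonneg fun _ => sq_nonneg _

lemma sum_grad_sq_le (h : 𝒯.IsMesh r) (i : Fin 𝒯.card) (v : SpaceTime n → ℝ) :
    ∑ k, ∫ x in 𝒯.int i, grad (𝒯.int i) v x k ^ 2 ≤ 𝒯.scaledNormSq i v := by
  have hh := h.meshSize_pos i
  have h1 : 0 ≤ ∑ k, ∑ l, ∫ x in 𝒯.int i, weakDeriv (𝒯.int i) ![k, l] v x ^ 2 :=
    Finset.sum_nonneg fun _ _ => Finset.sum_nonneg fun _ _ => integral_sq_nonneg _ _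
  have h2 := integral_sq_nonneg (volume.restrict (𝒯.int i)) v
  have h3 : 0 ≤ (𝒯.meshSize ^ 2)⁻¹ * ∫ x in 𝒯.int i, v x ^ 2 := by positivity
  have h4 := mul_nonneg (pow_pos hh 2).le h1
  rw [scaledNormSq]
  linarith

/-- Multiplied by `h⁻¹`, the trace inequality has exactly the powers of `h` of the first two terms
of the scaled norm. -/
lemma trace_estimate (h : 𝒯.IsMesh r) {C : ℝ} (hC0 : 0 ≤ C)
    (hC : ∀ i, HasTraceConst (𝒯.elem i) 𝒯.meshSize C) (hv : 𝒯.PiecewiseH2 v) (i : Fin 𝒯.card) :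
    𝒯.meshSize⁻¹ * ∫ x in frontier (𝒯.elem i), trace (𝒯.int i) v x ^ 2 ∂(surface n) ≤
      2 * C * 𝒯.scaledNormSq i v := by
  obtain ⟨c, hc⟩ := h.star i
  have hh := h.meshSize_pos i
  have h1 := hc.integral_trace_sq_le hC0 (hC i) ((hv i).of_le one_le_two)
  have h2 := mul_le_mul_of_nonneg_left h1 (inv_pos.2 hh).le
  refine h2.trans ?_
  have h4 : 0 ≤ ∑ k, ∑ l, ∫ x in 𝒯.int i, weakDeriv (𝒯.int i) ![k, l] v x ^ 2 :=
    Finset.sum_nonneg fun _ _ => Finset.sum_nonneg fun _ _ => integral_sq_nonneg _ _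
  have h5 := mul_nonneg (mul_nonneg zero_le_two hC0) (mul_nonneg (pow_pos hh 2).le h4)
  rw [scaledNormSq]
  have e : 𝒯.meshSize⁻¹ * (2 * C * (𝒯.meshSize⁻¹ * (∫ x in interior (𝒯.elem i), v x ^ 2) +
      𝒯.meshSize * ∑ k, ∫ x in interior (𝒯.elem i), grad (interior (𝒯.elem i)) v x k ^ 2)) =
      2 * C * ((𝒯.meshSize ^ 2)⁻¹ * (∫ x in 𝒯.int i, v x ^ 2) +
        ∑ k, ∫ x in 𝒯.int i, grad (𝒯.int i) v x k ^ 2) := by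
    simp only [Triangulation.int]
    field_simp
  rw [e]
  linarith

/-- The trace inequality for each component of the gradient, multiplied by `h`, produces the last
two terms of the scaled norm. -/
lemma traceGrad_estimate (h : 𝒯.IsMesh r) {C : ℝ} (hC0 : 0 ≤ C)
    (hC : ∀ i, HasTraceConst (𝒯.elem i) 𝒯.meshSize C) (hv : 𝒯.PiecewiseH2 v) (i : Fin 𝒯.card) :
    𝒯.meshSize * ∑ k, ∫ x in frontier (𝒯.elem i), traceGrad (𝒯.int i) v x k ^ 2 ∂(surface n) ≤
      2 * C * 𝒯.scaledNormSq i v := by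
  obtain ⟨c, hc⟩ := h.star i
  have hh := h.meshSize_pos i
  have h1 : ∀ k, 𝒯.meshSize *
      ∫ x in frontier (𝒯.elem i), traceGrad (𝒯.int i) v x k ^ 2 ∂(surface n) ≤
      2 * C * ((∫ x in 𝒯.int i, grad (𝒯.int i) v x k ^ 2) +
        𝒯.meshSize ^ 2 * ∑ l, ∫ x in 𝒯.int i, weakDeriv (𝒯.int i) ![k, l] v x ^ 2) := by
    intro k
    have h2 := hc.integral_trace_sq_le hC0 (hC i) ((hv i).grad k)
    have e : ∀ l, ∫ x in interior (𝒯.elem i), grad (interior (𝒯.elem i))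
        (fun y => grad (𝒯.int i) v y k) x l ^ 2 =
        ∫ x in 𝒯.int i, weakDeriv (𝒯.int i) ![k, l] v x ^ 2 := by
      intro l
      refine integral_congr_ae ?_
      filter_upwards [weakDeriv_ae_eq (isOpen_int 𝒯 i) ((hv i).grad_grad k l) .rfl] with x hx
      simp only [grad]
      rw [← hx]
      rfl
    simp_rw [e] at h2
    refine (mul_le_mul_of_nonneg_left h2 hh.le).trans (le_of_eq ?_)
    simp only [Triangulation.int]
    field_simp
  rw [Finset.mul_sum]
  refine (Finset.sum_le_sum fun k _ => h1 k).trans ?_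
  rw [← Finset.mul_sum, Finset.sum_add_distrib, ← Finset.mul_sum, scaledNormSq]
  have h2 := integral_sq_nonneg (volume.restrict (𝒯.int i)) v
  have h3 : 0 ≤ 2 * C * ((𝒯.meshSize ^ 2)⁻¹ * ∫ x in 𝒯.int i, v x ^ 2) := by positivity
  linarith

/-- The factor `n + 1` is the number of pure second derivatives in `□`, by Cauchy–Schwarz. -/
lemma box_estimate (h : 𝒯.IsMesh r) (hv : 𝒯.PiecewiseH2 v) (i : Fin 𝒯.card) :
    𝒯.meshSize ^ 2 * ∫ x in 𝒯.int i, box (𝒯.int i) v x ^ 2 ≤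
      (n + 1) * 𝒯.scaledNormSq i v := by
  have hh := h.meshSize_pos i
  have hi : ∀ k, Integrable (fun x => weakDeriv (𝒯.int i) ![k, k] v x ^ 2)
      (volume.restrict (𝒯.int i)) := fun k =>
    ((hv i).memLp_weakDeriv le_rfl ![k, k]).integrable_sq
  have h1 : ∫ x in 𝒯.int i, box (𝒯.int i) v x ^ 2 ≤
      (n + 1) * ∑ k, ∫ x in 𝒯.int i, weakDeriv (𝒯.int i) ![k, k] v x ^ 2 := by
    rw [← integral_finsetSum _ fun k _ => hi k, ← integral_const_mul]
    refine integral_mono ((isL2Op_box i).memLp v hv).integrable_sq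
      ((integrable_finsetSum _ fun k _ => hi k).const_mul _) fun x => ?_
    beta_reduce
    rw [box_eq_sum]
    refine (sq_sum_le_card_mul_sum_sq (s := Finset.univ)
      (f := fun k => -minkSign k * weakDeriv (𝒯.int i) ![k, k] v x)).trans (le_of_eq ?_)
    simp only [Finset.card_univ, Fintype.card_fin, Nat.cast_add, Nat.cast_one]
    congr 1
    refine Finset.sum_congr rfl fun k _ => ?_
    rw [mul_pow, ← sq_abs (-minkSign k), abs_neg, abs_minkSign, one_pow, one_mul]
  have h2 : ∑ k, ∫ x in 𝒯.int i, weakDeriv (𝒯.int i) ![k, k] v x ^ 2 ≤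
      ∑ k, ∑ l, ∫ x in 𝒯.int i, weakDeriv (𝒯.int i) ![k, l] v x ^ 2 :=
    Finset.sum_le_sum fun k _ => Finset.single_le_sum
      (f := fun l => ∫ x in 𝒯.int i, weakDeriv (𝒯.int i) ![k, l] v x ^ 2)
      (fun l _ => integral_sq_nonneg _ _) (Finset.mem_univ k)
  have h3 : 0 ≤ (𝒯.meshSize ^ 2)⁻¹ * ∫ x in 𝒯.int i, v x ^ 2 :=
    mul_nonneg (by positivity) (integral_sq_nonneg _ _)
  have h4 : 0 ≤ ∑ k, ∫ x in 𝒯.int i, grad (𝒯.int i) v x k ^ 2 :=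
    Finset.sum_nonneg fun _ _ => integral_sq_nonneg _ _
  have hn : (0 : ℝ) ≤ n + 1 := by positivity
  calc 𝒯.meshSize ^ 2 * ∫ x in 𝒯.int i, box (𝒯.int i) v x ^ 2
      ≤ 𝒯.meshSize ^ 2 * ((n + 1) *
        ∑ k, ∑ l, ∫ x in 𝒯.int i, weakDeriv (𝒯.int i) ![k, l] v x ^ 2) := by
        gcongr
        exact h1.trans (mul_le_mul_of_nonneg_left h2 hn)
    _ = (n + 1) * (𝒯.meshSize ^ 2 *
        ∑ k, ∑ l, ∫ x in 𝒯.int i, weakDeriv (𝒯.int i) ![k, l] v x ^ 2) := by ring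
    _ ≤ _ := by
      refine mul_le_mul_of_nonneg_left ?_ hn
      rw [scaledNormSq]
      linarith

lemma conormal_sq_le (S U : Set (SpaceTime n)) (v : SpaceTime n → ℝ) (x : SpaceTime n) :
    (outerNormal S x ⬝ᵥ (minkowski n).mulVec (traceGrad U v x)) ^ 2 ≤
      ∑ k, traceGrad U v x k ^ 2 := by
  rw [conormal_eq]
  refine dot_sq_le _ _ _ ((Finset.sum_congr rfl fun k _ => ?_).trans_le (outerNormal_sq_le S x))
  rw [mul_pow, ← sq_abs (minkSign k), abs_minkSign, one_pow, one_mul]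

lemma integrable_traceGrad_sq (h : 𝒯.IsMesh r) (hv : 𝒯.PiecewiseH2 v) (i : Fin 𝒯.card) :
    Integrable (fun x => ∑ k, traceGrad (𝒯.int i) v x k ^ 2)
      ((surface n).restrict (frontier (𝒯.elem i))) :=
  integrable_finsetSum _ fun k _ => ((h.isL2Op_traceGrad i k).memLp v hv).integrable_sq

/-- The faces of an element overlap in null sets only. -/
lemma sum_face_le (h : 𝒯.IsMesh r) (i : Fin 𝒯.card) {φ : SpaceTime n → ℝ} (hφ : ∀ x, 0 ≤ φ x)
    (hi : Integrable φ ((surface n).restrict (frontier (𝒯.elem i)))) :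
    ∑ j ∈ Finset.univ.erase i, ∫ x in 𝒯.face i j, φ x ∂(surface n) ≤
      ∫ x in frontier (𝒯.elem i), φ x ∂(surface n) := by
  have hsub : ∀ j : {j // j ≠ i}, 𝒯.face i j ⊆ frontier (𝒯.elem i) := fun j =>
    h.face_subset j.2.symm
  have hd : Pairwise (Function.onFun (AEDisjoint (surface n))
      fun j : {j // j ≠ i} => 𝒯.face i j) := by
    intro j k hjk
    have hjk' : (j : Fin 𝒯.card) ≠ k := fun e => hjk (Subtype.ext e)
    have := h.surface_face_inter j.2.symm k.2.symm hjk'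
    exact this
  have h1 : (surface n).restrict (⋃ j : {j // j ≠ i}, 𝒯.face i j) =
      ∑ j : {j // j ≠ i}, (surface n).restrict (𝒯.face i j) := by
    rw [Measure.restrict_iUnion_ae hd fun j => (h.measurableSet_face i j).nullMeasurableSet,
      Measure.sum_fintype]
  have h2 : ∑ j ∈ Finset.univ.erase i, ∫ x in 𝒯.face i j, φ x ∂(surface n) =
      ∑ j : {j // j ≠ i}, ∫ x in 𝒯.face i j, φ x ∂(surface n) :=
    Finset.sum_subtype _ (fun j => by simp) _
  have h3 : ∫ x, φ x ∂(∑ j : {j // j ≠ i}, (surface n).restrict (𝒯.face i j)) =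
      ∑ j : {j // j ≠ i}, ∫ x in 𝒯.face i j, φ x ∂(surface n) :=
    integral_finsetSum_measure fun j _ => hi.mono_measure (Measure.restrict_mono (hsub j) le_rfl)
  rw [h2, ← h3, ← h1]
  exact setIntegral_mono_set hi (Eventually.of_forall hφ) (Set.iUnion_subset hsub).eventuallyLE

/-- Squaring a sum of two sides costs a factor 2, and the sum over ordered pairs meets each side of
each face twice; hence the factor 4. -/
lemma sum_jump_le (h : 𝒯.IsMesh r) (hv : 𝒯.PiecewiseH2 v) :
    ∑ i, ∑ j ∈ Finset.univ.erase i, ∫ x in 𝒯.face i j, 𝒯.jump i j v x ^ 2 ∂(surface n) ≤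
      4 * ∑ i, ∑ k, ∫ x in frontier (𝒯.elem i), traceGrad (𝒯.int i) v x k ^ 2 ∂(surface n) := by
  set φ : Fin 𝒯.card → SpaceTime n → ℝ := fun i x => ∑ k, traceGrad (𝒯.int i) v x k ^ 2 with hφ
  have hφ0 : ∀ i x, 0 ≤ φ i x := fun i x => Finset.sum_nonneg fun _ _ => sq_nonneg _
  have hφi := fun i => h.integrable_traceGrad_sq hv i
  have h1 : ∀ i j, i ≠ j → Integrable (φ i) ((surface n).restrict (𝒯.face i j)) := fun i j hij =>
    (hφi i).mono_measure (Measure.restrict_mono (h.face_subset hij) le_rfl)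
  have h2 : ∀ i j, i ≠ j → ∫ x in 𝒯.face i j, 𝒯.jump i j v x ^ 2 ∂(surface n) ≤
      2 * (∫ x in 𝒯.face i j, φ i x ∂(surface n)) + 2 * ∫ x in 𝒯.face j i, φ j x ∂(surface n) := by
    intro i j hij
    have i1 := (h1 i j hij).const_mul 2
    have i2 := (h1 j i hij.symm).const_mul 2
    rw [face_comm] at i2
    rw [face_comm 𝒯 j i, ← integral_const_mul, ← integral_const_mul, ← integral_add i1 i2]
    refine integral_mono ((h.isL2Op_jump hij).memLp v hv).integrable_sq (i1.add i2) fun x => ?_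
    have a1 := conormal_sq_le (𝒯.elem i) (𝒯.int i) v x
    have a2 := conormal_sq_le (𝒯.elem j) (𝒯.int j) v x
    have a3 := add_sq_le (a := outerNormal (𝒯.elem i) x ⬝ᵥ
      (minkowski n).mulVec (traceGrad (𝒯.int i) v x)) (b := outerNormal (𝒯.elem j) x ⬝ᵥ
      (minkowski n).mulVec (traceGrad (𝒯.int j) v x))
    simp only [jump, hφ]
    linarith
  have hswap : ∑ i, ∑ j ∈ Finset.univ.erase i, ∫ x in 𝒯.face j i, φ j x ∂(surface n) =
      ∑ i, ∑ j ∈ Finset.univ.erase i, ∫ x in 𝒯.face i j, φ i x ∂(surface n) := by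
    refine Finset.sum_comm' fun x y => ?_
    simp [eq_comm]
  calc _ ≤ ∑ i, ∑ j ∈ Finset.univ.erase i, (2 * (∫ x in 𝒯.face i j, φ i x ∂(surface n)) +
        2 * ∫ x in 𝒯.face j i, φ j x ∂(surface n)) :=
        Finset.sum_le_sum fun i _ => Finset.sum_le_sum fun j hj =>
          h2 i j (Finset.ne_of_mem_erase hj).symm
    _ = 4 * ∑ i, ∑ j ∈ Finset.univ.erase i, ∫ x in 𝒯.face i j, φ i x ∂(surface n) := by
        simp_rw [Finset.sum_add_distrib, ← Finset.mul_sum, hswap]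
        ring
    _ ≤ 4 * ∑ i, ∫ x in frontier (𝒯.elem i), φ i x ∂(surface n) := by
        gcongr with i
        exact h.sum_face_le i (hφ0 i) (hφi i)
    _ = _ := by
        congr 1
        refine Finset.sum_congr rfl fun i _ => ?_
        exact integral_finsetSum _ fun k _ =>
          ((h.isL2Op_traceGrad i k).memLp v hv).integrable_sq

/-- The constant adds up `n + 1` from `□`, `2 C` from the lateral boundary and `4 · 2 C` from the
jumps. -/
lemma sForm_estimate (h : 𝒯.IsMesh r) (hSig : Sig ⊆ frontier M) {C : ℝ} (hC0 : 0 ≤ C)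
    (hC : ∀ i, HasTraceConst (𝒯.elem i) 𝒯.meshSize C) (hv : 𝒯.PiecewiseH2 v) :
    𝒯.sForm Sig v v ≤ (n + 1 + 10 * C) * ∑ i, 𝒯.scaledNormSq i v := by
  have e : 𝒯.sForm Sig v v = (∑ i, 𝒯.meshSize ^ 2 * ∫ x in 𝒯.int i, box (𝒯.int i) v x ^ 2) +
      (∑ i, 𝒯.meshSize⁻¹ * ∫ x in 𝒯.elem i ∩ Sig, trace (𝒯.int i) v x ^ 2 ∂(surface n)) +
      𝒯.meshSize * ∑ i, ∑ j ∈ Finset.univ.erase i,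
        ∫ x in 𝒯.face i j, 𝒯.jump i j v x ^ 2 ∂(surface n) := by
    simp only [sForm, Finset.mul_sum, ← Finset.sum_add_distrib, sq (box _ _ _), sq (trace _ _ _),
      sq (jump _ _ _ _ _)]
  have h1 : ∑ i, 𝒯.meshSize ^ 2 * ∫ x in 𝒯.int i, box (𝒯.int i) v x ^ 2 ≤
      ∑ i, (n + 1) * 𝒯.scaledNormSq i v := Finset.sum_le_sum fun i _ => h.box_estimate hv i
  have h2 : ∑ i, 𝒯.meshSize⁻¹ * ∫ x in 𝒯.elem i ∩ Sig, trace (𝒯.int i) v x ^ 2 ∂(surface n) ≤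
      ∑ i, 2 * C * 𝒯.scaledNormSq i v := by
    refine Finset.sum_le_sum fun i _ => le_trans ?_ (h.trace_estimate hC0 hC hv i)
    have hh := h.meshSize_pos i
    gcongr
    · exact Eventually.of_forall fun _ => sq_nonneg _
    · exact ((h.isL2Op_trace i).memLp v hv).integrable_sq
    · exact (inter_subset_bdry hSig i).trans (h.bdry_subset i)
  have h3 : 𝒯.meshSize * ∑ i, ∑ j ∈ Finset.univ.erase i,
      ∫ x in 𝒯.face i j, 𝒯.jump i j v x ^ 2 ∂(surface n) ≤
      ∑ i, 4 * (2 * C * 𝒯.scaledNormSq i v) := by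
    -- The mesh size is known to be positive only if there is an element.
    rcases isEmpty_or_nonempty (Fin 𝒯.card) with he | ⟨⟨i₀⟩⟩
    · simp
    · have hh := h.meshSize_pos i₀
      refine (mul_le_mul_of_nonneg_left (h.sum_jump_le hv) hh.le).trans ?_
      rw [mul_left_comm, Finset.mul_sum, Finset.mul_sum]
      refine Finset.sum_le_sum fun i _ => ?_
      have := h.traceGrad_estimate hC0 hC hv i
      linarith
  simp only [← Finset.mul_sum] at h1 h2 h3
  rw [e]
  simp only [← Finset.mul_sum]
  linarith

end IsMesh

end Triangulation

end Estimates

/-! ### Continuity of the bilinear form against finite element functions. -/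

namespace Triangulation.IsMesh

variable {n : ℕ} {M : Set (SpaceTime n)} {𝒯 : Triangulation M} {r : ℝ}
  {Sig Obs : Set (SpaceTime n)} {u v w z : SpaceTime n → ℝ}

section Continuity

lemma integral_conormal_bdry_le (h : 𝒯.IsMesh r) (hv : 𝒯.PiecewiseH2 v) (i : Fin 𝒯.card) :
    ∫ x in 𝒯.bdry i, ((minkowski n).mulVec (traceGrad (𝒯.int i) v x) ⬝ᵥ outerNormal M x) ^ 2
        ∂(surface n) ≤
      ∑ k, ∫ x in frontier (𝒯.elem i), traceGrad (𝒯.int i) v x k ^ 2 ∂(surface n) := by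
  have hi := h.integrable_traceGrad_sq hv i
  rw [← integral_finsetSum _ fun k _ => ((h.isL2Op_traceGrad i k).memLp v hv).integrable_sq]
  refine le_trans (integral_mono ((h.isL2Op_conormal_bdry i).memLp v hv).integrable_sq
    (hi.mono_measure (Measure.restrict_mono (h.bdry_subset i) le_rfl)) fun x => ?_)
    (setIntegral_mono_set hi (Eventually.of_forall fun x => Finset.sum_nonneg fun _ _ => sq_nonneg _)
      (h.bdry_subset i).eventuallyLE)
  beta_reduce
  rw [dotProduct_comm]
  exact conormal_sq_le _ _ _ _

/-- Only spatial components occur on the left; discarding the time components of the normal and of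
the gradient loses nothing. -/
lemma integral_normal_inter_le (h : 𝒯.IsMesh r) (hSig : Sig ⊆ frontier M)
    (hv : 𝒯.PiecewiseH2 v) (i : Fin 𝒯.card) :
    ∫ x in 𝒯.elem i ∩ Sig,
        (∑ k : Fin n, traceGrad (𝒯.int i) v x k.succ * outerNormal M x k.succ) ^ 2 ∂(surface n) ≤
      ∑ k, ∫ x in frontier (𝒯.elem i), traceGrad (𝒯.int i) v x k ^ 2 ∂(surface n) := by
  have hi := h.integrable_traceGrad_sq hv i
  have hsub := (inter_subset_bdry hSig i).trans (h.bdry_subset i)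
  rw [← integral_finsetSum _ fun k _ => ((h.isL2Op_traceGrad i k).memLp v hv).integrable_sq]
  refine le_trans (integral_mono ((h.isL2Op_normal_inter hSig i).memLp v hv).integrable_sq
    (hi.mono_measure (Measure.restrict_mono hsub le_rfl)) fun x => ?_)
    (setIntegral_mono_set hi (Eventually.of_forall fun x => Finset.sum_nonneg fun _ _ => sq_nonneg _)
      hsub.eventuallyLE)
  beta_reduce
  simp_rw [mul_comm (traceGrad _ _ _ _)]
  have h1 := outerNormal_sq_le M x
  rw [Fin.sum_univ_succ] at h1 ⊢
  have h2 := dot_sq_le Finset.univ (fun k : Fin n => outerNormal M x k.succ)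
    (fun k => traceGrad (𝒯.int i) v x k.succ) (by nlinarith [sq_nonneg (outerNormal M x 0)])
  nlinarith [sq_nonneg (traceGrad (𝒯.int i) v x 0)]

/-- The inverse inequality for the gradient of a finite element function. -/
lemma inverse_estimate (h : 𝒯.IsMesh r) {q : ℕ} {C : ℝ}
    (hC : ∀ (i : Fin 𝒯.card) (P : MvPolynomial (Fin (n + 1)) ℝ), P.totalDegree ≤ q →
      𝒯.meshSize * ∫ y in frontier (𝒯.elem i), polyFun P y ^ 2 ∂(surface n) ≤
        C * ∫ y in 𝒯.int i, polyFun P y ^ 2) (hz : z ∈ 𝒯.femSpace q) (i : Fin 𝒯.card) :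
    𝒯.meshSize * ∑ k, ∫ x in frontier (𝒯.elem i), traceGrad (𝒯.int i) z x k ^ 2 ∂(surface n) ≤
      C * ∑ k, ∫ x in 𝒯.int i, grad (𝒯.int i) z x k ^ 2 := by
  obtain ⟨P, hPq, hP⟩ := exists_poly hz i
  rw [Finset.mul_sum, Finset.mul_sum]
  refine Finset.sum_le_sum fun k _ => ?_
  have h1 : ∫ x in frontier (𝒯.elem i), traceGrad (𝒯.int i) z x k ^ 2 ∂(surface n) =
      ∫ x in frontier (𝒯.elem i), polyFun (MvPolynomial.pderiv k P) x ^ 2 ∂(surface n) := by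
    refine integral_congr_ae ?_
    filter_upwards [h.traceGrad_of_eqOn (contDiff_polyFun P) hP k] with x hx
    rw [hx, pd_polyFun]
  have h2 : ∫ x in 𝒯.int i, grad (𝒯.int i) z x k ^ 2 =
      ∫ x in 𝒯.int i, polyFun (MvPolynomial.pderiv k P) x ^ 2 := by
    refine integral_congr_ae ?_
    filter_upwards [h.grad_of_eqOn (contDiff_polyFun P) hP k] with x hx
    rw [hx, pd_polyFun]
  rw [h1, h2]
  exact hC i _ ((totalDegree_pderiv_le P k).trans hPq)

lemma sStarForm_self_nonneg (h : 𝒯.IsMesh r) (hz : 𝒯.PiecewiseH2 z) : 0 ≤ 𝒯.sStarForm z z := by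
  rw [sStarForm_self hz]
  refine Finset.sum_nonneg fun i _ => add_nonneg
    (Finset.sum_nonneg fun _ _ => integral_sq_nonneg _ _)
    (mul_nonneg (inv_pos.2 (h.meshSize_pos i)).le (integral_sq_nonneg _ _))

/-- The volume term and the pairing of the conormal of `v` with `z` match the two parts of `s*`
directly. The pairing of `∇z · n` with `v` involves boundary values of `∇z`, which `s*` does not
contain; they are recovered from the interior by the inverse inequality. In `1 + 4 C` the two trace
estimates for `v` contribute `2 C` each. -/
lemma abs_ahForm_le (h : 𝒯.IsMesh r) (hSig : Sig ⊆ frontier M) {q : ℕ} {C Ci : ℝ} (hC0 : 0 ≤ C)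
    (hC : ∀ i, HasTraceConst (𝒯.elem i) 𝒯.meshSize C) (hCi0 : 0 ≤ Ci)
    (hCi : ∀ (i : Fin 𝒯.card) (P : MvPolynomial (Fin (n + 1)) ℝ), P.totalDegree ≤ q →
      𝒯.meshSize * ∫ y in frontier (𝒯.elem i), polyFun P y ^ 2 ∂(surface n) ≤
        Ci * ∫ y in 𝒯.int i, polyFun P y ^ 2)
    (hv : 𝒯.PiecewiseH2 v) (hzq : z ∈ 𝒯.femSpace q) {t : ℝ} (ht : 0 < t) :
    |𝒯.ahForm Sig v z| ≤ t * (1 + Ci) * 𝒯.sStarForm z z +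
      (4 * t)⁻¹ * ((1 + 4 * C) * ∑ i, 𝒯.scaledNormSq i v) := by
  have hz := h.piecewiseH2_of_mem_femSpace hzq
  rw [ahForm, aForm_eq hv hz, sStarForm_self hz, ← Finset.sum_sub_distrib,
    ← Finset.sum_sub_distrib]
  simp only [Finset.mul_sum]
  rw [← Finset.sum_add_distrib]
  refine (Finset.abs_sum_le_sum_abs _ _).trans (Finset.sum_le_sum fun i _ => ?_)
  have hh := h.meshSize_pos i
  set H := 𝒯.meshSize
  have a1 : |∑ k, minkSign k * ∫ x in 𝒯.int i, grad (𝒯.int i) v x k * grad (𝒯.int i) z x k| ≤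
      t * (∑ k, ∫ x in 𝒯.int i, grad (𝒯.int i) z x k ^ 2) +
        (4 * t)⁻¹ * ∑ k, ∫ x in 𝒯.int i, grad (𝒯.int i) v x k ^ 2 := by
    rw [Finset.mul_sum, Finset.mul_sum, ← Finset.sum_add_distrib]
    refine (Finset.abs_sum_le_sum_abs _ _).trans (Finset.sum_le_sum fun k _ => ?_)
    rw [abs_mul, abs_minkSign, one_mul]
    simp_rw [mul_comm (grad (𝒯.int i) v _ k)]
    exact abs_integral_mul_le ((isL2Op_grad i k).memLp z hz) ((isL2Op_grad i k).memLp v hv) ht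
  -- The parameters `t h⁻¹` here and `t h` in the next step give boundary values the weight `h⁻¹`
  -- and boundary gradients the weight `h`.
  have a2 := abs_integral_mul_le ((h.isL2Op_trace_bdry i).memLp z hz)
    ((h.isL2Op_conormal_bdry i).memLp v hv) (mul_pos ht (inv_pos.2 hh))
  have a3 := abs_integral_mul_le ((h.isL2Op_normal_inter hSig i).memLp z hz)
    ((h.isL2Op_trace_inter hSig i).memLp v hv) (mul_pos ht hh)
  simp_rw [mul_comm (trace (𝒯.int i) z _)] at a2
  have b2 := h.integral_conormal_bdry_le hv i
  have b2' := h.traceGrad_estimate hC0 hC hv i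
  have b3 := h.integral_normal_inter_le hSig hz i
  have b3' := h.inverse_estimate hCi hzq i
  have b4 : ∫ x in 𝒯.elem i ∩ Sig, trace (𝒯.int i) v x ^ 2 ∂(surface n) ≤
      ∫ x in frontier (𝒯.elem i), trace (𝒯.int i) v x ^ 2 ∂(surface n) :=
    setIntegral_mono_set ((h.isL2Op_trace i).memLp v hv).integrable_sq
      (Eventually.of_forall fun _ => sq_nonneg _)
      ((inter_subset_bdry hSig i).trans (h.bdry_subset i)).eventuallyLE
  have b4' := h.trace_estimate hC0 hC hv i
  have b5 := h.sum_grad_sq_le i v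
  have b6 : 0 ≤ ∫ x in 𝒯.bdry i, trace (𝒯.int i) z x ^ 2 ∂(surface n) := integral_sq_nonneg _ _
  refine (abs_sub _ _).trans ?_
  refine (add_le_add_left (abs_sub _ _) _).trans ?_
  set Gz := ∑ k, ∫ x in 𝒯.int i, grad (𝒯.int i) z x k ^ 2
  set Gv := ∑ k, ∫ x in 𝒯.int i, grad (𝒯.int i) v x k ^ 2
  set R := 𝒯.scaledNormSq i v
  set Bz := ∫ x in 𝒯.bdry i, trace (𝒯.int i) z x ^ 2 ∂(surface n)
  have ht4 : 0 < (4 * t)⁻¹ := by positivity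
  have c2 : H * ∫ x in 𝒯.bdry i,
      ((minkowski n).mulVec (traceGrad (𝒯.int i) v x) ⬝ᵥ outerNormal M x) ^ 2 ∂(surface n) ≤
      2 * C * R := (mul_le_mul_of_nonneg_left b2 hh.le).trans b2'
  have c3 : H * ∫ x in 𝒯.elem i ∩ Sig,
      (∑ k : Fin n, traceGrad (𝒯.int i) z x k.succ * outerNormal M x k.succ) ^ 2 ∂(surface n) ≤
      Ci * Gz := (mul_le_mul_of_nonneg_left b3 hh.le).trans b3'
  have c4 : H⁻¹ * ∫ x in 𝒯.elem i ∩ Sig, trace (𝒯.int i) v x ^ 2 ∂(surface n) ≤ 2 * C * R :=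
    (mul_le_mul_of_nonneg_left b4 (inv_pos.2 hh).le).trans b4'
  have e2 : (4 * (t * H⁻¹))⁻¹ = (4 * t)⁻¹ * H := by field_simp
  have e3 : (4 * (t * H))⁻¹ = (4 * t)⁻¹ * H⁻¹ := by field_simp
  rw [e2, mul_assoc, mul_assoc] at a2
  rw [e3, mul_assoc, mul_assoc] at a3
  have d1 := mul_le_mul_of_nonneg_left b5 ht4.le
  have d2 := mul_le_mul_of_nonneg_left c2 ht4.le
  have d3 := mul_le_mul_of_nonneg_left c3 ht.le
  have d4 := mul_le_mul_of_nonneg_left c4 ht4.le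
  have d5 : 0 ≤ t * Ci * (H⁻¹ * Bz) := by positivity
  nlinarith

end Continuity

/-! ### The error identity and the estimate by the interpolation error. -/

section ErrorEstimate

lemma zero_mem_femSpace (𝒯 : Triangulation M) (q : ℕ) : (0 : SpaceTime n → ℝ) ∈ 𝒯.femSpace q :=
  ⟨continuousOn_const, fun _ => ⟨0, by simp, fun x _ => by simp⟩⟩

/-- The three parts vanish by the wave equation, by the boundary condition and by the absence of
jumps, respectively. -/
lemma sForm_eq_zero (h : 𝒯.IsMesh r) (hu : MemSobolev M 2 u)
    (hbox : ∀ᵐ x ∂volume.restrict M, box M u x = 0)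
    (hbd : ∀ i, ∀ᵐ x ∂(surface n).restrict (𝒯.elem i ∩ Sig), trace (𝒯.int i) u x = 0)
    (v : SpaceTime n → ℝ) : 𝒯.sForm Sig u v = 0 := by
  refine Finset.sum_eq_zero fun i _ => ?_
  have e1 : ∫ x in 𝒯.int i, box (𝒯.int i) u x * box (𝒯.int i) v x = 0 := by
    refine integral_eq_zero_of_ae ?_
    filter_upwards [h.ae_box_eq_zero hu hbox i] with x hx
    simp [hx]
  have e2 : ∫ x in 𝒯.elem i ∩ Sig, trace (𝒯.int i) u x * trace (𝒯.int i) v x ∂(surface n) = 0 := by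
    refine integral_eq_zero_of_ae ?_
    filter_upwards [hbd i] with x hx
    simp [hx]
  rw [e1, e2, mul_zero, mul_zero, zero_add, zero_add]
  refine Finset.sum_eq_zero fun j hj => ?_
  have e3 : ∫ x in 𝒯.face i j, 𝒯.jump i j u x * 𝒯.jump i j v x ∂(surface n) = 0 := by
    refine integral_eq_zero_of_ae ?_
    filter_upwards [h.ae_jump_eq_zero hu (Finset.ne_of_mem_erase hj).symm] with x hx
    simp [hx]
  rw [e3, mul_zero]

/-- The energy identity for the discrete error `uh - πu`. -/
lemma error_identity (h : 𝒯.IsMesh r) (hSig : Sig ⊆ frontier M) (hObs : Obs ⊆ closure M)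
    {p q : ℕ} {γ γs : ℝ} {u uObs uh zh πu : SpaceTime n → ℝ} (hu : MemSobolev M 2 u)
    (hbox : ∀ᵐ x ∂volume.restrict M, box M u x = 0)
    (hbd : ∀ i, ∀ᵐ x ∂(surface n).restrict (𝒯.elem i ∩ Sig), trace (𝒯.int i) u x = 0)
    (huObs : ∀ᵐ x ∂volume.restrict Obs, uObs x = u x)
    (hsol : 𝒯.IsDiscreteSolution Sig Obs γ γs p q uObs uh zh) (hπu : πu ∈ 𝒯.femSpace p) :
    (∫ x in Obs, (uh - πu) x ^ 2) + γ * 𝒯.sForm Sig (uh - πu) (uh - πu) +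
        γs * 𝒯.sStarForm zh zh =
      (∫ x in Obs, (u - πu) x * (uh - πu) x) + γ * 𝒯.sForm Sig (u - πu) (uh - πu) -
        𝒯.ahForm Sig (u - πu) zh := by
  obtain ⟨huh, hzh, heq⟩ := hsol
  have Hu := h.piecewiseH2_of_memSobolev hu
  have Huh := h.piecewiseH2_of_mem_femSpace huh
  have Hz := h.piecewiseH2_of_mem_femSpace hzh
  have Hπu := h.piecewiseH2_of_mem_femSpace hπu
  have Hξ : 𝒯.PiecewiseH2 (uh - πu) := Huh.sub Hπu
  have hid := h.isL2Op_id hObs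
  have hobs : ∀ v : SpaceTime n → ℝ, ∫ x in Obs, uObs x * v x = ∫ x in Obs, u x * v x :=
    fun v => by
    refine integral_congr_ae ?_
    filter_upwards [huObs] with x hx
    rw [hx]
  -- These three instances replace the test pair `(uh - πu, -zh)`: `T1 - T2` isolates the test
  -- function `uh - πu`, and `T1 - T3` gives `a_h(uh, zh) = γs s*(zh, zh)`. Thus closure of
  -- `femSpace` under differences is not needed.
  have T1 := heq uh huh zh hzh
  have T2 := heq πu hπu zh hzh
  have T3 := heq uh huh 0 (zero_mem_femSpace 𝒯 q)
  rw [bilin, hobs] at T1 T2 T3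
  rw [h.ahForm_zero_right hSig Huh, h.sStarForm_zero_right Hz] at T3
  have o1 : ∀ v w, 𝒯.PiecewiseH2 v → 𝒯.PiecewiseH2 w → ∫ x in Obs, (v - w) x * (uh - πu) x =
      (∫ x in Obs, v x * (uh - πu) x) - ∫ x in Obs, w x * (uh - πu) x := fun v w hv hw =>
    IsL2Op.integral_sub_left (F := fun v => v) (G := fun v => v) hid hid hv hw Hξ
  have o2 : ∀ w, 𝒯.PiecewiseH2 w → ∫ x in Obs, w x * (uh - πu) x =
      (∫ x in Obs, w x * uh x) - ∫ x in Obs, w x * πu x := fun w hw => by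
    have := hid.integral_sub_left hid Huh Hπu hw
    simp_rw [mul_comm _ (w _)] at this
    exact this
  have s1 := h.sForm_sub_right hSig Huh Hπu Huh
  have s2 := h.sForm_sub_left hSig Huh Hπu Hξ
  have s3 := h.sForm_sub_left hSig Hu Hπu Hξ
  rw [h.sForm_eq_zero hu hbox hbd] at s3
  have a1 := h.ahForm_sub_left hSig Huh Hπu Hz
  have a2 := h.ahForm_sub_left hSig Hu Hπu Hz
  rw [h.ahForm_eq_zero hu hbox hbd hzh] at a2
  have p1 := o1 uh πu Huh Hπu
  have p2 := o1 u πu Hu Hπu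
  have p3 := o2 uh Huh
  have p4 := o2 u Hu
  have q1 : γ * 𝒯.sForm Sig uh (uh - πu) = γ * 𝒯.sForm Sig uh uh - γ * 𝒯.sForm Sig uh πu := by
    rw [s1, mul_sub]
  have q2 : γ * 𝒯.sForm Sig (uh - πu) (uh - πu) =
      γ * 𝒯.sForm Sig uh (uh - πu) - γ * 𝒯.sForm Sig πu (uh - πu) := by
    rw [s2, mul_sub]
  have q3 : γ * 𝒯.sForm Sig (u - πu) (uh - πu) = γ * 0 - γ * 𝒯.sForm Sig πu (uh - πu) := by
    rw [s3, mul_sub]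
  simp only [sq ((uh - πu) _)]
  linarith

/-- The plain norm is smaller than the scaled one by the factor `h²`; only `h ≤ D` is kept of this,
so that the constant does not depend on the mesh. -/
lemma integral_sq_obs_le_scaled (h : 𝒯.IsMesh r) (hObs : Obs ⊆ closure M) {D : ℝ}
    (hD : 𝒯.meshSize ≤ D) (hv : 𝒯.PiecewiseH2 v) :
    ∫ x in Obs, v x ^ 2 ≤ D ^ 2 * ∑ i, 𝒯.scaledNormSq i v := by
  refine (h.integral_sq_obs_le hObs hv).trans ?_
  rw [Finset.mul_sum]
  refine Finset.sum_le_sum fun i _ => ?_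
  have hh := h.meshSize_pos i
  have n0 : 0 ≤ ∫ x in 𝒯.int i, v x ^ 2 := integral_sq_nonneg _ _
  have n1 : 0 ≤ ∑ k, ∫ x in 𝒯.int i, grad (𝒯.int i) v x k ^ 2 :=
    Finset.sum_nonneg fun _ _ => integral_sq_nonneg _ _
  have n2 : 0 ≤ 𝒯.meshSize ^ 2 *
      ∑ k, ∑ l, ∫ x in 𝒯.int i, weakDeriv (𝒯.int i) ![k, l] v x ^ 2 :=
    mul_nonneg (by positivity) (Finset.sum_nonneg fun _ _ => Finset.sum_nonneg
      fun _ _ => integral_sq_nonneg _ _)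
  calc ∫ x in 𝒯.int i, v x ^ 2
      = 𝒯.meshSize ^ 2 * ((𝒯.meshSize ^ 2)⁻¹ * ∫ x in 𝒯.int i, v x ^ 2) := by
        field_simp
    _ ≤ D ^ 2 * 𝒯.scaledNormSq i v := by
        rw [scaledNormSq]
        gcongr
        linarith

lemma integral_sq_obs_sub_le (h : 𝒯.IsMesh r) (hObs : Obs ⊆ closure M) (hu : 𝒯.PiecewiseH2 u)
    (hv : 𝒯.PiecewiseH2 v) : ∫ x in Obs, (u - v) x ^ 2 ≤
      2 * (∫ x in Obs, u x ^ 2) + 2 * ∫ x in Obs, v x ^ 2 := by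
  have hid := h.isL2Op_id hObs
  have i1 := (hid.memLp u hu).integrable_sq.const_mul 2
  have i2 := (hid.memLp v hv).integrable_sq.const_mul 2
  rw [← integral_const_mul, ← integral_const_mul, ← integral_add i1 i2]
  refine integral_mono (hid.memLp _ (hu.sub hv)).integrable_sq (i1.add i2) fun x => ?_
  beta_reduce
  rw [Pi.sub_apply]
  nlinarith [sq_nonneg (u x + v x)]

/-- `X`, `S` are the observation and stabiliser terms of the discrete error, `Y`, `Se` those of the
interpolation error, `Z` is the dual stabiliser and `R` the scaled norm. Half of each of `X`, `γ S`
and `γs Z` on the right is absorbed on the left; the parameter `γs / (2 (1 + Ci))` is chosen to make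
the coefficient of `Z` equal to `γs / 2`. -/
lemma error_arith {X Y S Se Z R A Bs Ah γ γs D L Ci C : ℝ} (hγ : 0 < γ) (hγs : 0 < γs)
    (hX : 0 ≤ X) (hS : 0 ≤ S) (hZ : 0 ≤ Z) (hCi : 0 < 1 + Ci)
    (key : X + γ * S + γs * Z = A + γ * Bs - Ah)
    (y1 : |A| ≤ 1 / 2 * Y + (4 * (1 / 2))⁻¹ * X) (y2 : |Bs| ≤ 1 / 2 * Se + (4 * (1 / 2))⁻¹ * S)
    (y3 : |Ah| ≤ γs / (2 * (1 + Ci)) * (1 + Ci) * Z +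
      (4 * (γs / (2 * (1 + Ci))))⁻¹ * ((1 + 4 * C) * R))
    (y4 : Se ≤ L * R) (y5 : Y ≤ D ^ 2 * R) :
    (2 * Y + 2 * X) + (2 * Se + 2 * S) + Z ≤ (2 * D ^ 2 + 2 * L + (2 + 2 / γ + 1 / γs) *
      (D ^ 2 + γ * L + (1 + Ci) * (1 + 4 * C) / γs)) * R := by
  have e3 : γs / (2 * (1 + Ci)) * (1 + Ci) = γs / 2 := by field_simp
  have e4 : (4 * (γs / (2 * (1 + Ci))))⁻¹ * ((1 + 4 * C) * R) =
      ((1 + Ci) * (1 + 4 * C) / γs * R) / 2 := by field_simp; norm_num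
  rw [e3, e4] at y3
  set Q := (D ^ 2 + γ * L + (1 + Ci) * (1 + 4 * C) / γs) * R with hQ
  have hγS := mul_nonneg hγ.le hS
  have hγZ := mul_nonneg hγs.le hZ
  have main : X + γ * S + γs * Z ≤ Q := by
    have m1 := le_abs_self A
    have m2 := mul_le_mul_of_nonneg_left ((le_abs_self _).trans y2) hγ.le
    have m3 := neg_abs_le Ah
    have m4 := mul_le_mul_of_nonneg_left y4 hγ.le
    norm_num at y1 m2
    rw [hQ]
    linarith
  have f1 : X ≤ Q := by linarith
  have f2 : S ≤ 1 / γ * Q := by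
    rw [one_div, inv_mul_eq_div, le_div_iff₀ hγ]
    linarith
  have f3 : Z ≤ 1 / γs * Q := by
    rw [one_div, inv_mul_eq_div, le_div_iff₀ hγs]
    linarith
  calc _ ≤ 2 * (D ^ 2 * R) + 2 * (L * R) + (2 * Q + 2 * (1 / γ * Q) + 1 / γs * Q) := by linarith
    _ = _ := by rw [hQ]; ring

/-- The error of the discrete solution is bounded by the interpolation error. -/
theorem residual_le (h : 𝒯.IsMesh r) (hSig : Sig ⊆ frontier M) (hObs : Obs ⊆ closure M)
    {p q : ℕ} {C Ci γ γs D : ℝ} (hC0 : 0 ≤ C)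
    (hC : ∀ i, HasTraceConst (𝒯.elem i) 𝒯.meshSize C) (hCi0 : 0 ≤ Ci)
    (hCi : ∀ (i : Fin 𝒯.card) (P : MvPolynomial (Fin (n + 1)) ℝ), P.totalDegree ≤ q →
      𝒯.meshSize * ∫ y in frontier (𝒯.elem i), polyFun P y ^ 2 ∂(surface n) ≤
        Ci * ∫ y in 𝒯.int i, polyFun P y ^ 2)
    (hγ : 0 < γ) (hγs : 0 < γs) (hD : 𝒯.meshSize ≤ D)
    {u uObs uh zh πu : SpaceTime n → ℝ} (hu : MemSobolev M 2 u)
    (hbox : ∀ᵐ x ∂volume.restrict M, box M u x = 0)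
    (hbd : ∀ i, ∀ᵐ x ∂(surface n).restrict (𝒯.elem i ∩ Sig), trace (𝒯.int i) u x = 0)
    (huObs : ∀ᵐ x ∂volume.restrict Obs, uObs x = u x)
    (hsol : 𝒯.IsDiscreteSolution Sig Obs γ γs p q uObs uh zh) (hπu : πu ∈ 𝒯.femSpace p) :
    (∫ x in Obs, (u - uh) x ^ 2) + 𝒯.sForm Sig (u - uh) (u - uh) + 𝒯.sStarForm zh zh ≤
      (2 * D ^ 2 + 2 * (n + 1 + 10 * C) + (2 + 2 / γ + 1 / γs) *
        (D ^ 2 + γ * (n + 1 + 10 * C) + (1 + Ci) * (1 + 4 * C) / γs)) *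
          ∑ i, 𝒯.scaledNormSq i (u - πu) := by
  have key := h.error_identity hSig hObs hu hbox hbd huObs hsol hπu
  obtain ⟨huh, hzh, -⟩ := hsol
  have Hπu := h.piecewiseH2_of_mem_femSpace hπu
  have Hξ := (h.piecewiseH2_of_mem_femSpace huh).sub Hπu
  have Hη := (h.piecewiseH2_of_memSobolev hu).sub Hπu
  have hid := h.isL2Op_id hObs
  have hCi1 : 0 < 1 + Ci := by linarith
  have hsub : u - uh = (u - πu) - (uh - πu) := by abel
  have w1 := h.integral_sq_obs_sub_le hObs Hη Hξ
  have w2 := h.sForm_sub_self_le hSig Hη Hξ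
  rw [← hsub] at w1 w2
  refine (add_le_add_left (add_le_add w1 w2) _).trans ?_
  exact error_arith hγ hγs (integral_sq_nonneg _ _) (h.sForm_self_nonneg _)
    (h.sStarForm_self_nonneg (h.piecewiseH2_of_mem_femSpace hzh)) hCi1 key
    (abs_integral_mul_le (hid.memLp _ Hη) (hid.memLp _ Hξ) (by norm_num))
    (h.abs_sForm_le hSig Hη Hξ (by norm_num))
    (h.abs_ahForm_le hSig hC0 hC hCi0 hCi Hη hzh (by positivity))
    (h.sForm_estimate hSig hC0 hC Hη) (h.integral_sq_obs_le_scaled hObs hD Hη)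

end ErrorEstimate

end Triangulation.IsMesh

/-! ### Geometry of the space-time cylinder. -/

section Cylinder

variable {n : ℕ} {T : ℝ} {Ω : Set (EuclideanSpace ℝ (Fin n))}

/-- The projection to the spatial part as a continuous linear map. -/
def spatialL (n : ℕ) : SpaceTime n →L[ℝ] EuclideanSpace ℝ (Fin n) :=
  LinearMap.toContinuousLinearMap
    { toFun := spatial
      map_add' := fun x y => by ext i; simp [spatial]
      map_smul' := fun a x => by ext i; simp [spatial] }

@[simp] lemma spatialL_apply (y : SpaceTime n) : spatialL n y = spatial y := rfl

lemma continuous_spatial : Continuous (spatial : SpaceTime n → _) := (spatialL n).continuous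

lemma continuous_time : Continuous fun y : SpaceTime n => y 0 :=
  (EuclideanSpace.proj (𝕜 := ℝ) (0 : Fin (n + 1))).continuous

lemma exists_spatial_eq (a : EuclideanSpace ℝ (Fin n)) (t : ℝ) :
    ∃ y : SpaceTime n, y 0 = t ∧ spatial y = a :=
  ⟨WithLp.toLp 2 (Fin.cons t fun i => a i), by simp, by ext i; simp [spatial]⟩

lemma spatial_single_zero (t : ℝ) :
    spatial (EuclideanSpace.single (0 : Fin (n + 1)) t : SpaceTime n) = 0 := by
  ext i; simp [spatial]

lemma isOpen_cylinder (hΩ : IsOpen Ω) : IsOpen (cylinder T Ω) :=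
  (isOpen_lt continuous_const continuous_time).inter
    ((isOpen_lt continuous_time continuous_const).inter (hΩ.preimage continuous_spatial))

lemma closure_cylinder_subset {y : SpaceTime n} (hy : y ∈ closure (cylinder T Ω)) :
    0 ≤ y 0 ∧ y 0 ≤ T ∧ spatial y ∈ closure Ω := by
  refine closure_minimal (t := {y : SpaceTime n | 0 ≤ y 0 ∧ y 0 ≤ T ∧ spatial y ∈ closure Ω})
    (fun z hz => ⟨hz.1.le, hz.2.1.le, subset_closure hz.2.2⟩) ?_ hy
  exact (isClosed_le continuous_const continuous_time).inter
    ((isClosed_le continuous_time continuous_const).inter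
      (isClosed_closure.preimage continuous_spatial))

/-- Approximate the spatial part from `Ω` while keeping the time fixed. -/
lemma mem_closure_cylinder {y : SpaceTime n} (h0 : 0 < y 0) (hT : y 0 < T)
    (hy : spatial y ∈ closure Ω) : y ∈ closure (cylinder T Ω) := by
  rw [mem_closure_iff_seq_limit] at hy
  obtain ⟨a, ha, hlim⟩ := hy
  let L : EuclideanSpace ℝ (Fin n) → SpaceTime n := fun a =>
    WithLp.toLp 2 (Fin.cons (y 0) fun i => a i)
  have hL : Continuous L := by
    refine (PiLp.continuous_toLp 2 _).comp (continuous_pi fun i => ?_)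
    refine Fin.cases ?_ (fun j => ?_) i
    · exact continuous_const
    · exact (EuclideanSpace.proj (𝕜 := ℝ) j).continuous
  have hLs : ∀ a, spatial (L a) = a := fun a => by ext i; simp [spatial, L]
  have hLy : L (spatial y) = y := by
    ext i
    refine Fin.cases ?_ (fun j => ?_) i <;> simp [spatial, L]
  refine mem_closure_of_tendsto (f := fun k => L (a k)) (b := atTop) ?_
    (Eventually.of_forall fun k => ⟨?_, ?_, ?_⟩)
  · have := (hL.tendsto (spatial y)).comp hlim
    rwa [hLy] at this
  · simpa [L] using h0
  · simpa [L] using hT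
  · rw [hLs]
    exact ha k

lemma lateral_subset_frontier (hΩ : IsOpen Ω) :
    cylinder T (frontier Ω) ⊆ frontier (cylinder T Ω) := by
  rintro y ⟨h0, hT, hy⟩
  rw [(isOpen_cylinder hΩ).frontier_eq]
  rw [hΩ.frontier_eq] at hy
  exact ⟨mem_closure_cylinder h0 hT hy.1, fun h => hy.2 h.2.2⟩

lemma cylinder_subset_closure {S : Set (EuclideanSpace ℝ (Fin n))} (hS : S ⊆ closure Ω) :
    cylinder T S ⊆ closure (cylinder T Ω) := fun _ hy =>
  mem_closure_cylinder hy.1 hy.2.1 (hS hy.2.2)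

lemma isBounded_cylinder (hΩ : Bornology.IsBounded Ω) : Bornology.IsBounded (cylinder T Ω) := by
  obtain ⟨R, hR⟩ := hΩ.exists_norm_le
  refine isBounded_iff_forall_norm_le.2 ⟨Real.sqrt (T ^ 2 + R ^ 2), fun y hy => ?_⟩
  have h1 : ‖y‖ ^ 2 = y 0 ^ 2 + ‖spatial y‖ ^ 2 := by
    rw [EuclideanSpace.real_norm_sq_eq, EuclideanSpace.real_norm_sq_eq, Fin.sum_univ_succ]
    rfl
  refine Real.le_sqrt_of_sq_le ?_
  rw [h1]
  exact add_le_add (pow_le_pow_left₀ hy.1.le hy.2.1.le 2)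
    (pow_le_pow_left₀ (norm_nonneg _) (hR _ hy.2.2) 2)

/-- The last clause is a consequence of the others: a frontier point is not in the open set, so `ρ ≥
0` there, and `ρ > 0` would exclude all nearby points of `Ω`. -/
lemma exists_defining_function (hΩ : IsOpen Ω) (hs : HasSmoothBoundary Ω)
    {a : EuclideanSpace ℝ (Fin n)} (ha : a ∈ frontier Ω) :
    ∃ ρ : EuclideanSpace ℝ (Fin n) → ℝ, ContDiffAt ℝ 1 ρ a ∧ fderiv ℝ ρ a ≠ 0 ∧
      (∀ᶠ b in 𝓝 a, (b ∈ Ω ↔ ρ b < 0)) ∧ ∀ᶠ b in 𝓝 a, b ∈ frontier Ω → ρ b = 0 := by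
  obtain ⟨U, ρ, hU, haU, hρ, hne, hΩU⟩ := hs a ha
  have hmem : ∀ b ∈ U, (b ∈ Ω ↔ ρ b < 0) := fun b hb => by
    have := Set.ext_iff.1 hΩU b
    simpa [hb] using this
  refine ⟨ρ, (hρ.contDiffAt (hU.mem_nhds haU)).of_le (by simp), hne a haU, ?_, ?_⟩
  · filter_upwards [hU.mem_nhds haU] with b hb using hmem b hb
  · filter_upwards [hU.mem_nhds haU] with b hb hbf
    rw [hΩ.frontier_eq] at hbf
    have h1 : 0 ≤ ρ b := not_lt.1 fun h => hbf.2 ((hmem b hb).2 h)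
    refine le_antisymm (not_lt.1 fun h => ?_) h1
    have hc : ContinuousAt ρ b := hρ.continuousOn.continuousAt (hU.mem_nhds hb)
    obtain ⟨c, ⟨hcU, hcρ⟩, hcΩ⟩ := mem_closure_iff_nhds.1 hbf.1 _
      (inter_mem (hU.mem_nhds hb) (hc.eventually (lt_mem_nhds h)))
    exact absurd ((hmem c hcU).1 hcΩ) (not_lt.2 (le_of_lt hcρ))

lemma fderiv_comp_spatial {ρ : EuclideanSpace ℝ (Fin n) → ℝ} {x : SpaceTime n}
    (hρ : ContDiffAt ℝ 1 ρ (spatial x)) :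
    HasStrictFDerivAt (fun y => ρ (spatial y)) ((fderiv ℝ ρ (spatial x)).comp (spatialL n)) x :=
  (hρ.hasStrictFDerivAt one_ne_zero).comp x (spatialL n).hasStrictFDerivAt

lemma exists_regularAt_lateral (hΩ : IsOpen Ω) (hs : HasSmoothBoundary Ω) {x : SpaceTime n}
    (h0 : 0 < x 0) (hT : x 0 < T) (hx : spatial x ∈ frontier Ω) :
    ∃ ρ, RegularAt (cylinder T Ω) x ρ := by
  obtain ⟨ρ, hρ, hne, hmem, hzero⟩ := exists_defining_function hΩ hs hx
  refine ⟨fun y => ρ (spatial y), ContDiffAt.comp x hρ (spatialL n).contDiff.contDiffAt, ?_,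
    hzero.self_of_nhds hx, ?_⟩
  · rw [(fderiv_comp_spatial hρ).hasFDerivAt.fderiv]
    intro h
    refine hne (ContinuousLinearMap.ext fun a => ?_)
    obtain ⟨y, -, hy⟩ := exists_spatial_eq a 0
    have := DFunLike.congr_fun h y
    simpa [hy] using this
  · filter_upwards [continuous_spatial.continuousAt.eventually hmem,
      continuous_time.continuousAt.eventually (lt_mem_nhds h0),
      continuous_time.continuousAt.eventually (gt_mem_nhds hT)] with y h1 h2 h3
    exact ⟨fun h => h1.1 h.2.2, fun h => ⟨h2, h3, h1.2 h⟩⟩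

lemma exists_regularAt_bottom (hΩ : IsOpen Ω) (hT : 0 < T) {x : SpaceTime n}
    (h0 : x 0 = 0) (hx : spatial x ∈ Ω) : ∃ ρ, RegularAt (cylinder T Ω) x ρ := by
  have hd : HasFDerivAt (fun y : SpaceTime n => -y 0)
      (-(EuclideanSpace.proj (𝕜 := ℝ) (0 : Fin (n + 1)))) x :=
    (EuclideanSpace.proj (𝕜 := ℝ) (0 : Fin (n + 1))).hasFDerivAt.neg
  refine ⟨fun y => -y 0,
    (EuclideanSpace.proj (𝕜 := ℝ) (0 : Fin (n + 1))).contDiff.contDiffAt.neg, ?_, by simp [h0], ?_⟩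
  · rw [hd.fderiv]
    intro h
    have := DFunLike.congr_fun h (EuclideanSpace.single (0 : Fin (n + 1)) (1 : ℝ))
    simp at this
  · filter_upwards [continuous_spatial.continuousAt.eventually (hΩ.mem_nhds hx),
      continuous_time.continuousAt.eventually (gt_mem_nhds (h0.trans_lt hT))] with y h1 h2
    rw [neg_lt_zero]
    exact ⟨fun h => h.1, fun h => ⟨h, h2, h1⟩⟩

lemma exists_regularAt_top (hΩ : IsOpen Ω) (hT : 0 < T) {x : SpaceTime n}
    (h0 : x 0 = T) (hx : spatial x ∈ Ω) : ∃ ρ, RegularAt (cylinder T Ω) x ρ := by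
  have hd : HasFDerivAt (fun y : SpaceTime n => y 0 - T)
      (EuclideanSpace.proj (𝕜 := ℝ) (0 : Fin (n + 1))) x :=
    (EuclideanSpace.proj (𝕜 := ℝ) (0 : Fin (n + 1))).hasFDerivAt.sub_const T
  refine ⟨fun y => y 0 - T,
    (EuclideanSpace.proj (𝕜 := ℝ) (0 : Fin (n + 1))).contDiff.contDiffAt.sub contDiffAt_const, ?_,
    by simp [h0], ?_⟩
  · rw [hd.fderiv]
    intro h
    have := DFunLike.congr_fun h (EuclideanSpace.single (0 : Fin (n + 1)) (1 : ℝ))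
    simp at this
  · filter_upwards [continuous_spatial.continuousAt.eventually (hΩ.mem_nhds hx),
      continuous_time.continuousAt.eventually (lt_mem_nhds (hT.trans_eq h0.symm))] with y h1 h2
    rw [sub_neg]
    exact ⟨fun h => h.2.1, fun h => ⟨h2, h, h1⟩⟩

/-- Time and the spatial defining function have independent differentials, so the edge has
codimension two. -/
lemma surface_edge_eq_zero (hΩ : IsOpen Ω) (hs : HasSmoothBoundary Ω) (s : ℝ) :
    surface n {y : SpaceTime n | y 0 = s ∧ spatial y ∈ frontier Ω} = 0 := by
  refine surface_eq_zero_of_pair fun x hx => ?_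
  obtain ⟨ρ, hρ, hne, -, hzero⟩ := exists_defining_function hΩ hs hx.2
  refine ⟨fun y => y 0 - s, fun y => ρ (spatial y), EuclideanSpace.proj (𝕜 := ℝ) (0 : Fin (n + 1)),
    _, (EuclideanSpace.proj (𝕜 := ℝ) (0 : Fin (n + 1))).hasStrictFDerivAt.sub_const s,
    fderiv_comp_spatial hρ, ?_, ?_, ?_⟩
  · obtain ⟨a, ha⟩ : ∃ a, fderiv ℝ ρ (spatial x) a ≠ 0 := by
      by_contra! hcon
      exact hne (ContinuousLinearMap.ext hcon)
    obtain ⟨y, hy0, hy⟩ := exists_spatial_eq a 0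
    exact ⟨y, by simp [hy0], by simpa [hy] using ha⟩
  · exact ⟨EuclideanSpace.single 0 1, by simp [spatial_single_zero], by simp⟩
  · filter_upwards [self_mem_nhdsWithin, mem_nhdsWithin_of_mem_nhds
      (continuous_spatial.continuousAt.eventually hzero)] with y hy hy'
    exact ⟨sub_eq_zero.2 hy.1, hy' hy.2⟩

/-- Off the two null edges, a boundary point lies on the bottom, on the top or on the lateral
boundary, and each of these has a defining function. -/
lemma ae_frontier_regularAt (hΩ : IsOpen Ω) (hs : HasSmoothBoundary Ω) (hT : 0 < T) :
    ∀ᵐ x ∂(surface n).restrict (frontier (cylinder T Ω)), ∃ ρ, RegularAt (cylinder T Ω) x ρ := by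
  filter_upwards [ae_restrict_mem isClosed_frontier.measurableSet,
    ae_restrict_of_ae (measure_eq_zero_iff_ae_notMem.1 (surface_edge_eq_zero hΩ hs 0)),
    ae_restrict_of_ae (measure_eq_zero_iff_ae_notMem.1 (surface_edge_eq_zero hΩ hs T))]
    with x hx hx0 hxT
  rw [(isOpen_cylinder hΩ).frontier_eq] at hx
  obtain ⟨h0, h1, h2⟩ := closure_cylinder_subset hx.1
  by_cases hxΩ : spatial x ∈ Ω
  · rcases h0.eq_or_lt with h0 | h0
    · exact exists_regularAt_bottom hΩ hT h0.symm hxΩ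
    rcases h1.eq_or_lt with h1 | h1
    · exact exists_regularAt_top hΩ hT h1 hxΩ
    exact absurd ⟨h0, h1, hxΩ⟩ hx.2
  · have hf : spatial x ∈ frontier Ω := by
      rw [hΩ.frontier_eq]
      exact ⟨h2, hxΩ⟩
    exact exists_regularAt_lateral hΩ hs (lt_of_le_of_ne h0 fun e => hx0 ⟨e.symm, hf⟩)
      (lt_of_le_of_ne h1 fun e => hxT ⟨e, hf⟩) hf

/-- From an interior point of the closure one can move a little in every direction without leaving
the closure. The two time directions exclude the bottom and the top, and the outward normal excludes
lateral points. -/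
lemma interior_closure_cylinder (hΩ : IsOpen Ω) (hs : HasSmoothBoundary Ω) :
    interior (closure (cylinder T Ω)) = cylinder T Ω := by
  refine Set.Subset.antisymm (fun x hx => ?_)
    (interior_maximal subset_closure (isOpen_cylinder hΩ))
  have hline : ∀ w : SpaceTime n, ∀ᶠ t : ℝ in 𝓝[>] 0, x + t • w ∈ closure (cylinder T Ω) :=
    fun w => ((tendsto_add_smul x w).eventually (isOpen_interior.mem_nhds hx)).mono
      fun t ht => interior_subset ht
  have h0 : 0 < x 0 := by
    obtain ⟨t, ht, ht0⟩ := ((hline (-EuclideanSpace.single 0 1)).and self_mem_nhdsWithin).exists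
    have h1 := (closure_cylinder_subset ht).1
    have ht0' : 0 < t := ht0
    simp at h1
    linarith
  have hT : x 0 < T := by
    obtain ⟨t, ht, ht0⟩ := ((hline (EuclideanSpace.single 0 1)).and self_mem_nhdsWithin).exists
    have h1 := (closure_cylinder_subset ht).2.1
    have ht0' : 0 < t := ht0
    simp at h1
    linarith
  refine ⟨h0, hT, ?_⟩
  by_contra hxΩ
  have hf : spatial x ∈ frontier Ω := by
    rw [hΩ.frontier_eq]
    exact ⟨(closure_cylinder_subset (interior_subset hx)).2.2, hxΩ⟩
  obtain ⟨ρ, hρ⟩ := exists_regularAt_lateral hΩ hs h0 hT hf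
  have hN := hρ.isOuterNormal (isOpen_cylinder hΩ)
  have hpos : 0 < inner ℝ (unitNormal ρ x) (unitNormal ρ x) := by
    rw [real_inner_self_eq_norm_sq, hN.1]
    norm_num
  obtain ⟨t, ht, ht'⟩ := (((hN.2 _).2 hpos).and (hline _)).exists
  exact ht ht'

end Cylinder

/-! ### Mesh size and interpolation error. -/

section Mesh

variable {n : ℕ} {M : Set (SpaceTime n)}

namespace Triangulation

lemma isCompact_elem (𝒯 : Triangulation M) (i : Fin 𝒯.card) : IsCompact (𝒯.elem i) :=
  (((Set.finite_range _).isCompact_convexHull ℝ).inter_right isClosed_closure)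

lemma diam_elem_le (𝒯 : Triangulation M) (i : Fin 𝒯.card) :
    Metric.diam (𝒯.elem i) ≤ 𝒯.meshSize :=
  le_ciSup (f := fun i => Metric.diam (𝒯.elem i)) (Set.finite_range _).bddAbove i

lemma meshSize_le (𝒯 : Triangulation M) (hM : Bornology.IsBounded M) :
    𝒯.meshSize ≤ Metric.diam (closure M) :=
  Real.iSup_le (fun i => Metric.diam_mono (𝒯.elem_subset i) hM.closure) Metric.diam_nonneg

/-- Otherwise each element has at most one point, and finitely many points do not cover a nonempty
open set. -/
lemma meshSize_pos (𝒯 : Triangulation M) (hM : IsOpen M) (hne : M.Nonempty) :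
    0 < 𝒯.meshSize := by
  by_contra! hcon
  have hsub : ∀ i, (𝒯.elem i).Subsingleton := fun i x hx y hy => by
    have := (Metric.dist_le_diam_of_mem (𝒯.isCompact_elem i).isBounded hx hy).trans
      ((𝒯.diam_elem_le i).trans hcon)
    exact dist_le_zero.1 this
  have hfin : M.Finite := by
    refine Set.Finite.subset (Set.finite_iUnion fun i => (hsub i).finite) ?_
    rw [𝒯.iUnion_elem]
    exact subset_closure
  exact (hM.measure_pos volume hne).ne' (hfin.measure_zero _)

/-- A quasi-uniform triangulation of a cylinder over a smooth domain satisfies the standing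
assumptions. -/
lemma isMesh_cylinder {T : ℝ} {Ω : Set (EuclideanSpace ℝ (Fin n))} (hn : 1 ≤ n) (hT : 0 < T)
    (hΩ : IsOpen Ω) (hne : Ω.Nonempty) (hs : HasSmoothBoundary Ω)
    (𝒯 : Triangulation (cylinder T Ω)) {r : ℝ} (hr : 0 < r)
    (hqu : ∀ i, ∃ c : SpaceTime n, Metric.ball c (r * 𝒯.meshSize) ⊆ 𝒯.elem i ∧
      ∀ y ∈ Metric.ball c (r * 𝒯.meshSize), StarConvex ℝ y (𝒯.elem i)) : 𝒯.IsMesh r where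
  dim_pos := hn
  isOpen := isOpen_cylinder hΩ
  interior_closure := interior_closure_cylinder hΩ hs
  regular := ae_frontier_regularAt hΩ hs hT
  star i := by
    obtain ⟨a, ha⟩ := hne
    obtain ⟨y, hy0, hy⟩ := exists_spatial_eq a (T / 2)
    have hh : 0 < 𝒯.meshSize := 𝒯.meshSize_pos (isOpen_cylinder hΩ)
      ⟨y, by rw [hy0]; positivity, by rw [hy0]; linarith, by rwa [hy]⟩
    obtain ⟨c, hc, hstar⟩ := hqu i
    exact ⟨c, 𝒯.isClosed_elem i, mul_pos hr hh, hc, hstar, fun x hx y hy =>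
      (Metric.dist_le_diam_of_mem (𝒯.isCompact_elem i).isBounded hx hy).trans (𝒯.diam_elem_le i)⟩

namespace IsMesh

variable {𝒯 : Triangulation M} {r : ℝ} {v : SpaceTime n → ℝ}

lemma integral_sq_le_sobolevNormSq (hv : 𝒯.PiecewiseH2 v) (i : Fin 𝒯.card) :
    ∫ x in 𝒯.int i, v x ^ 2 ≤ sobolevNormSq (𝒯.int i) 0 v := by
  rw [sobolevNormSq]
  simp only [zero_add, Finset.range_one, Finset.sum_singleton, Finset.univ_unique]
  refine (integral_congr_ae ?_).le
  filter_upwards [weakDeriv_ae_eq (isOpen_int 𝒯 i)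
    (isWeakDeriv_zero (w := default) (hv i).1) .rfl] with x hx
  exact congrArg (· ^ 2) hx.symm

lemma sum_le_sobolevNormSq (U : Set (SpaceTime n)) (m : ℕ) (v : SpaceTime n → ℝ) :
    ∑ w : Fin m → Fin (n + 1), ∫ x in U, weakDeriv U w v x ^ 2 ≤ sobolevNormSq U m v :=
  Finset.single_le_sum (f := fun m => ∑ w : Fin m → Fin (n + 1), ∫ x in U, weakDeriv U w v x ^ 2)
    (fun _ _ => Finset.sum_nonneg fun _ _ => integral_sq_nonneg _ _) (Finset.self_mem_range_succ m)

lemma sum_grad_le_sobolevNormSq (U : Set (SpaceTime n)) (v : SpaceTime n → ℝ) :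
    ∑ k, ∫ x in U, grad U v x k ^ 2 ≤ sobolevNormSq U 1 v := by
  refine le_trans (le_of_eq ?_) (sum_le_sobolevNormSq U 1 v)
  refine Fintype.sum_equiv (Equiv.funUnique (Fin 1) (Fin (n + 1))).symm _ _ fun k => ?_
  have : (Equiv.funUnique (Fin 1) (Fin (n + 1))).symm k = ![k] := by
    ext j; simp
  rw [this]
  rfl

lemma sum_hessian_le_sobolevNormSq (U : Set (SpaceTime n)) (v : SpaceTime n → ℝ) :
    ∑ k, ∑ l, ∫ x in U, weakDeriv U ![k, l] v x ^ 2 ≤ sobolevNormSq U 2 v := by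
  refine le_trans (le_of_eq ?_) (sum_le_sobolevNormSq U 2 v)
  rw [← Fintype.sum_prod_type' fun k l => ∫ x in U, weakDeriv U ![k, l] v x ^ 2]
  exact Fintype.sum_equiv (finTwoArrowEquiv (Fin (n + 1))).symm _ _ fun _ => rfl

/-- The scaled norm of a function that satisfies the interpolation error bounds. -/
lemma sum_scaledNormSq_le (hh : 0 < 𝒯.meshSize) (hv : 𝒯.PiecewiseH2 v) {p : ℕ}
    (hp : 1 ≤ p) {C N : ℝ} (hI : ∀ m ≤ 2, Real.sqrt (∑ i, sobolevNormSq (𝒯.int i) m v) ≤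
      C * 𝒯.meshSize ^ (p + 1 - m) * N) :
    ∑ i, 𝒯.scaledNormSq i v ≤ 3 * (C * 𝒯.meshSize ^ p * N) ^ 2 := by
  have h0 := (Real.sqrt_le_iff.1 (hI 0 (by norm_num))).2
  have h1 := (Real.sqrt_le_iff.1 (hI 1 (by norm_num))).2
  have h2 := (Real.sqrt_le_iff.1 (hI 2 le_rfl)).2
  have b0 := (Finset.sum_le_sum fun i (_ : i ∈ Finset.univ) =>
    integral_sq_le_sobolevNormSq hv i).trans h0
  have b1 := (Finset.sum_le_sum fun i (_ : i ∈ Finset.univ) =>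
    sum_grad_le_sobolevNormSq (𝒯.int i) v).trans h1
  have b2 := (Finset.sum_le_sum fun i (_ : i ∈ Finset.univ) =>
    sum_hessian_le_sobolevNormSq (𝒯.int i) v).trans h2
  -- As `p ≥ 1`, the exponents `p + 1 - m` with `m ≤ 2` are not truncated. The weights `h⁻²`, 1 and
  -- `h²` then bring all three bounds to the same order.
  obtain ⟨p, rfl⟩ : ∃ p', p = p' + 1 := ⟨p - 1, by omega⟩
  simp only [scaledNormSq, Finset.sum_add_distrib, ← Finset.mul_sum]
  set H := 𝒯.meshSize
  have c0 := mul_le_mul_of_nonneg_left b0 (inv_pos.2 (pow_pos hh 2)).le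
  have c2 := mul_le_mul_of_nonneg_left b2 (pow_pos hh 2).le
  have e0 : (H ^ 2)⁻¹ * (C * H ^ (p + 1 + 1 - 0) * N) ^ 2 = (C * H ^ (p + 1) * N) ^ 2 := by
    rw [Nat.sub_zero, pow_succ H (p + 1)]; field_simp
  have e1 : p + 1 + 1 - 1 = p + 1 := by omega
  have e2 : H ^ 2 * (C * H ^ (p + 1 + 1 - 2) * N) ^ 2 = (C * H ^ (p + 1) * N) ^ 2 := by
    rw [show p + 1 + 1 - 2 = p by omega]; ring
  rw [e0] at c0
  rw [e1] at b1
  rw [e2] at c2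
  linarith

end IsMesh

end Triangulation

end Mesh

end WaveDA

end

/-! ### Assembly of the error estimate. -/

theorem mainTheorem2 {n : ℕ} (hn : 1 ≤ n) (hn' : n ≤ 3) {T : ℝ} (hT : 0 < T)
    {Ω : Set (EuclideanSpace ℝ (Fin n))} (hΩo : IsOpen Ω) (hΩc : IsConnected Ω)
    (hΩb : Bornology.IsBounded Ω) (hΩs : WaveDA.HasSmoothBoundary Ω)
    {ω : Set (EuclideanSpace ℝ (Fin n))}
    (hω : ∃ W : Set (EuclideanSpace ℝ (Fin n)), IsOpen W ∧ ω = W ∩ closure Ω)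
    {p q : ℕ} (hq : 1 ≤ q) (hpq : q ≤ p) {γ γs : ℝ} (hγ : 0 < γ) (hγs : 0 < γs)
    {ι : Type*} (𝒯 : ι → WaveDA.Triangulation (WaveDA.cylinder T Ω))
    (hqu : WaveDA.QuasiUniform 𝒯) (hint : WaveDA.HasInterpolants 𝒯 p) :
    ∃ C : ℝ, 0 < C ∧ ∀ (a : ι) (u uObs uh zh : WaveDA.SpaceTime n → ℝ),
      WaveDA.MemSobolev (WaveDA.cylinder T Ω) (p + 1) u →
      WaveDA.IsWaveSolution T Ω u →
      (∀ᵐ x ∂(volume.restrict (WaveDA.cylinder T ω)), uObs x = u x) →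
      (𝒯 a).IsDiscreteSolution (WaveDA.cylinder T (frontier Ω)) (WaveDA.cylinder T ω)
        γ γs p q uObs uh zh →
      (𝒯 a).residualNorm (WaveDA.cylinder T (frontier Ω)) (WaveDA.cylinder T ω) (u - uh) zh ≤
        C * (𝒯 a).meshSize ^ p * WaveDA.sobolevNorm (WaveDA.cylinder T Ω) (p + 1) u := by
  obtain ⟨r, hr, hstar⟩ := hqu
  obtain ⟨CI, hCI⟩ := hint
  obtain ⟨Ct, hCt, Ht⟩ := WaveDA.IsStarBody.exists_trace_const n hr
  obtain ⟨Ci, hCi, Hi⟩ := WaveDA.exists_inverse_const n q hr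
  have hobs : WaveDA.cylinder T ω ⊆ closure (WaveDA.cylinder T Ω) := by
    obtain ⟨W, -, rfl⟩ := hω
    exact WaveDA.cylinder_subset_closure Set.inter_subset_right
  have hlat := WaveDA.lateral_subset_frontier (T := T) hΩo
  -- The diameter of the closed cylinder bounds every mesh size, so the constant `κ` serves the
  -- whole family.
  set D := Metric.diam (closure (WaveDA.cylinder T Ω))
  set κ : ℝ := 2 * D ^ 2 + 2 * (n + 1 + 10 * Ct) + (2 + 2 / γ + 1 / γs) *
    (D ^ 2 + γ * (n + 1 + 10 * Ct) + (1 + Ci) * (1 + 4 * Ct) / γs) with hκ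
  have hκ0 : 0 ≤ κ := by positivity
  -- The absolute value is needed because `CI` is not assumed nonnegative, and the summand 1 makes
  -- the constant positive.
  refine ⟨Real.sqrt (3 * κ) * |CI| + 1, by positivity, fun a u uObs uh zh hu hwave huObs hsol => ?_⟩
  have h := (𝒯 a).isMesh_cylinder hn hT hΩo hΩc.nonempty hΩs hr (hstar a)
  obtain ⟨πu, hπu, hI⟩ := hCI a u hu
  obtain ⟨hu2, hbox, g, hg, hg0⟩ := hwave
  have htrace : ∀ i, WaveDA.HasTraceConst ((𝒯 a).elem i) (𝒯 a).meshSize Ct := fun i => by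
    obtain ⟨c, hc⟩ := h.star i
    exact Ht _ c _ hc
  -- The boundary condition is posed for the trace on the whole cylinder and is passed on to the
  -- traces on the elements.
  have hbd : ∀ i, ∀ᵐ x ∂(WaveDA.surface n).restrict
      ((𝒯 a).elem i ∩ WaveDA.cylinder T (frontier Ω)),
      WaveDA.trace ((𝒯 a).int i) u x = 0 := fun i => by
    filter_upwards [ae_restrict_of_ae_restrict_of_subset
      (WaveDA.Triangulation.IsMesh.inter_subset_bdry hlat i) (h.ae_trace_eq_of_isTrace hg i),
      ae_restrict_of_ae_restrict_of_subset Set.inter_subset_right hg0] with x h1 h2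
    rw [h1, h2]
  have hres := h.residual_le hlat hobs hCt.le htrace hCi.le (fun i P hP => by
    obtain ⟨c, hc⟩ := h.star i
    exact Hi _ c _ hc P hP) hγ hγs
    ((𝒯 a).meshSize_le (WaveDA.isBounded_cylinder hΩb)) hu2 hbox hbd huObs hsol hπu
  rw [← hκ] at hres
  have hH : 0 < (𝒯 a).meshSize := by
    obtain ⟨b, hb⟩ := hΩc.nonempty
    obtain ⟨y, hy0, hy⟩ := WaveDA.exists_spatial_eq b (T / 2)
    exact (𝒯 a).meshSize_pos (WaveDA.isOpen_cylinder hΩo)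
      ⟨y, by rw [hy0]; positivity, by rw [hy0]; linarith, by rwa [hy]⟩
  have hη := (h.piecewiseH2_of_memSobolev hu2).sub (h.piecewiseH2_of_mem_femSpace hπu)
  have hsum := WaveDA.Triangulation.IsMesh.sum_scaledNormSq_le hH hη (hq.trans hpq) hI
  have hN : 0 ≤ WaveDA.sobolevNorm (WaveDA.cylinder T Ω) (p + 1) u := Real.sqrt_nonneg _
  set N := WaveDA.sobolevNorm (WaveDA.cylinder T Ω) (p + 1) u
  calc (𝒯 a).residualNorm (WaveDA.cylinder T (frontier Ω)) (WaveDA.cylinder T ω) (u - uh) zh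
      ≤ Real.sqrt (3 * κ * (CI * (𝒯 a).meshSize ^ p * N) ^ 2) := by
        refine Real.sqrt_le_sqrt (hres.trans ?_)
        rw [mul_comm 3 κ, mul_assoc]
        exact mul_le_mul_of_nonneg_left hsum hκ0
    _ = Real.sqrt (3 * κ) * |CI| * (𝒯 a).meshSize ^ p * N := by
        rw [Real.sqrt_mul (by positivity), Real.sqrt_sq_eq_abs, abs_mul, abs_mul,
          abs_of_nonneg hN, abs_of_pos (pow_pos hH p)]
        ring
    _ ≤ (Real.sqrt (3 * κ) * |CI| + 1) * (𝒯 a).meshSize ^ p * N := by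
        have := pow_pos hH p
        gcongr
        linarith
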